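/- Let $\mathbb T=\mathbb R/2\pi\mathbb Z$, $\beta>0$ and $V\in\mathcal C^{3,1}(\mathbb T)$ (three times differentiable with Lipschitz third derivative). Consider $N$ particles on $\mathbb T$ with joint law $$d\mathbb P_N(x_1,\dots,x_N)=\frac1{Z_N}\prod_{i<j}|e^{ix_i}-e^{ix_j}|^{2\beta/N}\prod_{i=1}^N e^{-V(x_i)}\frac{dx_i}{2\pi}.$$ Let $\mu_0^V$ be the probability measure proportional to $e^{-V(x)}\frac{dx}{2\pi}$, and let $\mu_\beta^V$ be the minimizer over all probability measures $\mu$ on $\mathbb T$ (it exists and is unique) of $$F(\mu)=\beta\iint\log\Big|\sin\frac{x-y}2\Big|^{-1}\mu(dx)\mu(dy)+\mathrm H(\mu\,|\,\mu_0^V),$$ where $\mathrm H$ is the relative entropy; write $\mu_\beta^V(x)$ for its density with respect to $dx$. Let $$\mathscr H=\Big\{f\in L^2(\mathbb T): f'\in L^2(\mathbb T),\ \int f\,d\mu_\beta^V=0\Big\},\qquad \langle f,g\rangle_{\mathscr H}=\int f'g'\,d\mu_\beta^V,$$ with weak derivatives, and let $\mathscr L$ be given by $$-\mathscr L\phi=\phi''+2\pi\beta\,H(\mu_\beta^V\phi')+(\log\mu_\beta^V)'\phi',\qquad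 Hu(x)=-\mathrm{p.v.}\int_{\mathbb T}\frac{u(t)}{\tan\frac{x-t}2}\,\frac{dt}{2\pi}.$$ On $\mathscr H$ the operator $\mathscr L$ is understood modulo additive constants: for $\psi\in\mathscr H$, $\mathscr L^{-1}\psi$ denotes the $\phi\in\mathscr H$ with $\phi''\in L^2(\mathbb T)$ and $\mathscr L\phi\in H^1(\mathbb T)$ such that $\mathscr L\phi-\int\mathscr L\phi\,d\mu_\beta^V=\psi$. Let $\gamma\ge2$ be an integer and let $\psi\in\mathcal C^{2\gamma+1}(\mathbb T)$ be real-valued with $\int\psi\,d\mu_\beta^V=0$. Then $\mathscr L^{-1}\psi$ exists and is unique, $\sigma^2:=\langle\psi,\mathscr L^{-1}\psi\rangle_{\mathscr H}=\int\psi'(\mathscr L^{-1}\psi)'\,d\mu_\beta^V\ge0$, and, under $\mathbb P_N$, $$\nu_N(\psi)=\frac1{\sqrt N}\sum_{i=1}^N\psi(x_i)\longrightarrow\mathcal N(0,\sigma^2)\quad\text{in law as }N\to\infty.$$ Moreover there is a constant $C=C(\beta,V,\psi,\gamma)>0$ such that for every $N\ge2$ $$W_2\big(\nu_N(\psi),\mathcal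 N(0,\sigma^2)\big)\le C\sqrt{\frac{\log N}{N^{\frac{\gamma-1}{\gamma+1}}}},$$ where $W_2(X,Y)=\inf\sqrt{\mathbb E|Z_1-Z_2|^2}$, the infimum over all couplings $(Z_1,Z_2)$ of the laws of $X$ and $Y$. -/

import Mathlib

open MeasureTheory Filter Topology ProbabilityTheory

noncomputable section

namespace HighTempCircular

instance instFactTwoPiPos : Fact (0 < 2 * Real.pi) := ⟨Real.two_pi_pos⟩

/-- The torus `ℝ / 2πℤ`. -/
abbrev Torus : Type := AddCircle (2 * Real.pi)

/-- The measure `dx / 2π` on the torus. -/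
abbrev unif : Measure Torus := AddCircle.haarAddCircle

/-- The `2π`-periodic function on the line associated with a function on the torus. -/
def lift (f : Torus → ℝ) : ℝ → ℝ := fun x => f (x : Torus)

/-- `f ∈ C^k(𝕋)`. -/
def IsCk (k : ℕ) (f : Torus → ℝ) : Prop := ContDiff ℝ (k : WithTop ℕ∞) (lift f)

/-- `f ∈ C^{k,1}(𝕋)`: the `k`-th derivative is Lipschitz (the chordal and the arc length
metrics are equivalent, and a periodic function is Lipschitz for the arc length if and only if its
lift to the line is Lipschitz). -/
def IsCk1 (k : ℕ) (f : Torus → ℝ) : Prop :=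
  IsCk k f ∧ ∃ K : NNReal, LipschitzWith K (iteratedDeriv k (lift f))

/-- The chordal distance `|e^{ix} - e^{iy}| = |2 sin ((x - y) / 2)|`. -/
def chord (x y : Torus) : ℝ := ‖(AddCircle.toCircle x : ℂ) - (AddCircle.toCircle y : ℂ)‖

/-! ### The particle system -/

/-- The unnormalized density with respect to `(dx / 2π)^{⊗ N}`:
`∏_{i<j} |e^{i x_i} - e^{i x_j}|^{2β/N} ∏_i e^{-V(x_i)}`. -/
def gibbsWeight (β : ℝ) (V : Torus → ℝ) (N : ℕ) (x : Fin N → Torus) : ℝ :=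
  (∏ i : Fin N, ∏ j ∈ Finset.Ioi i, chord (x i) (x j) ^ (2 * β / (N : ℝ))) *
    ∏ i : Fin N, Real.exp (-V (x i))

/-- The partition function `Z_N`. -/
def partitionFunction (β : ℝ) (V : Torus → ℝ) (N : ℕ) : ENNReal :=
  ∫⁻ x, ENNReal.ofReal (gibbsWeight β V N x) ∂(Measure.pi fun _ : Fin N => unif)

/-- The joint law `ℙ_N` of the `N` particles. -/
def gibbs (β : ℝ) (V : Torus → ℝ) (N : ℕ) : Measure (Fin N → Torus) :=
  (partitionFunction β V N)⁻¹ •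
    (Measure.pi fun _ : Fin N => unif).withDensity
      fun x => ENNReal.ofReal (gibbsWeight β V N x)

/-- `N^{-1/2} ∑_i ψ(x_i)`. It equals `√N (μ̂_N - μ)(ψ)` when `∫ ψ dμ = 0`. -/
def linStat (ψ : Torus → ℝ) (N : ℕ) (x : Fin N → Torus) : ℝ :=
  (∑ i, ψ (x i)) / √(N : ℝ)

/-- The law of the linear statistic under `ℙ_N`. -/
def linStatLaw (β : ℝ) (V ψ : Torus → ℝ) (N : ℕ) : Measure ℝ :=
  (gibbs β V N).map (linStat ψ N)

/-! ### The equilibrium measure -/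

/-- `log |sin ((x - y) / 2)|⁻¹ ∈ [0, +∞]`, with value `+∞` on the diagonal. -/
def logKernel (x y : Torus) : ENNReal :=
  if x = y then ⊤ else ENNReal.ofReal (Real.log (chord x y / 2)⁻¹)

/-- The logarithmic energy. -/
def logEnergy (μ : Measure Torus) : ENNReal := ∫⁻ x, ∫⁻ y, logKernel x y ∂μ ∂μ

/-- The probability measure proportional to `e^{-V(x)} dx / 2π`. -/
def refMeasure (V : Torus → ℝ) : Measure Torus := unif.tilted fun x => -V x

/-- `F(μ) = β 𝓔(μ) + H(μ | μ_0^V)`, where the relative entropy is Mathlib's Kullback–Leibler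
divergence. -/
def freeEnergy (β : ℝ) (V : Torus → ℝ) (μ : Measure Torus) : ENNReal :=
  ENNReal.ofReal β * logEnergy μ + InformationTheory.klDiv μ (refMeasure V)

/-- `μ` minimizes the free energy among all probability measures on the torus. -/
def IsEquilibrium (β : ℝ) (V : Torus → ℝ) (μ : ProbabilityMeasure Torus) : Prop :=
  ∀ ν : ProbabilityMeasure Torus,
    freeEnergy β V (μ : Measure Torus) ≤ freeEnergy β V (ν : Measure Torus)

/-- The density of `μ` with respect to the Lebesgue measure `dx` (of total mass `2π`). -/
def density (μ : ProbabilityMeasure Torus) (x : Torus) : ℝ :=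
  ((μ : Measure Torus).rnDeriv unif x).toReal / (2 * Real.pi)

/-! ### Weak derivatives and the space `H` -/

/-- The classical derivative of a function on the torus. -/
def torusDeriv (f : Torus → ℝ) (x : Torus) : ℝ :=
  deriv (fun t : ℝ => f (x + (t : Torus))) 0

/-- `g` is a weak derivative of `f`, in `L²(𝕋)`. -/
def IsWeakDeriv (f g : Torus → ℝ) : Prop :=
  MemLp g 2 unif ∧
    ∀ θ : Torus → ℝ, ContDiff ℝ (⊤ : ℕ∞) (lift θ) →
      ∫ x, f x * torusDeriv θ x ∂unif = -∫ x, g x * θ x ∂unif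

/-- The Sobolev space `H¹(𝕋)`. -/
def MemH1 (f : Torus → ℝ) : Prop := MemLp f 2 unif ∧ ∃ g, IsWeakDeriv f g

open Classical in
/-- The weak derivative (determined almost everywhere) of a function that has one. -/
def weakDeriv (f : Torus → ℝ) : Torus → ℝ :=
  if h : ∃ g, IsWeakDeriv f g then h.choose else 0

/-- The space `H = {f ∈ H¹(𝕋) : ∫ f dμ = 0}`; its elements are considered up to almost everywhere
equality. -/
def MemH (μ : ProbabilityMeasure Torus) (f : Torus → ℝ) : Prop :=
  MemH1 f ∧ ∫ x, f x ∂(μ : Measure Torus) = 0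

/-- The inner product `⟨f, g⟩_H = ∫ f' g' dμ`. -/
def innerH (μ : ProbabilityMeasure Torus) (f g : Torus → ℝ) : ℝ :=
  ∫ x, weakDeriv f x * weakDeriv g x ∂(μ : Measure Torus)

/-! ### The Hilbert transform -/

theorem periodic_cotHalf : Function.Periodic (fun x : ℝ => 1 / Real.tan (x / 2)) (2 * Real.pi) := by
  intro x
  have h : (x + 2 * Real.pi) / 2 = x / 2 + Real.pi := by ring
  simp only [h, Real.tan_periodic (x / 2)]

/-- `x ↦ 1 / tan (x / 2)` on the torus. -/
def cotHalf : Torus → ℝ := periodic_cotHalf.lift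

/-- The truncated integral `-∫_{|e^{ix} - e^{it}| > ε} u(t) / tan ((x - t) / 2) dt / 2π`. -/
def truncHilbert (u : Torus → ℝ) (x : Torus) (ε : ℝ) : ℝ :=
  -∫ t in {t : Torus | ε < chord x t}, u t * cotHalf (x - t) ∂unif

/-- The principal value defining the Hilbert transform of `u` exists almost everywhere. -/
def HasHilbert (u : Torus → ℝ) : Prop :=
  ∀ᵐ x ∂unif, ∃ l : ℝ, Tendsto (truncHilbert u x) (𝓝[>] 0) (𝓝 l)

/-- The Hilbert transform `H u (x) = -p.v. ∫ u(t) / tan ((x - t) / 2) dt / 2π`. -/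
def hilbert (u : Torus → ℝ) (x : Torus) : ℝ := limUnder (𝓝[>] 0) (truncHilbert u x)

/-! ### The operator `𝓛` -/

/-- `𝓛 φ = -(φ'' + 2πβ H(μ φ') + (log μ)' φ')`. -/
def opL (β : ℝ) (μ : ProbabilityMeasure Torus) (φ : Torus → ℝ) (x : Torus) : ℝ :=
  -(weakDeriv (weakDeriv φ) x
    + 2 * Real.pi * β * hilbert (fun t => density μ t * weakDeriv φ t) x
    + weakDeriv (fun t => Real.log (density μ t)) x * weakDeriv φ x)

/-- The domain of `𝓛` in `H`: every term of `𝓛 φ` is meaningful and `𝓛 φ ∈ H¹(𝕋)`. -/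
structure InDomainL (β : ℝ) (μ : ProbabilityMeasure Torus) (φ : Torus → ℝ) : Prop where
  memH : MemH μ φ
  deriv_memH1 : MemH1 (weakDeriv φ)
  logDensity_memH1 : MemH1 fun t => Real.log (density μ t)
  hasHilbert : HasHilbert fun t => density μ t * weakDeriv φ t
  memH1 : MemH1 (opL β μ φ)

/-- `φ = 𝓛⁻¹ ψ` in `H`. Functions that differ by a constant define the same element of `H`
(the `H`-norm does not see constants), represented by the one with mean zero under `μ`;
accordingly `𝓛 φ` is centred. -/
def IsInverseL (β : ℝ) (μ : ProbabilityMeasure Torus) (ψ φ : Torus → ℝ) : Prop :=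
  InDomainL β μ φ ∧
    ∀ᵐ x ∂unif, opL β μ φ x - ∫ y, opL β μ φ y ∂(μ : Measure Torus) = ψ x

/-! ### The Wasserstein distance -/

/-- The quadratic Wasserstein distance between two laws on the line. -/
def W2 (P Q : Measure ℝ) : ENNReal :=
  ⨅ (π : Measure (ℝ × ℝ)) (_ : π.map Prod.fst = P ∧ π.map Prod.snd = Q),
    (∫⁻ z, ENNReal.ofReal ((z.1 - z.2) ^ 2) ∂π) ^ (1 / 2 : ℝ)

end HighTempCircular

end

/-! The proof is Stein's method fed by the loop equation of the gas. Write `ρ` for the density of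
the equilibrium measure with respect to `dx / 2π`, `w` for `2β` times its logarithmic potential, and
`u = φ'` for the derivative of the solution of the linearized equation.

Equilibrium measure. The Euler–Lagrange equation is `ρ = e^{-V-w} / Z`, where `w` has Fourier
coefficients `β ρ̂_k / |k|`. It is solved through a dual problem that is strongly convex on `L²`
(`exists_minimizer`, `minimizer_eq`, `exists_solution`). The kernel operator gains one derivative,
so a bootstrap gives the regularity (`exists_eqDensity`). Positivity of the logarithmic energy of a
difference of two probability measures gives `F(ν) ≥ F(μ) + H(ν | μ)`, hence minimality and
uniqueness at once (`EqDensity.freeEnergy_le`).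

Inverse of `𝓛`. With `f = (ρ φ')'` the equation becomes `f / ρ + β K f = -(ψ + c)`, where `K`
multiplies the k-th mode by `1 / |k|`. The left side is coercive on `L²`, so Lax–Milgram solves it
(`EqDensity.exists_linSol`). The same positivity gives uniqueness and `σ² ≥ 0`, with equality only
for `ψ = 0` (`LinSol.unique`, `LinSol.variance`).

Stein identity. Let `F` be the linear statistic. Integrating by parts against the vector field with
components `u(x_i) h(F)` produces the double sum of `(u(x_i) - u(x_j)) / tan ((x_i - x_j) / 2)`.
Expanded around the equilibrium measure, its linear part combines with the drift into `-ψ` by the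
choice of `φ`. What remains is `E[F h(F)] = E[τ h'(F)] + E[R h(F)]`, where `τ` is the empirical mean
of `ψ' φ'` and `R` consists of a form quadratic in the fluctuations and a diagonal term
(`LinSol.stein_identity`).

A priori bounds. The Gibbs measure is at most `C N^β` times the product of the equilibrium measures
(`EqDensity.exists_gibbs_le`): the upper bound on the density comes from positivity of a regularized
energy, the lower bound on the normalization from Jensen. A polynomial loss is harmless, because
independent bounded variables have moments of every order: truncating at a high moment, fourth
moments under the Gibbs measure are `O(N^δ)` for every `δ > 0`. Hence `E[R²]` and `E[(τ - σ²)²]` are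
`O(N^{δ-1})` (`LinSol.exists_stein_bounds`).

From Stein to Wasserstein. For `Z` an independent standard Gaussian, the laws of `(Z + t F) / √(1 +
t²)` interpolate between the Gaussian law and the law of `F`. Monotone rearrangement moves along
this family with a velocity that the Stein identity turns into a conditional expectation of `R + t
(τ - 1) Z`. Integrating over `t` gives `W₂² ≤ C N^{δ-1}` (`SteinIdentity.exists_coupling`). The
choice `δ = 2 / (γ + 1)` yields the stated power, the logarithm entering only through `log 2 ≤ log
N`, and the limit theorem follows because `W₂` tends to zero. -/

noncomputable section

namespace HighTempCircular

open scoped ComplexConjugate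

/-! ### Characters and Fourier coefficients -/

/-- The character `x ↦ e^{ikx}`. -/
def ex (k : ℤ) (x : Torus) : ℂ := fourier k x

theorem ex_coe (k : ℤ) (x : ℝ) : ex k (x : Torus) = Complex.exp (Complex.I * (k * x : ℝ)) := by
  rw [ex, fourier_coe_apply]
  congr 1
  push_cast
  have : (Real.pi : ℂ) ≠ 0 := by exact_mod_cast Real.pi_ne_zero
  field_simp

theorem continuous_ex (k : ℤ) : Continuous (ex k) := (fourier k).continuous

theorem norm_ex (k : ℤ) (x : Torus) : ‖ex k x‖ = 1 := by
  rw [ex, fourier_apply, Circle.norm_coe]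

theorem ex_zero_index (x : Torus) : ex 0 x = 1 := fourier_zero

theorem ex_zero (k : ℤ) : ex k 0 = 1 := fourier_eval_zero k

theorem ex_neg_index (k : ℤ) (x : Torus) : ex (-k) x = conj (ex k x) := fourier_neg

theorem ex_add_index (j k : ℤ) (x : Torus) : ex (j + k) x = ex j x * ex k x := fourier_add

theorem ex_add (k : ℤ) (x y : Torus) : ex k (x + y) = ex k x * ex k y := by
  simp only [ex, fourier_apply, smul_add, AddCircle.toCircle_add, Circle.coe_mul]

theorem ex_neg (k : ℤ) (x : Torus) : ex k (-x) = conj (ex k x) := by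
  rw [← ex_neg_index]; simp only [ex, fourier_apply, smul_neg, neg_smul]

theorem ex_sub (k : ℤ) (x y : Torus) : ex k (x - y) = ex k x * conj (ex k y) := by
  rw [sub_eq_add_neg, ex_add, ex_neg]

theorem ex_mul_conj (k : ℤ) (x : Torus) : ex k x * conj (ex k x) = 1 := by
  rw [Complex.mul_conj, Complex.normSq_eq_norm_sq, norm_ex]; simp

theorem norm_ex_sub_one_le (k : ℤ) (h : ℝ) : ‖ex k (h : Torus) - 1‖ ≤ |(k : ℝ)| * |h| := by
  rw [ex_coe, ← abs_mul]
  exact Real.norm_exp_I_mul_ofReal_sub_one_le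

/-- `g` is the derivative of `f` along the torus. -/
def HasTDeriv {E : Type*} [NormedAddCommGroup E] [NormedSpace ℝ E] (f g : Torus → E) : Prop :=
  ∀ x : ℝ, HasDerivAt (fun t : ℝ => f (t : Torus)) (g (x : Torus)) x

theorem hasTDeriv_ex (k : ℤ) : HasTDeriv (ex k) (fun x => Complex.I * k * ex k x) := by
  intro x
  have h : HasDerivAt (fun t : ℝ => Complex.I * ((k * t : ℝ) : ℂ)) (Complex.I * k) x := by
    have := ((hasDerivAt_id x).const_mul (k : ℝ)).ofReal_comp.const_mul Complex.I
    simpa using this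
  have := h.cexp
  change HasDerivAt (fun t : ℝ => ex k (t : Torus)) (Complex.I * k * ex k (x : Torus)) x
  simp only [ex_coe]
  exact this.congr_deriv (mul_comm _ _)

/-! ### Differentiation and integration along the torus. -/

section TDeriv

variable {E : Type*} [NormedAddCommGroup E] [NormedSpace ℝ E]

theorem HasTDeriv.shift {f g : Torus → E} (h : HasTDeriv f g) (x : Torus) (t : ℝ) :
    HasDerivAt (fun t : ℝ => f (x + (t : Torus))) (g (x + (t : Torus))) t := by
  induction x using QuotientAddGroup.induction_on with
  | H y =>
    have := (h (y + t)).comp_const_add y t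
    simpa using this

theorem continuous_of_coe {X : Type*} [TopologicalSpace X] {f : Torus → X}
    (h : Continuous fun t : ℝ => f (t : Torus)) : Continuous f :=
  (QuotientAddGroup.isQuotientMap_mk _).continuous_iff.2 h

theorem continuous_coe_torus : Continuous fun t : ℝ => (t : Torus) :=
  AddCircle.continuous_mk' _

theorem HasTDeriv.continuous {f g : Torus → E} (h : HasTDeriv f g) : Continuous f :=
  continuous_of_coe (continuous_iff_continuousAt.2 fun x => (h x).continuousAt)

theorem integral_unif_eq (f : Torus → E) :
    ∫ x, f x ∂unif = (2 * Real.pi)⁻¹ • ∫ t in (0 : ℝ)..(2 * Real.pi), f (t : Torus) := by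
  rw [unif, AddCircle.integral_haarAddCircle]
  have := AddCircle.intervalIntegral_preimage (2 * Real.pi) 0 f
  rw [zero_add] at this
  rw [this]

theorem HasTDeriv.integral_eq_zero [CompleteSpace E] {f g : Torus → E} (h : HasTDeriv f g)
    (hg : Continuous g) : ∫ x, g x ∂unif = 0 := by
  rw [integral_unif_eq, intervalIntegral.integral_eq_sub_of_hasDerivAt (fun x _ => h x)
    ((hg.comp continuous_coe_torus).intervalIntegrable _ _)]
  have : ((2 * Real.pi : ℝ) : Torus) = ((0 : ℝ) : Torus) := by
    simp
  rw [this, sub_self, smul_zero]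

end TDeriv

theorem integrable_of_continuous {E : Type*} [NormedAddCommGroup E] {f : Torus → E}
    (hf : Continuous f) (μ : Measure Torus) [IsFiniteMeasure μ] : Integrable f μ :=
  integrableOn_univ.1 (hf.continuousOn.integrableOn_compact isCompact_univ)

theorem memLp_of_continuous {f : Torus → ℝ} (hf : Continuous f) (p : ENNReal) :
    MemLp f p unif := by
  obtain ⟨C, hC⟩ := (isCompact_univ (X := Torus)).exists_bound_of_continuousOn hf.continuousOn
  exact MemLp.of_bound hf.aestronglyMeasurable C (ae_of_all _ fun x => hC x trivial)

/-- The Fourier coefficients of a real function. -/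
def fc (f : Torus → ℝ) (k : ℤ) : ℂ := ∫ x, (f x : ℂ) * ex (-k) x ∂unif

theorem fc_eq (f : Torus → ℝ) (k : ℤ) : fc f k = fourierCoeff (fun x => (f x : ℂ)) k := by
  simp only [fc, fourierCoeff, ex, smul_eq_mul, mul_comm]

theorem fc_congr {f g : Torus → ℝ} (h : f =ᵐ[unif] g) : fc f = fc g := by
  funext k
  refine integral_congr_ae ?_
  filter_upwards [h] with x hx
  rw [hx]

theorem integrable_mul_ex {f : Torus → ℝ} (hf : Integrable f unif) (k : ℤ) :
    Integrable (fun x => (f x : ℂ) * ex k x) unif := by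
  refine hf.ofReal.mul_bdd (c := 1) (continuous_ex k).aestronglyMeasurable (ae_of_all _ fun x => ?_)
  rw [norm_ex]

theorem fc_add {f g : Torus → ℝ} (hf : Integrable f unif) (hg : Integrable g unif) (k : ℤ) :
    fc (fun x => f x + g x) k = fc f k + fc g k := by
  rw [fc, fc, fc, ← integral_add (integrable_mul_ex hf _) (integrable_mul_ex hg _)]
  simp only [Complex.ofReal_add, add_mul]

theorem fc_sub {f g : Torus → ℝ} (hf : Integrable f unif) (hg : Integrable g unif) (k : ℤ) :
    fc (fun x => f x - g x) k = fc f k - fc g k := by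
  rw [fc, fc, fc, ← integral_sub (integrable_mul_ex hf _) (integrable_mul_ex hg _)]
  simp only [Complex.ofReal_sub, sub_mul]

theorem fc_const_mul (c : ℝ) (f : Torus → ℝ) (k : ℤ) :
    fc (fun x => c * f x) k = c * fc f k := by
  rw [fc, fc, ← integral_const_mul]
  simp only [Complex.ofReal_mul, mul_assoc]

theorem fc_neg_index (f : Torus → ℝ) (k : ℤ) : fc f (-k) = conj (fc f k) := by
  rw [fc, fc, ← integral_conj]
  simp only [map_mul, Complex.conj_ofReal, ← ex_neg_index]

theorem fc_zero (f : Torus → ℝ) : fc f 0 = ((∫ x, f x ∂unif : ℝ) : ℂ) := by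
  rw [fc, ← integral_complex_ofReal]
  simp [ex_zero_index]

theorem integral_ex (k : ℤ) : ∫ x, ex k x ∂unif = if k = 0 then 1 else 0 := by
  split_ifs with h
  · subst h; simp [ex_zero_index]
  · have := (hasTDeriv_ex k).integral_eq_zero (continuous_const.mul (continuous_ex k))
    rw [integral_const_mul] at this
    refine (mul_eq_zero.1 this).resolve_left ?_
    exact mul_ne_zero Complex.I_ne_zero (by exact_mod_cast h)

theorem fc_const (c : ℝ) (k : ℤ) : fc (fun _ => c) k = if k = 0 then (c : ℂ) else 0 := by
  rw [fc, integral_const_mul, integral_ex]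
  simp

theorem fc_shift (f : Torus → ℝ) (h : Torus) (k : ℤ) :
    fc (fun x => f (x + h)) k = ex k h * fc f k := by
  have := integral_add_right_eq_self (μ := unif) (fun x => (f x : ℂ) * ex (-k) (x - h)) h
  simp only [add_sub_cancel_right] at this
  rw [fc, this, fc, ← integral_const_mul]
  refine integral_congr_ae (ae_of_all _ fun x => ?_)
  simp only [ex_sub, ex_neg_index, Complex.conj_conj]
  ring

theorem fc_deriv {f g : Torus → ℝ} (h : HasTDeriv f g) (hg : Continuous g) (k : ℤ) :
    fc g k = Complex.I * k * fc f k := by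
  have hf := h.continuous
  have h1 : HasTDeriv (fun x => (f x : ℂ) * ex (-k) x)
      (fun x => (g x : ℂ) * ex (-k) x + (f x : ℂ) * (Complex.I * (-k : ℤ) * ex (-k) x)) := by
    intro x
    exact (h x).ofReal_comp.mul (hasTDeriv_ex (-k) x)
  have c1 : Continuous fun x => (g x : ℂ) * ex (-k) x :=
    (Complex.continuous_ofReal.comp hg).mul (continuous_ex _)
  have c2 : Continuous fun x => (f x : ℂ) * (Complex.I * (-k : ℤ) * ex (-k) x) :=
    (Complex.continuous_ofReal.comp hf).mul (continuous_const.mul (continuous_ex _))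
  have h2 := h1.integral_eq_zero (c1.add c2)
  rw [integral_add (integrable_of_continuous c1 _) (integrable_of_continuous c2 _)] at h2
  have h3 : ∫ x, (f x : ℂ) * (Complex.I * (-k : ℤ) * ex (-k) x) ∂unif
      = -(Complex.I * k) * fc f k := by
    rw [fc, ← integral_const_mul]
    refine integral_congr_ae (ae_of_all _ fun x => ?_)
    push_cast; ring
  rw [h3] at h2
  rw [fc]
  linear_combination h2

/-! ### Parseval -/

theorem parseval {f g : Torus → ℝ} (hf : MemLp f 2 unif) (hg : MemLp g 2 unif) :
    HasSum (fun k => conj (fc f k) * fc g k) ((∫ x, f x * g x ∂unif : ℝ) : ℂ) := by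
  have hF : MemLp (fun x => (f x : ℂ)) 2 unif := hf.ofReal
  have hG : MemLp (fun x => (g x : ℂ)) 2 unif := hg.ofReal
  have key := (fourierBasis (T := 2 * Real.pi)).hasSum_inner_mul_inner (hF.toLp _) (hG.toLp _)
  have e1 : ∀ (u : Torus → ℝ) (hu : MemLp (fun x => (u x : ℂ)) 2 unif) (k : ℤ),
      inner ℂ ((fourierBasis (T := 2 * Real.pi)) k) (hu.toLp _) = fc u k := by
    intro u hu k
    rw [← HilbertBasis.repr_apply_apply, fourierBasis_repr, fc_eq,
      fourierCoeff_congr_ae hu.coeFn_toLp]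
  have e2 : inner ℂ (hF.toLp _) (hG.toLp _) = ((∫ x, f x * g x ∂unif : ℝ) : ℂ) := by
    rw [L2.inner_def, ← integral_complex_ofReal]
    refine integral_congr_ae ?_
    filter_upwards [hF.coeFn_toLp, hG.coeFn_toLp] with x h1 h2
    rw [h1, h2]
    simp [mul_comm]
  rw [e2] at key
  refine key.congr_fun fun k => ?_
  rw [e1, ← inner_conj_symm, e1]

theorem parseval_sq {f : Torus → ℝ} (hf : MemLp f 2 unif) :
    HasSum (fun k => ‖fc f k‖ ^ 2) (∫ x, f x ^ 2 ∂unif) := by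
  have := parseval hf hf
  simp only [mul_comm (conj _), Complex.mul_conj, Complex.normSq_eq_norm_sq] at this
  have h2 := (Complex.hasSum_ofReal.1 this)
  simpa only [sq] using h2

theorem ae_eq_of_fc_eq {f g : Torus → ℝ} (hf : MemLp f 2 unif) (hg : MemLp g 2 unif)
    (h : fc f = fc g) : f =ᵐ[unif] g := by
  have h1 := parseval_sq (hf.sub hg)
  have h2 : ∀ k, fc (f - g) k = 0 := fun k => by
    have := fc_sub (hf.integrable one_le_two) (hg.integrable one_le_two) k
    rw [h, sub_self] at this
    exact this
  simp only [h2, norm_zero, ne_eq, OfNat.ofNat_ne_zero, not_false_eq_true, zero_pow] at h1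
  have h3 := h1.unique hasSum_zero
  have h4 := (integral_eq_zero_iff_of_nonneg (fun x => sq_nonneg _) (hf.sub hg).integrable_sq).1 h3
  filter_upwards [h4] with x hx
  have : (f - g) x = 0 := by simpa using hx
  exact sub_eq_zero.1 this

theorem eq_of_fc_eq {f g : Torus → ℝ} (hf : Continuous f) (hg : Continuous g)
    (h : fc f = fc g) : f = g :=
  (Continuous.ae_eq_iff_eq unif hf hg).1
    (ae_eq_of_fc_eq (memLp_of_continuous hf 2) (memLp_of_continuous hg 2) h)

/-! ### Synthesis -/

theorem continuous_tsum_ex {a : ℤ → ℂ} (ha : Summable fun k => ‖a k‖) :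
    Continuous fun x => ∑' k, a k * ex k x :=
  continuous_tsum (fun k => continuous_const.mul (continuous_ex k)) ha
    (fun k x => by rw [norm_mul, norm_ex, mul_one])

theorem summable_mul_ex {a : ℤ → ℂ} (ha : Summable fun k => ‖a k‖) (x : Torus) :
    Summable fun k => a k * ex k x :=
  Summable.of_norm (by simpa only [norm_mul, norm_ex, mul_one] using ha)

theorem integral_tsum_ex {a : ℤ → ℂ} (ha : Summable fun k => ‖a k‖) (j : ℤ) :
    ∫ x, (∑' k, a k * ex k x) * ex (-j) x ∂unif = a j := by
  have h1 : ∀ x, (∑' k, a k * ex k x) * ex (-j) x = ∑' k, a k * ex (k - j) x := by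
    intro x
    rw [← tsum_mul_right]
    refine tsum_congr fun k => ?_
    rw [sub_eq_add_neg, ex_add_index]; ring
  simp only [h1]
  rw [← integral_tsum_of_summable_integral_norm]
  · simp only [integral_const_mul, integral_ex]
    rw [tsum_eq_single j]
    · simp
    · intro k hk
      rw [if_neg (sub_ne_zero.2 hk), mul_zero]
  · intro k
    exact integrable_of_continuous (continuous_const.mul (continuous_ex _)) _
  · simpa [norm_mul, norm_ex] using ha

/-- Absolute summability gives uniform convergence, hence continuity, and Hermitian symmetry of the
coefficients makes the sum real. This is how continuous representatives of `L²` solutions are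
produced throughout. -/
theorem exists_synth {a : ℤ → ℂ} (ha : Summable fun k => ‖a k‖)
    (hc : ∀ k, a (-k) = conj (a k)) :
    ∃ f : Torus → ℝ, Continuous f ∧ (∀ k, fc f k = a k) ∧
      ∀ x, HasSum (fun k => a k * ex k x) (f x : ℂ) := by
  have hre : ∀ x, conj (∑' k, a k * ex k x) = ∑' k, a k * ex k x := by
    intro x
    rw [Complex.conj_tsum, ← (Equiv.neg ℤ).tsum_eq]
    refine tsum_congr fun k => ?_
    simp only [Equiv.neg_apply, hc, map_mul, Complex.conj_conj, ex_neg_index]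
  have hre' : ∀ x, (((∑' k, a k * ex k x).re : ℝ) : ℂ) = ∑' k, a k * ex k x :=
    fun x => Complex.conj_eq_iff_re.1 (hre x)
  refine ⟨fun x => (∑' k, a k * ex k x).re, Complex.continuous_re.comp (continuous_tsum_ex ha),
    fun k => ?_, fun x => ?_⟩
  · simp only [fc, hre', integral_tsum_ex ha]
  · rw [hre']; exact (summable_mul_ex ha x).hasSum

theorem hasSum_fc {f : Torus → ℝ} (hf : Continuous f) (h : Summable fun k => ‖fc f k‖)
    (x : Torus) : HasSum (fun k => fc f k * ex k x) (f x : ℂ) := by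
  obtain ⟨g, hg, hgf, hs⟩ := exists_synth h (fc_neg_index f)
  rw [eq_of_fc_eq hf hg (funext fun k => (hgf k).symm)]
  simpa only [hgf] using hs x

theorem exists_continuous_ae_eq {f : Torus → ℝ} (hf : MemLp f 2 unif)
    (h : Summable fun k => ‖fc f k‖) : ∃ g : Torus → ℝ, Continuous g ∧ f =ᵐ[unif] g := by
  obtain ⟨g, hg, hgf, -⟩ := exists_synth h (fc_neg_index f)
  exact ⟨g, hg, ae_eq_of_fc_eq hf (memLp_of_continuous hg 2) (funext fun k => (hgf k).symm)⟩

/-- Each summable power of `|k|` buys one classical derivative, by termwise differentiation. Every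
step from Fourier decay to smoothness goes through this lemma. -/
theorem exists_hasTDeriv {f : Torus → ℝ} (hf : Continuous f)
    (h : Summable fun k : ℤ => |(k : ℝ)| * ‖fc f k‖) :
    ∃ g : Torus → ℝ, Continuous g ∧ HasTDeriv f g ∧ ∀ k, fc g k = Complex.I * k * fc f k := by
  have hn : ∀ k : ℤ, ‖Complex.I * k * fc f k‖ = |(k : ℝ)| * ‖fc f k‖ := by
    intro k; simp
  have h0 : Summable fun k : ℤ => ‖fc f k‖ := by
    -- The weight `|k|` loses the zero mode, so the comparison is made off a finite set.
    refine Summable.of_norm_bounded_eventually h ?_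
    have : ({0} : Set ℤ)ᶜ ∈ cofinite := (Set.finite_singleton 0).compl_mem_cofinite
    filter_upwards [this] with k hk
    have hk' : (1 : ℝ) ≤ |(k : ℝ)| := by
      have : (1 : ℤ) ≤ |k| := Int.one_le_abs (by simpa using hk)
      exact_mod_cast this
    rw [norm_norm]
    nlinarith [norm_nonneg (fc f k)]
  obtain ⟨g, hg, hgf, hs⟩ := exists_synth (a := fun k => Complex.I * k * fc f k)
    (by simpa only [hn] using h) (by intro k; simp [fc_neg_index])
  refine ⟨g, hg, fun x => ?_, hgf⟩
  have hd := hasDerivAt_tsum (u := fun k : ℤ => |(k : ℝ)| * ‖fc f k‖) h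
    (g := fun k (t : ℝ) => fc f k * ex k (t : Torus))
    (g' := fun k (t : ℝ) => fc f k * (Complex.I * k * ex k (t : Torus)))
    (fun k t => (hasTDeriv_ex k t).const_mul _)
    (fun k t => by simp [norm_ex, mul_comm]) (y₀ := 0)
    (by simpa using (hasSum_fc hf h0 0).summable) x
  have e1 : (fun t : ℝ => ∑' k, fc f k * ex k (t : Torus)) = fun t : ℝ => (f t : ℂ) := by
    funext t; exact (hasSum_fc hf h0 t).tsum_eq
  have e2 : ∑' k : ℤ, fc f k * (Complex.I * k * ex k (x : Torus)) = (g x : ℂ) := by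
    rw [← (hs x).tsum_eq]; exact tsum_congr fun k => by ring
  rw [e1, e2] at hd
  have h5 := (Complex.reCLM.hasFDerivAt.comp_hasDerivAt x hd)
  simpa [Function.comp_def] using h5

/-! ### Square summability and difference quotients -/

/-- `f` is Lipschitz along translations in `L²`. -/
def L2Lip (f : Torus → ℝ) : Prop :=
  ∃ C : ℝ, ∀ h : ℝ, ∫ x, (f (x + (h : Torus)) - f x) ^ 2 ∂unif ≤ C * h ^ 2

/-- The Fourier side of `f ∈ H¹`. -/
def SqSum (f : Torus → ℝ) : Prop := Summable fun k : ℤ => (|(k : ℝ)| * ‖fc f k‖) ^ 2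

theorem memLp_shift {f : Torus → ℝ} (hf : MemLp f 2 unif) (h : Torus) :
    MemLp (fun x => f (x + h)) 2 unif :=
  hf.comp_measurePreserving (measurePreserving_add_right unif h)

theorem hasSum_shift_sub {f : Torus → ℝ} (hf : MemLp f 2 unif) (h : ℝ) :
    HasSum (fun k => (‖ex k (h : Torus) - 1‖ * ‖fc f k‖) ^ 2)
      (∫ x, (f (x + (h : Torus)) - f x) ^ 2 ∂unif) := by
  have := parseval_sq ((memLp_shift hf h).sub hf)
  refine this.congr_fun fun k => ?_
  have h1 := fc_sub ((memLp_shift hf h).integrable one_le_two) (hf.integrable one_le_two) k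
  rw [fc_shift] at h1
  have h2 : fc ((fun x => f (x + (h : Torus))) - f) k = (ex k (h : Torus) - 1) * fc f k := by
    rw [sub_mul, one_mul]; exact h1
  rw [h2, norm_mul]

/-- `SqSum` and `L2Lip` are two descriptions of `H¹`: Fourier multipliers act on the first, while
products and exponentials are controlled through the second by pointwise Lipschitz bounds. Passing
from one to the other avoids product and chain rules for weak derivatives. -/
theorem SqSum.l2Lip {f : Torus → ℝ} (hf : MemLp f 2 unif) (h : SqSum f) : L2Lip f := by
  refine ⟨∑' k : ℤ, (|(k : ℝ)| * ‖fc f k‖) ^ 2, fun t => ?_⟩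
  rw [← tsum_mul_right, ← (hasSum_shift_sub hf t).tsum_eq]
  refine Summable.tsum_le_tsum (fun k => ?_) (hasSum_shift_sub hf t).summable (h.mul_right _)
  have := norm_ex_sub_one_le k t
  calc (‖ex k (t : Torus) - 1‖ * ‖fc f k‖) ^ 2 ≤ (|(k : ℝ)| * |t| * ‖fc f k‖) ^ 2 := by gcongr
    _ = _ := by rw [← sq_abs t]; ring

theorem L2Lip.sqSum {f : Torus → ℝ} (hf : MemLp f 2 unif) (h : L2Lip f) : SqSum f := by
  obtain ⟨C, hC⟩ := h
  refine summable_of_sum_le (c := C) (fun k => sq_nonneg _) fun s => ?_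
  -- A finite partial sum is a limit of difference quotients as `h → 0`, all bounded by the same
  -- constant.
  have hlim : ∀ k : ℤ, Tendsto (fun h : ℝ => (‖ex k (h : Torus) - 1‖ / |h| * ‖fc f k‖) ^ 2)
      (𝓝[≠] 0) (𝓝 ((|(k : ℝ)| * ‖fc f k‖) ^ 2)) := by
    intro k
    have h1 := (hasDerivAt_iff_tendsto_slope.1 (hasTDeriv_ex k 0)).norm
    have h2 : Tendsto (fun h : ℝ => ‖ex k (h : Torus) - 1‖ / |h|) (𝓝[≠] 0) (𝓝 |(k : ℝ)|) := by
      have e : ‖Complex.I * k * ex k ((0 : ℝ) : Torus)‖ = |(k : ℝ)| := by simp [norm_ex]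
      rw [e] at h1
      refine h1.congr fun h => ?_
      simp [slope_def_module, ex_zero, div_eq_inv_mul]
    exact (h2.mul_const _).pow 2
  refine le_of_tendsto (tendsto_finsetSum s fun k _ => hlim k) ?_
  filter_upwards [self_mem_nhdsWithin] with t ht
  have ht' : (0 : ℝ) < t ^ 2 := sq_pos_of_ne_zero ht
  have h3 := (sum_le_hasSum s (fun k _ => sq_nonneg _) (hasSum_shift_sub hf t)).trans (hC t)
  have h4 : ∑ k ∈ s, (‖ex k (t : Torus) - 1‖ / |t| * ‖fc f k‖) ^ 2
      = (∑ k ∈ s, (‖ex k (t : Torus) - 1‖ * ‖fc f k‖) ^ 2) / t ^ 2 := by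
    rw [Finset.sum_div]
    refine Finset.sum_congr rfl fun k _ => ?_
    rw [← sq_abs t]; field_simp
  rw [h4, div_le_iff₀ ht']
  exact h3

theorem summable_of_sq {a b : ℤ → ℝ} (ha : Summable fun k => a k ^ 2)
    (hb : Summable fun k => b k ^ 2) : Summable fun k => a k * b k :=
  Summable.of_norm_bounded (ha.add hb) fun k => by
    rw [Real.norm_eq_abs, abs_le]
    constructor <;> nlinarith [sq_nonneg (a k - b k), sq_nonneg (a k + b k)]

theorem summable_int_rpow {s : ℝ} (hs : 1 < s) : Summable fun k : ℤ => |(k : ℝ)| ^ (-s) :=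
  Real.summable_abs_int_rpow hs

/-- Cauchy–Schwarz: `∑ |k|^s ‖f̂_k‖ < ∞` for `s < 1/2` when `f ∈ H¹`. -/
theorem SqSum.summable_rpow {f : Torus → ℝ} (h : SqSum f) {s : ℝ} (hs : s < 1 / 2) :
    Summable fun k : ℤ => |(k : ℝ)| ^ s * ‖fc f k‖ := by
  have h1 : Summable fun k : ℤ => (|(k : ℝ)| ^ (s - 1)) ^ 2 := by
    have := summable_int_rpow (s := 2 - 2 * s) (by linarith)
    refine this.congr fun k => ?_
    rw [← Real.rpow_natCast, ← Real.rpow_mul (abs_nonneg _)]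
    congr 1; push_cast; ring
  refine Summable.of_norm_bounded_eventually (summable_of_sq h1 h) ?_
  have : ({0} : Set ℤ)ᶜ ∈ cofinite := (Set.finite_singleton 0).compl_mem_cofinite
  filter_upwards [this] with k hk
  have hk' : 0 < |(k : ℝ)| := abs_pos.2 (by exact_mod_cast hk)
  rw [Real.norm_of_nonneg (by positivity), ← mul_assoc, ← Real.rpow_add_one hk'.ne']
  simp

theorem SqSum.summable {f : Torus → ℝ} (h : SqSum f) : Summable fun k : ℤ => ‖fc f k‖ := by
  simpa using h.summable_rpow (s := 0) (by norm_num)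

/-! ### The chord and the cotangent -/

/-- `|e^{iz} - 1|`. -/
def ch (z : Torus) : ℝ := ‖ex 1 z - 1‖

theorem chord_eq (x y : Torus) : chord x y = ch (x - y) := by
  have h1 : ∀ z : Torus, (AddCircle.toCircle z : ℂ) = ex 1 z := fun z => fourier_one.symm
  rw [chord, ch, h1, h1, ex_sub]
  have : ex 1 x * conj (ex 1 y) - 1 = (ex 1 x - ex 1 y) * conj (ex 1 y) := by
    rw [sub_mul, ex_mul_conj]
  rw [this, norm_mul, RCLike.norm_conj, norm_ex, mul_one]

theorem continuous_ch : Continuous ch := ((continuous_ex 1).sub continuous_const).norm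

theorem ch_nonneg (z : Torus) : 0 ≤ ch z := norm_nonneg _

theorem ch_le_two (z : Torus) : ch z ≤ 2 := by
  refine (norm_sub_le _ _).trans ?_
  rw [norm_ex]; norm_num

theorem ch_neg (z : Torus) : ch (-z) = ch z := by
  rw [ch, ch, ex_neg, ← RCLike.norm_conj]; simp

theorem ch_zero : ch 0 = 0 := by simp [ch, ex_zero]

theorem ch_eq_zero {z : Torus} : ch z = 0 ↔ z = 0 := by
  refine ⟨fun h => ?_, fun h => h ▸ ch_zero⟩
  rw [ch, norm_eq_zero, sub_eq_zero, ← ex_zero 1, ex, ex, fourier_one, fourier_one] at h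
  exact AddCircle.injective_toCircle (by positivity) (Subtype.ext h)

theorem ch_pos {z : Torus} (hz : z ≠ 0) : 0 < ch z :=
  (ch_nonneg z).lt_of_ne fun h => hz (ch_eq_zero.1 h.symm)

theorem ex_one_coe (t : ℝ) : ex 1 (t : Torus) = Complex.exp (t * Complex.I) := by
  rw [ex_coe]; push_cast; congr 1; ring

theorem ex_one_half (t : ℝ) : ex 1 (t : Torus) = Complex.exp ((t / 2 : ℝ) * Complex.I) ^ 2 := by
  rw [ex_one_coe, ← Complex.exp_nat_mul]
  congr 1; push_cast; ring

theorem ex_one_sub_one (t : ℝ) : ex 1 (t : Torus) - 1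
    = 2 * Complex.I * Real.sin (t / 2) * Complex.exp ((t / 2 : ℝ) * Complex.I) := by
  have h : (Real.cos (t / 2) : ℂ) ^ 2 + (Real.sin (t / 2) : ℂ) ^ 2 = 1 := by
    exact_mod_cast Real.cos_sq_add_sin_sq (t / 2)
  rw [ex_one_half, Complex.exp_mul_I, ← Complex.ofReal_cos, ← Complex.ofReal_sin]
  linear_combination h - (Real.sin (t / 2) : ℂ) ^ 2 * Complex.I_sq

theorem ex_one_add_one (t : ℝ) : ex 1 (t : Torus) + 1
    = 2 * Real.cos (t / 2) * Complex.exp ((t / 2 : ℝ) * Complex.I) := by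
  have h : (Real.cos (t / 2) : ℂ) ^ 2 + (Real.sin (t / 2) : ℂ) ^ 2 = 1 := by
    exact_mod_cast Real.cos_sq_add_sin_sq (t / 2)
  rw [ex_one_half, Complex.exp_mul_I, ← Complex.ofReal_cos, ← Complex.ofReal_sin]
  linear_combination (-1 : ℂ) * h + (Real.sin (t / 2) : ℂ) ^ 2 * Complex.I_sq

theorem ch_coe (t : ℝ) : ch (t : Torus) = 2 * |Real.sin (t / 2)| := by
  rw [ch, ex_one_sub_one, norm_mul, Complex.norm_exp_ofReal_mul_I, norm_mul, Complex.norm_real]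
  simp

theorem cotHalf_coe (t : ℝ) : cotHalf (t : Torus) = 1 / Real.tan (t / 2) :=
  Function.Periodic.lift_coe _ _

theorem cotHalf_coe' (t : ℝ) : cotHalf (t : Torus) = Real.cos (t / 2) / Real.sin (t / 2) := by
  rw [cotHalf_coe, Real.tan_eq_sin_div_cos, one_div_div]

theorem cotHalf_neg (z : Torus) : cotHalf (-z) = -cotHalf z := by
  induction z using QuotientAddGroup.induction_on with
  | H t =>
    have := cotHalf_coe' (-t)
    rw [neg_div, Real.cos_neg, Real.sin_neg, div_neg, ← cotHalf_coe'] at this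
    exact this

theorem abs_cotHalf_mul_ch_le (z : Torus) : |cotHalf z| * ch z ≤ 2 := by
  induction z using QuotientAddGroup.induction_on with
  | H t =>
    have h1 : |cotHalf (t : Torus)| * ch (t : Torus) ≤ 2 := by
      rw [cotHalf_coe', ch_coe, abs_div]
      rcases eq_or_ne (Real.sin (t / 2)) 0 with h | h
      · simp [h]
      · have : 0 < |Real.sin (t / 2)| := abs_pos.2 h
        rw [div_mul_eq_mul_div, div_le_iff₀ this]
        nlinarith [Real.abs_cos_le_one (t / 2)]
    exact h1

theorem abs_cotHalf_le {z : Torus} (hz : z ≠ 0) : |cotHalf z| ≤ 2 / ch z := by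
  rw [le_div_iff₀ (ch_pos hz)]; exact abs_cotHalf_mul_ch_le z

/-- The Cayley form of the cotangent, free of denominators. It fails at `z = 0`, where `cotHalf` has
the default value `0`. The Fourier symbol of the Hilbert transform and the expansion of the
interaction kernel both come from it. -/
theorem cotHalf_mul {z : Torus} (hz : z ≠ 0) :
    (cotHalf z : ℂ) * (ex 1 z - 1) = Complex.I * (ex 1 z + 1) := by
  induction z using QuotientAddGroup.induction_on with
  | H t =>
    have h0 : ch (t : Torus) ≠ 0 := fun h => hz (ch_eq_zero.1 h)
    have h1 : (Real.sin (t / 2) : ℂ) ≠ 0 := by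
      rw [ch_coe] at h0
      intro h
      apply h0
      rw [Complex.ofReal_eq_zero.1 h]; simp
    have : (cotHalf (t : Torus) : ℂ) * (ex 1 (t : Torus) - 1) = Complex.I * (ex 1 (t : Torus) + 1) := by
      rw [cotHalf_coe', ex_one_sub_one, ex_one_add_one, Complex.ofReal_div]
      field_simp
    exact this

theorem measurable_cotHalf : Measurable cotHalf := by
  have h : cotHalf = fun z => if z = 0 then 0 else
      (Complex.I * (ex 1 z + 1) / (ex 1 z - 1)).re := by
    funext z
    split_ifs with hz
    · subst hz
      have := cotHalf_coe' 0
      simpa using this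
    · have hne : ex 1 z - 1 ≠ 0 := fun h => hz (ch_eq_zero.1 (by rw [ch, h, norm_zero]))
      rw [← cotHalf_mul hz, mul_div_cancel_right₀ _ hne, Complex.ofReal_re]
  rw [h]
  refine Measurable.ite (measurableSet_singleton 0) measurable_const ?_
  exact Complex.measurable_re.comp (((continuous_const.mul ((continuous_ex 1).add
    continuous_const)).measurable).div ((continuous_ex 1).sub continuous_const).measurable)

theorem norm_ex_sub_one_le_ch (k : ℤ) (z : Torus) : ‖ex k z - 1‖ ≤ |(k : ℝ)| * ch z := by
  have hn : ∀ n : ℕ, ‖ex n z - 1‖ ≤ n * ch z := by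
    intro n
    induction n with
    | zero => simp [ex_zero_index]
    | succ n ih =>
      have : ex ((n + 1 : ℕ) : ℤ) z - 1 = ex n z * (ex 1 z - 1) + (ex n z - 1) := by
        push_cast; rw [ex_add_index]; ring
      rw [this]
      refine (norm_add_le _ _).trans ?_
      rw [norm_mul, norm_ex, one_mul]
      push_cast
      have : ‖ex 1 z - 1‖ = ch z := rfl
      linarith
  rcases Int.natAbs_eq k with h | h
  · rw [h]; simpa using hn k.natAbs
  · rw [h, ex_neg_index]
    have : conj (ex (k.natAbs : ℤ) z) - 1 = conj (ex (k.natAbs : ℤ) z - 1) := by simp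
    rw [this, RCLike.norm_conj]
    simpa using hn k.natAbs

/-! ### Integrability of negative powers of the chord -/

theorem integrable_unif_iff {f : Torus → ℝ} (hf : Measurable f) :
    Integrable f unif ↔
      IntegrableOn (fun t : ℝ => f (t : Torus)) (Set.Ioc 0 (2 * Real.pi)) := by
  have h1 : Integrable f unif ↔ Integrable f (volume : Measure Torus) := by
    rw [AddCircle.volume_eq_smul_haarAddCircle, integrable_smul_measure]
    · simp [Real.pi_pos]
    · exact ENNReal.ofReal_ne_top
  have h2 := (AddCircle.measurePreserving_mk (2 * Real.pi) 0).integrable_comp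
    (g := f) hf.aestronglyMeasurable
  rw [zero_add] at h2
  rw [h1, ← h2]
  rfl

/-- The chord vanishes only linearly, at the two ends of a fundamental interval. Jordan's inequality
`sin a ≥ 2a / π` bounds it below there by `2 / π` times the distance to the nearer end. -/
theorem integrable_ch_rpow {s : ℝ} (hs0 : 0 < s) (hs1 : s < 1) :
    Integrable (fun z => ch z ^ (-s)) unif := by
  have hm : Measurable fun z => ch z ^ (-s) := continuous_ch.measurable.pow_const _
  rw [integrable_unif_iff hm]
  have h1 : IntervalIntegrable (fun t : ℝ => t ^ (-s)) volume 0 (2 * Real.pi) :=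
    intervalIntegral.intervalIntegrable_rpow' (by linarith)
  have h2 : IntervalIntegrable (fun t : ℝ => (2 * Real.pi - t) ^ (-s)) volume 0 (2 * Real.pi) := by
    have := (h1.comp_sub_left (2 * Real.pi)).symm
    simpa using this
  have h3 := (intervalIntegrable_iff_integrableOn_Ioc_of_le Real.two_pi_pos.le).1
    ((h1.add h2).const_mul ((2 / Real.pi) ^ (-s)))
  refine h3.mono' (hm.comp continuous_coe_torus.measurable).aestronglyMeasurable ?_
  filter_upwards [ae_restrict_mem measurableSet_Ioc] with t ht
  have hpi := Real.pi_pos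
  rw [Real.norm_of_nonneg (Real.rpow_nonneg (ch_nonneg _) _)]
  have ht0 : 0 ≤ t / 2 := by linarith [ht.1]
  have key : ∀ a : ℝ, 0 ≤ a → (a ≤ Real.pi) → 2 / Real.pi * (a / 1) ≤ 2 * Real.sin (a / 2) := by
    intro a ha ha2
    have := Real.mul_le_sin (x := a / 2) (by linarith) (by linarith)
    calc 2 / Real.pi * (a / 1) = 2 * (2 / Real.pi * (a / 2)) := by ring
      _ ≤ _ := by linarith
  rw [ch_coe]
  have hpos1 : 0 ≤ t ^ (-s) := Real.rpow_nonneg ht.1.le _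
  have hpos2 : 0 ≤ (2 * Real.pi - t) ^ (-s) := Real.rpow_nonneg (by linarith [ht.2]) _
  have hc : 0 ≤ (2 / Real.pi) ^ (-s) := by positivity
  rcases le_total t Real.pi with h | h
  · have h4 := key t ht.1.le h
    have h5 : 2 / Real.pi * t ≤ 2 * |Real.sin (t / 2)| := by
      rw [div_one] at h4
      exact h4.trans (by gcongr; exact le_abs_self _)
    have h6 : 0 < 2 / Real.pi * t := by have := ht.1; positivity
    refine (Real.rpow_le_rpow_of_nonpos h6 h5 (by linarith)).trans ?_
    rw [Real.mul_rpow (by positivity) ht.1.le]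
    nlinarith
  · rcases ht.2.eq_or_lt with h7 | h7
    -- The end `t = 2π` is again the point `0` of the torus; the negative powers of zero there take
    -- the default value `0`.
    · rw [h7]
      have : (2 * Real.pi) / 2 = Real.pi := by ring
      rw [this, Real.sin_pi, abs_zero, mul_zero, Real.zero_rpow (by linarith)]
      simp only [sub_self, Real.zero_rpow (by linarith : -s ≠ 0)]
      rw [h7] at hpos1
      nlinarith
    have h4 := key (2 * Real.pi - t) (by linarith) (by linarith)
    have h8 : Real.sin ((2 * Real.pi - t) / 2) = Real.sin (t / 2) := by
      rw [show (2 * Real.pi - t) / 2 = Real.pi - t / 2 by ring, Real.sin_pi_sub]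
    rw [h8, div_one] at h4
    have h5 : 2 / Real.pi * (2 * Real.pi - t) ≤ 2 * |Real.sin (t / 2)| :=
      h4.trans (by gcongr; exact le_abs_self _)
    have h6 : 0 < 2 / Real.pi * (2 * Real.pi - t) := by
      have : 0 < 2 * Real.pi - t := by linarith
      positivity
    refine (Real.rpow_le_rpow_of_nonpos h6 h5 (by linarith)).trans ?_
    rw [Real.mul_rpow (by positivity) (by linarith)]
    nlinarith

/-! ### The logarithmic kernel and its Poisson regularization -/

/-- `-log |e^{iz} - 1|`. -/
def lg (z : Torus) : ℝ := -Real.log (ch z)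

theorem measurable_lg : Measurable lg := (continuous_ch.measurable.log).neg

theorem lg_ge (z : Torus) : -Real.log 2 ≤ lg z := by
  rw [lg, neg_le_neg_iff]
  rcases (ch_nonneg z).eq_or_lt with h | h
  · rw [← h, Real.log_zero]; exact Real.log_nonneg (by norm_num)
  · exact Real.log_le_log h (ch_le_two z)

theorem integrable_lg : Integrable lg unif := by
  have h1 := integrable_ch_rpow (s := 1 / 2) (by norm_num) (by norm_num)
  refine ((h1.const_mul 2).add (integrable_const (Real.log 2))).mono'
    measurable_lg.aestronglyMeasurable (ae_of_all _ fun z => ?_)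
  have hl2 : 0 ≤ Real.log 2 := Real.log_nonneg (by norm_num)
  rw [Real.norm_eq_abs, abs_le]
  have hp : 0 ≤ ch z ^ (-(1 / 2) : ℝ) := Real.rpow_nonneg (ch_nonneg z) _
  constructor
  · have := lg_ge z
    simp only [Pi.add_apply]; linarith
  · rcases (ch_nonneg z).eq_or_lt with h | h
    · simp only [lg, ← h, Real.log_zero, neg_zero, Pi.add_apply]
      rw [← h] at hp
      linarith
    · have := Real.log_le_rpow_div (x := (ch z)⁻¹) (by positivity) (ε := 1 / 2) (by norm_num)
      rw [Real.log_inv, Real.inv_rpow h.le, ← Real.rpow_neg h.le] at this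
      simp only [lg, Pi.add_apply]; linarith

/-- `-log |1 - r e^{iz}|`. -/
def pk (r : ℝ) (z : Torus) : ℝ := -Real.log ‖1 - r * ex 1 z‖

/-- The Fourier coefficients of the Poisson regularization. -/
def pc (r : ℝ) (k : ℤ) : ℝ := r ^ k.natAbs / (2 * |(k : ℝ)|)

theorem pc_nonneg {r : ℝ} (hr : 0 ≤ r) (k : ℤ) : 0 ≤ pc r k := by unfold pc; positivity

theorem pc_neg (r : ℝ) (k : ℤ) : pc r (-k) = pc r k := by simp [pc]

theorem ex_natCast (n : ℕ) (z : Torus) : ex n z = ex 1 z ^ n := by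
  induction n with
  | zero => simp [ex_zero_index]
  | succ n ih => push_cast; rw [ex_add_index, ih, pow_succ]

/-- The Taylor series of `-log (1 - r e^{iz})`, averaged with its conjugate, spreads evenly over the
modes `k` and `-k`. The zero mode contributes `0` because dividing by zero gives `0`. The
coefficients are nonnegative, which is the source of all positivity statements on the energy. -/
theorem hasSum_pk {r : ℝ} (hr : 0 ≤ r) (hr1 : r < 1) (z : Torus) :
    HasSum (fun k : ℤ => (pc r k : ℂ) * ex k z) (pk r z : ℂ) := by
  have hw : ‖(r : ℂ) * ex 1 z‖ < 1 := by
    rw [norm_mul, norm_ex, mul_one, Complex.norm_real, Real.norm_of_nonneg hr]; exact hr1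
  have h1 := (Complex.hasSum_taylorSeries_neg_log hw).div_const 2
  have h2 : HasSum (fun n : ℕ => ((pc r (n : ℤ) : ℝ) : ℂ) * ex (n : ℤ) z)
      (-Complex.log (1 - r * ex 1 z) / 2) := by
    refine h1.congr_fun fun n => ?_
    rw [ex_natCast, mul_pow, pc]
    push_cast
    simp only [Int.natAbs_natCast, Nat.abs_cast]
    push_cast
    ring
  have h3 : HasSum (fun n : ℕ => ((pc r (-(n : ℤ)) : ℝ) : ℂ) * ex (-(n : ℤ)) z)
      (conj (-Complex.log (1 - r * ex 1 z) / 2)) := by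
    have := Complex.hasSum_conj'.2 h2
    refine this.congr_fun fun n => ?_
    rw [pc_neg, ex_neg_index, map_mul, Complex.conj_ofReal]
  have h4 := HasSum.of_nat_of_neg (f := fun k : ℤ => (pc r k : ℂ) * ex k z) h2 h3
  have h5 : -Complex.log (1 - r * ex 1 z) / 2 + conj (-Complex.log (1 - r * ex 1 z) / 2)
      - (pc r 0 : ℂ) * ex 0 z = (pk r z : ℂ) := by
    rw [Complex.add_conj]
    have : pc r 0 = 0 := by simp [pc]
    rw [this]
    have h6 : (-Complex.log (1 - r * ex 1 z) / 2).re = -Real.log ‖1 - r * ex 1 z‖ / 2 := by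
      rw [← Complex.log_re]
      simp
    rw [h6, pk]; push_cast; ring
  rw [← h5]
  exact h4

theorem summable_pc {r : ℝ} (hr : 0 ≤ r) (hr1 : r < 1) : Summable fun k : ℤ => pc r k := by
  have := (hasSum_pk hr hr1 0).summable
  simp only [ex_zero, mul_one] at this
  exact Complex.summable_ofReal.1 this

theorem norm_one_sub_le {r : ℝ} (hr : 0 ≤ r) (z : Torus) : ‖1 - r * ex 1 z‖ ≤ 1 + r := by
  refine (norm_sub_le _ _).trans ?_
  rw [norm_mul, norm_ex, Complex.norm_real, Real.norm_of_nonneg hr]; simp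

theorem le_norm_one_sub {r : ℝ} (hr : 0 ≤ r) (z : Torus) : 1 - r ≤ ‖1 - r * ex 1 z‖ := by
  refine le_trans ?_ (norm_sub_norm_le _ _)
  rw [norm_mul, norm_ex, Complex.norm_real, Real.norm_of_nonneg hr]; simp

theorem norm_one_sub_sq (r : ℝ) (z : Torus) :
    ‖1 - r * ex 1 z‖ ^ 2 = 1 - 2 * r * (ex 1 z).re + r ^ 2 := by
  have h := norm_ex 1 z
  have h2 : (ex 1 z).re ^ 2 + (ex 1 z).im ^ 2 = 1 := by
    have := Complex.sq_norm (ex 1 z)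
    rw [h, Complex.normSq_apply] at this
    nlinarith
  rw [Complex.sq_norm, Complex.normSq_apply]
  simp only [Complex.sub_re, Complex.one_re, Complex.mul_re, Complex.ofReal_re, Complex.ofReal_im,
    zero_mul, sub_zero, Complex.sub_im, Complex.one_im, Complex.mul_im, add_zero, zero_sub]
  linear_combination r ^ 2 * h2

theorem ch_sq (z : Torus) : ch z ^ 2 = 2 - 2 * (ex 1 z).re := by
  have := norm_one_sub_sq 1 z
  rw [Complex.ofReal_one, one_mul, norm_sub_rev] at this
  rw [ch, this]; ring

/-- After squaring, the difference of the two sides is a multiple of `(1 - r)² (1 + Re e^{iz})`. A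
constant tending to `1` as `r → 1` is essential: at `r = 1 - 1/N` each of the `N²` pairs may lose
only `O(1/N)`. -/
theorem ch_le_mul_norm {r : ℝ} (hr : 0 ≤ r) (z : Torus) :
    ch z ≤ 2 / (1 + r) * ‖1 - r * ex 1 z‖ := by
  rw [div_mul_eq_mul_div, le_div_iff₀ (by linarith)]
  refine abs_le_of_sq_le_sq' ?_ (by positivity) |>.2
  rw [mul_pow, mul_pow, ch_sq, norm_one_sub_sq]
  have h1 : -1 ≤ (ex 1 z).re := by
    have := Complex.abs_re_le_norm (ex 1 z)
    rw [norm_ex] at this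
    exact (abs_le.1 this).1
  nlinarith [mul_nonneg (sq_nonneg (1 - r)) (by linarith : 0 ≤ 1 + (ex 1 z).re)]

theorem pk_ge {r : ℝ} (hr : 0 ≤ r) (hr1 : r < 1) (z : Torus) : -Real.log 2 ≤ pk r z := by
  rw [pk, neg_le_neg_iff]
  have h := le_norm_one_sub hr z
  have h2 := norm_one_sub_le hr z
  exact Real.log_le_log (by linarith) (by linarith)

theorem pk_le_lg {r : ℝ} (hr : 0 ≤ r) (hr1 : r < 1) {z : Torus} (hz : z ≠ 0) :
    pk r z ≤ lg z + Real.log (2 / (1 + r)) := by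
  have h := le_norm_one_sub hr z
  have h2 := Real.log_le_log (ch_pos hz) (ch_le_mul_norm hr z)
  rw [Real.log_mul (by positivity) (by linarith)] at h2
  rw [pk, lg]; linarith

theorem abs_pk_le {r : ℝ} (hr : 0 ≤ r) (hr1 : r < 1) {z : Torus} (hz : z ≠ 0) :
    |pk r z| ≤ |lg z| + Real.log 2 := by
  have h1 := pk_ge hr hr1 z
  have h2 := pk_le_lg hr hr1 hz
  have h3 : Real.log (2 / (1 + r)) ≤ Real.log 2 :=
    Real.log_le_log (by positivity) (div_le_self (by norm_num) (by linarith))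
  have h4 := le_abs_self (lg z)
  have h5 := abs_nonneg (lg z)
  rw [abs_le]; constructor <;> linarith

theorem continuous_pk {r : ℝ} (hr : 0 ≤ r) (hr1 : r < 1) : Continuous (pk r) := by
  unfold pk
  refine (Continuous.log ?_ fun z => ?_).neg
  · exact (continuous_const.sub (continuous_const.mul (continuous_ex 1))).norm
  · have := le_norm_one_sub hr z
    intro h
    linarith

theorem tendsto_pk {z : Torus} (hz : z ≠ 0) : Tendsto (fun r => pk r z) (𝓝[<] 1) (𝓝 (lg z)) := by
  have h1 : Tendsto (fun r : ℝ => ‖1 - (r : ℂ) * ex 1 z‖) (𝓝[<] 1) (𝓝 (ch z)) := by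
    have : ContinuousAt (fun r : ℝ => ‖1 - (r : ℂ) * ex 1 z‖) 1 := by fun_prop
    have h := this.tendsto
    simp only [Complex.ofReal_one, one_mul] at h
    rw [norm_sub_rev] at h
    exact h.mono_left nhdsWithin_le_nhds
  exact (h1.log (ch_pos hz).ne').neg

/-! ### Double integrals of the regularized kernel -/

/-- The Fourier coefficients of a measure. -/
def mc (m : Measure Torus) (k : ℤ) : ℂ := ∫ x, ex (-k) x ∂m

theorem integral_ex_measure (m : Measure Torus) (k : ℤ) : ∫ x, ex k x ∂m = conj (mc m k) := by
  rw [mc, ← integral_conj]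
  simp only [ex_neg_index, Complex.conj_conj]

theorem norm_mc_le (m : Measure Torus) [IsProbabilityMeasure m] (k : ℤ) : ‖mc m k‖ ≤ 1 := by
  refine (norm_integral_le_integral_norm _).trans ?_
  simp [norm_ex]

theorem integral_pk {r : ℝ} (hr : 0 ≤ r) (hr1 : r < 1) (m : Measure Torus) [IsProbabilityMeasure m]
    (x : Torus) :
    HasSum (fun k : ℤ => (pc r k : ℂ) * mc m k * ex k x) ((∫ y, pk r (x - y) ∂m : ℝ) : ℂ) := by
  have hs := summable_pc hr hr1
  have h := hasSum_integral_of_summable_integral_norm (μ := m)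
    (F := fun (k : ℤ) y => (pc r k : ℂ) * ex k (x - y)) (fun k =>
      integrable_of_continuous (continuous_const.mul ((continuous_ex k).comp (by fun_prop))) _)
    (by
      simp only [norm_mul, norm_ex, mul_one, Complex.norm_real,
        Real.norm_of_nonneg (pc_nonneg hr _)]
      simpa using hs)
  have e1 : ∫ y, ∑' k : ℤ, (pc r k : ℂ) * ex k (x - y) ∂m
      = ((∫ y, pk r (x - y) ∂m : ℝ) : ℂ) := by
    rw [← integral_complex_ofReal]
    exact integral_congr_ae (ae_of_all _ fun y => (hasSum_pk hr hr1 _).tsum_eq)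
  rw [e1] at h
  refine h.congr_fun fun k => ?_
  rw [integral_const_mul]
  simp only [ex_sub]
  rw [integral_const_mul, mc]
  simp only [ex_neg_index]
  ring

/-- Fourier series diagonalize the regularized energy; with nonnegative coefficients it becomes a
positive semidefinite form in the Fourier coefficients of the measures. -/
theorem integral_integral_pk {r : ℝ} (hr : 0 ≤ r) (hr1 : r < 1) (n m : Measure Torus)
    [IsProbabilityMeasure n] [IsProbabilityMeasure m] :
    HasSum (fun k : ℤ => (pc r k : ℂ) * (conj (mc n k) * mc m k))
      ((∫ x, ∫ y, pk r (x - y) ∂m ∂n : ℝ) : ℂ) := by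
  have hs := summable_pc hr hr1
  have h := hasSum_integral_of_summable_integral_norm (μ := n)
    (F := fun (k : ℤ) x => (pc r k : ℂ) * mc m k * ex k x) (fun k =>
      integrable_of_continuous (continuous_const.mul (continuous_ex k)) _)
    (by
      simp only [norm_mul, norm_ex, mul_one, Complex.norm_real,
        Real.norm_of_nonneg (pc_nonneg hr _)]
      refine Summable.of_nonneg_of_le (fun k => ?_) (fun k => ?_) hs
      · simp only [integral_const, probReal_univ, one_smul]
        exact mul_nonneg (pc_nonneg hr k) (norm_nonneg _)
      · simp only [integral_const, probReal_univ, one_smul]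
        exact mul_le_of_le_one_right (pc_nonneg hr k) (norm_mc_le m k))
  have e1 : ∫ x, ∑' k : ℤ, (pc r k : ℂ) * mc m k * ex k x ∂n
      = ((∫ x, ∫ y, pk r (x - y) ∂m ∂n : ℝ) : ℂ) := by
    rw [← integral_complex_ofReal]
    exact integral_congr_ae (ae_of_all _ fun x => (integral_pk hr hr1 m x).tsum_eq)
  rw [e1] at h
  refine h.congr_fun fun k => ?_
  rw [integral_const_mul, integral_ex_measure]
  ring

/-- The regularized energy of a difference of probability measures is nonnegative. -/
theorem pk_energy_sub_nonneg {r : ℝ} (hr : 0 ≤ r) (hr1 : r < 1) (n m : Measure Torus)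
    [IsProbabilityMeasure n] [IsProbabilityMeasure m] :
    0 ≤ (∫ x, ∫ y, pk r (x - y) ∂n ∂n) - 2 * (∫ x, ∫ y, pk r (x - y) ∂m ∂n)
      + ∫ x, ∫ y, pk r (x - y) ∂m ∂m := by
  have h := ((integral_integral_pk hr hr1 n n).sub
    ((integral_integral_pk hr hr1 n m).add (Complex.hasSum_conj'.2
        (integral_integral_pk hr hr1 n m)))).add (integral_integral_pk hr hr1 m m)
  have h1 : HasSum (fun k : ℤ => ((pc r k * ‖mc n k - mc m k‖ ^ 2 : ℝ) : ℂ))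
      (((∫ x, ∫ y, pk r (x - y) ∂n ∂n) - 2 * (∫ x, ∫ y, pk r (x - y) ∂m ∂n)
      + ∫ x, ∫ y, pk r (x - y) ∂m ∂m : ℝ) : ℂ) := by
    have e : (((∫ x, ∫ y, pk r (x - y) ∂n ∂n) - 2 * (∫ x, ∫ y, pk r (x - y) ∂m ∂n)
      + ∫ x, ∫ y, pk r (x - y) ∂m ∂m : ℝ) : ℂ) =
      ((∫ x, ∫ y, pk r (x - y) ∂n ∂n : ℝ) : ℂ) - (((∫ x, ∫ y, pk r (x - y) ∂m ∂n : ℝ) : ℂ)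
      + conj ((∫ x, ∫ y, pk r (x - y) ∂m ∂n : ℝ) : ℂ))
      + ((∫ x, ∫ y, pk r (x - y) ∂m ∂m : ℝ) : ℂ) := by
      rw [Complex.conj_ofReal]; push_cast; ring
    rw [e]
    refine h.congr_fun fun k => ?_
    rw [← Complex.normSq_eq_norm_sq]
    push_cast
    rw [← Complex.mul_conj]
    simp only [map_sub, map_mul, Complex.conj_ofReal, Complex.conj_conj]
    ring
  exact (Complex.hasSum_ofReal.1 h1).nonneg fun k =>
    mul_nonneg (pc_nonneg hr k) (sq_nonneg _)

/-! ### The Hilbert transform of Hölder functions -/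

/-- Hölder continuity of exponent `1/4`. -/
def Hol (v : Torus → ℝ) : Prop := ∃ C : ℝ, ∀ x z, |v (x + z) - v x| ≤ C * ch z ^ (1 / 4 : ℝ)

/-- The Hilbert transform, as an absolutely convergent integral. -/
def hil (v : Torus → ℝ) (x : Torus) : ℝ := -∫ t, (v t - v x) * cotHalf (x - t) ∂unif

/-- Interpolation: `min (2, s) ≤ 2 s^{1/4}` with `s = |k| ch z` bounds each increment `e^{ikz} - 1`.
The exponent `1/4` lies below the limit `1/2` available for functions in `H¹`. -/
theorem hol_of_summable {v : Torus → ℝ} (hv : Continuous v) (h0 : Summable fun k => ‖fc v k‖)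
    (h : Summable fun k : ℤ => |(k : ℝ)| ^ (1 / 4 : ℝ) * ‖fc v k‖) : Hol v := by
  refine ⟨2 * ∑' k : ℤ, |(k : ℝ)| ^ (1 / 4 : ℝ) * ‖fc v k‖, fun x z => ?_⟩
  have h1 := (hasSum_fc hv h0 (x + z)).sub (hasSum_fc hv h0 x)
  have hb : ∀ k : ℤ, ‖fc v k * ex k (x + z) - fc v k * ex k x‖
      ≤ 2 * (|(k : ℝ)| ^ (1 / 4 : ℝ) * ‖fc v k‖) * ch z ^ (1 / 4 : ℝ) := by
    intro k
    have e : fc v k * ex k (x + z) - fc v k * ex k x = fc v k * ex k x * (ex k z - 1) := by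
      rw [ex_add]; ring
    rw [e, norm_mul, norm_mul, norm_ex, mul_one]
    have h2 : ‖ex k z - 1‖ ≤ 2 * (|(k : ℝ)| * ch z) ^ (1 / 4 : ℝ) := by
      have h3 := norm_ex_sub_one_le_ch k z
      have h4 : ‖ex k z - 1‖ ≤ 2 := by
        refine (norm_sub_le _ _).trans ?_
        rw [norm_ex]; norm_num
      have hnn : 0 ≤ |(k : ℝ)| * ch z := mul_nonneg (abs_nonneg _) (ch_nonneg z)
      rcases le_total 1 (|(k : ℝ)| * ch z) with h5 | h5
      · have := Real.one_le_rpow h5 (z := 1 / 4) (by norm_num)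
        linarith
      · have h6 := Real.rpow_le_rpow_of_exponent_ge' hnn h5 (z := 1 / 4) (y := 1) (by norm_num)
          (by norm_num)
        rw [Real.rpow_one] at h6
        have := Real.rpow_nonneg hnn (1 / 4)
        linarith
    rw [Real.mul_rpow (abs_nonneg _) (ch_nonneg z)] at h2
    calc ‖fc v k‖ * ‖ex k z - 1‖ ≤ ‖fc v k‖ * (2 * (|(k : ℝ)| ^ (1 / 4 : ℝ) * ch z ^ (1 / 4 : ℝ))) := by
          gcongr
      _ = _ := by ring
  have hs : Summable fun k : ℤ => 2 * (|(k : ℝ)| ^ (1 / 4 : ℝ) * ‖fc v k‖) * ch z ^ (1 / 4 : ℝ) :=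
    (h.mul_left 2).mul_right _
  have h7 := tsum_of_norm_bounded hs.hasSum hb
  rw [h1.tsum_eq, tsum_mul_right, tsum_mul_left, ← Complex.ofReal_sub, Complex.norm_real] at h7
  exact h7

theorem SqSum.hol {v : Torus → ℝ} (hv : Continuous v) (h : SqSum v) : Hol v :=
  hol_of_summable hv h.summable (h.summable_rpow (by norm_num))

/-- The Hölder gain `1/4` against the pole of order `1` leaves the power `-3/4`, integrable and
independent of `x`: one dominating function serves continuity, Fubini and the principal value. -/
theorem Hol.bound {v : Torus → ℝ} (h : Hol v) :
    ∃ C : ℝ, 0 ≤ C ∧ ∀ x s, |(v (x - s) - v x) * cotHalf s| ≤ C * ch s ^ (-(3 / 4) : ℝ) := by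
  obtain ⟨C, hC⟩ := h
  refine ⟨2 * |C|, by positivity, fun x s => ?_⟩
  rcases eq_or_ne s 0 with rfl | hs
  · have : 0 ≤ ch 0 ^ (-(3 / 4) : ℝ) := Real.rpow_nonneg (ch_nonneg _) _
    simp only [sub_zero, sub_self, zero_mul, abs_zero]
    positivity
  have h1 := hC x (-s)
  rw [ch_neg, ← sub_eq_add_neg] at h1
  have hp := ch_pos hs
  rw [abs_mul]
  calc |v (x - s) - v x| * |cotHalf s| ≤ (|C| * ch s ^ (1 / 4 : ℝ)) * (2 / ch s) := by
        gcongr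
        · exact h1.trans (by gcongr; exact le_abs_self C)
        · exact abs_cotHalf_le hs
    _ = 2 * |C| * (ch s ^ (1 / 4 : ℝ) / ch s) := by ring
    _ = _ := by
      rw [← Real.rpow_sub_one hp.ne']; norm_num

theorem hil_eq (v : Torus → ℝ) (x : Torus) :
    hil v x = -∫ s, (v (x - s) - v x) * cotHalf s ∂unif := by
  rw [hil]
  have := integral_sub_left_eq_self (μ := unif) (fun t => (v t - v x) * cotHalf (x - t)) x
  rw [← this]
  simp only [sub_sub_cancel]

theorem Hol.integrable {v : Torus → ℝ} (hv : Continuous v) (h : Hol v) (x : Torus) :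
    Integrable (fun s => (v (x - s) - v x) * cotHalf s) unif := by
  obtain ⟨C, -, hC⟩ := h.bound
  refine ((integrable_ch_rpow (s := 3 / 4) (by norm_num) (by norm_num)).const_mul C).mono' ?_
    (ae_of_all _ fun s => hC x s)
  exact (((hv.comp (by fun_prop)).sub continuous_const).measurable.mul
    measurable_cotHalf).aestronglyMeasurable

theorem Hol.integrable' {v : Torus → ℝ} (hv : Continuous v) (h : Hol v) (x : Torus) :
    Integrable (fun t => (v t - v x) * cotHalf (x - t)) unif := by
  have := (h.integrable hv x).comp_sub_left x
  simpa only [sub_sub_cancel] using this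

theorem continuous_hil {v : Torus → ℝ} (hv : Continuous v) (h : Hol v) : Continuous (hil v) := by
  obtain ⟨C, -, hC⟩ := h.bound
  have : hil v = fun x => -∫ s, (v (x - s) - v x) * cotHalf s ∂unif := funext (hil_eq v)
  rw [this]
  refine (continuous_of_dominated (fun x => (h.integrable hv x).aestronglyMeasurable)
    (fun x => ae_of_all _ fun s => hC x s)
    ((integrable_ch_rpow (s := 3 / 4) (by norm_num) (by norm_num)).const_mul C)
    (ae_of_all _ fun s => ?_)).neg
  exact ((hv.comp (by fun_prop)).sub hv).mul continuous_const

theorem integrable_cotHalf_ex (k : ℤ) :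
    Integrable (fun s => (cotHalf s : ℂ) * (ex k s - 1)) unif := by
  refine Integrable.of_bound (C := 2 * |(k : ℝ)|) ?_ (ae_of_all _ fun s => ?_)
  · exact ((Complex.measurable_ofReal.comp measurable_cotHalf).mul
      ((continuous_ex k).sub continuous_const).measurable).aestronglyMeasurable
  · rw [norm_mul, Complex.norm_real, Real.norm_eq_abs]
    have h1 := norm_ex_sub_one_le_ch k s
    have h2 := abs_cotHalf_mul_ch_le s
    calc |cotHalf s| * ‖ex k s - 1‖ ≤ |cotHalf s| * (|(k : ℝ)| * ch s) := by gcongr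
      _ = (|cotHalf s| * ch s) * |(k : ℝ)| := by ring
      _ ≤ _ := by gcongr

instance instNullSingletonUnif : NullSingletonClass unif := by
  have hn : (𝓝[≠] (0 : Torus)).NeBot := by
    refine (mem_closure_iff_nhdsWithin_neBot).1 ?_
    have h1 : Tendsto (fun t : ℝ => (t : Torus)) (𝓝[>] 0) (𝓝 (0 : Torus)) := by
      have := continuous_coe_torus.tendsto 0
      simpa using this.mono_left nhdsWithin_le_nhds
    refine mem_closure_of_tendsto h1 ?_
    have h2 : Set.Ioo (0 : ℝ) (2 * Real.pi) ∈ 𝓝[>] (0 : ℝ) := Ioo_mem_nhdsGT Real.two_pi_pos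
    filter_upwards [h2] with t ht h0
    have h3 := ch_eq_zero.2 h0
    rw [ch_coe] at h3
    have := Real.sin_pos_of_pos_of_lt_pi (x := t / 2) (by linarith [ht.1]) (by linarith [ht.2])
    rw [abs_of_pos this] at h3
    linarith
  infer_instance

theorem ae_ne (z : Torus) : ∀ᵐ s ∂unif, s ≠ z := by
  have : (unif : Measure Torus) {z} = 0 := measure_singleton z
  rw [ae_iff]
  simp [this]

/-- By `cotHalf_mul`, consecutive integrands differ by `i (e^{i(k+1)s} + e^{iks})`, whose integral
is explicit. The symbol `i sign k` then follows by induction in both directions from `k = 0`,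
without contour integrals. -/
theorem integral_cotHalf_ex_succ (k : ℤ) :
    ∫ s, (cotHalf s : ℂ) * (ex (k + 1) s - 1) ∂unif = ∫ s, (cotHalf s : ℂ) * (ex k s - 1) ∂unif
      + Complex.I * ((if k + 1 = 0 then 1 else 0) + if k = 0 then 1 else 0) := by
  have hc : Continuous fun s => Complex.I * (ex (k + 1) s + ex k s) :=
    continuous_const.mul ((continuous_ex _).add (continuous_ex _))
  rw [← integral_ex, ← integral_ex, ← integral_add (integrable_of_continuous (continuous_ex _) _)
    (integrable_of_continuous (continuous_ex _) _), ← integral_const_mul,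
    ← integral_add (integrable_cotHalf_ex k) (integrable_of_continuous hc _)]
  refine integral_congr_ae ?_
  filter_upwards [ae_ne 0] with s hs
  have := cotHalf_mul hs
  rw [ex_add_index]
  linear_combination ex k s * this

theorem integral_cotHalf_ex (k : ℤ) :
    ∫ s, (cotHalf s : ℂ) * (ex k s - 1) ∂unif = Complex.I * (k.sign : ℂ) := by
  have h0 : ∫ s, (cotHalf s : ℂ) * (ex 0 s - 1) ∂unif = 0 := by simp [ex_zero_index]
  have hp : ∀ n : ℕ, ∫ s, (cotHalf s : ℂ) * (ex ((n : ℤ) + 1) s - 1) ∂unif = Complex.I := by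
    intro n
    induction n with
    | zero => rw [integral_cotHalf_ex_succ]; simp [h0]
    | succ n ih =>
      rw [integral_cotHalf_ex_succ]
      push_cast
      rw [ih, if_neg (by omega), if_neg (by omega)]
      simp
  have hn : ∀ n : ℕ, ∫ s, (cotHalf s : ℂ) * (ex (-(n : ℤ) - 1) s - 1) ∂unif = -Complex.I := by
    intro n
    induction n with
    | zero =>
      have := integral_cotHalf_ex_succ (-1)
      simp only [Int.reduceNeg, Int.reduceAdd, h0] at this
      simp only [Nat.cast_zero, neg_zero, zero_sub]
      norm_num at this
      exact eq_neg_of_add_eq_zero_left this.symm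
    | succ n ih =>
      have := integral_cotHalf_ex_succ (-((n + 1 : ℕ) : ℤ) - 1)
      rw [if_neg (by push_cast; omega), if_neg (by push_cast; omega)] at this
      have e : (-((n + 1 : ℕ) : ℤ) - 1) + 1 = -(n : ℤ) - 1 := by push_cast; ring
      rw [e, ih] at this
      simpa using this.symm
  rcases lt_trichotomy k 0 with h | h | h
  · obtain ⟨n, rfl⟩ : ∃ n : ℕ, k = -(n : ℤ) - 1 := ⟨(-k - 1).toNat, by omega⟩
    rw [hn, Int.sign_eq_neg_one_of_neg h]; simp
  · subst h; simp [h0]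
  · obtain ⟨n, rfl⟩ : ∃ n : ℕ, k = (n : ℤ) + 1 := ⟨(k - 1).toNat, by omega⟩
    rw [hp, Int.sign_eq_one_of_pos h]; simp

theorem fc_hil {v : Torus → ℝ} (hv : Continuous v) (h : Hol v) (k : ℤ) :
    fc (hil v) k = Complex.I * (k.sign : ℂ) * fc v k := by
  obtain ⟨C, hC0, hC⟩ := h.bound
  have hint : Integrable (Function.uncurry fun x s : Torus =>
      (((v (x - s) - v x) * cotHalf s : ℝ) : ℂ) * ex (-k) x) (unif.prod unif) := by
    have hb : Integrable (fun p : Torus × Torus => C * ch p.2 ^ (-(3 / 4) : ℝ))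
        (unif.prod unif) :=
      ((integrable_ch_rpow (s := 3 / 4) (by norm_num) (by norm_num)).const_mul C).comp_snd unif
    refine hb.mono' ?_ (ae_of_all _ fun p => ?_)
    · have m1 : Measurable fun p : Torus × Torus => (v (p.1 - p.2) - v p.1) * cotHalf p.2 :=
        (Continuous.measurable (by fun_prop)).mul (measurable_cotHalf.comp measurable_snd)
      exact ((Complex.measurable_ofReal.comp m1).mul
        ((continuous_ex (-k)).measurable.comp measurable_fst)).aestronglyMeasurable
    · simp only [Function.uncurry, norm_mul, norm_ex, mul_one]
      rw [Complex.norm_real]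
      exact hC p.1 p.2
  have e1 : fc (hil v) k
      = -∫ x, ∫ s, (((v (x - s) - v x) * cotHalf s : ℝ) : ℂ) * ex (-k) x ∂unif ∂unif := by
    rw [fc, ← integral_neg]
    refine integral_congr_ae (ae_of_all _ fun x => ?_)
    simp only [hil_eq v x]
    rw [integral_mul_const, integral_complex_ofReal]
    push_cast; ring
  rw [e1, integral_integral_swap hint]
  have e2 : ∀ s, ∫ x, (((v (x - s) - v x) * cotHalf s : ℝ) : ℂ) * ex (-k) x ∂unif
      = (cotHalf s : ℂ) * (ex (-k) s - 1) * fc v k := by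
    intro s
    have i1 : Integrable (fun x => v (x + -s)) unif :=
      integrable_of_continuous (hv.comp (by fun_prop)) _
    have h1 := fc_sub i1 (integrable_of_continuous hv unif) k
    rw [fc_shift, ex_neg, ← ex_neg_index, fc] at h1
    calc _ = (cotHalf s : ℂ) * ∫ x, ((v (x + -s) - v x : ℝ) : ℂ) * ex (-k) x ∂unif := by
          rw [← integral_const_mul]
          refine integral_congr_ae (ae_of_all _ fun x => ?_)
          simp only [sub_eq_add_neg]
          push_cast; ring
      _ = _ := by rw [h1]; ring
  simp only [e2]
  rw [integral_mul_const, integral_cotHalf_ex]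
  simp

/-- The reflection `t ↦ 2x - t` preserves the truncation set and reverses the sign of the integrand.
-/
theorem integral_cotHalf_trunc (x : Torus) (ε : ℝ) :
    ∫ t in {t : Torus | ε < chord x t}, cotHalf (x - t) ∂unif = 0 := by
  have hm : MeasurableSet {t : Torus | ε < chord x t} := by
    simp only [chord_eq]
    exact measurableSet_lt measurable_const
      (continuous_ch.comp (continuous_const.sub continuous_id)).measurable
  rw [← integral_indicator hm]
  set F : Torus → ℝ := fun t => Set.indicator {t : Torus | ε < chord x t}
    (fun t => cotHalf (x - t)) t with hF
  have h1 := integral_sub_left_eq_self (μ := unif) F (x + x)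
  have h2 : ∀ t, F (x + x - t) = -F t := by
    intro t
    have e1 : x - (x + x - t) = -(x - t) := by abel
    have e2 : chord x (x + x - t) = chord x t := by rw [chord_eq, chord_eq, e1, ch_neg]
    simp only [hF, Set.indicator, Set.mem_ofPred_eq, e2, e1, cotHalf_neg]
    split_ifs <;> simp
  simp only [h2, integral_neg] at h1
  change ∫ t, F t ∂unif = 0
  linarith

/-- Since the truncated cotangent has integral zero, `v x` may be subtracted under the integral for
free. The integrand is then absolutely integrable and dominated convergence removes the truncation.
-/
theorem tendsto_truncHilbert {v : Torus → ℝ} (hv : Continuous v) (h : Hol v) (x : Torus) :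
    Tendsto (truncHilbert v x) (𝓝[>] 0) (𝓝 (hil v x)) := by
  have hm : ∀ ε : ℝ, MeasurableSet {t : Torus | ε < chord x t} := by
    intro ε
    simp only [chord_eq]
    exact measurableSet_lt measurable_const
      (continuous_ch.comp (continuous_const.sub continuous_id)).measurable
  have hI := h.integrable' hv x
  have hlim : Tendsto (fun ε : ℝ => -∫ t, Set.indicator {t : Torus | ε < chord x t}
      (fun t => (v t - v x) * cotHalf (x - t)) t ∂unif) (𝓝[>] 0) (𝓝 (hil v x)) := by
    refine Tendsto.neg ?_
    refine tendsto_integral_filter_of_dominated_convergence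
      (fun t => ‖(v t - v x) * cotHalf (x - t)‖) (Eventually.of_forall fun ε => ?_)
      (Eventually.of_forall fun ε => ae_of_all _ fun t => ?_) hI.norm ?_
    · exact hI.aestronglyMeasurable.indicator (hm ε)
    · exact norm_indicator_le_norm_self _ _
    · filter_upwards [ae_ne x] with t ht
      have hp : 0 < chord x t := by rw [chord_eq]; exact ch_pos (sub_ne_zero.2 ht.symm)
      refine tendsto_const_nhds.congr' ?_
      have : Set.Iio (chord x t) ∈ 𝓝[>] (0 : ℝ) := mem_nhdsWithin_of_mem_nhds (Iio_mem_nhds hp)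
      filter_upwards [this] with ε hε
      rw [Set.indicator_of_mem]
      exact hε
  refine hlim.congr' ?_
  filter_upwards [self_mem_nhdsWithin] with ε hε
  have hε : 0 < ε := hε
  rw [integral_indicator (hm ε), truncHilbert]
  congr 1
  have ic : IntegrableOn (fun t => cotHalf (x - t)) {t : Torus | ε < chord x t} unif := by
    refine Integrable.of_bound (C := 2 / ε)
      (measurable_cotHalf.comp (by fun_prop)).aestronglyMeasurable ?_
    filter_upwards [ae_restrict_mem (hm ε)] with t ht
    have ht' : ε < ch (x - t) := by rw [← chord_eq]; exact ht
    have hne : x - t ≠ 0 := fun h0 => by rw [h0, ch_zero] at ht'; linarith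
    exact (abs_cotHalf_le hne).trans (by gcongr)
  have e : ∀ t, v t * cotHalf (x - t)
      = (v t - v x) * cotHalf (x - t) + v x * cotHalf (x - t) := fun t => by ring
  simp only [e]
  rw [integral_add hI.integrableOn (ic.const_mul _), integral_const_mul, integral_cotHalf_trunc]
  simp

theorem truncHilbert_congr {u v : Torus → ℝ} (h : u =ᵐ[unif] v) : truncHilbert u = truncHilbert v := by
  funext x ε
  rw [truncHilbert, truncHilbert]
  congr 1
  refine integral_congr_ae (ae_restrict_of_ae ?_)
  filter_upwards [h] with t ht
  rw [ht]

theorem hasHilbert_of_ae_eq {u v : Torus → ℝ} (huv : u =ᵐ[unif] v) (hv : Continuous v)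
    (h : Hol v) : HasHilbert u := by
  refine ae_of_all _ fun x => ⟨hil v x, ?_⟩
  rw [truncHilbert_congr huv]
  exact tendsto_truncHilbert hv h x

theorem hilbert_eq_hil {u v : Torus → ℝ} (huv : u =ᵐ[unif] v) (hv : Continuous v)
    (h : Hol v) : hilbert u = hil v := by
  funext x
  rw [hilbert, truncHilbert_congr huv]
  exact (tendsto_truncHilbert hv h x).limUnder_eq

/-! ### Fourier multipliers on real `L²` -/

/-- Riesz–Fischer for complex functions; Hermitian symmetry shows that taking the real part leaves
the coefficients unchanged. -/
theorem exists_memLp_fc {a : ℤ → ℂ} (ha : Summable fun k => ‖a k‖ ^ 2)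
    (hc : ∀ k, a (-k) = conj (a k)) : ∃ g : Torus → ℝ, MemLp g 2 unif ∧ ∀ k, fc g k = a k := by
  have hmem : Memℓp a 2 := by
    refine memℓp_gen ?_
    simpa using ha
  set G : Lp ℂ 2 (unif : Measure Torus) :=
    (fourierBasis (T := 2 * Real.pi)).repr.symm ⟨a, hmem⟩ with hG
  have hGk : ∀ k, fourierCoeff G k = a k := by
    intro k
    rw [← fourierBasis_repr, hG, LinearIsometryEquiv.apply_symm_apply]
  have hGm : MemLp G 2 unif := Lp.memLp G
  have hGi : Integrable G unif := hGm.integrable one_le_two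
  refine ⟨fun x => (G x).re, hGm.re, fun k => ?_⟩
  have hi : ∀ k, Integrable (fun x => G x * ex k x) unif := fun k =>
    hGi.mul_bdd (c := 1) (continuous_ex k).aestronglyMeasurable
      (ae_of_all _ fun x => by rw [norm_ex])
  have h1 : ∀ k, ∫ x, G x * ex (-k) x ∂unif = a k := by
    intro k
    rw [← hGk, fourierCoeff]
    simp only [ex, smul_eq_mul, mul_comm]
  have h2 : ∀ x, (((G x).re : ℝ) : ℂ) * ex (-k) x
      = (G x * ex (-k) x + conj (G x * ex (- -k) x)) / 2 := by
    intro x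
    rw [Complex.re_eq_add_conj, map_mul, ← ex_neg_index, neg_neg]; ring
  have hic : Integrable (fun x => conj (G x * ex (- -k) x)) unif :=
    (LinearIsometryEquiv.integrable_comp_iff Complex.conjLIE).2 (hi _)
  simp only [fc, h2]
  rw [integral_div, integral_add (hi _) hic, integral_conj, h1, h1, hc, Complex.conj_conj]
  ring

/-- Real square integrable functions on the torus. -/
abbrev L2T : Type := Lp ℝ 2 (unif : Measure Torus)

theorem L2T.integrable (f : L2T) : Integrable f unif := (Lp.memLp f).integrable one_le_two

theorem L2T.ext_fc {f g : L2T} (h : ∀ k, fc f k = fc g k) : f = g :=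
  Lp.ext (ae_eq_of_fc_eq (Lp.memLp f) (Lp.memLp g) (funext h))

theorem L2T.fc_add (f g : L2T) (k : ℤ) : fc (f + g : L2T) k = fc f k + fc g k := by
  rw [fc_congr (Lp.coeFn_add f g)]
  exact HighTempCircular.fc_add f.integrable g.integrable k

theorem L2T.fc_smul (c : ℝ) (f : L2T) (k : ℤ) : fc (c • f : L2T) k = c * fc f k := by
  rw [fc_congr (Lp.coeFn_smul c f)]
  exact fc_const_mul c f k

theorem L2T.inner_eq (f g : L2T) : inner ℝ f g = ∫ x, f x * g x ∂unif := by
  rw [L2.inner_def]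
  refine integral_congr_ae (ae_of_all _ fun x => ?_)
  simp [mul_comm]

theorem L2T.norm_sq_eq (f : L2T) : ‖f‖ ^ 2 = ∫ x, f x ^ 2 ∂unif := by
  rw [← real_inner_self_eq_norm_sq, L2T.inner_eq]
  simp only [sq]

theorem L2T.hasSum_norm_sq (f : L2T) : HasSum (fun k => ‖fc f k‖ ^ 2) (‖f‖ ^ 2) := by
  rw [L2T.norm_sq_eq]; exact parseval_sq (Lp.memLp f)

theorem exists_multiplier {m : ℤ → ℝ} {M : ℝ} (hM : 0 ≤ M) (hm : ∀ k, |m k| ≤ M)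
    (he : ∀ k, m (-k) = m k) : ∃ T : L2T →L[ℝ] L2T, ∀ f k, fc (T f) k = m k * fc f k := by
  have h1 : ∀ f : L2T, ∃ g : L2T, ∀ k, fc g k = m k * fc f k := by
    intro f
    obtain ⟨g, hg, hgf⟩ := exists_memLp_fc (a := fun k => m k * fc f k) (by
      refine Summable.of_nonneg_of_le (fun k => sq_nonneg _) (fun k => ?_)
        ((L2T.hasSum_norm_sq f).summable.mul_left (M ^ 2))
      rw [norm_mul, mul_pow, Complex.norm_real, Real.norm_eq_abs]
      gcongr
      exact hm k) (fun k => by simp [he, fc_neg_index])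
    exact ⟨hg.toLp g, fun k => by rw [fc_congr hg.coeFn_toLp, hgf]⟩
  choose F hF using h1
  let L : L2T →ₗ[ℝ] L2T :=
    { toFun := F
      map_add' := fun f g => L2T.ext_fc fun k => by
        rw [L2T.fc_add, hF, hF, hF, L2T.fc_add]; ring
      map_smul' := fun c f => L2T.ext_fc fun k => by
        rw [RingHom.id_apply, L2T.fc_smul, hF, hF, L2T.fc_smul]; ring }
  refine ⟨L.mkContinuous M fun f => ?_, fun f k => hF f k⟩
  refine abs_le_of_sq_le_sq' ?_ (by positivity) |>.2
  rw [mul_pow]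
  refine hasSum_le (fun k => ?_) (L2T.hasSum_norm_sq (L f))
    ((L2T.hasSum_norm_sq f).mul_left (M ^ 2))
  change ‖fc (F f) k‖ ^ 2 ≤ _
  rw [hF, norm_mul, mul_pow, Complex.norm_real, Real.norm_eq_abs]
  gcongr
  exact hm k

/-! ### A strongly convex dual problem -/

theorem exp_integral_le {y : Torus → ℝ} (hy : Integrable y unif)
    (he : Integrable (fun x => Real.exp (y x)) unif) :
    Real.exp (∫ x, y x ∂unif) ≤ ∫ x, Real.exp (y x) ∂unif := by
  set c := ∫ x, y x ∂unif with hc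
  have hyc : Integrable (fun x => y x - c) unif := hy.sub (integrable_const _)
  have h1 : ∫ x, Real.exp c * (1 + (y x - c)) ∂unif = Real.exp c := by
    rw [integral_const_mul, integral_add (integrable_const _) hyc,
      integral_sub hy (integrable_const _)]
    simp [← hc]
  rw [← h1]
  refine integral_mono (((integrable_const _).add hyc).const_mul _) he
    fun x => ?_
  have := Real.add_one_le_exp (y x - c)
  calc Real.exp c * (1 + (y x - c)) ≤ Real.exp c * Real.exp (y x - c) := by gcongr; linarith
    _ = _ := by rw [← Real.exp_add]; congr 1; ring

/-- Midpoint convexity of `f ↦ log ∫ e^f`. Once both exponentials are normalized by their integrals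
`A` and `B`, it is the pointwise inequality between the geometric and arithmetic means. -/
theorem integral_exp_midpoint_sq_le {y z : Torus → ℝ} (hym : AEStronglyMeasurable y unif)
    (hzm : AEStronglyMeasurable z unif)
    (hy : Integrable (fun x => Real.exp (y x)) unif)
    (hz : Integrable (fun x => Real.exp (z x)) unif) :
    Integrable (fun x => Real.exp ((y x + z x) / 2)) unif ∧
      Real.log (∫ x, Real.exp ((y x + z x) / 2) ∂unif) ≤
        (Real.log (∫ x, Real.exp (y x) ∂unif) + Real.log (∫ x, Real.exp (z x) ∂unif)) / 2 := by
  set A := ∫ x, Real.exp (y x) ∂unif with hA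
  set B := ∫ x, Real.exp (z x) ∂unif with hB
  have hA0 : 0 < A := integral_exp_pos hy
  have hB0 : 0 < B := integral_exp_pos hz
  have hpt : ∀ x, Real.exp ((y x + z x) / 2) ≤ Real.exp ((Real.log A + Real.log B) / 2) *
      ((Real.exp (y x) / A + Real.exp (z x) / B) / 2) := by
    intro x
    have e1 : Real.exp (y x) / A = Real.exp ((y x - Real.log A) / 2) ^ 2 := by
      rw [← Real.exp_nat_mul, ← Real.exp_log hA0, ← Real.exp_sub, Real.exp_log hA0]
      congr 1; push_cast; ring
    have e2 : Real.exp (z x) / B = Real.exp ((z x - Real.log B) / 2) ^ 2 := by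
      rw [← Real.exp_nat_mul, ← Real.exp_log hB0, ← Real.exp_sub, Real.exp_log hB0]
      congr 1; push_cast; ring
    have e3 : Real.exp ((y x + z x) / 2) = Real.exp ((Real.log A + Real.log B) / 2) *
        (Real.exp ((y x - Real.log A) / 2) * Real.exp ((z x - Real.log B) / 2)) := by
      rw [← Real.exp_add, ← Real.exp_add]; congr 1; ring
    rw [e1, e2, e3]
    gcongr
    nlinarith [sq_nonneg (Real.exp ((y x - Real.log A) / 2) - Real.exp ((z x - Real.log B) / 2))]
  have hdom : Integrable (fun x => Real.exp ((Real.log A + Real.log B) / 2) *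
      ((Real.exp (y x) / A + Real.exp (z x) / B) / 2)) unif :=
    (((hy.div_const _).add (hz.div_const _)).div_const _).const_mul _
  have hint : Integrable (fun x => Real.exp ((y x + z x) / 2)) unif := by
    refine hdom.mono' ?_ (ae_of_all _ fun x => ?_)
    · exact Real.continuous_exp.comp_aestronglyMeasurable
        ((hym.add hzm).aemeasurable.div_const 2).aestronglyMeasurable
    · rw [Real.norm_of_nonneg (Real.exp_pos _).le]; exact hpt x
  refine ⟨hint, ?_⟩
  have h1 := integral_mono hint hdom hpt
  rw [integral_const_mul, integral_div, integral_add (hy.div_const _) (hz.div_const _),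
    integral_div, integral_div, ← hA, ← hB, div_self hA0.ne', div_self hB0.ne'] at h1
  have h2 : ∫ x, Real.exp ((y x + z x) / 2) ∂unif ≤ Real.exp ((Real.log A + Real.log B) / 2) := by
    linarith
  have h3 := Real.log_le_log (integral_exp_pos hint) h2
  rwa [Real.log_exp] at h3

/-- Convexity of the log-integral plus the quadratic term makes every minimizing sequence Cauchy, so
the limit exists strongly and no weak compactness is needed. -/
theorem exists_minimizer {V : Torus → ℝ} (hV : Continuous V) (T : L2T →L[ℝ] L2T) :
    ∃ a : L2T, Integrable (fun x => Real.exp (-V x - T a x)) unif ∧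
      ∀ b : L2T, Integrable (fun x => Real.exp (-V x - T b x)) unif →
        ‖a‖ ^ 2 / 2 + Real.log (∫ x, Real.exp (-V x - T a x) ∂unif) ≤
          ‖b‖ ^ 2 / 2 + Real.log (∫ x, Real.exp (-V x - T b x) ∂unif) := by
  set D : Set L2T := {a | Integrable (fun x => Real.exp (-V x - T a x)) unif} with hD
  set J : L2T → ℝ := fun a => ‖a‖ ^ 2 / 2 + Real.log (∫ x, Real.exp (-V x - T a x) ∂unif) with hJ
  have hVi : Integrable V unif := integrable_of_continuous hV _
  have hmeas : ∀ a : L2T, AEStronglyMeasurable (fun x => -V x - T a x) unif := fun a =>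
    hV.aestronglyMeasurable.neg.sub (Lp.aestronglyMeasurable _)
  have h0D : (0 : L2T) ∈ D := by
    have : (fun x => Real.exp (-V x - T 0 x)) =ᵐ[unif] fun x => Real.exp (-V x) := by
      rw [map_zero]
      filter_upwards [Lp.coeFn_zero ℝ 2 (unif : Measure Torus)] with x hx
      rw [hx]; simp
    exact (integrable_of_continuous (Real.continuous_exp.comp hV.neg) _).congr this.symm
  have hmean : ∀ f : L2T, |∫ x, f x ∂unif| ≤ ‖f‖ := by
    intro f
    have h1 : fc f 0 = ((∫ x, f x ∂unif : ℝ) : ℂ) := fc_zero f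
    have h2 := le_hasSum (L2T.hasSum_norm_sq f) 0 fun k _ => sq_nonneg _
    rw [h1, Complex.norm_real, Real.norm_eq_abs] at h2
    exact abs_le_of_sq_le_sq' (by simpa using h2) (norm_nonneg _) |>.2
  obtain ⟨c, hc⟩ : ∃ c : ℝ, ∀ a ∈ D, c ≤ J a := by
    -- By Jensen the log-integral is at least `-∫ V - ‖T‖ ‖a‖`, and the square absorbs the linear
    -- term: `‖a‖²/2 - ‖T‖ ‖a‖ ≥ -‖T‖²/2`.
    refine ⟨-(∫ x, V x ∂unif) - ‖T‖ ^ 2 / 2, fun a ha => ?_⟩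
    have h1 := exp_integral_le (hVi.neg.sub (T a).integrable) ha
    have h2 := Real.log_le_log (Real.exp_pos _) h1
    rw [Real.log_exp] at h2
    have h3 : ∫ x, (-V - ⇑(T a)) x ∂unif = -(∫ x, V x ∂unif) - ∫ x, T a x ∂unif := by
      rw [← integral_neg]
      exact integral_sub hVi.neg (T a).integrable
    rw [h3] at h2
    have h4 := (abs_le.1 (hmean (T a))).2
    have h5 := T.le_opNorm a
    have h6 : -(∫ x, V x ∂unif) - ∫ x, T a x ∂unif ≤
      Real.log (∫ x, Real.exp (-V x - T a x) ∂unif) := h2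
    simp only [hJ]
    nlinarith [sq_nonneg (‖a‖ - ‖T‖)]
  have hbdd : BddBelow (J '' D) := ⟨c, by rintro _ ⟨a, ha, rfl⟩; exact hc a ha⟩
  have hne : (J '' D).Nonempty := ⟨_, 0, h0D, rfl⟩
  set j := sInf (J '' D) with hj
  have hjle : ∀ a ∈ D, j ≤ J a := fun a ha => csInf_le hbdd ⟨a, ha, rfl⟩
  have hseq : ∀ n : ℕ, ∃ a ∈ D, J a < j + 1 / ((n : ℝ) + 1) := by
    intro n
    obtain ⟨_, ⟨a, ha, rfl⟩, hlt⟩ := exists_lt_of_csInf_lt hne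
      (show j < j + 1 / ((n : ℝ) + 1) by have : (0 : ℝ) < 1 / ((n : ℝ) + 1) := by positivity
                                         linarith)
    exact ⟨a, ha, hlt⟩
  choose a haD haJ using hseq
  -- The infimum is compared with the value at the midpoint; the parallelogram law turns half the
  -- squared norm into the gain `‖u - v‖² / 8`.
  have hconv : ∀ u ∈ D, ∀ v ∈ D, ‖u - v‖ ^ 2 / 8 ≤ (J u + J v) / 2 - j := by
    intro u hu v hv
    have h1 := integral_exp_midpoint_sq_le (hmeas u) (hmeas v) hu hv
    have e : (fun x => Real.exp (-V x - T ((2 : ℝ)⁻¹ • (u + v)) x)) =ᵐ[unif]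
        fun x => Real.exp (((-V x - T u x) + (-V x - T v x)) / 2) := by
      rw [map_smul, map_add]
      filter_upwards [Lp.coeFn_smul (2 : ℝ)⁻¹ (T u + T v), Lp.coeFn_add (T u) (T v)] with x h1 h2
      rw [h1, Pi.smul_apply, h2, Pi.add_apply, smul_eq_mul]
      congr 1; ring
    have hm : (2 : ℝ)⁻¹ • (u + v) ∈ D := h1.1.congr e.symm
    have h2 := hjle _ hm
    simp only [hJ] at h2 ⊢
    rw [integral_congr_ae e, norm_smul] at h2
    have h3 := parallelogram_law_with_norm ℝ u v
    have h4 : (‖(2 : ℝ)⁻¹‖ * ‖u + v‖) ^ 2 = ‖u + v‖ ^ 2 / 4 := by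
      rw [Real.norm_of_nonneg (by norm_num)]; ring
    rw [h4] at h2
    nlinarith [h1.2]
  have hcau : CauchySeq a := by
    refine Metric.cauchySeq_iff'.2 fun ε hε => ?_
    obtain ⟨n, hn⟩ := exists_nat_one_div_lt (show 0 < ε ^ 2 / 8 by positivity)
    refine ⟨n, fun m hm => ?_⟩
    have h1 := hconv _ (haD m) _ (haD n)
    have h2 : (1 : ℝ) / ((m : ℝ) + 1) ≤ 1 / ((n : ℝ) + 1) :=
      one_div_le_one_div_of_le (by positivity) (by have : (n : ℝ) ≤ m := by exact_mod_cast hm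
                                                   linarith)
    rw [dist_eq_norm]
    refine lt_of_pow_lt_pow_left₀ 2 hε.le ?_
    linarith [haJ m, haJ n]
  obtain ⟨a₀, ha₀⟩ := cauchySeq_tendsto_of_complete hcau
  have hT : Tendsto (fun n => T (a n)) atTop (𝓝 (T a₀)) := (T.continuous.tendsto a₀).comp ha₀
  obtain ⟨ns, hns, hae⟩ := (tendstoInMeasure_of_tendsto_Lp hT).exists_seq_tendsto_ae
  set Zn : ℕ → ℝ := fun n => ∫ x, Real.exp (-V x - T (a n) x) ∂unif with hZn
  have hZn0 : ∀ n, 0 < Zn n := fun n => integral_exp_pos (haD n)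
  have hJlim : Tendsto (fun n => J (a n)) atTop (𝓝 j) := by
    refine tendsto_of_tendsto_of_tendsto_of_le_of_le tendsto_const_nhds
      (h := fun n : ℕ => j + 1 / ((n : ℝ) + 1)) ?_ (fun n => hjle _ (haD n)) (fun n => (haJ n).le)
    simpa using tendsto_one_div_add_atTop_nhds_zero_nat.const_add j
  have hZlim : Tendsto (fun n => Zn (ns n)) atTop (𝓝 (Real.exp (j - ‖a₀‖ ^ 2 / 2))) := by
    have h1 : Tendsto (fun n => Real.exp (J (a n) - ‖a n‖ ^ 2 / 2)) atTop
        (𝓝 (Real.exp (j - ‖a₀‖ ^ 2 / 2))) :=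
      (Real.continuous_exp.tendsto _).comp (hJlim.sub ((ha₀.norm.pow 2).div_const 2))
    have h2 : (fun n => Real.exp (J (a n) - ‖a n‖ ^ 2 / 2)) = Zn := by
      funext n
      simp only [hJ, add_sub_cancel_left]
      exact Real.exp_log (hZn0 n)
    rw [h2] at h1
    exact h1.comp hns.tendsto_atTop
  -- The log-integral is not known to be continuous, nor the domain closed. Fatou along an almost
  -- everywhere convergent subsequence gives both membership of the limit and the required
  -- inequality.
  have hfatou : ∫⁻ x, ENNReal.ofReal (Real.exp (-V x - T a₀ x)) ∂unif
      ≤ ENNReal.ofReal (Real.exp (j - ‖a₀‖ ^ 2 / 2)) := by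
    have h1 : ∫⁻ x, ENNReal.ofReal (Real.exp (-V x - T a₀ x)) ∂unif =
        ∫⁻ x, liminf (fun n => ENNReal.ofReal (Real.exp (-V x - T (a (ns n)) x))) atTop ∂unif := by
      refine lintegral_congr_ae ?_
      filter_upwards [hae] with x hx
      refine (Tendsto.liminf_eq ?_).symm
      exact (ENNReal.continuous_ofReal.tendsto _).comp
        ((Real.continuous_exp.tendsto _).comp (hx.const_sub _))
    rw [h1]
    refine (lintegral_liminf_le' fun n => ?_).trans (le_of_eq ?_)
    · exact (Real.continuous_exp.comp_aestronglyMeasurable (hmeas _)).aemeasurable.ennreal_ofReal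
    · have h2 : ∀ n, ∫⁻ x, ENNReal.ofReal (Real.exp (-V x - T (a (ns n)) x)) ∂unif
          = ENNReal.ofReal (Zn (ns n)) := fun n =>
        (ofReal_integral_eq_lintegral_ofReal (haD _)
          (ae_of_all _ fun x => (Real.exp_pos _).le)).symm
      simp only [h2]
      exact ((ENNReal.continuous_ofReal.tendsto _).comp hZlim).liminf_eq
  have ha₀D : Integrable (fun x => Real.exp (-V x - T a₀ x)) unif := by
    refine ⟨Real.continuous_exp.comp_aestronglyMeasurable (hmeas _), ?_⟩
    rw [hasFiniteIntegral_iff_ofReal (ae_of_all _ fun x => (Real.exp_pos _).le)]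
    exact hfatou.trans_lt ENNReal.ofReal_lt_top
  refine ⟨a₀, ha₀D, fun b hb => le_trans ?_ (hjle b hb)⟩
  rw [← ofReal_integral_eq_lintegral_ofReal ha₀D (ae_of_all _ fun x => (Real.exp_pos _).le),
    ENNReal.ofReal_le_ofReal_iff (Real.exp_pos _).le] at hfatou
  have := Real.log_le_log (integral_exp_pos ha₀D) hfatou
  rw [Real.log_exp] at this
  linarith

/-- The Euler–Lagrange equation of the dual problem. -/
theorem minimizer_eq {V : Torus → ℝ} {T : L2T →L[ℝ] L2T} {a : L2T}
    (ha : Integrable (fun x => Real.exp (-V x - T a x)) unif)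
    (hmin : ∀ b : L2T, Integrable (fun x => Real.exp (-V x - T b x)) unif →
        ‖a‖ ^ 2 / 2 + Real.log (∫ x, Real.exp (-V x - T a x) ∂unif) ≤
          ‖b‖ ^ 2 / 2 + Real.log (∫ x, Real.exp (-V x - T b x) ∂unif))
    {b : L2T} {B : Torus → ℝ} (hB : T b =ᵐ[unif] B) (hBb : ∀ x, |B x| ≤ 1)
    (hBm : AEStronglyMeasurable B unif) :
    inner ℝ a b * (∫ x, Real.exp (-V x - T a x) ∂unif) =
      ∫ x, B x * Real.exp (-V x - T a x) ∂unif := by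
  set R : Torus → ℝ := fun x => Real.exp (-V x - T a x) with hR
  set Z := ∫ x, R x ∂unif with hZ
  have hZ0 : 0 < Z := integral_exp_pos ha
  set I := ∫ x, B x * R x ∂unif with hI
  have hBR : Integrable (fun x => B x * R x) unif :=
    ha.bdd_mul (c := 1) hBm (ae_of_all _ fun x => hBb x)
  -- First variation in the direction `b`, in the elementary form `e^{-tB} ≤ 1 - tB + t²` for `|tB|
  -- ≤ 1`. A linear term dominated by a quadratic one for both signs of `t` has coefficient zero.
  have key : ∀ t : ℝ, |t| ≤ 1 → 0 ≤ t * (inner ℝ a b - I / Z) + t ^ 2 * (‖b‖ ^ 2 / 2 + 1) := by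
    intro t ht
    have e : (fun x => Real.exp (-V x - T (a + t • b) x)) =ᵐ[unif]
        fun x => Real.exp (-(t * B x)) * R x := by
      rw [map_add, map_smul]
      filter_upwards [Lp.coeFn_add (T a) (t • T b), Lp.coeFn_smul t (T b), hB] with x h1 h2 h3
      rw [h1, Pi.add_apply, h2, Pi.smul_apply, h3, smul_eq_mul, hR, ← Real.exp_add]
      congr 1; ring
    have hy : ∀ x, |-(t * B x)| ≤ 1 := by
      intro x
      rw [abs_neg, abs_mul]
      have := hBb x
      nlinarith [abs_nonneg t, abs_nonneg (B x)]
    have hub : ∀ x, Real.exp (-(t * B x)) ≤ 1 - t * B x + t ^ 2 := by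
      intro x
      have h1 := (abs_le.1 (Real.abs_exp_sub_one_sub_id_le (hy x))).2
      have h2 : (-(t * B x)) ^ 2 ≤ t ^ 2 := by
        have h3 : B x ^ 2 ≤ 1 := by
          rw [← sq_abs]; have := hBb x; nlinarith [abs_nonneg (B x)]
        nlinarith [sq_nonneg t]
      linarith
    have hint1 : Integrable (fun x => Real.exp (-(t * B x)) * R x) unif := by
      refine ha.bdd_mul (c := Real.exp 1)
        (Real.continuous_exp.comp_aestronglyMeasurable (hBm.const_mul t).neg)
        (ae_of_all _ fun x => ?_)
      rw [Real.norm_of_nonneg (Real.exp_pos _).le]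
      exact Real.exp_le_exp.2 ((le_abs_self _).trans (hy x))
    have hint2 : Integrable (fun x => (1 + t ^ 2) * R x - t * (B x * R x)) unif :=
      (ha.const_mul _).sub (hBR.const_mul _)
    have h1 : ∫ x, Real.exp (-(t * B x)) * R x ∂unif ≤ (1 + t ^ 2) * Z - t * I := by
      refine (integral_mono hint1 hint2 fun x => ?_).trans (le_of_eq ?_)
      · have hRp : 0 < R x := Real.exp_pos _
        have := hub x
        simp only
        nlinarith
      · rw [integral_sub (ha.const_mul _) (hBR.const_mul _), integral_const_mul,
          integral_const_mul]
    have h2 := hmin (a + t • b) (hint1.congr e.symm)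
    rw [integral_congr_ae e] at h2
    have hpos : 0 < ∫ x, Real.exp (-(t * B x)) * R x ∂unif := by
      rw [← integral_congr_ae e]
      exact integral_exp_pos (hint1.congr e.symm)
    have h3 : Real.log (∫ x, Real.exp (-(t * B x)) * R x ∂unif) ≤
        Real.log Z + (t ^ 2 - t * (I / Z)) := by
      have h4 := Real.log_le_log hpos h1
      have h5 : (1 + t ^ 2) * Z - t * I = Z * (1 + (t ^ 2 - t * (I / Z))) := by
        field_simp
        ring
      have h6 : 0 < 1 + (t ^ 2 - t * (I / Z)) := by
        rw [h5] at h1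
        exact pos_of_mul_pos_right (hpos.trans_le h1) hZ0.le
      rw [h5, Real.log_mul hZ0.ne' h6.ne'] at h4
      have := Real.log_le_sub_one_of_pos h6
      linarith
    rw [norm_add_sq_real, real_inner_smul_right, norm_smul, mul_pow, Real.norm_eq_abs,
      sq_abs] at h2
    nlinarith
  have heq : inner ℝ a b - I / Z = 0 := by
    set d := inner ℝ a b - I / Z with hd
    set c := ‖b‖ ^ 2 / 2 + 1 with hc
    have hc1 : 1 ≤ c := by have := sq_nonneg ‖b‖; linarith
    by_contra hne
    have hd0 : 0 < |d| := abs_pos.2 hne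
    obtain ⟨s, hs0, hs1, hs2⟩ : ∃ s : ℝ, 0 < s ∧ s ≤ 1 ∧ s * c < |d| := by
      refine ⟨min 1 (|d| / (2 * c)), by positivity, min_le_left _ _, ?_⟩
      calc min 1 (|d| / (2 * c)) * c ≤ |d| / (2 * c) * c := by gcongr; exact min_le_right _ _
        _ = |d| / 2 := by field_simp
        _ < |d| := by linarith
    rcases lt_or_gt_of_ne hne with h | h
    · have := key s (by rw [abs_of_pos hs0]; exact hs1)
      rw [abs_of_neg h] at hs2
      nlinarith
    · have := key (-s) (by rw [abs_neg, abs_of_pos hs0]; exact hs1)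
      rw [abs_of_pos h] at hs2
      nlinarith
  have : inner ℝ a b = I / Z := by linarith
  rw [this]; field_simp

/-! ### The equilibrium density -/

theorem continuous_re_ex (k : ℤ) : Continuous fun x => (ex k x).re :=
  Complex.continuous_re.comp (continuous_ex k)

theorem continuous_im_ex (k : ℤ) : Continuous fun x => (ex k x).im :=
  Complex.continuous_im.comp (continuous_ex k)

theorem abs_re_ex_le (k : ℤ) (x : Torus) : |(ex k x).re| ≤ 1 :=
  (Complex.abs_re_le_norm _).trans (norm_ex k x).le

theorem abs_im_ex_le (k : ℤ) (x : Torus) : |(ex k x).im| ≤ 1 :=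
  (Complex.abs_im_le_norm _).trans (norm_ex k x).le

theorem fc_re_ex (k j : ℤ) (h1 : j ≠ k) (h2 : j ≠ -k) : fc (fun x => (ex k x).re) j = 0 := by
  have e : ∀ x, (((ex k x).re : ℝ) : ℂ) * ex (-j) x = (ex (k - j) x + ex (-k - j) x) / 2 := by
    intro x
    rw [Complex.re_eq_add_conj, ← ex_neg_index, sub_eq_add_neg, ex_add_index, sub_eq_add_neg,
      ex_add_index]; ring
  simp only [fc, e]
  rw [integral_div, integral_add (integrable_of_continuous (continuous_ex _) _)
    (integrable_of_continuous (continuous_ex _) _), integral_ex, integral_ex,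
    if_neg (by omega), if_neg (by omega)]
  simp

theorem fc_im_ex (k j : ℤ) (h1 : j ≠ k) (h2 : j ≠ -k) : fc (fun x => (ex k x).im) j = 0 := by
  have e : ∀ x, (((ex k x).im : ℝ) : ℂ) * ex (-j) x
      = (ex (k - j) x - ex (-k - j) x) / (2 * Complex.I) := by
    intro x
    rw [Complex.im_eq_sub_conj, ← ex_neg_index, sub_eq_add_neg k, ex_add_index, sub_eq_add_neg (-k),
      ex_add_index]; ring
  simp only [fc, e]
  rw [integral_div, integral_sub (integrable_of_continuous (continuous_ex _) _)
    (integrable_of_continuous (continuous_ex _) _), integral_ex, integral_ex,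
    if_neg (by omega), if_neg (by omega)]
  simp

theorem fc_eq_re_im {f : Torus → ℝ} (hf : Integrable f unif) (k : ℤ) :
    fc f k = ((∫ x, f x * (ex (-k) x).re ∂unif : ℝ) : ℂ)
      + ((∫ x, f x * (ex (-k) x).im ∂unif : ℝ) : ℂ) * Complex.I := by
  have i1 : Integrable (fun x => f x * (ex (-k) x).re) unif :=
    hf.mul_bdd (c := 1) (continuous_re_ex _).aestronglyMeasurable
      (ae_of_all _ fun x => abs_re_ex_le _ _)
  have i2 : Integrable (fun x => f x * (ex (-k) x).im) unif :=
    hf.mul_bdd (c := 1) (continuous_im_ex _).aestronglyMeasurable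
      (ae_of_all _ fun x => abs_im_ex_le _ _)
  rw [fc, ← integral_complex_ofReal, ← integral_complex_ofReal, ← integral_mul_const,
    ← integral_add i1.ofReal (i2.ofReal.mul_const _)]
  refine integral_congr_ae (ae_of_all _ fun x => ?_)
  simp only
  conv_lhs => rw [← Complex.re_add_im (ex (-k) x)]
  push_cast; ring

/-- A weak solution of the equilibrium equation. -/
theorem exists_weak_solution {β : ℝ} (hβ : 0 < β) {V : Torus → ℝ} (hV : Continuous V) :
    ∃ w : Torus → ℝ, MemLp w 2 unif ∧ Integrable (fun x => Real.exp (-V x - w x)) unif ∧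
      ∀ k : ℤ, fc w k * (∫ x, Real.exp (-V x - w x) ∂unif : ℝ) =
        ((β / max |(k : ℝ)| 1 : ℝ) : ℂ) * fc (fun x => Real.exp (-V x - w x)) k := by
  -- `T` is a square root of the kernel operator, so that the potential `T a` of the minimizer `a`
  -- solves the equation with multiplier `β / max |k| 1`. The maximum only serves the zero mode,
  -- where it adds a constant to the potential.
  set t : ℤ → ℝ := fun k => √(β / max |(k : ℝ)| 1) with ht
  have htle : ∀ k, |t k| ≤ √β := by
    intro k
    rw [abs_of_nonneg (Real.sqrt_nonneg _)]
    exact Real.sqrt_le_sqrt (div_le_self hβ.le (le_max_right _ _))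
  have hte : ∀ k, t (-k) = t k := by intro k; simp [ht]
  obtain ⟨T, hT⟩ := exists_multiplier (Real.sqrt_nonneg β) htle hte
  obtain ⟨a, ha, hmin⟩ := exists_minimizer hV T
  refine ⟨T a, Lp.memLp _, ha, fun k => ?_⟩
  set R : Torus → ℝ := fun x => Real.exp (-V x - T a x) with hR
  set Z := ∫ x, R x ∂unif with hZ
  have key : ∀ g : Torus → ℝ, Continuous g → (∀ x, |g x| ≤ 1) →
      (∀ j : ℤ, j ≠ k → j ≠ -k → fc g j = 0) →
      (∫ x, a x * g x ∂unif) * Z = t k * ∫ x, R x * g x ∂unif := by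
    intro g hg hg1 hgj
    have hgm := memLp_of_continuous hg 2
    -- The variation lemma wants directions with `|T b| ≤ 1`. A test function supported on the modes
    -- `k` and `-k` is an eigenfunction of `T` with eigenvalue at most `√β`, so this scaling is
    -- enough.
    set c : ℝ := (1 + √β)⁻¹ with hc
    have hc0 : 0 < c := by positivity
    have hTb : T (c • hgm.toLp g) =ᵐ[unif] fun x => c * (t k * g x) := by
      refine ae_eq_of_fc_eq (Lp.memLp _)
        (memLp_of_continuous (continuous_const.mul (continuous_const.mul hg)) 2) (funext fun j => ?_)
      rw [hT, L2T.fc_smul, fc_congr hgm.coeFn_toLp, fc_const_mul, fc_const_mul]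
      by_cases h1 : j = k
      · rw [h1]; ring
      by_cases h2 : j = -k
      · rw [h2, hte]; ring
      rw [hgj j h1 h2]; ring
    have h := minimizer_eq ha hmin hTb (fun x => by
      rw [abs_mul, abs_mul, abs_of_pos hc0]
      calc c * (|t k| * |g x|) ≤ c * (√β * 1) := by
            gcongr
            · exact htle k
            · exact hg1 x
        _ ≤ c * (1 + √β) := by gcongr; linarith
        _ = 1 := inv_mul_cancel₀ (by positivity))
      (continuous_const.mul (continuous_const.mul hg)).aestronglyMeasurable
    rw [real_inner_smul_right, L2T.inner_eq] at h
    have e1 : ∫ x, a x * (hgm.toLp g) x ∂unif = ∫ x, a x * g x ∂unif := by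
      refine integral_congr_ae ?_
      filter_upwards [hgm.coeFn_toLp] with x hx
      rw [hx]
    have e2 : ∫ x, c * (t k * g x) * R x ∂unif = c * (t k * ∫ x, R x * g x ∂unif) := by
      rw [← integral_const_mul, ← integral_const_mul]
      refine integral_congr_ae (ae_of_all _ fun x => ?_)
      simp only; ring
    rw [e1] at h
    have h' : c * ((∫ x, a x * g x ∂unif) * Z) = c * (t k * ∫ x, R x * g x ∂unif) := by
      rw [← e2, ← mul_assoc]; exact h
    exact mul_left_cancel₀ hc0.ne' h'
  have k1 := key _ (continuous_re_ex (-k)) (abs_re_ex_le (-k))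
    fun j h1 h2 => fc_re_ex (-k) j h2 (by simpa using h1)
  have k2 := key _ (continuous_im_ex (-k)) (abs_im_ex_le (-k))
    fun j h1 h2 => fc_im_ex (-k) j h2 (by simpa using h1)
  have h3 : fc a k * Z = t k * fc R k := by
    rw [fc_eq_re_im a.integrable, fc_eq_re_im ha]
    have k1' : ((∫ x, a x * (ex (-k) x).re ∂unif : ℝ) : ℂ) * Z
      = t k * ((∫ x, R x * (ex (-k) x).re ∂unif : ℝ) : ℂ) := by exact_mod_cast k1
    have k2' : ((∫ x, a x * (ex (-k) x).im ∂unif : ℝ) : ℂ) * Z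
      = t k * ((∫ x, R x * (ex (-k) x).im ∂unif : ℝ) : ℂ) := by exact_mod_cast k2
    linear_combination k1' + Complex.I * k2'
  have h4 : t k * t k = β / max |(k : ℝ)| 1 := Real.mul_self_sqrt (by positivity)
  rw [hT, mul_assoc, h3, ← h4]
  push_cast; ring

theorem mc_withDensity {ρ : Torus → ℝ} (hρm : AEMeasurable ρ unif) (h0 : ∀ x, 0 ≤ ρ x) (k : ℤ) :
    mc (unif.withDensity fun x => ENNReal.ofReal (ρ x)) k = fc ρ k := by
  rw [mc, integral_withDensity_eq_integral_toReal_smul₀ hρm.ennreal_ofReal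
    (ae_of_all _ fun x => ENNReal.ofReal_lt_top), fc]
  refine integral_congr_ae (ae_of_all _ fun x => ?_)
  simp [ENNReal.toReal_ofReal (h0 x)]

theorem isProbabilityMeasure_withDensity {ρ : Torus → ℝ} (hρ : Integrable ρ unif)
    (h0 : ∀ x, 0 ≤ ρ x) (h1 : ∫ x, ρ x ∂unif = 1) :
    IsProbabilityMeasure (unif.withDensity fun x => ENNReal.ofReal (ρ x)) := by
  constructor
  rw [withDensity_apply _ MeasurableSet.univ, Measure.restrict_univ,
    ← ofReal_integral_eq_lintegral_ofReal hρ (ae_of_all _ h0), h1, ENNReal.ofReal_one]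

/-- Formally `w` is `β` plus `2β` times the logarithmic potential of a probability measure, and the
kernel is at least `-log 2`. At this stage `ρ` is merely integrable and `w` merely in `L²`, so the
bound is proved for the Poisson means of `w` and transferred by pairing with the indicator of `{w <
c}`. -/
theorem weak_solution_bounded_below {β : ℝ} (hβ : 0 < β) {w ρ : Torus → ℝ} (hw : MemLp w 2 unif)
    (hρ : Integrable ρ unif) (h0 : ∀ x, 0 ≤ ρ x) (h1 : ∫ x, ρ x ∂unif = 1)
    (h : ∀ k : ℤ, fc w k = ((β / max |(k : ℝ)| 1 : ℝ) : ℂ) * fc ρ k) :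
    ∀ᵐ x ∂unif, β - 2 * β * Real.log 2 ≤ w x := by
  have hP := isProbabilityMeasure_withDensity hρ h0 h1
  set μ := unif.withDensity fun x => ENNReal.ofReal (ρ x) with hμ
  set c := β - 2 * β * Real.log 2 with hc
  have hreg : ∀ r : ℝ, 0 ≤ r → r < 1 → ∃ wr : Torus → ℝ, Continuous wr ∧ (∀ x, c ≤ wr x) ∧
      ∀ k : ℤ, fc wr k = ((r ^ k.natAbs : ℝ) : ℂ) * fc w k := by
    intro r hr hr1
    have hs : Summable fun k : ℤ => ‖((r ^ k.natAbs : ℝ) : ℂ) * fc w k‖ := by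
      refine Summable.of_norm_bounded_eventually ((summable_pc hr hr1).mul_left (2 * β)) ?_
      have : ({0} : Set ℤ)ᶜ ∈ cofinite := (Set.finite_singleton 0).compl_mem_cofinite
      filter_upwards [this] with k hk
      have hk' : (1 : ℝ) ≤ |(k : ℝ)| := by
        have : (1 : ℤ) ≤ |k| := Int.one_le_abs (by simpa using hk)
        exact_mod_cast this
      rw [norm_norm, h, norm_mul, norm_mul, ← mc_withDensity hρ.aemeasurable h0, ← hμ,
        Complex.norm_real, Complex.norm_real, max_eq_left hk', pc,
        Real.norm_of_nonneg (by positivity), Real.norm_of_nonneg (by positivity)]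
      have := norm_mc_le μ k
      calc r ^ k.natAbs * (β / |(k : ℝ)| * ‖mc μ k‖) ≤ r ^ k.natAbs * (β / |(k : ℝ)| * 1) := by
            gcongr
        _ = _ := by field_simp
    obtain ⟨wr, hwr, hwk, hsum⟩ := exists_synth hs (by
      intro k; rw [fc_neg_index]; simp)
    refine ⟨wr, hwr, fun x => ?_, hwk⟩
    have h2 := (integral_pk hr hr1 μ x).mul_left ((2 * β : ℝ) : ℂ)
    -- The zero mode of `w` equals `β`, whereas the regularized kernel has none.
    have h3 : HasSum (fun k : ℤ => if k = 0 then (β : ℂ) else 0) (β : ℂ) := hasSum_ite_eq 0 (β : ℂ)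
    have h4 := (h2.add h3).unique ((hsum x).congr_fun fun k => ?_)
    · have h5 : wr x = 2 * β * (∫ y, pk r (x - y) ∂μ) + β := by
        have := h4.symm
        exact_mod_cast this
      have h6 : -Real.log 2 ≤ ∫ y, pk r (x - y) ∂μ := by
        have : ∫ _y, -Real.log 2 ∂μ = -Real.log 2 := by simp
        rw [← this]
        exact integral_mono (integrable_const _)
          (integrable_of_continuous ((continuous_pk hr hr1).comp (by fun_prop)) _)
          fun y => pk_ge hr hr1 _
      rw [h5, hc]
      nlinarith
    · rw [h, ← mc_withDensity hρ.aemeasurable h0, ← hμ]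
      by_cases hk : k = 0
      · subst hk
        simp [pc, mc, ex_zero_index]
      · have hk' : (1 : ℝ) ≤ |(k : ℝ)| := by
          have : (1 : ℤ) ≤ |k| := Int.one_le_abs hk
          exact_mod_cast this
        have hk'' : ((|(k : ℝ)| : ℝ) : ℂ) ≠ 0 := by
          have : |(k : ℝ)| ≠ 0 := by linarith
          exact_mod_cast this
        rw [if_neg hk, max_eq_left hk', pc]
        push_cast
        field_simp
        ring
  obtain ⟨A, hAm, hA⟩ : ∃ A : Set Torus, MeasurableSet A ∧ ∀ᵐ x ∂unif, (x ∈ A ↔ w x < c) := by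
    obtain ⟨w', hw'm, hw'⟩ := hw.aestronglyMeasurable
    refine ⟨{x | w' x < c}, measurableSet_lt hw'm.measurable measurable_const, ?_⟩
    filter_upwards [hw'] with x hx
    simp [hx]
  set g : Torus → ℝ := A.indicator fun _ => 1 with hg
  have hgm : MemLp g 2 unif := memLp_indicator_const 2 hAm 1 (Or.inr (measure_ne_top _ _))
  have hg0 : ∀ x, 0 ≤ g x := fun x => Set.indicator_nonneg (fun _ _ => zero_le_one) x
  have hgi : Integrable g unif := hgm.integrable one_le_two
  -- Abel summation of the Parseval pairing, dominated by its absolutely convergent limit.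
  have hlim : Tendsto (fun r : ℝ => ∑' k : ℤ, conj (((r ^ k.natAbs : ℝ) : ℂ) * fc w k) * fc g k)
      (𝓝[<] 1) (𝓝 (∑' k : ℤ, conj (fc w k) * fc g k)) := by
    refine tendsto_tsum_of_dominated_convergence (bound := fun k => ‖conj (fc w k) * fc g k‖)
      (parseval hw hgm).summable.norm (fun k => ?_) ?_
    · have h1 : Tendsto (fun r : ℝ => r ^ k.natAbs) (𝓝[<] 1) (𝓝 1) := by
        have := (continuous_pow k.natAbs (M := ℝ)).tendsto 1
        simp only [one_pow] at this
        exact this.mono_left nhdsWithin_le_nhds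
      have h2 := (((Complex.continuous_ofReal.tendsto _).comp h1).mul_const (conj (fc w k))).mul_const
        (fc g k)
      simpa [Function.comp_def] using h2
    · have : Set.Ico (0 : ℝ) 1 ∈ 𝓝[<] (1 : ℝ) := Ico_mem_nhdsLT one_pos
      filter_upwards [this] with r hr k
      rw [map_mul, Complex.conj_ofReal, mul_assoc, norm_mul, Complex.norm_real,
        Real.norm_of_nonneg (pow_nonneg hr.1 _)]
      exact mul_le_of_le_one_left (norm_nonneg _) (pow_le_one₀ hr.1 hr.2.le)
  rw [(parseval hw hgm).tsum_eq] at hlim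
  have hlim2 := (Complex.continuous_re.tendsto _).comp hlim
  rw [Complex.ofReal_re] at hlim2
  have hge : c * ∫ x, g x ∂unif ≤ ∫ x, w x * g x ∂unif := by
    refine ge_of_tendsto hlim2 ?_
    have : Set.Ico (0 : ℝ) 1 ∈ 𝓝[<] (1 : ℝ) := Ico_mem_nhdsLT one_pos
    filter_upwards [this] with r hr
    obtain ⟨wr, hwr, hwc, hwk⟩ := hreg r hr.1 hr.2
    have h5 := (parseval (memLp_of_continuous hwr 2) hgm).tsum_eq
    simp only [hwk] at h5
    simp only [Function.comp, h5, Complex.ofReal_re]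
    rw [← integral_const_mul]
    refine integral_mono (hgi.const_mul _) ((memLp_of_continuous hwr 2).integrable_mul hgm)
      fun x => ?_
    exact mul_le_mul_of_nonneg_right (hwc x) (hg0 x)
  have hwg : Integrable (fun x => w x * g x) unif := hw.integrable_mul hgm
  have h7 : ∫ x, (c - w x) * g x ∂unif ≤ 0 := by
    have e : ∀ x, (c - w x) * g x = c * g x - w x * g x := fun x => by ring
    simp only [e]
    rw [integral_sub (hgi.const_mul _) hwg, integral_const_mul]
    linarith
  have hnn : 0 ≤ᵐ[unif] fun x => (c - w x) * g x := by
    filter_upwards [hA] with x hx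
    by_cases hxA : x ∈ A
    · have := hx.1 hxA
      simp only [hg, Set.indicator_of_mem hxA, Pi.zero_apply]; linarith
    · simp [hg, Set.indicator_of_notMem hxA]
  have hi : Integrable (fun x => (c - w x) * g x) unif := by
    have e : (fun x => (c - w x) * g x) = fun x => c * g x - w x * g x := by funext x; ring
    rw [e]; exact (hgi.const_mul _).sub hwg
  have h8 := (integral_eq_zero_iff_of_nonneg_ae hnn hi).1 (le_antisymm h7 (integral_nonneg_of_ae hnn))
  filter_upwards [h8, hA] with x hx hxA
  by_contra hlt
  push Not at hlt
  have hxm := hxA.2 hlt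
  simp only [hg, Set.indicator_of_mem hxm, Pi.zero_apply, mul_one] at hx
  linarith

/-- A continuous solution of the equilibrium equation. -/
theorem exists_solution {β : ℝ} (hβ : 0 < β) {V : Torus → ℝ} (hV : Continuous V) :
    ∃ (w : Torus → ℝ) (Z : ℝ), Continuous w ∧ 0 < Z ∧
      ∫ x, Real.exp (-V x - w x) / Z ∂unif = 1 ∧
      ∀ k : ℤ, fc w k = ((β / |(k : ℝ)| : ℝ) : ℂ) * fc (fun x => Real.exp (-V x - w x) / Z) k := by
  obtain ⟨w, hw, hint, heq⟩ := exists_weak_solution hβ hV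
  set Z := ∫ x, Real.exp (-V x - w x) ∂unif with hZ
  have hZ0 : 0 < Z := integral_exp_pos hint
  have hZc : (Z : ℂ) ≠ 0 := by exact_mod_cast hZ0.ne'
  set ρ : Torus → ℝ := fun x => Real.exp (-V x - w x) / Z with hρ
  have hρi : Integrable ρ unif := hint.div_const _
  have hρ0 : ∀ x, 0 ≤ ρ x := fun x => by positivity
  have hρ1 : ∫ x, ρ x ∂unif = 1 := by rw [hρ, integral_div, ← hZ, div_self hZ0.ne']
  have hfρ : ∀ k, fc ρ k = (Z : ℂ)⁻¹ * fc (fun x => Real.exp (-V x - w x)) k := by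
    intro k
    have := fc_const_mul Z⁻¹ (fun x => Real.exp (-V x - w x)) k
    push_cast at this
    rw [← this, hρ]
    simp only [div_eq_inv_mul]
  have hfw : ∀ k : ℤ, fc w k = ((β / max |(k : ℝ)| 1 : ℝ) : ℂ) * fc ρ k := by
    intro k
    rw [hfρ, mul_left_comm, ← heq]
    field_simp
  have hbd := weak_solution_bounded_below hβ hw hρi hρ0 hρ1 hfw
  obtain ⟨M, hM⟩ := (isCompact_univ (X := Torus)).exists_bound_of_continuousOn hV.continuousOn
  have hρm : MemLp ρ 2 unif := by
    refine MemLp.of_bound hρi.aestronglyMeasurable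
      (Real.exp (M - (β - 2 * β * Real.log 2)) / Z) ?_
    filter_upwards [hbd] with x hx
    rw [Real.norm_of_nonneg (hρ0 x)]
    have h1 := (abs_le.1 (hM x trivial)).1
    simp only [hρ]
    gcongr
    linarith
  have hs : Summable fun k => ‖fc w k‖ := by
    have h1 : Summable fun k : ℤ => (β / max |(k : ℝ)| 1) ^ 2 := by
      have := (summable_int_rpow (s := 2) (by norm_num)).mul_left (β ^ 2)
      refine Summable.of_norm_bounded_eventually this ?_
      have : ({0} : Set ℤ)ᶜ ∈ cofinite := (Set.finite_singleton 0).compl_mem_cofinite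
      filter_upwards [this] with k hk
      have hk' : (1 : ℝ) ≤ |(k : ℝ)| := by
        have : (1 : ℤ) ≤ |k| := Int.one_le_abs (by simpa using hk)
        exact_mod_cast this
      rw [max_eq_left hk', Real.norm_of_nonneg (by positivity), Real.rpow_neg (abs_nonneg _),
        div_pow, div_eq_mul_inv, Real.rpow_two]
    refine (summable_of_sq h1 (parseval_sq hρm).summable).congr fun k => ?_
    rw [hfw, norm_mul, Complex.norm_real, Real.norm_of_nonneg (by positivity)]
  obtain ⟨w₁, hw₁, hww₁⟩ := exists_continuous_ae_eq hw hs
  -- Subtracting `β` removes the zero mode created by the maximum in the multiplier; the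
  -- normalization `Z e^β` compensates, so the density is unchanged.
  have hee : (fun x => Real.exp (-V x - (w₁ x - β)) / (Z * Real.exp β)) =ᵐ[unif] ρ := by
    filter_upwards [hww₁] with x hx
    rw [hρ, ← hx, show -V x - (w x - β) = (-V x - w x) + β by ring, Real.exp_add]
    have := Real.exp_pos β
    field_simp
  refine ⟨fun x => w₁ x - β, Z * Real.exp β, hw₁.sub continuous_const, by positivity, ?_, fun k => ?_⟩
  · rw [integral_congr_ae hee, hρ1]
  · rw [fc_congr hee, fc_sub (integrable_of_continuous hw₁ _) (integrable_const _),
      fc_const, ← fc_congr hww₁, hfw]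
    by_cases hk : k = 0
    · subst hk
      rw [fc_zero, hρ1]
      simp
    · have hk' : (1 : ℝ) ≤ |(k : ℝ)| := by
        have : (1 : ℤ) ≤ |k| := Int.one_le_abs hk
        exact_mod_cast this
      rw [if_neg hk, max_eq_left hk', sub_zero]

/-! ### Regularity -/

theorem exists_abs_le {f : Torus → ℝ} (hf : Continuous f) : ∃ M : ℝ, 0 < M ∧ ∀ x, |f x| ≤ M := by
  obtain ⟨M, hM⟩ := (isCompact_univ (X := Torus)).exists_bound_of_continuousOn hf.continuousOn
  exact ⟨|M| + 1, by positivity, fun x => (hM x trivial).trans ((le_abs_self M).trans (by linarith))⟩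

theorem HasTDeriv.lipschitz {f g : Torus → ℝ} (h : HasTDeriv f g) {M : ℝ} (hM : ∀ x, |g x| ≤ M)
    (x : Torus) (t : ℝ) : |f (x + (t : Torus)) - f x| ≤ M * |t| := by
  have := Convex.norm_image_sub_le_of_norm_hasDerivWithin_le (s := Set.univ)
    (f := fun t : ℝ => f (x + (t : Torus))) (f' := fun t => g (x + (t : Torus))) (C := M)
    (fun t _ => (h.shift x t).hasDerivWithinAt) (fun t _ => hM _) convex_univ (Set.mem_univ 0)
    (Set.mem_univ t)
  simpa using this

theorem HasTDeriv.l2Lip {f g : Torus → ℝ} (h : HasTDeriv f g) (hg : Continuous g) : L2Lip f := by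
  obtain ⟨M, hM0, hM⟩ := exists_abs_le hg
  refine ⟨M ^ 2, fun t => ?_⟩
  have h1 : ∀ x, (f (x + (t : Torus)) - f x) ^ 2 ≤ M ^ 2 * t ^ 2 := fun x => by
    rw [← sq_abs, ← sq_abs t, ← mul_pow]
    gcongr
    exact h.lipschitz hM x t
  have hf := h.continuous
  have := integral_mono (μ := unif) (integrable_of_continuous (by fun_prop) _)
    (integrable_const (M ^ 2 * t ^ 2)) h1
  simpa using this

/-- The single stability principle behind products, sums and exponentials: a pointwise bound on
increments, squared and integrated. -/
theorem L2Lip.of_le {f g₁ g₂ : Torus → ℝ} (hf : Continuous f) (h1 : Continuous g₁)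
    (h2 : Continuous g₂) (l1 : L2Lip g₁) (l2 : L2Lip g₂) {C : ℝ}
    (h : ∀ x z, |f (x + z) - f x| ≤ C * (|g₁ (x + z) - g₁ x| + |g₂ (x + z) - g₂ x|)) : L2Lip f := by
  obtain ⟨C₁, hC₁⟩ := l1
  obtain ⟨C₂, hC₂⟩ := l2
  refine ⟨2 * C ^ 2 * (C₁ + C₂), fun t => ?_⟩
  have hp : ∀ x, (f (x + (t : Torus)) - f x) ^ 2 ≤ 2 * C ^ 2 *
      ((g₁ (x + (t : Torus)) - g₁ x) ^ 2 + (g₂ (x + (t : Torus)) - g₂ x) ^ 2) := by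
    intro x
    have := h x t
    rw [← sq_abs (f _ - _), ← sq_abs (g₁ _ - _), ← sq_abs (g₂ _ - _)]
    set A := |g₁ (x + (t : Torus)) - g₁ x|
    set B := |g₂ (x + (t : Torus)) - g₂ x|
    calc |f (x + (t : Torus)) - f x| ^ 2 ≤ (C * (A + B)) ^ 2 := by gcongr
      _ ≤ _ := by nlinarith [mul_nonneg (sq_nonneg C) (sq_nonneg (A - B))]
  have i1 : Integrable (fun x => (g₁ (x + (t : Torus)) - g₁ x) ^ 2) unif :=
    integrable_of_continuous (by fun_prop) _
  have i2 : Integrable (fun x => (g₂ (x + (t : Torus)) - g₂ x) ^ 2) unif :=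
    integrable_of_continuous (by fun_prop) _
  have := integral_mono (μ := unif) (integrable_of_continuous (by fun_prop) _)
    ((i1.add i2).const_mul (2 * C ^ 2)) hp
  refine this.trans ?_
  rw [integral_const_mul]
  have e : ∫ x, ((fun x => (g₁ (x + (t : Torus)) - g₁ x) ^ 2) +
      fun x => (g₂ (x + (t : Torus)) - g₂ x) ^ 2) x ∂unif ≤ (C₁ + C₂) * t ^ 2 := by
    rw [integral_add' i1 i2]
    have := hC₁ t
    have := hC₂ t
    linarith
  calc _ ≤ 2 * C ^ 2 * ((C₁ + C₂) * t ^ 2) := by gcongr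
    _ = _ := by ring

theorem L2Lip.mul {f g : Torus → ℝ} (hf : Continuous f) (hg : Continuous g) (l1 : L2Lip f)
    (l2 : L2Lip g) : L2Lip fun x => f x * g x := by
  obtain ⟨M, hM0, hM⟩ := exists_abs_le hf
  obtain ⟨M', hM0', hM'⟩ := exists_abs_le hg
  refine L2Lip.of_le (hf.mul hg) hf hg l1 l2 (C := M + M') fun x z => ?_
  have e : f (x + z) * g (x + z) - f x * g x
      = (f (x + z) - f x) * g (x + z) + f x * (g (x + z) - g x) := by ring
  rw [e]
  refine (abs_add_le _ _).trans ?_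
  rw [abs_mul, abs_mul]
  have := hM x
  have := hM' (x + z)
  have := abs_nonneg (f (x + z) - f x)
  have := abs_nonneg (g (x + z) - g x)
  nlinarith [abs_nonneg (f x), abs_nonneg (g (x + z))]

theorem L2Lip.add {f g : Torus → ℝ} (hf : Continuous f) (hg : Continuous g) (l1 : L2Lip f)
    (l2 : L2Lip g) : L2Lip fun x => f x + g x := by
  refine L2Lip.of_le (hf.add hg) hf hg l1 l2 (C := 1) fun x z => ?_
  rw [one_mul]
  refine le_trans (le_of_eq ?_) (abs_add_le _ _)
  congr 1; ring

theorem L2Lip.exp {f : Torus → ℝ} (hf : Continuous f) (l1 : L2Lip f) :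
    L2Lip fun x => Real.exp (f x) := by
  obtain ⟨M, hM0, hM⟩ := exists_abs_le hf
  refine L2Lip.of_le (Real.continuous_exp.comp hf) hf hf l1 l1 (C := Real.exp M) fun x z => ?_
  have h1 : ∀ a b : ℝ, a ≤ M → b ≤ M → Real.exp a - Real.exp b ≤ Real.exp M * |a - b| := by
    intro a b ha hb
    have h2 := Real.add_one_le_exp (b - a)
    have h3 : Real.exp b = Real.exp a * Real.exp (b - a) := by rw [← Real.exp_add]; congr 1; ring
    have h4 : Real.exp a - Real.exp b ≤ Real.exp a * (a - b) := by
      rw [h3]; nlinarith [Real.exp_pos a]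
    calc _ ≤ Real.exp a * (a - b) := h4
      _ ≤ Real.exp a * |a - b| := by gcongr; exact le_abs_self _
      _ ≤ _ := by gcongr
  have hb : ∀ y, f y ≤ M := fun y => (le_abs_self _).trans (hM y)
  have h5 : |Real.exp (f (x + z)) - Real.exp (f x)| ≤ Real.exp M * |f (x + z) - f x| := by
    rw [abs_le]
    constructor
    · have := h1 _ _ (hb x) (hb (x + z))
      rw [abs_sub_comm] at this; linarith
    · exact h1 _ _ (hb (x + z)) (hb x)
  refine h5.trans ?_
  gcongr
  linarith [abs_nonneg (f (x + z) - f x)]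

/-- A multiplier of size `1 / |k|` maps `L²` into `H¹`. The zero mode plays no role, since its
weight vanishes. -/
theorem SqSum.of_multiplier {f g : Torus → ℝ} {β : ℝ} (hg : MemLp g 2 unif)
    (h : ∀ k : ℤ, ‖fc f k‖ ≤ |β / (k : ℝ)| * ‖fc g k‖) : SqSum f := by
  refine Summable.of_nonneg_of_le (fun k => sq_nonneg _) (fun k => ?_)
    ((parseval_sq hg).summable.mul_left (β ^ 2))
  rw [← sq_abs β, ← mul_pow]
  refine pow_le_pow_left₀ (by positivity) ?_ 2
  by_cases hk : (k : ℝ) = 0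
  · rw [hk]; simp only [abs_zero, zero_mul]; positivity
  · calc |(k : ℝ)| * ‖fc f k‖ ≤ |(k : ℝ)| * (|β / (k : ℝ)| * ‖fc g k‖) := by gcongr; exact h k
      _ = _ := by
        rw [abs_div]
        have : |(k : ℝ)| ≠ 0 := abs_ne_zero.2 hk
        field_simp

theorem summable_of_multiplier {f g : Torus → ℝ} {β : ℝ} (hg : Summable fun k => ‖fc g k‖)
    (h : ∀ k : ℤ, ‖fc f k‖ ≤ |β / (k : ℝ)| * ‖fc g k‖) :
    Summable fun k : ℤ => |(k : ℝ)| * ‖fc f k‖ := by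
  refine Summable.of_nonneg_of_le (fun k => by positivity) (fun k => ?_) (hg.mul_left |β|)
  by_cases hk : (k : ℝ) = 0
  · rw [hk]; simp only [abs_zero, zero_mul]; positivity
  · calc |(k : ℝ)| * ‖fc f k‖ ≤ |(k : ℝ)| * (|β / (k : ℝ)| * ‖fc g k‖) := by gcongr; exact h k
      _ = _ := by
        rw [abs_div]
        have : |(k : ℝ)| ≠ 0 := abs_ne_zero.2 hk
        field_simp

theorem SqSum.summable_mul_of_deriv {f g : Torus → ℝ} (hg : SqSum g)
    (h : ∀ k : ℤ, fc g k = Complex.I * k * fc f k) :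
    Summable fun k : ℤ => |(k : ℝ)| * ‖fc f k‖ := by
  refine hg.summable.congr fun k => ?_
  rw [h]; simp

/-- The equilibrium density `ρ` (with respect to `dx / 2π`), its potential `w`, and their
derivatives. -/
structure EqDensity (β : ℝ) (V V₁ ρ ρ₁ ρ₂ w w₁ : Torus → ℝ) : Prop where
  V_deriv : HasTDeriv V V₁
  V₁_cont : Continuous V₁
  w_deriv : HasTDeriv w w₁
  w₁_cont : Continuous w₁
  ρ_eq : ∃ Z : ℝ, 0 < Z ∧ ∀ x, ρ x = Real.exp (-V x - w x) / Z
  ρ_int : ∫ x, ρ x ∂unif = 1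
  ρ_deriv : HasTDeriv ρ ρ₁
  ρ₁_eq : ∀ x, ρ₁ x = -(V₁ x + w₁ x) * ρ x
  ρ₁_deriv : HasTDeriv ρ₁ ρ₂
  ρ₂_cont : Continuous ρ₂
  fc_w : ∀ k : ℤ, fc w k = ((β / |(k : ℝ)| : ℝ) : ℂ) * fc ρ k
  ρ_summable : Summable fun k => ‖fc ρ k‖
  ρ_hol : Hol ρ
  w₁_eq : ∀ x, w₁ x = β * hil ρ x

/-- Bootstrap: `ρ ∈ L²` puts `w` in `H¹`, hence `ρ = e^{-V-w} / Z` in `H¹`, hence `w` is `C¹` and so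
is `ρ`. One more round of the same argument for `w₁` and `ρ₁` makes both twice differentiable. -/
theorem exists_eqDensity {β : ℝ} (hβ : 0 < β) {V V₁ V₂ : Torus → ℝ} (h1 : HasTDeriv V V₁)
    (h2 : HasTDeriv V₁ V₂) (h3 : Continuous V₂) :
    ∃ ρ ρ₁ ρ₂ w w₁, EqDensity β V V₁ ρ ρ₁ ρ₂ w w₁ := by
  have hV := h1.continuous
  have hV₁ := h2.continuous
  obtain ⟨w, Z, hw, hZ, hint, hfw⟩ := exists_solution hβ hV
  set ρ : Torus → ℝ := fun x => Real.exp (-V x - w x) / Z with hρ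
  have hρc : Continuous ρ := by fun_prop
  have hb : ∀ k : ℤ, ‖fc w k‖ ≤ |β / (k : ℝ)| * ‖fc ρ k‖ := by
    intro k
    rw [hfw, norm_mul, Complex.norm_real, Real.norm_eq_abs, abs_div, abs_div, abs_abs]
  have lw : L2Lip w := (SqSum.of_multiplier (memLp_of_continuous hρc 2) hb).l2Lip
    (memLp_of_continuous hw 2)
  have lconst : ∀ c : ℝ, L2Lip fun _ => c := fun c => ⟨0, fun h => by simp⟩
  have lV : L2Lip V := h1.l2Lip hV₁
  have lρ : L2Lip ρ := by
    have e : ρ = fun x => Real.exp (-1 * (V x + w x)) * Z⁻¹ := by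
      funext x
      simp only [hρ, div_eq_mul_inv]
      congr 2; ring
    rw [e]
    exact L2Lip.mul (by fun_prop) continuous_const (L2Lip.exp (by fun_prop)
      (L2Lip.mul continuous_const (by fun_prop) (lconst _) (L2Lip.add hV hw lV lw))) (lconst _)
  have sρ : SqSum ρ := lρ.sqSum (memLp_of_continuous hρc 2)
  obtain ⟨w₁, hw₁, hww₁, hfw₁⟩ := exists_hasTDeriv hw (summable_of_multiplier sρ.summable hb)
  set ρ₁ : Torus → ℝ := fun x => -(V₁ x + w₁ x) * ρ x with hρ₁
  have dρ : HasTDeriv ρ ρ₁ := by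
    intro x
    have := (((h1 x).neg.sub (hww₁ x)).exp).div_const Z
    refine this.congr_deriv ?_
    simp only [hρ₁, hρ, Pi.sub_apply, Pi.neg_apply]
    ring
  have hρ₁c : Continuous ρ₁ := by fun_prop
  have hb₁ : ∀ k : ℤ, ‖fc w₁ k‖ ≤ |β / (k : ℝ)| * ‖fc ρ₁ k‖ := by
    intro k
    rw [hfw₁, fc_deriv dρ hρ₁c, norm_mul, norm_mul]
    calc _ ≤ ‖Complex.I * (k : ℂ)‖ * (|β / (k : ℝ)| * ‖fc ρ k‖) := by
          rw [norm_mul]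
          gcongr
          exact hb k
      _ = _ := by rw [norm_mul (_ * _)]; ring
  have lw₁ : L2Lip w₁ := (SqSum.of_multiplier (memLp_of_continuous hρ₁c 2) hb₁).l2Lip
    (memLp_of_continuous hw₁ 2)
  have lρ₁ : L2Lip ρ₁ := by
    have e : ρ₁ = fun x => (-1 * (V₁ x + w₁ x)) * ρ x := by
      funext x; rw [hρ₁]; ring
    rw [e]
    exact L2Lip.mul (by fun_prop) hρc (L2Lip.mul continuous_const (by fun_prop) (lconst _)
      (L2Lip.add hV₁ hw₁ (h2.l2Lip h3) lw₁)) lρ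
  have sρ₁ : SqSum ρ₁ := lρ₁.sqSum (memLp_of_continuous hρ₁c 2)
  obtain ⟨w₂, hw₂, hww₂, -⟩ := exists_hasTDeriv hw₁ (summable_of_multiplier sρ₁.summable hb₁)
  refine ⟨ρ, ρ₁, fun x => -(V₂ x + w₂ x) * ρ x + -(V₁ x + w₁ x) * ρ₁ x, w, w₁,
    ⟨h1, hV₁, hww₁, hw₁, ⟨Z, hZ, fun x => rfl⟩, hint, dρ, fun x => rfl, ?_, by fun_prop, hfw,
      sρ.summable, sρ.hol hρc, ?_⟩⟩
  · intro x
    exact (((h2 x).add (hww₂ x)).neg).mul (dρ x)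
  · have hh := continuous_hil hρc (sρ.hol hρc)
    have : w₁ = fun x => β * hil ρ x := by
      refine eq_of_fc_eq hw₁ (continuous_const.mul hh) (funext fun k => ?_)
      rw [hfw₁, fc_const_mul, fc_hil hρc (sρ.hol hρc), hfw]
      by_cases hk : k = 0
      · subst hk; simp
      · have hk1 : (k : ℂ) = (k.sign : ℂ) * ((|(k : ℝ)| : ℝ) : ℂ) := by
          have : (k : ℝ) = (k.sign : ℝ) * |(k : ℝ)| := by
            have := Int.sign_mul_abs k
            exact_mod_cast this.symm
          exact_mod_cast this
        have hk2 : ((|(k : ℝ)| : ℝ) : ℂ) ≠ 0 := by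
          have : |(k : ℝ)| ≠ 0 := abs_ne_zero.2 (by exact_mod_cast hk)
          exact_mod_cast this
        conv_lhs => rw [hk1]
        push_cast
        field_simp
    intro x; rw [this]

theorem IsCk.exists_deriv {n : ℕ} {f : Torus → ℝ} (h : IsCk (n + 1) f) :
    ∃ g, HasTDeriv f g ∧ IsCk n g := by
  have h1 : ∀ x : ℝ, torusDeriv f (x : Torus) = deriv (lift f) x := by
    intro x
    have : (fun t : ℝ => f ((x : Torus) + (t : Torus))) = fun t : ℝ => lift f (x + t) := by
      funext t; simp [lift]
    rw [torusDeriv, this, deriv_comp_const_add]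
    simp
  have h2 : lift (torusDeriv f) = deriv (lift f) := funext h1
  have hd := (contDiff_succ_iff_deriv (n := (n : WithTop ℕ∞)) (f := lift f)).1 (by exact_mod_cast h)
  refine ⟨torusDeriv f, fun x => ?_, ?_⟩
  · rw [h1]; exact (hd.1 x).hasDerivAt
  · rw [IsCk, h2]; exact hd.2.2

theorem IsCk.continuous {n : ℕ} {f : Torus → ℝ} (h : IsCk n f) : Continuous f :=
  continuous_of_coe (ContDiff.continuous h)

/-! ### The linearized equation -/

/-- By Parseval the pairing equals `∑ |D̂_k|² / |k|`, the logarithmic energy of `D` up to a factor.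
It is used three times: for coercivity, for the sign of the variance and for uniqueness. -/
theorem integral_mul_nonneg_of_fc {D h : Torus → ℝ} (hD : MemLp D 2 unif) (hh : MemLp h 2 unif)
    (hk : ∀ k : ℤ, fc h k = ((1 / |(k : ℝ)| : ℝ) : ℂ) * fc D k) : 0 ≤ ∫ x, h x * D x ∂unif := by
  have h1 := parseval hh hD
  have h2 : HasSum (fun k : ℤ => ((1 / |(k : ℝ)| * ‖fc D k‖ ^ 2 : ℝ) : ℂ))
      ((∫ x, h x * D x ∂unif : ℝ) : ℂ) := by
    refine h1.congr_fun fun k => ?_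
    rw [hk, map_mul, Complex.conj_ofReal, mul_assoc, mul_comm (conj _), Complex.mul_conj,
      Complex.normSq_eq_norm_sq]
    push_cast; ring
  exact (Complex.hasSum_ofReal.1 h2).nonneg fun k => by positivity

theorem exists_mulOp {g : Torus → ℝ} (hg : Continuous g) :
    ∃ T : L2T →L[ℝ] L2T, ∀ f : L2T, T f =ᵐ[unif] fun x => g x * f x := by
  obtain ⟨M, hM0, hM⟩ := exists_abs_le hg
  have hm : ∀ f : L2T, MemLp (fun x => g x * f x) 2 unif := fun f =>
    (Lp.memLp f).of_le_mul (c := M) (hg.aestronglyMeasurable.mul (Lp.aestronglyMeasurable f))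
      (ae_of_all _ fun x => by
        rw [norm_mul]
        exact mul_le_mul_of_nonneg_right (hM x) (norm_nonneg _))
  let L : L2T →ₗ[ℝ] L2T :=
    { toFun := fun f => (hm f).toLp _
      map_add' := fun f f' => by
        refine Lp.ext ?_
        filter_upwards [(hm (f + f')).coeFn_toLp, (hm f).coeFn_toLp, (hm f').coeFn_toLp,
          Lp.coeFn_add f f', Lp.coeFn_add ((hm f).toLp _) ((hm f').toLp _)] with x h1 h2 h3 h4 h5
        rw [h1, h5, Pi.add_apply, h2, h3, h4, Pi.add_apply]; ring
      map_smul' := fun c f => by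
        refine Lp.ext ?_
        filter_upwards [(hm (c • f)).coeFn_toLp, (hm f).coeFn_toLp,
          Lp.coeFn_smul c f, Lp.coeFn_smul c ((hm f).toLp _)] with x h1 h2 h3 h4
        rw [h1, RingHom.id_apply, h4, Pi.smul_apply, h2, h3, Pi.smul_apply, smul_eq_mul,
          smul_eq_mul]; ring }
  refine ⟨L.mkContinuous M fun f => ?_, fun f => (hm f).coeFn_toLp⟩
  refine Lp.norm_le_mul_norm_of_ae_le_mul ?_
  filter_upwards [(hm f).coeFn_toLp] with x hx
  change ‖((hm f).toLp _) x‖ ≤ _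
  rw [hx, norm_mul]
  exact mul_le_mul_of_nonneg_right (hM x) (norm_nonneg _)

/-- The operator `f ↦ f / ρ + β K f` is coercive: multiplication by `1 / ρ` is bounded below and `K`
is nonnegative. Lax–Milgram inverts it. -/
theorem exists_linear_solution {β : ℝ} (hβ : 0 < β) {ρ ψ : Torus → ℝ} (hρ : Continuous ρ)
    (hρ0 : ∀ x, 0 < ρ x) (hψ : Continuous ψ) :
    ∃ (f h : Torus → ℝ) (c : ℝ), MemLp f 2 unif ∧ MemLp h 2 unif ∧ ∫ x, f x ∂unif = 0 ∧
      (∀ k : ℤ, fc h k = ((1 / |(k : ℝ)| : ℝ) : ℂ) * fc f k) ∧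
      ∀ᵐ x ∂unif, f x / ρ x + β * h x = -(ψ x + c) := by
  obtain ⟨K, hK⟩ := exists_multiplier (m := fun k => 1 / |(k : ℝ)|) (M := 1) zero_le_one
    (fun k => by
      rw [abs_of_nonneg (by positivity)]
      by_cases hk : k = 0
      · simp [hk]
      · have hk' : (1 : ℝ) ≤ |(k : ℝ)| := by
          have : (1 : ℤ) ≤ |k| := Int.one_le_abs hk
          exact_mod_cast this
        exact div_le_one_of_le₀ hk' (abs_nonneg _)) (fun k => by simp)
  have hinv : Continuous fun x => (ρ x)⁻¹ := hρ.inv₀ fun x => (hρ0 x).ne'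
  obtain ⟨Q, hQ⟩ := exists_mulOp hinv
  obtain ⟨M, hM0, hM⟩ := exists_abs_le hρ
  set A : L2T →L[ℝ] L2T := Q + β • K with hA
  have hAf : ∀ f : L2T, A f =ᵐ[unif] fun x => f x / ρ x + β * K f x := by
    intro f
    have : A f = Q f + β • K f := rfl
    rw [this]
    filter_upwards [Lp.coeFn_add (Q f) (β • K f), Lp.coeFn_smul β (K f), hQ f] with x h1 h2 h3
    rw [h1, Pi.add_apply, h2, h3, Pi.smul_apply, smul_eq_mul]; ring
  have hpos : ∀ f : L2T, M⁻¹ * ‖f‖ ^ 2 ≤ inner ℝ (A f) f := by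
    intro f
    have e1 : inner ℝ (A f) f = inner ℝ (Q f) f + β * inner ℝ (K f) f := by
      rw [hA, add_apply, inner_add_left, smul_apply,
        real_inner_smul_left]
    have h2 : 0 ≤ inner ℝ (K f) f := by
      rw [L2T.inner_eq]
      exact integral_mul_nonneg_of_fc (Lp.memLp f) (Lp.memLp _) (hK f)
    have h3 : M⁻¹ * ‖f‖ ^ 2 ≤ inner ℝ (Q f) f := by
      rw [L2T.inner_eq, L2T.norm_sq_eq, ← integral_const_mul]
      refine integral_mono_ae ((Lp.memLp f).integrable_sq.const_mul _)
        ((Lp.memLp (Q f)).integrable_mul (Lp.memLp f)) ?_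
      filter_upwards [hQ f] with x hx
      rw [hx]
      have h4 : M⁻¹ ≤ (ρ x)⁻¹ := inv_anti₀ (hρ0 x) ((le_abs_self _).trans (hM x))
      nlinarith [sq_nonneg (f x)]
    rw [e1]; nlinarith
  set B : L2T →L[ℝ] L2T →L[ℝ] ℝ := (innerSL ℝ).comp A with hB
  have hBc : IsCoercive B := ⟨M⁻¹, by positivity, fun f => by
    have := hpos f
    rw [mul_assoc, ← sq]; exact this⟩
  have hsurj : ∀ s : L2T, ∃ f : L2T, A f = s := by
    intro s
    refine ⟨hBc.continuousLinearEquivOfBilin.symm s, ?_⟩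
    refine ext_inner_right ℝ fun w => ?_
    have := hBc.continuousLinearEquivOfBilin_apply (hBc.continuousLinearEquivOfBilin.symm s) w
    rw [ContinuousLinearEquiv.apply_symm_apply] at this
    rw [this]; rfl
  have hψm := memLp_of_continuous hψ 2
  have h1m : MemLp (fun _ : Torus => (1 : ℝ)) 2 unif := memLp_of_continuous continuous_const 2
  obtain ⟨f₀, hf₀⟩ := hsurj (-(hψm.toLp ψ))
  obtain ⟨f₁, hf₁⟩ := hsurj (h1m.toLp _)
  have hf₁int : inner ℝ (A f₁) f₁ = ∫ x, f₁ x ∂unif := by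
    rw [hf₁, L2T.inner_eq]
    refine integral_congr_ae ?_
    filter_upwards [h1m.coeFn_toLp] with x hx
    rw [hx, one_mul]
  have hf₁pos : 0 < ∫ x, f₁ x ∂unif := by
    rw [← hf₁int]
    refine lt_of_lt_of_le ?_ (hpos f₁)
    have : f₁ ≠ 0 := by
      intro h0
      rw [h0, map_zero] at hf₁
      have h2 := h1m.coeFn_toLp
      rw [← hf₁] at h2
      have h3 : (fun _ : Torus => (1 : ℝ)) =ᵐ[unif] fun _ => 0 :=
        h2.symm.trans (Lp.coeFn_zero ℝ 2 (unif : Measure Torus))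
      obtain ⟨x, hx⟩ := h3.exists
      norm_num at hx
    have := norm_pos_iff.2 this
    positivity
  -- The constant restores mean zero, needed for `f` to be a derivative. The division is legitimate
  -- because `∫ f₁` is the quadratic form at `f₁ ≠ 0`.
  set c : ℝ := (∫ x, f₀ x ∂unif) / ∫ x, f₁ x ∂unif with hc
  set f : L2T := f₀ + (-c) • f₁ with hf
  refine ⟨f, K f, c, Lp.memLp _, Lp.memLp _, ?_, hK f, ?_⟩
  · have h1 : fc f 0 = 0 := by
      rw [hf, L2T.fc_add, L2T.fc_smul, fc_zero, fc_zero, hc]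
      have : ((∫ x, f₁ x ∂unif : ℝ) : ℂ) ≠ 0 := by exact_mod_cast hf₁pos.ne'
      push_cast
      field_simp
      ring
    rw [fc_zero] at h1
    exact_mod_cast h1
  · have e : A f = -(hψm.toLp ψ) + (-c) • h1m.toLp _ := by
      rw [hf, map_add, map_smul, hf₀, hf₁]
    have h1 := hAf f
    rw [e] at h1
    filter_upwards [h1, Lp.coeFn_add (-(hψm.toLp ψ)) ((-c) • h1m.toLp (fun _ => (1 : ℝ))),
      Lp.coeFn_neg (hψm.toLp ψ), Lp.coeFn_smul (-c) (h1m.toLp (fun _ => (1 : ℝ))),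
      hψm.coeFn_toLp, h1m.coeFn_toLp] with x h1 h2 h3 h4 h5 h6
    rw [← h1, h2, Pi.add_apply, h3, Pi.neg_apply, h5, h4, Pi.smul_apply, h6, smul_eq_mul]; ring

theorem exists_primitive {f : Torus → ℝ} (hf : Continuous f) (hs : Summable fun k => ‖fc f k‖)
    (h0 : ∫ x, f x ∂unif = 0) : ∃ v : Torus → ℝ, HasTDeriv v f := by
  set a : ℤ → ℂ := fun k => fc f k / (Complex.I * k) with ha
  have hle : ∀ k : ℤ, |(k : ℝ)| * ‖a k‖ ≤ ‖fc f k‖ := by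
    intro k
    rw [ha, norm_div, norm_mul, Complex.norm_I, one_mul]
    by_cases hk : k = 0
    · simp [hk]
    · have : |(k : ℝ)| ≠ 0 := abs_ne_zero.2 (by exact_mod_cast hk)
      rw [Complex.norm_intCast]
      exact le_of_eq (by field_simp)
  have hs1 : Summable fun k : ℤ => |(k : ℝ)| * ‖a k‖ :=
    Summable.of_nonneg_of_le (fun k => by positivity) hle hs
  have hs0 : Summable fun k => ‖a k‖ := by
    refine Summable.of_nonneg_of_le (fun k => norm_nonneg _) (fun k => ?_) hs
    by_cases hk : k = 0
    · simp [ha, hk]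
    · have hk' : (1 : ℝ) ≤ |(k : ℝ)| := by
        have : (1 : ℤ) ≤ |k| := Int.one_le_abs hk
        exact_mod_cast this
      exact (le_mul_of_one_le_left (norm_nonneg _) hk').trans (hle k)
  obtain ⟨v, hv, hvk, -⟩ := exists_synth hs0 (fun k => by
    simp only [ha, fc_neg_index, map_div₀, map_mul, Complex.conj_I]
    push_cast
    simp)
  obtain ⟨g, hg, hvg, hgk⟩ := exists_hasTDeriv hv (by simpa only [hvk] using hs1)
  have : g = f := by
    refine eq_of_fc_eq hg hf (funext fun k => ?_)
    rw [hgk, hvk]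
    by_cases hk : k = 0
    · rw [hk, fc_zero, h0]; simp
    · have : (k : ℂ) ≠ 0 := by exact_mod_cast hk
      simp only [ha]
      field_simp
  exact ⟨v, this ▸ hvg⟩

theorem HasTDeriv.add {f f' g g' : Torus → ℝ} (hf : HasTDeriv f f') (hg : HasTDeriv g g') :
    HasTDeriv (fun x => f x + g x) (fun x => f' x + g' x) := fun x => (hf x).add (hg x)

theorem HasTDeriv.mul {f f' g g' : Torus → ℝ} (hf : HasTDeriv f f') (hg : HasTDeriv g g') :
    HasTDeriv (fun x => f x * g x) (fun x => f' x * g x + f x * g' x) := fun x => (hf x).mul (hg x)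

theorem HasTDeriv.add_const {f f' : Torus → ℝ} (hf : HasTDeriv f f') (c : ℝ) :
    HasTDeriv (fun x => f x + c) f' := fun x => (hf x).add_const c

theorem HasTDeriv.const_mul {f f' : Torus → ℝ} (hf : HasTDeriv f f') (c : ℝ) :
    HasTDeriv (fun x => c * f x) (fun x => c * f' x) := fun x => (hf x).const_mul c

theorem HasTDeriv.inv {f f' : Torus → ℝ} (hf : HasTDeriv f f') (h0 : ∀ x, f x ≠ 0) :
    HasTDeriv (fun x => (f x)⁻¹) (fun x => -f' x / f x ^ 2) := fun x => (hf x).fun_inv (h0 x)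

theorem HasTDeriv.sqSum {f g : Torus → ℝ} (h : HasTDeriv f g) (hg : Continuous g) : SqSum f :=
  (h.l2Lip hg).sqSum (memLp_of_continuous h.continuous 2)

theorem HasTDeriv.integral_mul_eq {f f' g g' : Torus → ℝ} (hf : HasTDeriv f f')
    (hg : HasTDeriv g g') (hf' : Continuous f') (hg' : Continuous g') :
    ∫ x, f' x * g x ∂unif = -∫ x, f x * g' x ∂unif := by
  have c1 : Continuous fun x => f' x * g x := hf'.mul hg.continuous
  have c2 : Continuous fun x => f x * g' x := hf.continuous.mul hg'
  have := (hf.mul hg).integral_eq_zero (c1.add c2)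
  rw [integral_add (integrable_of_continuous c1 _) (integrable_of_continuous c2 _)] at this
  linarith

theorem EqDensity.ρ_pos {β : ℝ} {V V₁ ρ ρ₁ ρ₂ w w₁ : Torus → ℝ}
    (E : EqDensity β V V₁ ρ ρ₁ ρ₂ w w₁) (x : Torus) : 0 < ρ x := by
  obtain ⟨Z, hZ, h⟩ := E.ρ_eq
  rw [h]; positivity

theorem EqDensity.ρ_cont {β : ℝ} {V V₁ ρ ρ₁ ρ₂ w w₁ : Torus → ℝ}
    (E : EqDensity β V V₁ ρ ρ₁ ρ₂ w w₁) : Continuous ρ := E.ρ_deriv.continuous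

theorem EqDensity.ρ₁_cont {β : ℝ} {V V₁ ρ ρ₁ ρ₂ w w₁ : Torus → ℝ}
    (E : EqDensity β V V₁ ρ ρ₁ ρ₂ w w₁) : Continuous ρ₁ := E.ρ₁_deriv.continuous

/-- A classical solution `φ` of the linearized equation, with `u = φ'`. -/
structure LinSol (β : ℝ) (ρ ρ₁ ψ φ u u₁ u₂ f κ : Torus → ℝ) (c : ℝ) : Prop where
  φ_deriv : HasTDeriv φ u
  u_deriv : HasTDeriv u u₁
  u₁_deriv : HasTDeriv u₁ u₂
  u₂_cont : Continuous u₂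
  φ_int : ∫ x, φ x * ρ x ∂unif = 0
  v_deriv : HasTDeriv (fun x => ρ x * u x) f
  f_cont : Continuous f
  κ_cont : Continuous κ
  fc_κ : ∀ k : ℤ, fc κ k = ((1 / |(k : ℝ)| : ℝ) : ℂ) * fc f k
  f_eq : ∀ x, f x / ρ x + β * κ x = -(ψ x + c)
  hil_eq : ∀ x, hil (fun x => ρ x * u x) x = κ x
  eq : ∀ x, u₁ x + β * hil (fun x => ρ x * u x) x + ρ₁ x / ρ x * u x = -(ψ x + c)

/-- If `f = v'`, then `i sign k · v̂_k = f̂_k / |k|`: the Hilbert transform of `v` is `K f`, which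
is what makes the nonlocal term of the operator symmetric in `f`. -/
theorem hil_eq_of_fc {v f κ : Torus → ℝ} (hv : Continuous v) (hh : Hol v)
    (hk : ∀ k : ℤ, fc f k = Complex.I * k * fc v k)
    (hκ : ∀ k : ℤ, fc κ k = ((1 / |(k : ℝ)| : ℝ) : ℂ) * fc f k) : fc (hil v) = fc κ := by
  funext k
  rw [fc_hil hv hh, hκ, hk]
  by_cases hk0 : k = 0
  · subst hk0; simp
  · have hk1 : (k : ℂ) = (k.sign : ℂ) * ((|(k : ℝ)| : ℝ) : ℂ) := by
      have : (k : ℝ) = (k.sign : ℝ) * |(k : ℝ)| := by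
        have := Int.sign_mul_abs k
        exact_mod_cast this.symm
      exact_mod_cast this
    have hk2 : ((|(k : ℝ)| : ℝ) : ℂ) ≠ 0 := by
      have : |(k : ℝ)| ≠ 0 := abs_ne_zero.2 (by exact_mod_cast hk0)
      exact_mod_cast this
    conv_rhs => rw [hk1]
    push_cast
    field_simp

theorem EqDensity.exists_linSol {β : ℝ} (hβ : 0 < β) {V V₁ ρ ρ₁ ρ₂ w w₁ : Torus → ℝ}
    (E : EqDensity β V V₁ ρ ρ₁ ρ₂ w w₁) {ψ ψ₁ : Torus → ℝ} (hψ : HasTDeriv ψ ψ₁)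
    (hψ₁ : Continuous ψ₁) : ∃ φ u u₁ u₂ f κ c, LinSol β ρ ρ₁ ψ φ u u₁ u₂ f κ c := by
  have hρ := E.ρ_cont
  have hρ₁ := E.ρ₁_cont
  have hρ0 := E.ρ_pos
  have hρne : ∀ x, ρ x ≠ 0 := fun x => (hρ0 x).ne'
  have hψc := hψ.continuous
  obtain ⟨F, h, c, hF, hh, hF0, hhk, hFe⟩ := exists_linear_solution hβ hρ hρ0 hψc
  have hb : ∀ k : ℤ, ‖fc h k‖ ≤ |1 / (k : ℝ)| * ‖fc F k‖ := by
    intro k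
    rw [hhk, norm_mul, Complex.norm_real, Real.norm_eq_abs, abs_div, abs_div, abs_abs]
  have sh : SqSum h := SqSum.of_multiplier hF hb
  obtain ⟨κ, hκ, hhκ⟩ := exists_continuous_ae_eq hh sh.summable
  -- The equation itself provides a continuous representative: solved for `f`, it only involves `ρ`,
  -- `ψ` and the already continuous `κ`.
  set f : Torus → ℝ := fun x => ρ x * (-1 * (ψ x + c + β * κ x)) with hf
  have hfc : Continuous f := by fun_prop
  have hFf : F =ᵐ[unif] f := by
    filter_upwards [hFe, hhκ] with x h1 h2
    rw [h2] at h1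
    have := hρne x
    field_simp at h1
    simp only [hf]
    linarith
  have hf0 : ∫ x, f x ∂unif = 0 := by rw [← integral_congr_ae hFf, hF0]
  have hκk : ∀ k : ℤ, fc κ k = ((1 / |(k : ℝ)| : ℝ) : ℂ) * fc f k := by
    intro k; rw [← fc_congr hhκ, ← fc_congr hFf, hhk]
  have hbκ : ∀ k : ℤ, ‖fc κ k‖ ≤ |1 / (k : ℝ)| * ‖fc f k‖ := by
    intro k; rw [← fc_congr hhκ, ← fc_congr hFf]; exact hb k
  have lκ : L2Lip κ := (SqSum.of_multiplier (memLp_of_continuous hfc 2) hbκ).l2Lip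
    (memLp_of_continuous hκ 2)
  have lconst : ∀ c : ℝ, L2Lip fun _ => c := fun c => ⟨0, fun h => by simp⟩
  have lf : L2Lip f := by
    refine L2Lip.mul hρ (by fun_prop) (E.ρ_deriv.l2Lip hρ₁) (L2Lip.mul continuous_const (by fun_prop)
      (lconst _) (L2Lip.add (by fun_prop) (by fun_prop) ?_ ?_))
    · exact L2Lip.add hψc continuous_const (hψ.l2Lip hψ₁) (lconst c)
    · exact L2Lip.mul continuous_const hκ (lconst β) lκ
  have sf : SqSum f := lf.sqSum (memLp_of_continuous hfc 2)
  obtain ⟨κ₁, hκ₁, hκκ₁, -⟩ := exists_hasTDeriv hκ (summable_of_multiplier sf.summable hbκ)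
  obtain ⟨f₁, hff₁, hf₁⟩ : ∃ f₁, HasTDeriv f f₁ ∧ Continuous f₁ :=
    ⟨_, E.ρ_deriv.mul (((hψ.add_const c).add (hκκ₁.const_mul β)).const_mul (-1)), by fun_prop⟩
  obtain ⟨v₀, hv₀⟩ := exists_primitive hfc sf.summable hf0
  have hv₀c := hv₀.continuous
  have hinvc : Continuous fun x => (ρ x)⁻¹ := hρ.inv₀ hρne
  have hinvpos : 0 < ∫ x, (ρ x)⁻¹ ∂unif := by
    rw [integral_pos_iff_support_of_nonneg (fun x => (inv_pos.2 (hρ0 x)).le)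
      (integrable_of_continuous hinvc _)]
    have : Function.support (fun x => (ρ x)⁻¹) = Set.univ := by
      ext x; simp [hρne x]
    rw [this]; simp
  -- The primitive `v = ρ u` is determined up to a constant; `d` is the one for which `u = v / ρ`
  -- has mean zero, hence a periodic primitive `φ`.
  set d : ℝ := -(∫ x, v₀ x * (ρ x)⁻¹ ∂unif) / ∫ x, (ρ x)⁻¹ ∂unif with hd
  set v : Torus → ℝ := fun x => v₀ x + d with hv
  have hvf : HasTDeriv v f := hv₀.add_const d
  have hvc := hvf.continuous
  set u : Torus → ℝ := fun x => v x * (ρ x)⁻¹ with hu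
  have huc : Continuous u := hvc.mul hinvc
  have hu0 : ∫ x, u x ∂unif = 0 := by
    have e : ∀ x, u x = v₀ x * (ρ x)⁻¹ + d * (ρ x)⁻¹ := fun x => by simp only [hu, hv]; ring
    simp only [e]
    rw [integral_add (integrable_of_continuous (by fun_prop) _)
      (integrable_of_continuous (by fun_prop) _), integral_const_mul, hd,
      div_mul_cancel₀ _ hinvpos.ne']
    ring
  have dinv := E.ρ_deriv.inv hρne
  set q : Torus → ℝ := fun x => -ρ₁ x / ρ x ^ 2 with hq
  obtain ⟨q₁, hqq₁, hq₁⟩ : ∃ q₁, HasTDeriv q q₁ ∧ Continuous q₁ := by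
    have h1 : HasTDeriv (fun x => -1 * (ρ₁ x * ((ρ x)⁻¹ * (ρ x)⁻¹))) _ :=
      (E.ρ₁_deriv.mul (dinv.mul dinv)).const_mul (-1)
    have e : q = fun x => -1 * (ρ₁ x * ((ρ x)⁻¹ * (ρ x)⁻¹)) := by
      funext x; simp only [hq]; have := hρne x; field_simp
    rw [e]
    have hρ₂ := E.ρ₂_cont
    refine ⟨_, h1, ?_⟩
    have : Continuous fun x => -ρ₁ x / ρ x ^ 2 :=
      hρ₁.neg.div (hρ.pow 2) fun x => pow_ne_zero 2 (hρne x)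
    fun_prop
  have hqc := hqq₁.continuous
  have huu₁ : HasTDeriv u (fun x => f x * (ρ x)⁻¹ + v x * q x) := hvf.mul dinv
  set u₁ : Torus → ℝ := fun x => f x * (ρ x)⁻¹ + v x * q x with hu₁
  have hu₁u₂ := (hff₁.mul dinv).add (hvf.mul hqq₁)
  have su : SqSum u := huu₁.sqSum (by fun_prop)
  obtain ⟨φ₀, hφ₀⟩ := exists_primitive huc su.summable hu0
  have hvu : (fun x => ρ x * u x) = v := by
    funext x; simp only [hu]; have := hρne x; field_simp
  have sv : SqSum v := hvf.sqSum hfc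
  have hκv : ∀ x, hil v x = κ x := by
    have := eq_of_fc_eq (continuous_hil hvc (sv.hol hvc)) hκ
      (hil_eq_of_fc hvc (sv.hol hvc) (fc_deriv hvf hfc) hκk)
    intro x; rw [this]
  have hfeq : ∀ x, f x / ρ x + β * κ x = -(ψ x + c) := by
    intro x; simp only [hf]; have := hρne x; field_simp; ring
  refine ⟨fun x => φ₀ x + -(∫ x, φ₀ x * ρ x ∂unif), u, u₁, _, f, κ, c,
    ⟨hφ₀.add_const _, huu₁, hu₁u₂, ?_, ?_, ?_, hfc, hκ, hκk, hfeq, ?_, ?_⟩⟩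
  · have : Continuous fun x => -ρ₁ x / ρ x ^ 2 := hqc
    fun_prop
  · have hφ₀c := hφ₀.continuous
    have e : ∀ x, (φ₀ x + -(∫ x, φ₀ x * ρ x ∂unif)) * ρ x
      = φ₀ x * ρ x + -(∫ x, φ₀ x * ρ x ∂unif) * ρ x := fun x => by ring
    simp only [e]
    rw [integral_add (integrable_of_continuous (by fun_prop) _)
      (integrable_of_continuous (by fun_prop) _), integral_const_mul, E.ρ_int]
    ring
  · rw [hvu]; exact hvf
  · rw [hvu]; exact hκv
  · intro x
    rw [hvu, hκv, ← hfeq x]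
    simp only [hu₁, hu, hq]
    have := hρne x
    field_simp
    ring

/-- An integration by parts turns the variance into `-∫ ψ f`, and the equation for `f` into `∫ f² /
ρ + β ∫ κ f`, a sum of two nonnegative terms; the constant drops out because `f` has mean zero.
Vanishing forces `f = 0`, so `ψ` is constant, and zero because it is centred. -/
theorem LinSol.variance {β : ℝ} (hβ : 0 < β) {V V₁ ρ ρ₁ ρ₂ w w₁ : Torus → ℝ}
    (E : EqDensity β V V₁ ρ ρ₁ ρ₂ w w₁) {ψ ψ₁ φ u u₁ u₂ f κ : Torus → ℝ} {c : ℝ}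
    (L : LinSol β ρ ρ₁ ψ φ u u₁ u₂ f κ c) (hψ : HasTDeriv ψ ψ₁) (hψ₁ : Continuous ψ₁)
    (hψ0 : ∫ x, ψ x * ρ x ∂unif = 0) :
    0 ≤ ∫ x, ψ₁ x * u x * ρ x ∂unif ∧ (∫ x, ψ₁ x * u x * ρ x ∂unif = 0 → ∀ x, ψ x = 0) := by
  have hρ := E.ρ_cont
  have hρ0 := E.ρ_pos
  have hf := L.f_cont
  have hκ := L.κ_cont
  have hψc := hψ.continuous
  have huc := L.u_deriv.continuous
  have hinvc : Continuous fun x => (ρ x)⁻¹ := hρ.inv₀ fun x => (hρ0 x).ne'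
  have e1 : ∫ x, ψ₁ x * u x * ρ x ∂unif = -∫ x, ψ x * f x ∂unif := by
    rw [← hψ.integral_mul_eq L.v_deriv hψ₁ hf]
    refine integral_congr_ae (ae_of_all _ fun x => ?_)
    simp only; ring
  have hf0 : ∫ x, f x ∂unif = 0 := L.v_deriv.integral_eq_zero hf
  have e2 : -∫ x, ψ x * f x ∂unif = ∫ x, f x ^ 2 * (ρ x)⁻¹ ∂unif + β * ∫ x, κ x * f x ∂unif := by
    have e : ∀ x, -(ψ x * f x) = (f x ^ 2 * (ρ x)⁻¹ + β * (κ x * f x)) + c * f x := by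
      intro x
      have := L.f_eq x
      have h1 : -ψ x = f x * (ρ x)⁻¹ + β * κ x + c := by rw [← div_eq_mul_inv]; linarith
      linear_combination f x * h1
    rw [← integral_neg]
    simp only [e]
    rw [integral_add, integral_add, integral_const_mul, integral_const_mul, hf0]
    · ring
    all_goals exact integrable_of_continuous (by fun_prop) _
  have hk : 0 ≤ ∫ x, κ x * f x ∂unif :=
    integral_mul_nonneg_of_fc (memLp_of_continuous hf 2) (memLp_of_continuous hκ 2) L.fc_κ
  have hnn : ∀ x, 0 ≤ f x ^ 2 * (ρ x)⁻¹ := fun x =>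
    mul_nonneg (sq_nonneg _) (inv_nonneg.2 (hρ0 x).le)
  have hq : 0 ≤ ∫ x, f x ^ 2 * (ρ x)⁻¹ ∂unif := integral_nonneg hnn
  rw [e1, e2]
  refine ⟨by positivity, fun h0 => ?_⟩
  have h1 : ∫ x, f x ^ 2 * (ρ x)⁻¹ ∂unif = 0 := by nlinarith
  have hfz : f = fun _ => 0 := by
    have h2 := (integral_eq_zero_iff_of_nonneg hnn (integrable_of_continuous (by fun_prop) _)).1 h1
    refine (Continuous.ae_eq_iff_eq unif hf continuous_const).1 ?_
    filter_upwards [h2] with x hx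
    have : f x ^ 2 * (ρ x)⁻¹ = 0 := hx
    simpa [(hρ0 x).ne'] using this
  have hκz : κ = fun _ => 0 := by
    refine eq_of_fc_eq hκ continuous_const (funext fun k => ?_)
    rw [L.fc_κ, hfz, fc_const]
    simp
  have hψk : ∀ x, ψ x = -c := by
    intro x
    have := L.f_eq x
    rw [hfz, hκz] at this
    simp at this
    linarith
  have hc : c = 0 := by
    simp only [hψk] at hψ0
    rw [integral_const_mul, E.ρ_int] at hψ0
    linarith
  intro x; rw [hψk, hc, neg_zero]

/-! ### Weak derivatives -/

theorem HasTDeriv.torusDeriv_eq {f g : Torus → ℝ} (h : HasTDeriv f g) (x : Torus) :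
    torusDeriv f x = g x := by
  have := (h.shift x 0).deriv
  rw [torusDeriv, this]; simp

theorem isWeakDeriv_congr {f f' : Torus → ℝ} (h : f =ᵐ[unif] f') : IsWeakDeriv f = IsWeakDeriv f' := by
  funext g
  have : ∀ θ : Torus → ℝ, ∫ x, f x * torusDeriv θ x ∂unif = ∫ x, f' x * torusDeriv θ x ∂unif := by
    intro θ
    refine integral_congr_ae ?_
    filter_upwards [h] with x hx
    rw [hx]
  simp only [IsWeakDeriv, this]

theorem weakDeriv_congr {f f' : Torus → ℝ} (h : f =ᵐ[unif] f') : weakDeriv f = weakDeriv f' := by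
  unfold weakDeriv
  rw [isWeakDeriv_congr h]

theorem memH1_congr {f f' : Torus → ℝ} (h : f =ᵐ[unif] f') : MemH1 f ↔ MemH1 f' := by
  rw [MemH1, MemH1, isWeakDeriv_congr h, memLp_congr_ae h]

theorem contDiff_ex (k : ℤ) : ContDiff ℝ (⊤ : ℕ∞) fun t : ℝ => ex k (t : Torus) := by
  simp only [ex_coe]
  have : ContDiff ℝ (⊤ : ℕ∞) fun t : ℝ => ((k * t : ℝ) : ℂ) :=
    Complex.ofRealCLM.contDiff.comp (contDiff_const.mul contDiff_id)
  exact (contDiff_const.mul this).cexp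

theorem hasTDeriv_re_ex (k : ℤ) :
    HasTDeriv (fun x => (ex k x).re) (fun x => -k * (ex k x).im) := by
  intro x
  have := (Complex.reCLM.hasFDerivAt.comp_hasDerivAt x (hasTDeriv_ex k x))
  simpa [Function.comp_def] using this

theorem hasTDeriv_im_ex (k : ℤ) :
    HasTDeriv (fun x => (ex k x).im) (fun x => k * (ex k x).re) := by
  intro x
  have := (Complex.imCLM.hasFDerivAt.comp_hasDerivAt x (hasTDeriv_ex k x))
  simpa [Function.comp_def] using this

theorem contDiff_lift_re_ex (k : ℤ) : ContDiff ℝ (⊤ : ℕ∞) (lift fun x => (ex k x).re) :=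
  Complex.reCLM.contDiff.comp (contDiff_ex k)

theorem contDiff_lift_im_ex (k : ℤ) : ContDiff ℝ (⊤ : ℕ∞) (lift fun x => (ex k x).im) :=
  Complex.imCLM.contDiff.comp (contDiff_ex k)

/-- Weak derivatives are tested against real functions only; the cosine and the sine together
recover the complex Fourier coefficient. -/
theorem fc_of_tested {f g : Torus → ℝ} (hf : Integrable f unif) (hg : Integrable g unif) (k : ℤ)
    (h1 : ∫ x, f x * (-((-k : ℤ) : ℝ) * (ex (-k) x).im) ∂unif = -∫ x, g x * (ex (-k) x).re ∂unif)
    (h2 : ∫ x, f x * (((-k : ℤ) : ℝ) * (ex (-k) x).re) ∂unif = -∫ x, g x * (ex (-k) x).im ∂unif) :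
    fc g k = Complex.I * k * fc f k := by
  have e1 : ∫ x, f x * (-((-k : ℤ) : ℝ) * (ex (-k) x).im) ∂unif
      = k * ∫ x, f x * (ex (-k) x).im ∂unif := by
    rw [← integral_const_mul]
    refine integral_congr_ae (ae_of_all _ fun x => ?_)
    push_cast; ring
  have e2 : ∫ x, f x * (((-k : ℤ) : ℝ) * (ex (-k) x).re) ∂unif
      = -(k * ∫ x, f x * (ex (-k) x).re ∂unif) := by
    rw [← integral_const_mul, ← integral_neg]
    refine integral_congr_ae (ae_of_all _ fun x => ?_)
    push_cast; ring
  rw [e1] at h1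
  rw [e2] at h2
  rw [fc_eq_re_im hf, fc_eq_re_im hg]
  have h1' : ((∫ x, g x * (ex (-k) x).re ∂unif : ℝ) : ℂ)
      = -(k * ((∫ x, f x * (ex (-k) x).im ∂unif : ℝ) : ℂ)) := by
    have : ∫ x, g x * (ex (-k) x).re ∂unif = -(k * ∫ x, f x * (ex (-k) x).im ∂unif) := by linarith
    rw [this]; push_cast; ring
  have h2' : ((∫ x, g x * (ex (-k) x).im ∂unif : ℝ) : ℂ)
      = k * ((∫ x, f x * (ex (-k) x).re ∂unif : ℝ) : ℂ) := by
    have : ∫ x, g x * (ex (-k) x).im ∂unif = k * ∫ x, f x * (ex (-k) x).re ∂unif := by linarith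
    rw [this]; push_cast; ring
  rw [h1', h2']
  linear_combination (-(k : ℂ) * ((∫ x, f x * (ex (-k) x).im ∂unif : ℝ) : ℂ)) * Complex.I_sq

theorem IsWeakDeriv.fc_eq {f g : Torus → ℝ} (hf : MemLp f 2 unif) (h : IsWeakDeriv f g) (k : ℤ) :
    fc g k = Complex.I * k * fc f k := by
  have h1 := h.2 _ (contDiff_lift_re_ex (-k))
  have h2 := h.2 _ (contDiff_lift_im_ex (-k))
  simp only [(hasTDeriv_re_ex (-k)).torusDeriv_eq] at h1
  simp only [(hasTDeriv_im_ex (-k)).torusDeriv_eq] at h2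
  exact fc_of_tested (hf.integrable one_le_two) (h.1.integrable one_le_two) k h1 h2

theorem HasTDeriv.isWeakDeriv {f g : Torus → ℝ} (h : HasTDeriv f g) (hg : Continuous g) :
    IsWeakDeriv f g := by
  refine ⟨memLp_of_continuous hg 2, fun θ hθ => ?_⟩
  obtain ⟨θ', hθ', hc⟩ := IsCk.exists_deriv (n := 0) (f := θ) (hθ.of_le (by exact_mod_cast le_top))
  simp only [hθ'.torusDeriv_eq]
  have := h.integral_mul_eq hθ' hg hc.continuous
  linarith

theorem weakDeriv_spec {f : Torus → ℝ} (h : ∃ g, IsWeakDeriv f g) : IsWeakDeriv f (weakDeriv f) := by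
  rw [weakDeriv, dif_pos h]
  exact h.choose_spec

theorem weakDeriv_ae_eq {f g : Torus → ℝ} (hf : MemLp f 2 unif) (h : IsWeakDeriv f g) :
    weakDeriv f =ᵐ[unif] g := by
  have h1 := weakDeriv_spec ⟨g, h⟩
  refine ae_eq_of_fc_eq h1.1 h.1 (funext fun k => ?_)
  rw [h1.fc_eq hf, h.fc_eq hf]

theorem HasTDeriv.memH1 {f g : Torus → ℝ} (h : HasTDeriv f g) (hg : Continuous g) : MemH1 f :=
  ⟨memLp_of_continuous h.continuous 2, g, h.isWeakDeriv hg⟩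

theorem HasTDeriv.weakDeriv_ae_eq {f g : Torus → ℝ} (h : HasTDeriv f g) (hg : Continuous g) :
    weakDeriv f =ᵐ[unif] g :=
  HighTempCircular.weakDeriv_ae_eq (memLp_of_continuous h.continuous 2) (h.isWeakDeriv hg)

theorem integral_mul_of_fc_deriv {f g θ θ' : Torus → ℝ} (hf : MemLp f 2 unif)
    (hg : MemLp g 2 unif) (h : ∀ k : ℤ, fc g k = Complex.I * k * fc f k) (hθ : HasTDeriv θ θ')
    (hθ' : Continuous θ') : ∫ x, f x * θ' x ∂unif = -∫ x, g x * θ x ∂unif := by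
  have h1 := parseval hf (memLp_of_continuous hθ' 2)
  have h2 := (parseval hg (memLp_of_continuous hθ.continuous 2)).neg
  have := h1.unique (h2.congr_fun fun k => ?_)
  · exact_mod_cast this
  · simp only [fc_deriv hθ hθ', h, map_mul, Complex.conj_I, map_intCast]
    ring

/-- The product rule for a weakly differentiable and a `C¹` function. -/
theorem fc_mul_deriv {f g a a' : Torus → ℝ} (hf : MemLp f 2 unif) (hg : MemLp g 2 unif)
    (h : ∀ k : ℤ, fc g k = Complex.I * k * fc f k) (ha : HasTDeriv a a') (ha' : Continuous a')
    (k : ℤ) :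
    fc (fun x => a x * g x + a' x * f x) k = Complex.I * k * fc (fun x => a x * f x) k := by
  have hac := ha.continuous
  have hfi := hf.integrable one_le_two
  have hgi := hg.integrable one_le_two
  have hmul : ∀ {b F : Torus → ℝ}, Continuous b → Integrable F unif →
      Integrable (fun x => b x * F x) unif := by
    intro b F hb hF
    obtain ⟨M, -, hM⟩ := exists_abs_le hb
    exact hF.bdd_mul (c := M) hb.aestronglyMeasurable (ae_of_all _ hM)
  have key : ∀ θ θ' : Torus → ℝ, HasTDeriv θ θ' → Continuous θ' →
      ∫ x, a x * f x * θ' x ∂unif = -∫ x, (a x * g x + a' x * f x) * θ x ∂unif := by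
    intro θ θ' hθ hθ'
    have hθc := hθ.continuous
    have h1 := integral_mul_of_fc_deriv hf hg h (ha.mul hθ) (by fun_prop)
    have e1 : ∫ x, f x * (a' x * θ x + a x * θ' x) ∂unif
        = ∫ x, a' x * θ x * f x ∂unif + ∫ x, a x * f x * θ' x ∂unif := by
      rw [← integral_add (hmul (by fun_prop) hfi)]
      · exact integral_congr_ae (ae_of_all _ fun x => by simp only; ring)
      · refine (hmul (b := fun x => a x * θ' x) (by fun_prop) hfi).congr (ae_of_all _ fun x => ?_)
        simp only; ring
    have e2 : ∫ x, (a x * g x + a' x * f x) * θ x ∂unif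
        = ∫ x, g x * (a x * θ x) ∂unif + ∫ x, a' x * θ x * f x ∂unif := by
      rw [← integral_add _ (hmul (by fun_prop) hfi)]
      · exact integral_congr_ae (ae_of_all _ fun x => by simp only; ring)
      · refine (hmul (b := fun x => a x * θ x) (by fun_prop) hgi).congr (ae_of_all _ fun x => ?_)
        simp only; ring
    rw [e1] at h1
    rw [e2]; linarith
  have c1 := continuous_re_ex (-k)
  have c2 := continuous_im_ex (-k)
  exact fc_of_tested (hmul hac hfi) ((hmul hac hgi).add (hmul ha' hfi)) k
    (key _ _ (hasTDeriv_re_ex (-k)) (by fun_prop)) (key _ _ (hasTDeriv_im_ex (-k)) (by fun_prop))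

/-! ### The inverse of the operator -/

theorem integral_eqMeasure {ρ : Torus → ℝ} (hρ : Continuous ρ) (h0 : ∀ x, 0 ≤ ρ x)
    (g : Torus → ℝ) :
    ∫ x, g x ∂(unif.withDensity fun x => ENNReal.ofReal (ρ x)) = ∫ x, g x * ρ x ∂unif := by
  rw [integral_withDensity_eq_integral_toReal_smul₀ hρ.measurable.ennreal_ofReal.aemeasurable
    (ae_of_all _ fun x => ENNReal.ofReal_lt_top)]
  refine integral_congr_ae (ae_of_all _ fun x => ?_)
  simp [ENNReal.toReal_ofReal (h0 x), mul_comm]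

theorem density_ae_eq {ρ : Torus → ℝ} (hρ : Continuous ρ) (h0 : ∀ x, 0 ≤ ρ x)
    {μ : ProbabilityMeasure Torus}
    (hμ : (μ : Measure Torus) = unif.withDensity fun x => ENNReal.ofReal (ρ x)) :
    density μ =ᵐ[unif] fun x => ρ x / (2 * Real.pi) := by
  have := Measure.rnDeriv_withDensity unif (f := fun x => ENNReal.ofReal (ρ x))
    hρ.measurable.ennreal_ofReal
  filter_upwards [this] with x hx
  rw [density, hμ, hx, ENNReal.toReal_ofReal (h0 x)]

theorem hil_const_mul (c : ℝ) (v : Torus → ℝ) (x : Torus) :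
    hil (fun t => c * v t) x = c * hil v x := by
  rw [hil, hil, mul_neg, ← integral_const_mul]
  congr 1
  refine integral_congr_ae (ae_of_all _ fun t => ?_)
  simp only; ring

theorem Hol.const_mul {v : Torus → ℝ} (h : Hol v) (c : ℝ) : Hol fun x => c * v x := by
  obtain ⟨C, hC⟩ := h
  refine ⟨|c| * C, fun x z => ?_⟩
  rw [← mul_sub, abs_mul, mul_assoc]
  exact mul_le_mul_of_nonneg_left (hC x z) (abs_nonneg c)

section Inverse

variable {β : ℝ} {V V₁ ρ ρ₁ ρ₂ w w₁ : Torus → ℝ} {μ : ProbabilityMeasure Torus}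

theorem EqDensity.logDensity_ae_eq (E : EqDensity β V V₁ ρ ρ₁ ρ₂ w w₁)
    (hμ : (μ : Measure Torus) = unif.withDensity fun x => ENNReal.ofReal (ρ x)) :
    (fun t => Real.log (density μ t)) =ᵐ[unif] fun x => Real.log (ρ x / (2 * Real.pi)) := by
  filter_upwards [density_ae_eq E.ρ_cont (fun x => (E.ρ_pos x).le) hμ] with x hx
  rw [hx]

theorem EqDensity.hasTDeriv_log (E : EqDensity β V V₁ ρ ρ₁ ρ₂ w w₁) :
    HasTDeriv (fun x => Real.log (ρ x / (2 * Real.pi))) (fun x => ρ₁ x / ρ x) := by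
  intro x
  have hp := E.ρ_pos x
  have hpi := Real.pi_pos
  have := ((E.ρ_deriv x).div_const (2 * Real.pi)).log (by positivity)
  refine this.congr_deriv ?_
  field_simp

theorem EqDensity.continuous_logDeriv (E : EqDensity β V V₁ ρ ρ₁ ρ₂ w w₁) :
    Continuous fun x => ρ₁ x / ρ x := E.ρ₁_cont.div E.ρ_cont fun x => (E.ρ_pos x).ne'

/-- The operator in terms of continuous representatives. -/
theorem EqDensity.opL_ae_eq (E : EqDensity β V V₁ ρ ρ₁ ρ₂ w w₁)
    (hμ : (μ : Measure Torus) = unif.withDensity fun x => ENNReal.ofReal (ρ x))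
    {φ U U₁ : Torus → ℝ} (hU : weakDeriv φ =ᵐ[unif] U) (hUc : Continuous U)
    (hh : Hol fun x => ρ x * U x) (hU₁ : weakDeriv (weakDeriv φ) =ᵐ[unif] U₁) :
    HasHilbert (fun t => density μ t * weakDeriv φ t) ∧
    opL β μ φ =ᵐ[unif] fun x =>
      -(U₁ x + β * hil (fun x => ρ x * U x) x + ρ₁ x / ρ x * U x) := by
  have hρ := E.ρ_cont
  have hd := density_ae_eq E.ρ_cont (fun x => (E.ρ_pos x).le) hμ
  have hv : (fun t => density μ t * weakDeriv φ t) =ᵐ[unif]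
      fun x => (2 * Real.pi)⁻¹ * (ρ x * U x) := by
    filter_upwards [hd, hU] with x h1 h2
    rw [h1, h2]; ring
  have hc : Continuous fun x => (2 * Real.pi)⁻¹ * (ρ x * U x) := by fun_prop
  refine ⟨hasHilbert_of_ae_eq hv hc (hh.const_mul _), ?_⟩
  have hlog : weakDeriv (fun t => Real.log (density μ t)) =ᵐ[unif] fun x => ρ₁ x / ρ x := by
    rw [weakDeriv_congr (E.logDensity_ae_eq hμ)]
    exact E.hasTDeriv_log.weakDeriv_ae_eq E.continuous_logDeriv
  filter_upwards [hU, hU₁, hlog] with x h1 h2 h3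
  rw [opL, h2, h3, h1, hilbert_eq_hil hv hc (hh.const_mul _), hil_const_mul]
  have := Real.pi_pos
  field_simp

theorem LinSol.isInverseL (E : EqDensity β V V₁ ρ ρ₁ ρ₂ w w₁)
    (hμ : (μ : Measure Torus) = unif.withDensity fun x => ENNReal.ofReal (ρ x))
    {ψ ψ₁ φ u u₁ u₂ f κ : Torus → ℝ} {c : ℝ}
    (L : LinSol β ρ ρ₁ ψ φ u u₁ u₂ f κ c) (hψ : HasTDeriv ψ ψ₁) (hψ₁ : Continuous ψ₁)
    (hψ0 : ∫ x, ψ x * ρ x ∂unif = 0) : IsInverseL β μ ψ φ := by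
  have hρ := E.ρ_cont
  have hρ0 : ∀ x, 0 ≤ ρ x := fun x => (E.ρ_pos x).le
  have huc := L.u_deriv.continuous
  have hu₁c := L.u₁_deriv.continuous
  have hψc := hψ.continuous
  have hU : weakDeriv φ =ᵐ[unif] u := L.φ_deriv.weakDeriv_ae_eq huc
  have hU₁ : weakDeriv (weakDeriv φ) =ᵐ[unif] u₁ := by
    rw [weakDeriv_congr hU]; exact L.u_deriv.weakDeriv_ae_eq hu₁c
  have hh : Hol fun x => ρ x * u x :=
    (L.v_deriv.sqSum L.f_cont).hol L.v_deriv.continuous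
  obtain ⟨hH, hop⟩ := E.opL_ae_eq hμ hU huc hh hU₁
  have hop' : opL β μ φ =ᵐ[unif] fun x => ψ x + c := by
    filter_upwards [hop] with x hx
    rw [hx, L.eq]; ring
  have hint : ∫ y, opL β μ φ y ∂(μ : Measure Torus) = c := by
    rw [hμ, integral_eqMeasure hρ hρ0]
    have : ∫ x, opL β μ φ x * ρ x ∂unif = ∫ x, ψ x * ρ x + c * ρ x ∂unif := by
      refine integral_congr_ae ?_
      filter_upwards [hop'] with x hx
      rw [hx]; ring
    rw [this, integral_add (integrable_of_continuous (by fun_prop) _)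
      (integrable_of_continuous (by fun_prop) _), hψ0, integral_const_mul, E.ρ_int]
    ring
  refine ⟨⟨⟨L.φ_deriv.memH1 huc, ?_⟩, ?_, ?_, hH, ?_⟩, ?_⟩
  · rw [hμ, integral_eqMeasure hρ hρ0, L.φ_int]
  · exact (memH1_congr hU).2 (L.u_deriv.memH1 hu₁c)
  · exact (memH1_congr (E.logDensity_ae_eq hμ)).2 (E.hasTDeriv_log.memH1 E.continuous_logDeriv)
  · exact (memH1_congr hop').2 ((hψ.add_const c).memH1 hψ₁)
  · filter_upwards [hop'] with x hx
    rw [hint, hx]; ring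

theorem sqSum_of_fc_deriv {f g : Torus → ℝ} (hg : MemLp g 2 unif)
    (h : ∀ k : ℤ, fc g k = Complex.I * k * fc f k) : SqSum f := by
  refine (parseval_sq hg).summable.congr fun k => ?_
  rw [h]; simp

/-- The same energy argument as for the variance: the difference of the two functions `(ρ φ')'` has
mean zero and satisfies the homogeneous equation up to a constant, so pairing it with itself kills
it. The remaining constants are fixed by periodicity of `φ` and by centring. A competitor is only
weakly differentiable, so everything is done almost everywhere. -/
theorem LinSol.unique (hβ : 0 < β) (E : EqDensity β V V₁ ρ ρ₁ ρ₂ w w₁)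
    (hμ : (μ : Measure Torus) = unif.withDensity fun x => ENNReal.ofReal (ρ x))
    {ψ φ u u₁ u₂ f κ : Torus → ℝ} {c : ℝ} (L : LinSol β ρ ρ₁ ψ φ u u₁ u₂ f κ c)
    {φ' : Torus → ℝ} (h : IsInverseL β μ ψ φ') : φ' =ᵐ[unif] φ := by
  have hρ := E.ρ_cont
  have hρ₁ := E.ρ₁_cont
  have hρ0 : ∀ x, 0 ≤ ρ x := fun x => (E.ρ_pos x).le
  have hρne : ∀ x, ρ x ≠ 0 := fun x => (E.ρ_pos x).ne'
  have huc := L.u_deriv.continuous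
  have hu₁c := L.u₁_deriv.continuous
  have hφc := L.φ_deriv.continuous
  obtain ⟨hD, heq⟩ := h
  obtain ⟨hφ'm, hφ'w⟩ := hD.memH.1
  have hW := weakDeriv_spec hφ'w
  have hW₁ := weakDeriv_spec hD.deriv_memH1.2
  set W := weakDeriv φ' with hWdef
  set W₁ := weakDeriv W with hW₁def
  have hfW : ∀ k : ℤ, fc W k = Complex.I * k * fc φ' k := hW.fc_eq hφ'm
  have hfW₁ : ∀ k : ℤ, fc W₁ k = Complex.I * k * fc W k := hW₁.fc_eq hW.1
  have sW : SqSum W := sqSum_of_fc_deriv hW₁.1 hfW₁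
  obtain ⟨U, hUc, hWU⟩ := exists_continuous_ae_eq hW.1 sW.summable
  have hUm := memLp_of_continuous hUc 2
  have hfU : fc U = fc W := (fc_congr hWU).symm
  have sU : SqSum U := by rw [SqSum, hfU]; exact sW
  have hvc : Continuous fun x => ρ x * U x := hρ.mul hUc
  have sv : SqSum fun x => ρ x * U x :=
    (L2Lip.mul hρ hUc (E.ρ_deriv.l2Lip hρ₁) (sU.l2Lip hUm)).sqSum (memLp_of_continuous hvc 2)
  have hh := sv.hol hvc
  obtain ⟨-, hop⟩ := E.opL_ae_eq hμ hWU hUc hh (EventuallyEq.refl _ _)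
  set c' := ∫ y, opL β μ φ' y ∂(μ : Measure Torus) with hc'
  set F : Torus → ℝ := fun x => ρ x * W₁ x + ρ₁ x * U x with hF
  have hFm : MemLp F 2 unif := by
    obtain ⟨M, -, hM⟩ := exists_abs_le hρ
    refine MemLp.add (f := fun x => ρ x * W₁ x) (g := fun x => ρ₁ x * U x)
      (hW₁.1.of_le_mul (c := M) (hρ.aestronglyMeasurable.mul hW₁.1.aestronglyMeasurable)
      (ae_of_all _ fun x => ?_)) (memLp_of_continuous (by fun_prop) 2)
    rw [norm_mul]
    exact mul_le_mul_of_nonneg_right (hM x) (norm_nonneg _)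
  have hfF : ∀ k : ℤ, fc F k = Complex.I * k * fc (fun x => ρ x * U x) k :=
    fc_mul_deriv hUm hW₁.1 (fun k => by rw [hfW₁, hfU]) E.ρ_deriv hρ₁
  have hfv := fc_deriv L.v_deriv L.f_cont
  have hFeq : ∀ᵐ x ∂unif, F x / ρ x + β * hil (fun x => ρ x * U x) x = -(ψ x + c') := by
    filter_upwards [hop, heq] with x h1 h2
    rw [h1] at h2
    simp only [hF]
    have := hρne x
    have h3 : (ρ x * W₁ x + ρ₁ x * U x) / ρ x = W₁ x + ρ₁ x / ρ x * U x := by field_simp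
    rw [h3]; linarith
  have hhilc := continuous_hil hvc hh
  have hhilm := memLp_of_continuous hhilc 2
  have hκm := memLp_of_continuous L.κ_cont 2
  have hfm := memLp_of_continuous L.f_cont 2
  -- An auxiliary function with the coefficients of `K F`, introduced only to identify them with
  -- those of the Hilbert transform of `ρ U`.
  obtain ⟨κ', hκ'm, hκ'⟩ := exists_memLp_fc (a := fun k : ℤ => ((1 / |(k : ℝ)| : ℝ) : ℂ) * fc F k) (by
      refine Summable.of_nonneg_of_le (fun k => sq_nonneg _) (fun k => ?_) (parseval_sq hFm).summable
      rw [norm_mul, Complex.norm_real, Real.norm_of_nonneg (by positivity)]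
      have : 1 / |(k : ℝ)| ≤ 1 := by
        by_cases hk : k = 0
        · simp [hk]
        · have hk' : (1 : ℝ) ≤ |(k : ℝ)| := by
            have : (1 : ℤ) ≤ |k| := Int.one_le_abs hk
            exact_mod_cast this
          exact div_le_one_of_le₀ hk' (abs_nonneg _)
      gcongr
      exact mul_le_of_le_one_left (norm_nonneg _) this) (fun k => by
        rw [fc_neg_index]; simp)
  have hfhil := hil_eq_of_fc hvc hh hfF hκ'
  have hDm : MemLp (fun x => F x - f x) 2 unif := hFm.sub hfm
  have hEm : MemLp (fun x => hil (fun x => ρ x * U x) x - κ x) 2 unif := hhilm.sub hκm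
  have hFf0 : ∫ x, (F x - f x) ∂unif = 0 := by
    have h1 := hfF 0
    have h2 := hfv 0
    rw [fc_zero] at h1 h2
    rw [integral_sub (hFm.integrable one_le_two) (hfm.integrable one_le_two)]
    have h1' : ∫ x, F x ∂unif = 0 := by
      have : ((∫ x, F x ∂unif : ℝ) : ℂ) = 0 := by rw [h1]; simp
      exact_mod_cast this
    have h2' : ∫ x, f x ∂unif = 0 := by
      have : ((∫ x, f x ∂unif : ℝ) : ℂ) = 0 := by rw [h2]; simp
      exact_mod_cast this
    rw [h1', h2', sub_zero]
  have hpos := integral_mul_nonneg_of_fc hDm hEm (fun k => by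
    rw [fc_sub (hhilm.integrable one_le_two) (hκm.integrable one_le_two),
      fc_sub (hFm.integrable one_le_two) (hfm.integrable one_le_two), hfhil, hκ', L.fc_κ]
    ring)
  have hsq : ∀ᵐ x ∂unif, (F x - f x) ^ 2 / ρ x =
      (c - c') * (F x - f x) - β * ((hil (fun x => ρ x * U x) x - κ x) * (F x - f x)) := by
    filter_upwards [hFeq] with x hx
    have h1 := L.f_eq x
    have h2 : (F x - f x) / ρ x
        = (c - c') - β * (hil (fun x => ρ x * U x) x - κ x) := by
      rw [sub_div]; linarith
    calc (F x - f x) ^ 2 / ρ x = (F x - f x) / ρ x * (F x - f x) := by ring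
      _ = _ := by rw [h2]; ring
  have hEDi : Integrable (fun x => (hil (fun x => ρ x * U x) x - κ x) * (F x - f x)) unif :=
    hEm.integrable_mul hDm
  have hI : ∫ x, (F x - f x) ^ 2 / ρ x ∂unif ≤ 0 := by
    rw [integral_congr_ae hsq, integral_sub ((hDm.integrable one_le_two).const_mul _)
      (hEDi.const_mul _), integral_const_mul, hFf0, integral_const_mul]
    have := mul_nonneg hβ.le hpos
    linarith
  have hFfae : F =ᵐ[unif] f := by
    have hint : Integrable (fun x => (F x - f x) ^ 2 / ρ x) unif := by
      refine Integrable.congr ?_ (EventuallyEq.symm hsq)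
      exact ((hDm.integrable one_le_two).const_mul _).sub (hEDi.const_mul _)
    have hnn : ∀ x, 0 ≤ (F x - f x) ^ 2 / ρ x := fun x => div_nonneg (sq_nonneg _) (hρ0 x)
    have := (integral_eq_zero_iff_of_nonneg hnn hint).1 (le_antisymm hI (integral_nonneg hnn))
    filter_upwards [this] with x hx
    have hx' : (F x - f x) ^ 2 / ρ x = 0 := hx
    have : F x - f x = 0 := by simpa [hρne x] using hx'
    linarith
  have hIk : ∀ k : ℤ, k ≠ 0 → Complex.I * (k : ℂ) ≠ 0 := fun k hk =>
    mul_ne_zero Complex.I_ne_zero (by exact_mod_cast hk)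
  -- the two functions `ρ U` and `ρ u` differ by a constant
  have hconst : ∀ {p q : Torus → ℝ}, MemLp p 2 unif → MemLp q 2 unif →
      (∀ k : ℤ, k ≠ 0 → fc p k = fc q k) → ∃ d : ℝ, p =ᵐ[unif] fun x => q x + d := by
    intro p q hp hq hpq
    refine ⟨∫ x, p x ∂unif - ∫ x, q x ∂unif, ae_eq_of_fc_eq hp
      (hq.add (memLp_of_continuous continuous_const 2)) (funext fun k => ?_)⟩
    rw [fc_add (hq.integrable one_le_two) (integrable_const _), fc_const]
    by_cases hk : k = 0
    · rw [if_pos hk, hk, fc_zero, fc_zero]; push_cast; ring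
    · rw [if_neg hk, hpq k hk, add_zero]
  obtain ⟨d, hd⟩ := hconst (memLp_of_continuous hvc 2) (memLp_of_continuous L.v_deriv.continuous 2)
    (fun k hk => by
      refine mul_left_cancel₀ (hIk k hk) ?_
      rw [← hfF, ← hfv, fc_congr hFfae])
  have hinvc : Continuous fun x => (ρ x)⁻¹ := hρ.inv₀ hρne
  have hUu : U =ᵐ[unif] fun x => u x + d * (ρ x)⁻¹ := by
    filter_upwards [hd] with x hx
    have := hρne x
    field_simp
    linarith
  have hinvpos : 0 < ∫ x, (ρ x)⁻¹ ∂unif := by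
    rw [integral_pos_iff_support_of_nonneg (fun x => (inv_pos.2 (E.ρ_pos x)).le)
      (integrable_of_continuous hinvc _)]
    have : Function.support (fun x => (ρ x)⁻¹) = Set.univ := by
      ext x; simp [hρne x]
    rw [this]; simp
  -- Both `U` and `u` are derivatives of periodic functions and have mean zero, while `1 / ρ` has a
  -- positive integral.
  have hd0 : d = 0 := by
    have h1 : ∫ x, U x ∂unif = 0 := by
      have h2 := hfW 0
      rw [← hfU, fc_zero] at h2
      have : ((∫ x, U x ∂unif : ℝ) : ℂ) = 0 := by rw [h2]; simp
      exact_mod_cast this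
    have h3 : ∫ x, u x ∂unif = 0 := L.φ_deriv.integral_eq_zero huc
    rw [integral_congr_ae hUu, integral_add (integrable_of_continuous huc _)
      ((integrable_of_continuous hinvc _).const_mul _), h3, integral_const_mul, zero_add] at h1
    exact (mul_eq_zero.1 h1).resolve_right hinvpos.ne'
  have hφm := memLp_of_continuous hφc 2
  obtain ⟨d', hd'⟩ := hconst hφ'm hφm (fun k hk => by
    refine mul_left_cancel₀ (hIk k hk) ?_
    rw [← hfW, ← fc_deriv L.φ_deriv huc, ← hfU]
    have : U =ᵐ[unif] u := by
      filter_upwards [hUu] with x hx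
      rw [hx, hd0]; ring
    rw [fc_congr this])
  have hd'0 : d' = 0 := by
    have h1 := hD.memH.2
    rw [hμ, integral_eqMeasure hρ hρ0] at h1
    have h2 : ∫ x, φ' x * ρ x ∂unif = ∫ x, φ x * ρ x + d' * ρ x ∂unif := by
      refine integral_congr_ae ?_
      filter_upwards [hd'] with x hx
      rw [hx]; ring
    rw [h2, integral_add (integrable_of_continuous (by fun_prop) _)
      (integrable_of_continuous (by fun_prop) _), L.φ_int, integral_const_mul, E.ρ_int] at h1
    linarith
  filter_upwards [hd'] with x hx
  rw [hx, hd'0, add_zero]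

theorem LinSol.innerH_eq (E : EqDensity β V V₁ ρ ρ₁ ρ₂ w w₁)
    (hμ : (μ : Measure Torus) = unif.withDensity fun x => ENNReal.ofReal (ρ x))
    {ψ ψ₁ φ u u₁ u₂ f κ : Torus → ℝ} {c : ℝ}
    (L : LinSol β ρ ρ₁ ψ φ u u₁ u₂ f κ c) (hψ : HasTDeriv ψ ψ₁) (hψ₁ : Continuous ψ₁) :
    innerH μ ψ φ = ∫ x, ψ₁ x * u x * ρ x ∂unif := by
  rw [innerH, hμ, integral_eqMeasure E.ρ_cont fun x => (E.ρ_pos x).le]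
  refine integral_congr_ae ?_
  filter_upwards [hψ.weakDeriv_ae_eq hψ₁, L.φ_deriv.weakDeriv_ae_eq L.u_deriv.continuous] with x h1 h2
  rw [h1, h2]

end Inverse

/-! ### Minimality of the equilibrium measure -/

theorem measurable_lg_sub : Measurable fun p : Torus × Torus => lg (p.1 - p.2) :=
  measurable_lg.comp (measurable_fst.sub measurable_snd)

/-- The regularized kernel is dominated by `|lg| + log 2` off the diagonal, and the diagonal is
assumed negligible. Nonnegativity of the regularized energies thus passes to the logarithmic one. -/
theorem tendsto_pk_energy {n m : Measure Torus} [IsProbabilityMeasure n] [IsProbabilityMeasure m]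
    (hi : Integrable (fun p : Torus × Torus => lg (p.1 - p.2)) (n.prod m))
    (hne : ∀ᵐ p ∂n.prod m, p.1 ≠ p.2) :
    Tendsto (fun r => ∫ x, ∫ y, pk r (x - y) ∂m ∂n) (𝓝[<] 1)
      (𝓝 (∫ p, lg (p.1 - p.2) ∂n.prod m)) := by
  have hr : ∀ᶠ r : ℝ in 𝓝[<] 1, r ∈ Set.Ico (0 : ℝ) 1 := Ico_mem_nhdsLT one_pos
  have hc : ∀ r ∈ Set.Ico (0 : ℝ) 1, Continuous fun p : Torus × Torus => pk r (p.1 - p.2) :=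
    fun r hr => (continuous_pk hr.1 hr.2).comp (by fun_prop)
  have h := tendsto_integral_filter_of_dominated_convergence (μ := n.prod m) (l := 𝓝[<] (1 : ℝ))
    (F := fun r p => pk r (p.1 - p.2)) (f := fun p => lg (p.1 - p.2))
    (fun p => |lg (p.1 - p.2)| + Real.log 2)
    (by filter_upwards [hr] with r hr using (hc r hr).aestronglyMeasurable)
    (by
      filter_upwards [hr] with r hr
      filter_upwards [hne] with p hp
      exact abs_pk_le hr.1 hr.2 (sub_ne_zero.2 hp))
    (hi.abs.add (integrable_const _))
    (by filter_upwards [hne] with p hp using tendsto_pk (sub_ne_zero.2 hp))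
  refine h.congr' ?_
  filter_upwards [hr] with r hr
  exact integral_prod (fun p : Torus × Torus => pk r (p.1 - p.2))
    ((hc r hr).integrable_of_hasCompactSupport (HasCompactSupport.of_compactSpace _))

theorem lg_energy_sub_nonneg {n m : Measure Torus} [IsProbabilityMeasure n] [IsProbabilityMeasure m]
    (hn : Integrable (fun p : Torus × Torus => lg (p.1 - p.2)) (n.prod n))
    (hn' : ∀ᵐ p ∂n.prod n, p.1 ≠ p.2)
    (hnm : Integrable (fun p : Torus × Torus => lg (p.1 - p.2)) (n.prod m))
    (hnm' : ∀ᵐ p ∂n.prod m, p.1 ≠ p.2)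
    (hm : Integrable (fun p : Torus × Torus => lg (p.1 - p.2)) (m.prod m))
    (hm' : ∀ᵐ p ∂m.prod m, p.1 ≠ p.2) :
    0 ≤ (∫ p, lg (p.1 - p.2) ∂n.prod n) - 2 * (∫ p, lg (p.1 - p.2) ∂n.prod m)
      + ∫ p, lg (p.1 - p.2) ∂m.prod m := by
  refine ge_of_tendsto (((tendsto_pk_energy hn hn').sub
    ((tendsto_pk_energy hnm hnm').const_mul 2)).add (tendsto_pk_energy hm hm')) ?_
  filter_upwards [Ico_mem_nhdsLT (one_pos : (0 : ℝ) < 1)] with r hr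
  exact pk_energy_sub_nonneg hr.1 hr.2 n m

theorem logKernel_eq {x y : Torus} (h : x ≠ y) :
    logKernel x y = ENNReal.ofReal (Real.log 2 + lg (x - y)) := by
  have := ch_pos (sub_ne_zero.2 h)
  rw [logKernel, if_neg h, chord_eq, inv_div, Real.log_div two_ne_zero this.ne', lg, sub_eq_add_neg]

theorem measurable_logKernel : Measurable fun p : Torus × Torus => logKernel p.1 p.2 := by
  unfold logKernel
  refine Measurable.ite (measurableSet_eq_fun measurable_fst measurable_snd) measurable_const ?_
  simp only [chord_eq]
  have : Measurable fun p : Torus × Torus => ch (p.1 - p.2) :=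
    continuous_ch.measurable.comp (measurable_fst.sub measurable_snd)
  exact ((this.div_const 2).inv.log).ennreal_ofReal

theorem logEnergy_eq_lintegral (n : Measure Torus) [IsProbabilityMeasure n] :
    logEnergy n = ∫⁻ p, logKernel p.1 p.2 ∂n.prod n :=
  (lintegral_prod _ measurable_logKernel.aemeasurable).symm

theorem logEnergy_eq {n : Measure Torus} [IsProbabilityMeasure n]
    (hi : Integrable (fun p : Torus × Torus => lg (p.1 - p.2)) (n.prod n))
    (hne : ∀ᵐ p ∂n.prod n, p.1 ≠ p.2) :
    0 ≤ Real.log 2 + ∫ p, lg (p.1 - p.2) ∂n.prod n ∧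
    logEnergy n = ENNReal.ofReal (Real.log 2 + ∫ p, lg (p.1 - p.2) ∂n.prod n) := by
  have hnn : ∀ p : Torus × Torus, 0 ≤ Real.log 2 + lg (p.1 - p.2) := fun p => by
    linarith [lg_ge (p.1 - p.2)]
  have hii : Integrable (fun p : Torus × Torus => Real.log 2 + lg (p.1 - p.2)) (n.prod n) :=
    (integrable_const _).add hi
  have h1 : ∫ p : Torus × Torus, (Real.log 2 + lg (p.1 - p.2)) ∂n.prod n
      = Real.log 2 + ∫ p, lg (p.1 - p.2) ∂n.prod n := by
    rw [integral_add (integrable_const _) hi]; simp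
  rw [← h1]
  refine ⟨integral_nonneg hnn, ?_⟩
  rw [logEnergy_eq_lintegral, ofReal_integral_eq_lintegral_ofReal hii (ae_of_all _ hnn)]
  refine lintegral_congr_ae ?_
  filter_upwards [hne] with p hp using logKernel_eq hp

/-- The kernel is infinite on the diagonal, so finite energy rules out atoms; off the diagonal the
kernel is nonnegative and finiteness is integrability. -/
theorem of_logEnergy_ne_top {n : Measure Torus} [IsProbabilityMeasure n] (h : logEnergy n ≠ ⊤) :
    Integrable (fun p : Torus × Torus => lg (p.1 - p.2)) (n.prod n) ∧
      ∀ᵐ p ∂n.prod n, p.1 ≠ p.2 := by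
  rw [logEnergy_eq_lintegral] at h
  have hne : ∀ᵐ p ∂n.prod n, p.1 ≠ p.2 := by
    filter_upwards [ae_lt_top measurable_logKernel h] with p hp heq
    simp [logKernel, heq] at hp
  refine ⟨?_, hne⟩
  have hii : Integrable (fun p : Torus × Torus => Real.log 2 + lg (p.1 - p.2)) (n.prod n) := by
    refine ⟨(measurable_const.add measurable_lg_sub).aestronglyMeasurable, ?_⟩
    rw [hasFiniteIntegral_iff_ofReal (ae_of_all _ fun p => by
      change 0 ≤ Real.log 2 + lg (p.1 - p.2)
      linarith [lg_ge (p.1 - p.2)])]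
    refine lt_of_le_of_lt (le_of_eq (lintegral_congr_ae ?_)) (lt_top_iff_ne_top.2 h)
    filter_upwards [hne] with p hp using (logKernel_eq hp).symm
  refine (hii.sub (integrable_const (Real.log 2))).congr (ae_of_all _ fun p => ?_)
  simp

theorem ae_ne_prod (n : Measure Torus) [SFinite n] {m : Measure Torus} [SFinite m] (hm : m ≪ unif) :
    ∀ᵐ p ∂n.prod m, p.1 ≠ p.2 := by
  refine (Measure.ae_prod_iff_ae_ae (measurableSet_eq_fun measurable_fst measurable_snd).compl).2 ?_
  refine ae_of_all _ fun x => hm.ae_le ?_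
  filter_upwards [ae_ne x] with y hy using hy.symm

/-! ### The equilibrium potential and the variational inequality. -/

section
variable {β : ℝ} {V V₁ ρ ρ₁ ρ₂ w w₁ : Torus → ℝ}

/-- The measure with density `ρ`. -/
def dens (ρ : Torus → ℝ) : Measure Torus := unif.withDensity fun x => ENNReal.ofReal (ρ x)

theorem EqDensity.isProb (E : EqDensity β V V₁ ρ ρ₁ ρ₂ w w₁) : IsProbabilityMeasure (dens ρ) :=
  isProbabilityMeasure_withDensity (integrable_of_continuous E.ρ_cont _) (fun x => (E.ρ_pos x).le)
    E.ρ_int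

theorem dens_ac (ρ : Torus → ℝ) : dens ρ ≪ unif := withDensity_absolutelyContinuous _ _

theorem EqDensity.integrable_dens (E : EqDensity β V V₁ ρ ρ₁ ρ₂ w w₁) {g : Torus → ℝ}
    (hg : Integrable g unif) : Integrable g (dens ρ) := by
  have hm : Measurable ρ := E.ρ_cont.measurable
  rw [dens, integrable_withDensity_iff hm.ennreal_ofReal (ae_of_all _ fun x => ENNReal.ofReal_lt_top)]
  obtain ⟨M, hM, hb⟩ := exists_abs_le E.ρ_cont
  refine hg.mul_bdd (c := M) ?_ (ae_of_all _ fun x => ?_)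
  · exact hm.ennreal_ofReal.ennreal_toReal.aestronglyMeasurable
  · rw [ENNReal.toReal_ofReal (E.ρ_pos x).le]; exact hb x

theorem EqDensity.integral_dens (E : EqDensity β V V₁ ρ ρ₁ ρ₂ w w₁) (g : Torus → ℝ) :
    ∫ x, g x ∂dens ρ = ∫ x, g x * ρ x ∂unif :=
  integral_eqMeasure E.ρ_cont (fun x => (E.ρ_pos x).le) g

theorem integrable_lg_sub (x : Torus) : Integrable (fun y => lg (x - y)) unif :=
  integrable_lg.comp_sub_left x

theorem EqDensity.integrable_lg_prod (E : EqDensity β V V₁ ρ ρ₁ ρ₂ w w₁)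
    (n : Measure Torus) [IsProbabilityMeasure n] :
    Integrable (fun p : Torus × Torus => lg (p.1 - p.2)) (n.prod (dens ρ)) := by
  have := E.isProb
  rw [integrable_prod_iff measurable_lg_sub.aestronglyMeasurable]
  refine ⟨ae_of_all _ fun x => E.integrable_dens (integrable_lg_sub x), ?_⟩
  obtain ⟨M, hM, hb⟩ := exists_abs_le E.ρ_cont
  refine (integrable_const (M * ∫ y, |lg y| ∂unif)).mono'
    (measurable_lg_sub.norm.stronglyMeasurable.integral_prod_right).aestronglyMeasurable
    (ae_of_all _ fun x => ?_)
  rw [Real.norm_of_nonneg (integral_nonneg fun y => norm_nonneg _), E.integral_dens]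
  have h1 : ∫ y, |lg y| ∂unif = ∫ y, |lg (x - y)| ∂unif :=
    (integral_sub_left_eq_self (fun y => |lg y|) unif x).symm
  rw [h1, ← integral_const_mul]
  refine integral_mono_of_nonneg (ae_of_all _ fun y => mul_nonneg (norm_nonneg _) (E.ρ_pos y).le)
    ((integrable_lg_sub x).abs.const_mul _) (ae_of_all _ fun y => ?_)
  change ‖lg (x - y)‖ * ρ y ≤ M * |lg (x - y)|
  rw [mul_comm, Real.norm_eq_abs]
  gcongr
  exact (le_abs_self _).trans (hb y)

/-- Bernoulli's inequality `1 - r^{|k|} ≤ |k| (1 - r)` cancels the factor `1 / |k|` of the kernel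
and leaves the summable coefficients of `ρ`. The explicit rate matters later, with `1 - r = 1/N`. -/
theorem EqDensity.potential_approx (hβ : 0 < β) (E : EqDensity β V V₁ ρ ρ₁ ρ₂ w w₁) {r : ℝ}
    (hr : 0 ≤ r) (hr1 : r < 1) (x : Torus) :
    |∫ y, pk r (x - y) ∂dens ρ - w x / (2 * β)| ≤ (1 - r) / 2 * ∑' k, ‖fc ρ k‖ := by
  have := E.isProb
  have hmc : ∀ k, mc (dens ρ) k = fc ρ k := fun k =>
    mc_withDensity E.ρ_cont.measurable.aemeasurable (fun x => (E.ρ_pos x).le) k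
  have hws : Summable fun k => ‖fc w k‖ := by
    refine Summable.of_nonneg_of_le (fun _ => norm_nonneg _) (fun k => ?_)
      (E.ρ_summable.mul_left β)
    rw [E.fc_w, norm_mul, Complex.norm_real, Real.norm_of_nonneg (by positivity)]
    gcongr
    rcases eq_or_ne k 0 with rfl | hk
    · simpa using hβ.le
    · refine div_le_self hβ.le ?_
      exact_mod_cast Int.one_le_abs hk
  have h1 := integral_pk hr hr1 (dens ρ) x
  have h2 := (hasSum_fc E.w_deriv.continuous hws x).mul_left ((1 / (2 * β) : ℝ) : ℂ)
  have h := h1.sub h2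
  have hb : ∀ k : ℤ, ‖(pc r k : ℂ) * mc (dens ρ) k * ex k x -
      ((1 / (2 * β) : ℝ) : ℂ) * (fc w k * ex k x)‖ ≤ (1 - r) / 2 * ‖fc ρ k‖ := by
    intro k
    have : (pc r k : ℂ) * mc (dens ρ) k * ex k x - ((1 / (2 * β) : ℝ) : ℂ) * (fc w k * ex k x)
        = ((pc r k - 1 / (2 * |(k : ℝ)|) : ℝ) : ℂ) * fc ρ k * ex k x := by
      rw [hmc, E.fc_w]
      have : (1 / (2 * β)) * (β / |(k : ℝ)|) = 1 / (2 * |(k : ℝ)|) := by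
        field_simp
      rw [← this]
      push_cast; ring
    rw [this, norm_mul, norm_mul, norm_ex, mul_one, Complex.norm_real]
    gcongr
    rw [Real.norm_eq_abs, abs_le]
    rcases eq_or_ne k 0 with rfl | hk
    · simp [pc]; linarith
    have hk1 : (0 : ℝ) < |(k : ℝ)| := by positivity
    have hka : (k.natAbs : ℝ) = |(k : ℝ)| := by rw [Nat.cast_natAbs]; simp
    have hB : 1 + (k.natAbs : ℝ) * (r - 1) ≤ r ^ k.natAbs := by
      have := one_add_mul_le_pow (a := r - 1) (by linarith) k.natAbs
      simpa using this
    have hle : r ^ k.natAbs ≤ 1 := pow_le_one₀ hr hr1.le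
    rw [hka] at hB
    have heq : pc r k - 1 / (2 * |(k : ℝ)|) = (r ^ k.natAbs - 1) / (2 * |(k : ℝ)|) := by
      unfold pc; ring
    rw [heq]
    constructor
    · rw [le_div_iff₀ (by positivity)]; nlinarith
    · exact (div_nonpos_of_nonpos_of_nonneg (by linarith) (by positivity)).trans (by linarith)
  have hn := tsum_of_norm_bounded (E.ρ_summable.hasSum.mul_left ((1 - r) / 2)) hb
  rw [h.tsum_eq] at hn
  have he : ((∫ y, pk r (x - y) ∂dens ρ : ℝ) : ℂ) - ((1 / (2 * β) : ℝ) : ℂ) * (w x : ℂ)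
      = ((∫ y, pk r (x - y) ∂dens ρ - w x / (2 * β) : ℝ) : ℂ) := by
    push_cast; ring
  rwa [he, Complex.norm_real, Real.norm_eq_abs] at hn

theorem EqDensity.potential_eq (hβ : 0 < β) (E : EqDensity β V V₁ ρ ρ₁ ρ₂ w w₁) (x : Torus) :
    ∫ y, lg (x - y) ∂dens ρ = w x / (2 * β) := by
  have hr : ∀ᶠ r : ℝ in 𝓝[<] 1, r ∈ Set.Ico (0 : ℝ) 1 := Ico_mem_nhdsLT one_pos
  have := E.isProb
  have hne : ∀ᵐ y ∂dens ρ, x - y ≠ 0 := (dens_ac ρ).ae_le (by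
    filter_upwards [ae_ne x] with y hy using sub_ne_zero.2 hy.symm)
  have h := tendsto_integral_filter_of_dominated_convergence (μ := dens ρ) (l := 𝓝[<] (1 : ℝ))
    (F := fun r y => pk r (x - y)) (f := fun y => lg (x - y))
    (fun y => |lg (x - y)| + Real.log 2)
    (by filter_upwards [hr] with r hr using
          ((continuous_pk hr.1 hr.2).comp (by fun_prop)).aestronglyMeasurable)
    (by
      filter_upwards [hr] with r hr
      filter_upwards [hne] with p hp
      exact abs_pk_le hr.1 hr.2 hp)
    ((E.integrable_dens (integrable_lg_sub x)).abs.add (integrable_const _))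
    (by filter_upwards [hne] with p hp using tendsto_pk hp)
  refine tendsto_nhds_unique h ?_
  rw [tendsto_iff_norm_sub_tendsto_zero]
  refine squeeze_zero' (Eventually.of_forall fun _ => norm_nonneg _) (by
    filter_upwards [hr] with r hr using E.potential_approx hβ hr.1 hr.2 x) ?_
  have : Tendsto (fun r : ℝ => (1 - r) / 2 * ∑' k, ‖fc ρ k‖) (𝓝 1) (𝓝 ((1 - 1) / 2 * ∑' k, ‖fc ρ k‖)) :=
    (((tendsto_const_nhds.sub tendsto_id).div_const 2).mul_const _)
  simp only [sub_self, zero_div, zero_mul] at this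
  exact this.mono_left nhdsWithin_le_nhds

theorem EqDensity.lg_energy_eq (hβ : 0 < β) (E : EqDensity β V V₁ ρ ρ₁ ρ₂ w w₁)
    (n : Measure Torus) [IsProbabilityMeasure n] :
    ∫ p, lg (p.1 - p.2) ∂n.prod (dens ρ) = (∫ x, w x ∂n) / (2 * β) := by
  have := E.isProb
  rw [integral_prod _ (E.integrable_lg_prod n)]
  simp only [E.potential_eq hβ, integral_div]

theorem EqDensity.dens_eq_tilted (E : EqDensity β V V₁ ρ ρ₁ ρ₂ w w₁) :
    dens ρ = (refMeasure V).tilted fun x => -w x := by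
  have hV := E.V_deriv.continuous
  have hw := E.w_deriv.continuous
  obtain ⟨Z, hZ, h⟩ := E.ρ_eq
  rw [refMeasure, tilted_tilted (integrable_of_continuous (by fun_prop) _), Measure.tilted, dens]
  congr 1
  funext x
  have hZ' : ∫ x, Real.exp (((fun x => -V x) + fun x => -w x) x) ∂unif = Z := by
    have h1 := E.ρ_int
    simp only [h, integral_div] at h1
    rw [div_eq_one_iff_eq hZ.ne'] at h1
    rw [← h1]; rfl
  rw [hZ', h]; rfl

/-- Because `ρ` is the tilt of the reference measure by `-w` and `w` is `2β` times the potential of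
`ρ`, all linear terms cancel: the increase in free energy is exactly the relative entropy plus `β`
times the logarithmic energy of the signed difference, which is nonnegative. Keeping the entropy on
the left yields uniqueness of the minimizer. -/
theorem EqDensity.freeEnergy_le (hβ : 0 < β) (E : EqDensity β V V₁ ρ ρ₁ ρ₂ w w₁)
    (n : Measure Torus) [IsProbabilityMeasure n] :
    freeEnergy β V (dens ρ) ≠ ⊤ ∧
    freeEnergy β V (dens ρ) + InformationTheory.klDiv n (dens ρ) ≤ freeEnergy β V n := by
  have hP := E.isProb
  have hV := E.V_deriv.continuous
  have hw := E.w_deriv.continuous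
  have hPr : IsProbabilityMeasure (refMeasure V) :=
    isProbabilityMeasure_tilted (integrable_of_continuous (by fun_prop) _)
  have hwi : Integrable (fun x => Real.exp (-w x)) (refMeasure V) :=
    integrable_of_continuous (by fun_prop) _
  set c₀ := Real.log (∫ z, Real.exp (-w z) ∂refMeasure V) with hc₀
  have hkl : ∀ m : Measure Torus, IsProbabilityMeasure m → m ≪ refMeasure V →
      Integrable (llr m (refMeasure V)) m →
      m ≪ dens ρ ∧ Integrable (llr m (dens ρ)) m ∧
      ∫ x, llr m (dens ρ) x ∂m = ∫ x, w x ∂m + c₀ + ∫ x, llr m (refMeasure V) x ∂m := by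
    intro m hm hac hi
    have h1 := llr_tilted_right hac hwi
    have hint := integrable_llr_tilted_right hac (integrable_of_continuous hw.neg _) hi hwi
    rw [E.dens_eq_tilted]
    refine ⟨hac.trans (absolutelyContinuous_tilted hwi), hint, ?_⟩
    rw [integral_congr_ae h1]
    simp only [neg_neg]
    rw [integral_add (f := fun x => w x + _) (integrable_of_continuous (by fun_prop) _) hi,
      integral_add (integrable_of_continuous hw _) (integrable_const _)]
    simp [hc₀]
  have hacμ : dens ρ ≪ refMeasure V := by
    rw [E.dens_eq_tilted]; exact tilted_absolutelyContinuous _ _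
  have hllrμ : Integrable (llr (dens ρ) (refMeasure V)) (dens ρ) := by
    have h1 := llr_tilted_left (μ := refMeasure V) (ν := refMeasure V) (f := fun x => -w x)
      Measure.AbsolutelyContinuous.rfl hwi hw.neg.measurable.aemeasurable
    have h2 : llr (dens ρ) (refMeasure V) =ᵐ[dens ρ] fun x => -w x - c₀ := by
      refine hacμ.ae_le ?_
      rw [E.dens_eq_tilted]
      filter_upwards [h1, llr_self (refMeasure V)] with x hx hx'
      rw [hx, hx', Pi.zero_apply, add_zero]
    exact (integrable_congr h2).2 (integrable_of_continuous (by fun_prop) _)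
  have hμμ := hkl (dens ρ) hP hacμ hllrμ
  have hself : ∫ x, llr (dens ρ) (dens ρ) x ∂dens ρ = 0 := by
    rw [integral_congr_ae (llr_self (dens ρ))]; simp
  have hklreal : ∀ (m m' : Measure Torus) [IsProbabilityMeasure m] [IsProbabilityMeasure m'],
      m ≪ m' → Integrable (llr m m') m → 0 ≤ ∫ x, llr m m' x ∂m ∧
      InformationTheory.klDiv m m' = ENNReal.ofReal (∫ x, llr m m' x ∂m) := by
    intro m m' _ _ h1 h2
    have h3 := InformationTheory.integral_llr_add_sub_measure_univ_nonneg h1 h2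
    have h4 := InformationTheory.klDiv_of_ac_of_integrable h1 h2
    simp only [probReal_univ, add_sub_cancel_right] at h3 h4
    exact ⟨h3, h4⟩
  have hμi := E.integrable_lg_prod (dens ρ)
  have hμne := ae_ne_prod (dens ρ) (dens_ac ρ)
  obtain ⟨hEμ0, hEμ⟩ := logEnergy_eq hμi hμne
  obtain ⟨hKμ0, hKμ⟩ := hklreal (dens ρ) (refMeasure V) hacμ hllrμ
  have hFμ : freeEnergy β V (dens ρ) = ENNReal.ofReal
      (β * (Real.log 2 + ∫ p, lg (p.1 - p.2) ∂(dens ρ).prod (dens ρ)) +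
        ∫ x, llr (dens ρ) (refMeasure V) x ∂dens ρ) := by
    rw [freeEnergy, hEμ, hKμ, ← ENNReal.ofReal_mul hβ.le,
      ← ENNReal.ofReal_add (mul_nonneg hβ.le hEμ0) hKμ0]
  refine ⟨by rw [hFμ]; exact ENNReal.ofReal_ne_top, ?_⟩
  by_cases hF : freeEnergy β V n = ⊤
  · rw [hF]; exact le_top
  obtain ⟨hF1, hF2⟩ := ENNReal.add_ne_top.1 hF
  have hEn : logEnergy n ≠ ⊤ := by
    intro h
    rw [h, ENNReal.mul_top (by simpa using hβ)] at hF1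
    exact hF1 rfl
  obtain ⟨hni, hnne⟩ := of_logEnergy_ne_top hEn
  obtain ⟨hnac, hnllr⟩ := InformationTheory.klDiv_ne_top_iff.1 hF2
  obtain ⟨hE0, hE⟩ := logEnergy_eq hni hnne
  obtain ⟨hK0, hK⟩ := hklreal n (refMeasure V) hnac hnllr
  obtain ⟨hac', hi', heq'⟩ := hkl n inferInstance hnac hnllr
  obtain ⟨hK0', hK'⟩ := hklreal n (dens ρ) hac' hi'
  have hFn : freeEnergy β V n = ENNReal.ofReal
      (β * (Real.log 2 + ∫ p, lg (p.1 - p.2) ∂n.prod n) + ∫ x, llr n (refMeasure V) x ∂n) := by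
    rw [freeEnergy, hE, hK, ← ENNReal.ofReal_mul hβ.le,
      ← ENNReal.ofReal_add (mul_nonneg hβ.le hE0) hK0]
  rw [hFn, hFμ, hK', ← ENNReal.ofReal_add (add_nonneg (mul_nonneg hβ.le hEμ0) hKμ0) hK0']
  refine ENNReal.ofReal_le_ofReal ?_
  have hen := lg_energy_sub_nonneg hni hnne (E.integrable_lg_prod n) (ae_ne_prod n (dens_ac ρ))
    hμi hμne
  have h1 := E.lg_energy_eq hβ n
  have h2 := E.lg_energy_eq hβ (dens ρ)
  have h3 := hμμ.2.2
  rw [hself] at h3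
  have hen' := mul_le_mul_of_nonneg_left hen hβ.le
  have h1' : β * (2 * ∫ p, lg (p.1 - p.2) ∂n.prod (dens ρ)) = ∫ x, w x ∂n := by
    rw [h1]; field_simp
  have h2' : β * (2 * ∫ p, lg (p.1 - p.2) ∂(dens ρ).prod (dens ρ)) = ∫ x, w x ∂dens ρ := by
    rw [h2]; field_simp
  rw [heq']
  nlinarith

theorem EqDensity.isEquilibrium (hβ : 0 < β) (E : EqDensity β V V₁ ρ ρ₁ ρ₂ w w₁)
    {μ : ProbabilityMeasure Torus} (hμ : (μ : Measure Torus) = dens ρ) : IsEquilibrium β V μ := by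
  intro ν
  rw [hμ]
  exact le_self_add.trans (E.freeEnergy_le hβ ν).2

theorem EqDensity.eq_of_isEquilibrium (hβ : 0 < β) (E : EqDensity β V V₁ ρ ρ₁ ρ₂ w w₁)
    {μ : ProbabilityMeasure Torus} (hμ : (μ : Measure Torus) = dens ρ)
    {μ' : ProbabilityMeasure Torus} (h : IsEquilibrium β V μ') : μ' = μ := by
  have := E.isProb
  obtain ⟨h1, h2⟩ := E.freeEnergy_le hβ (μ' : Measure Torus)
  have h3 := h μ
  rw [hμ] at h3
  have h4 : InformationTheory.klDiv (μ' : Measure Torus) (dens ρ) = 0 := by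
    have := h2.trans h3
    simpa using (ENNReal.add_le_add_iff_left h1).1 (this.trans (add_zero _).ge)
  rw [InformationTheory.klDiv_eq_zero_iff] at h4
  exact Subtype.ext (h4.trans hμ.symm)

end

/-! ### Comparison of the Gibbs measure with the product measure -/

theorem pi_dens {ρ : Torus → ℝ} (hρ : Continuous ρ) (h0 : ∀ x, 0 ≤ ρ x) [IsFiniteMeasure (dens ρ)]
    (N : ℕ) : Measure.pi (fun _ : Fin N => dens ρ) =
      (Measure.pi fun _ : Fin N => unif).withDensity fun x => ENNReal.ofReal (∏ i, ρ (x i)) := by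
  symm
  refine (Measure.pi_eq fun s hs => ?_).symm
  rw [withDensity_apply _ (MeasurableSet.univ_pi hs),
    ← lintegral_indicator (MeasurableSet.univ_pi hs)]
  have hsi : ∀ i, Integrable ((s i).indicator ρ) unif := fun i =>
    (integrable_of_continuous hρ _).indicator (hs i)
  have hs0 : ∀ i y, 0 ≤ (s i).indicator ρ y := fun i y => Set.indicator_nonneg (fun z _ => h0 z) y
  have h1 : ∀ x : Fin N → Torus, (Set.univ.pi s).indicator
      (fun x => ENNReal.ofReal (∏ i, ρ (x i))) x = ENNReal.ofReal (∏ i, (s i).indicator ρ (x i)) := by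
    intro x
    by_cases hx : x ∈ Set.univ.pi s
    · rw [Set.indicator_of_mem hx]
      congr 1
      exact Finset.prod_congr rfl fun i _ => (Set.indicator_of_mem (hx i trivial) _).symm
    · rw [Set.indicator_of_notMem hx]
      simp only [Set.mem_pi, Set.mem_univ, true_imp_iff, not_forall] at hx
      obtain ⟨i, hi⟩ := hx
      rw [Finset.prod_eq_zero (Finset.mem_univ i) (Set.indicator_of_notMem hi _), ENNReal.ofReal_zero]
  simp only [h1]
  rw [← ofReal_integral_eq_lintegral_ofReal (Integrable.fintype_prod hsi)
    (ae_of_all _ fun x => Finset.prod_nonneg fun i _ => hs0 i _),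
    integral_fintype_prod_eq_prod, ENNReal.ofReal_prod_of_nonneg fun i _ => integral_nonneg (hs0 i)]
  refine Finset.prod_congr rfl fun i _ => ?_
  rw [ofReal_integral_eq_lintegral_ofReal (hsi i) (ae_of_all _ (hs0 i)), dens,
    withDensity_apply _ (hs i), ← lintegral_indicator (hs i)]
  refine lintegral_congr fun y => ?_
  by_cases hy : y ∈ s i
  · simp [hy]
  · simp [hy]

/-- The empirical measure of a configuration. -/
def emp {N : ℕ} (x : Fin N → Torus) : Measure Torus :=
  ((N : ENNReal)⁻¹) • ∑ i, Measure.dirac (x i)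

theorem isProb_emp {N : ℕ} (hN : 1 ≤ N) (x : Fin N → Torus) : IsProbabilityMeasure (emp x) := by
  constructor
  have : (N : ENNReal) ≠ 0 := by exact_mod_cast (by omega : N ≠ 0)
  simp [emp, ENNReal.inv_mul_cancel this (ENNReal.natCast_ne_top N)]

theorem integral_emp {N : ℕ} (x : Fin N → Torus) (f : Torus → ℝ) :
    ∫ y, f y ∂emp x = (∑ i, f (x i)) / N := by
  rw [emp, integral_smul_measure, integral_finsetSum_measure]
  · simp [div_eq_inv_mul]
  · intro i _
    exact integrable_dirac (by simp)

theorem sum_sum_eq_diag_add {N : ℕ} (f : Fin N → Fin N → ℝ) (hf : ∀ i j, f i j = f j i) :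
    ∑ i, ∑ j, f i j = ∑ i, f i i + 2 * ∑ i, ∑ j ∈ Finset.Ioi i, f i j := by
  have h1 := Finset.sum_sum_Ioi_add_eq_sum_sum_off_diag f
  have h2 : ∀ i, ∑ j, f j i = f i i + ∑ j ∈ ({i}ᶜ : Finset (Fin N)), f j i := fun i => by
    rw [← Finset.sum_add_sum_compl {i}]; simp
  have h3 : ∑ i, ∑ j, f i j = ∑ i, ∑ j, f j i := by simp only [hf]
  rw [h3]
  simp only [h2, Finset.sum_add_distrib, ← h1]
  have h4 : ∑ i, ∑ j ∈ Finset.Ioi i, f j i = ∑ i, ∑ j ∈ Finset.Ioi i, f i j :=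
    Finset.sum_congr rfl fun i _ => Finset.sum_congr rfl fun j _ => hf j i
  rw [h4]; ring

/-- The density, up to a constant, of the Gibbs measure with respect to the product of the
equilibrium measures. -/
def wt (β : ℝ) (w : Torus → ℝ) (N : ℕ) (x : Fin N → Torus) : ℝ :=
  (∏ i : Fin N, ∏ j ∈ Finset.Ioi i, ch (x i - x j) ^ (2 * β / (N : ℝ))) *
    Real.exp (∑ i, w (x i))

theorem wt_nonneg (β : ℝ) (w : Torus → ℝ) (N : ℕ) (x : Fin N → Torus) : 0 ≤ wt β w N x :=
  mul_nonneg (Finset.prod_nonneg fun _ _ => Finset.prod_nonneg fun _ _ =>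
    Real.rpow_nonneg (ch_nonneg _) _) (Real.exp_nonneg _)

theorem continuous_interaction {β : ℝ} (hβ : 0 ≤ β) (N : ℕ) :
    Continuous fun x : Fin N → Torus =>
      ∏ i : Fin N, ∏ j ∈ Finset.Ioi i, ch (x i - x j) ^ (2 * β / (N : ℝ)) := by
  refine continuous_finsetProd _ fun i _ => continuous_finsetProd _ fun j _ => ?_
  refine Continuous.rpow_const (continuous_ch.comp (by fun_prop)) fun x => Or.inr (by positivity)

theorem continuous_wt {β : ℝ} (hβ : 0 ≤ β) {w : Torus → ℝ} (hw : Continuous w) (N : ℕ) :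
    Continuous (wt β w N) :=
  (continuous_interaction hβ N).mul (by fun_prop)

theorem wt_of_ne (β : ℝ) (w : Torus → ℝ) (N : ℕ) {x : Fin N → Torus}
    (hx : ∀ i j, i ≠ j → x i ≠ x j) :
    wt β w N x = Real.exp (-(2 * β / N) * ∑ i, ∑ j ∈ Finset.Ioi i, lg (x i - x j) +
      ∑ i, w (x i)) := by
  rw [wt, Real.exp_add]
  congr 1
  rw [Finset.mul_sum, Real.exp_sum]
  refine Finset.prod_congr rfl fun i _ => ?_
  rw [Finset.mul_sum, Real.exp_sum]
  refine Finset.prod_congr rfl fun j hj => ?_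
  have hne : x i - x j ≠ 0 := sub_ne_zero.2 (hx i j (Finset.mem_Ioi.1 hj).ne)
  rw [Real.rpow_def_of_pos (ch_pos hne), lg]
  congr 1; ring

section
variable {β : ℝ} {V V₁ ρ ρ₁ ρ₂ w w₁ : Torus → ℝ}

/-- Positivity of the energy of the empirical measure minus the equilibrium measure. The empirical
measure has infinite logarithmic energy, which is why the regularized kernel is used. Replacing the
potential by `w` costs three times the approximation error, two from the cross term and one from the
self-energy. -/
theorem EqDensity.pk_energy_le (hβ : 0 < β) (E : EqDensity β V V₁ ρ ρ₁ ρ₂ w w₁) {r : ℝ}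
    (hr : 0 ≤ r) (hr1 : r < 1) {N : ℕ} (hN : 1 ≤ N) (x : Fin N → Torus) :
    2 * N / (2 * β) * ∑ i, w (x i) - N ^ 2 * (∫ y, w y ∂dens ρ) / (2 * β)
      - 3 * N ^ 2 * ((1 - r) / 2 * ∑' k, ‖fc ρ k‖) ≤ ∑ i, ∑ j, pk r (x i - x j) := by
  have := E.isProb
  have := isProb_emp hN x
  have hNp : (0 : ℝ) < N := by exact_mod_cast hN
  have h := pk_energy_sub_nonneg hr hr1 (emp x) (dens ρ)
  set ε := (1 - r) / 2 * ∑' k, ‖fc ρ k‖ with hε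
  have hap := E.potential_approx hβ hr hr1
  rw [← hε] at hap
  have h1 : ∫ z, ∫ y, pk r (z - y) ∂emp x ∂emp x = (∑ i, ∑ j, pk r (x i - x j)) / N ^ 2 := by
    rw [integral_emp]
    simp only [integral_emp]
    rw [← Finset.sum_div, div_div, sq]
  have h2 : (∑ i, w (x i)) / (2 * β) / N - ε ≤ ∫ z, ∫ y, pk r (z - y) ∂dens ρ ∂emp x := by
    rw [integral_emp, Finset.sum_div, Finset.sum_div]
    have : ε = ∑ i : Fin N, ε / N := by simp; field_simp
    rw [this, ← Finset.sum_sub_distrib, Finset.sum_div]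
    refine Finset.sum_le_sum fun i _ => ?_
    rw [← sub_div]
    gcongr
    linarith [(abs_le.1 (hap (x i))).1]
  have h3 : ∫ z, ∫ y, pk r (z - y) ∂dens ρ ∂dens ρ ≤ (∫ y, w y ∂dens ρ) / (2 * β) + ε := by
    have hint : Integrable (fun z => ∫ y, pk r (z - y) ∂dens ρ) (dens ρ) := by
      have hc : Continuous fun p : Torus × Torus => pk r (p.1 - p.2) :=
        (continuous_pk hr hr1).comp (by fun_prop)
      exact (hc.integrable_of_hasCompactSupport (μ := (dens ρ).prod (dens ρ))
        (HasCompactSupport.of_compactSpace _)).integral_prod_left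
    have hwi : Integrable (fun z => w z / (2 * β)) (dens ρ) :=
      (integrable_of_continuous E.w_deriv.continuous _).div_const _
    have : (∫ y, w y ∂dens ρ) / (2 * β) + ε = ∫ y, (w y / (2 * β) + ε) ∂dens ρ := by
      rw [integral_add hwi (integrable_const _), integral_div]; simp
    rw [this]
    refine integral_mono hint (hwi.add (integrable_const _)) fun z => ?_
    change _ ≤ w z / (2 * β) + ε
    linarith [(abs_le.1 (hap z)).2]
  rw [h1] at h
  have h4 : 2 * ((∑ i, w (x i)) / (2 * β) / N - ε) - ((∫ y, w y ∂dens ρ) / (2 * β) + ε)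
      ≤ (∑ i, ∑ j, pk r (x i - x j)) / N ^ 2 := by linarith
  rw [le_div_iff₀ (by positivity)] at h4
  refine le_trans (le_of_eq ?_) h4
  field_simp; ring

/-- A weighted Onsager inequality: discreteness of the charges costs only their regularized
self-energy, logarithmic in `N` per particle. The interaction carries a factor `β / N`, so the total
loss is a power of `N`. -/
theorem EqDensity.wt_le (hβ : 0 < β) (E : EqDensity β V V₁ ρ ρ₁ ρ₂ w w₁) {N : ℕ} (hN : 1 ≤ N)
    (x : Fin N → Torus) :
    wt β w N x ≤ Real.exp (N * (∫ y, w y ∂dens ρ) / 2) *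
      (Real.exp (β + 3 * β / 2 * ∑' k, ‖fc ρ k‖) * (N : ℝ) ^ β) := by
  have hNp : (0 : ℝ) < N := by exact_mod_cast hN
  have hN1 : (1 : ℝ) ≤ N := by exact_mod_cast hN
  by_cases hx : ∀ i j, i ≠ j → x i ≠ x j
  swap
  · push Not at hx
    obtain ⟨i, j, hij, he⟩ := hx
    have h0 : wt β w N x = 0 := by
      have hz : ∀ i j : Fin N, i < j → x i = x j → wt β w N x = 0 := by
        intro i j hij he
        rw [wt, Finset.prod_eq_zero (Finset.mem_univ i), zero_mul]
        refine Finset.prod_eq_zero (Finset.mem_Ioi.2 hij) ?_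
        rw [he, sub_self, ch_zero, Real.zero_rpow (by positivity)]
      rcases lt_or_gt_of_ne hij with h | h
      · exact hz i j h he
      · exact hz j i h he.symm
    rw [h0]; positivity
  rw [wt_of_ne β w N hx, Real.rpow_def_of_pos hNp, ← Real.exp_add, ← Real.exp_add]
  refine Real.exp_le_exp.2 ?_
  -- This scale balances the losses: the diagonal costs `β log N`, while the replacement of the
  -- potential and the comparison of the two kernels over all pairs cost `O(1)`.
  set r : ℝ := 1 - 1 / N with hr
  have h1N : (1 : ℝ) / N ≤ 1 := by rw [div_le_one hNp]; exact hN1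
  have h0N : (0 : ℝ) < 1 / N := by positivity
  have hr0 : 0 ≤ r := by linarith
  have hr1 : r < 1 := by linarith
  have hE := E.pk_energy_le hβ hr0 hr1 hN x
  rw [sum_sum_eq_diag_add (fun i j => pk r (x i - x j)) (fun i j => by
    have h1 : ex 1 (x j - x i) = conj (ex 1 (x i - x j)) := by
      rw [← neg_sub, ex_neg]
    simp only [pk]
    rw [h1, ← Complex.norm_conj]; simp)] at hE
  have hdiag : ∑ i : Fin N, pk r (x i - x i) = N * Real.log N := by
    have : pk r 0 = Real.log N := by
      have h1 : (1 : ℂ) - (r : ℂ) = ((1 / N : ℝ) : ℂ) := by rw [hr]; push_cast; ring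
      rw [pk, ex_zero, mul_one, h1, Complex.norm_real, Real.norm_of_nonneg h0N.le, one_div,
        Real.log_inv, neg_neg]
    simp [this]
  rw [hdiag] at hE
  have hlog : Real.log (2 / (1 + r)) ≤ 1 / N := by
    refine (Real.log_le_sub_one_of_pos (by positivity)).trans ?_
    rw [div_sub_one (by positivity), div_le_iff₀ (by positivity), hr]
    nlinarith
  have hcount : ∑ i : Fin N, ∑ j ∈ Finset.Ioi i, (1 : ℝ) ≤ N ^ 2 / 2 := by
    have h1 := sum_sum_eq_diag_add (fun _ _ : Fin N => (1 : ℝ)) fun _ _ => rfl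
    simp only [Finset.sum_const, Finset.card_univ, Fintype.card_fin, nsmul_eq_mul, mul_one] at h1 ⊢
    nlinarith
  have hlow : ∑ i, ∑ j ∈ Finset.Ioi i, pk r (x i - x j) - N / 2 ≤
      ∑ i, ∑ j ∈ Finset.Ioi i, lg (x i - x j) := by
    have h1 : ∑ i, ∑ j ∈ Finset.Ioi i, (pk r (x i - x j) - 1 / N) ≤
        ∑ i, ∑ j ∈ Finset.Ioi i, lg (x i - x j) := by
      refine Finset.sum_le_sum fun i _ => Finset.sum_le_sum fun j hj => ?_
      have := pk_le_lg hr0 hr1 (sub_ne_zero.2 (hx i j (Finset.mem_Ioi.1 hj).ne))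
      linarith
    have h2 : ∑ i : Fin N, ∑ j ∈ Finset.Ioi i, (1 / N : ℝ) ≤ N / 2 := by
      have : ∑ i : Fin N, ∑ j ∈ Finset.Ioi i, (1 / N : ℝ)
          = 1 / N * ∑ i : Fin N, ∑ j ∈ Finset.Ioi i, (1 : ℝ) := by
        simp only [Finset.mul_sum, mul_one]
      rw [this]
      calc 1 / (N : ℝ) * _ ≤ 1 / N * (N ^ 2 / 2) := by gcongr
        _ = N / 2 := by field_simp
    simp only [Finset.sum_sub_distrib] at h1
    linarith
  set S := ∑' k, ‖fc ρ k‖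
  set W := ∫ y, w y ∂dens ρ
  set A := ∑ i, w (x i)
  set P := ∑ i, ∑ j ∈ Finset.Ioi i, pk r (x i - x j)
  set L := ∑ i, ∑ j ∈ Finset.Ioi i, lg (x i - x j)
  have hr' : (1 - r) = 1 / N := by rw [hr]; ring
  rw [hr'] at hE
  have hk : β / N * (2 * N / (2 * β) * A - N ^ 2 * W / (2 * β) - 3 * N ^ 2 * (1 / N / 2 * S))
      = A - N * W / 2 - 3 * β / 2 * S := by field_simp
  have hk2 : β / N * (N * Real.log N + 2 * P) = β * Real.log N + 2 * β / N * P := by field_simp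
  have hm := mul_le_mul_of_nonneg_left hE (by positivity : 0 ≤ β / N)
  rw [hk, hk2] at hm
  have hm2 := mul_le_mul_of_nonneg_left hlow (by positivity : 0 ≤ 2 * β / N)
  have hk3 : 2 * β / N * (P - N / 2) = 2 * β / N * P - β := by field_simp
  rw [hk3] at hm2
  nlinarith

theorem map_eval_pair {m : Measure Torus} [IsProbabilityMeasure m] {N : ℕ} {i j : Fin N}
    (hij : i ≠ j) :
    MeasurePreserving (fun x : Fin N → Torus => (x i, x j)) (Measure.pi fun _ => m) (m.prod m) := by
  refine ⟨by fun_prop, ?_⟩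
  have h := (iIndepFun_pi (μ := fun _ : Fin N => m) (X := fun _ y => y)
    (fun _ => aemeasurable_id)).indepFun hij
  rw [indepFun_iff_map_prod_eq_prod_map_map (measurable_pi_apply i).aemeasurable
    (measurable_pi_apply j).aemeasurable] at h
  rw [h]
  have e := fun i : Fin N => (measurePreserving_eval (fun _ : Fin N => m) i).map_eq
  have e' : ∀ i : Fin N, Measure.map (fun x : Fin N → Torus => x i) (Measure.pi fun _ => m) = m := e
  rw [e', e']

/-- Jensen in tangent-line form for the logarithm of the weight. The pairs contribute `-(N - 1) W /
2` and the one-body terms `N W`, so the mean is `(N + 1) W / 2`, which matches the exponent of the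
upper bound up to a constant. -/
theorem EqDensity.le_lintegral_wt (hβ : 0 < β) (E : EqDensity β V V₁ ρ ρ₁ ρ₂ w w₁) {N : ℕ}
    (hN : 1 ≤ N) :
    ENNReal.ofReal (Real.exp ((N + 1) * (∫ y, w y ∂dens ρ) / 2)) ≤
      ∫⁻ x, ENNReal.ofReal (wt β w N x) ∂(Measure.pi fun _ => dens ρ) := by
  have := E.isProb
  have hNp : (0 : ℝ) < N := by exact_mod_cast hN
  set Q := Measure.pi fun _ : Fin N => dens ρ with hQ
  have hw := E.w_deriv.continuous
  have hwc := continuous_wt hβ.le hw N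
  have hwi : Integrable (wt β w N) Q :=
    hwc.integrable_of_hasCompactSupport (HasCompactSupport.of_compactSpace _)
  rw [← ofReal_integral_eq_lintegral_ofReal hwi (ae_of_all _ (wt_nonneg β w N))]
  refine ENNReal.ofReal_le_ofReal ?_
  set W := ∫ y, w y ∂dens ρ with hW
  set X : (Fin N → Torus) → ℝ := fun x => -(2 * β / N) * ∑ i, ∑ j ∈ Finset.Ioi i, lg (x i - x j) +
      ∑ i, w (x i) with hX
  have hlgi : ∀ i : Fin N, ∀ j ∈ Finset.Ioi i,
      Integrable (fun x : Fin N → Torus => lg (x i - x j)) Q := fun i j hj =>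
    (map_eval_pair (Finset.mem_Ioi.1 hj).ne).integrable_comp_of_integrable
      (E.integrable_lg_prod (dens ρ))
  have hlgv : ∀ i : Fin N, ∀ j ∈ Finset.Ioi i,
      ∫ x : Fin N → Torus, lg (x i - x j) ∂Q = W / (2 * β) := fun i j hj => by
    rw [← E.lg_energy_eq hβ (dens ρ), ← (map_eval_pair (N := N) (Finset.mem_Ioi.1 hj).ne).map_eq,
      integral_map (by fun_prop) measurable_lg_sub.aestronglyMeasurable]
  have hwv : ∀ i : Fin N, ∫ x : Fin N → Torus, w (x i) ∂Q = W := fun i => by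
    have := (measurePreserving_eval (fun _ : Fin N => dens ρ) i)
    rw [hW, ← this.map_eq, integral_map (measurable_pi_apply i).aemeasurable
      hw.aestronglyMeasurable]
  have hwii : ∀ i ∈ Finset.univ, Integrable (fun x : Fin N → Torus => w (x i)) Q := fun i _ =>
    (hw.comp (continuous_apply i)).integrable_of_hasCompactSupport
      (HasCompactSupport.of_compactSpace _)
  have hLi : Integrable (fun x : Fin N → Torus => ∑ i, ∑ j ∈ Finset.Ioi i, lg (x i - x j)) Q :=
    integrable_finsetSum _ fun i _ => integrable_finsetSum _ (hlgi i)
  have hL : ∫ x : Fin N → Torus, ∑ i, ∑ j ∈ Finset.Ioi i, lg (x i - x j) ∂Q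
      = (N ^ 2 - N) / 2 * (W / (2 * β)) := by
    rw [integral_finsetSum _ fun i _ => integrable_finsetSum _ (hlgi i)]
    have h1 : ∀ i : Fin N, ∫ x : Fin N → Torus, ∑ j ∈ Finset.Ioi i, lg (x i - x j) ∂Q
        = W / (2 * β) * ∑ j ∈ Finset.Ioi i, (1 : ℝ) := fun i => by
      rw [integral_finsetSum _ (hlgi i), Finset.sum_congr rfl (hlgv i)]; simp [mul_comm]
    simp only [h1]
    rw [← Finset.mul_sum]
    have h2 := sum_sum_eq_diag_add (fun _ _ : Fin N => (1 : ℝ)) fun _ _ => rfl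
    have h3 : ∑ i : Fin N, ∑ j ∈ Finset.Ioi i, (1 : ℝ) = (N ^ 2 - N) / 2 := by
      simp only [Finset.sum_const, Finset.card_univ, Fintype.card_fin, nsmul_eq_mul, mul_one] at h2 ⊢
      linarith
    rw [h3]; ring
  have hXi : Integrable X Q := (hLi.const_mul _).add (integrable_finsetSum _ hwii)
  have hXv : ∫ x, X x ∂Q = (N + 1) * W / 2 := by
    rw [hX, integral_add (hLi.const_mul _) (integrable_finsetSum _ hwii), integral_const_mul, hL,
      integral_finsetSum _ hwii]
    simp only [hwv]
    simp
    field_simp; ring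
  set m := (N + 1) * W / 2 with hm
  have hdist : ∀ᵐ x ∂Q, ∀ i j, i ≠ j → x i ≠ x j := by
    rw [ae_all_iff]; intro i
    rw [ae_all_iff]; intro j
    by_cases hij : i = j
    · exact ae_of_all _ fun x h => absurd hij h
    · have := (map_eval_pair (m := dens ρ) (N := N) hij).quasiMeasurePreserving.ae
        (ae_ne_prod (dens ρ) (dens_ac ρ))
      filter_upwards [this] with x hx _ using hx
  have hii : Integrable (fun x => Real.exp m * (1 + X x - m)) Q :=
    (((integrable_const _).add hXi).sub (integrable_const _)).const_mul _
  calc Real.exp m = ∫ x, Real.exp m * (1 + X x - m) ∂Q := by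
        rw [integral_const_mul, integral_sub (f := fun x => 1 + X x)
          ((integrable_const _).add hXi) (integrable_const _),
          integral_add (integrable_const _) hXi, hXv]
        simp
    _ ≤ ∫ x, wt β w N x ∂Q := by
        refine integral_mono_ae hii hwi ?_
        filter_upwards [hdist] with x hx
        rw [wt_of_ne β w N hx]
        change Real.exp m * (1 + X x - m) ≤ Real.exp (X x)
        have h1 := Real.add_one_le_exp (X x - m)
        calc Real.exp m * (1 + X x - m) ≤ Real.exp m * Real.exp (X x - m) := by
              gcongr; linarith
          _ = Real.exp (X x) := by rw [← Real.exp_add]; congr 1; ring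

/-- The Euler–Lagrange equation reads `e^{-V} = Z ρ e^w`: it trades the external potential for the
product density and the one-body factor in `wt`. -/
theorem EqDensity.gibbsWeight_eq (E : EqDensity β V V₁ ρ ρ₁ ρ₂ w w₁) :
    ∃ Z : ℝ, 0 < Z ∧ ∀ (N : ℕ) (x : Fin N → Torus),
      gibbsWeight β V N x = Z ^ N * (∏ i, ρ (x i)) * wt β w N x := by
  obtain ⟨Z, hZ, h⟩ := E.ρ_eq
  refine ⟨Z, hZ, fun N x => ?_⟩
  have h1 : ∏ i, Real.exp (-V (x i)) = Z ^ N * (∏ i, ρ (x i)) * Real.exp (∑ i, w (x i)) := by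
    rw [Real.exp_sum]
    have : Z ^ N = ∏ _i : Fin N, Z := by simp
    rw [this, ← Finset.prod_mul_distrib, ← Finset.prod_mul_distrib]
    refine Finset.prod_congr rfl fun i _ => ?_
    rw [h, mul_div_cancel₀ _ hZ.ne', ← Real.exp_add]
    congr 1; ring
  simp only [gibbsWeight, wt, chord_eq]
  rw [h1]; ring

theorem EqDensity.gibbs_eq (hβ : 0 < β) (E : EqDensity β V V₁ ρ ρ₁ ρ₂ w w₁) (N : ℕ) :
    gibbs β V N = (∫⁻ x, ENNReal.ofReal (wt β w N x) ∂(Measure.pi fun _ => dens ρ))⁻¹ •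
      (Measure.pi fun _ => dens ρ).withDensity fun x => ENNReal.ofReal (wt β w N x) := by
  have := E.isProb
  obtain ⟨Z, hZ, h⟩ := E.gibbsWeight_eq
  have hρ0 : ∀ x : Fin N → Torus, 0 ≤ ∏ i, ρ (x i) := fun x =>
    Finset.prod_nonneg fun i _ => (E.ρ_pos _).le
  have hρm : Measurable fun x : Fin N → Torus => ENNReal.ofReal (∏ i, ρ (x i)) := by
    have hρ := E.ρ_cont
    exact (continuous_finsetProd _ fun i _ =>
      hρ.comp (continuous_apply i)).measurable.ennreal_ofReal
  have hwm : Measurable fun x => ENNReal.ofReal (wt β w N x) :=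
    (continuous_wt hβ.le E.w_deriv.continuous N).measurable.ennreal_ofReal
  have hg : (fun x => ENNReal.ofReal (gibbsWeight β V N x)) = ENNReal.ofReal (Z ^ N) •
      ((fun x : Fin N → Torus => ENNReal.ofReal (∏ i, ρ (x i))) *
        fun x => ENNReal.ofReal (wt β w N x)) := by
    funext x
    rw [h, mul_assoc, ENNReal.ofReal_mul (by positivity), ENNReal.ofReal_mul (hρ0 x)]; rfl
  have hd : (Measure.pi fun _ : Fin N => unif).withDensity
      (fun x => ENNReal.ofReal (gibbsWeight β V N x)) = ENNReal.ofReal (Z ^ N) •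
      (Measure.pi fun _ => dens ρ).withDensity fun x => ENNReal.ofReal (wt β w N x) := by
    rw [hg, withDensity_smul _ (hρm.mul hwm), withDensity_mul _ hρm hwm,
      pi_dens E.ρ_cont fun x => (E.ρ_pos x).le]
  have hp : partitionFunction β V N = ENNReal.ofReal (Z ^ N) *
      ∫⁻ x, ENNReal.ofReal (wt β w N x) ∂(Measure.pi fun _ => dens ρ) := by
    have h1 := congrArg (fun m : Measure (Fin N → Torus) => m Set.univ) hd
    simpa [withDensity_apply, partitionFunction] using h1
  have hZ0 : ENNReal.ofReal (Z ^ N) ≠ 0 := by simpa using by positivity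
  rw [gibbs, hd, hp, smul_smul, ENNReal.mul_inv (Or.inl hZ0) (Or.inl ENNReal.ofReal_ne_top),
    mul_assoc, mul_comm _ (ENNReal.ofReal (Z ^ N)), ← mul_assoc,
    ENNReal.inv_mul_cancel hZ0 ENNReal.ofReal_ne_top, one_mul]

/-- The Gibbs measure is dominated by a polynomial factor times the product of the equilibrium
measures. -/
theorem EqDensity.exists_gibbs_le (hβ : 0 < β) (E : EqDensity β V V₁ ρ ρ₁ ρ₂ w w₁) :
    ∃ C : ℝ, 0 < C ∧ ∀ N : ℕ, 1 ≤ N → IsProbabilityMeasure (gibbs β V N) ∧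
      gibbs β V N ≤ ENNReal.ofReal (C * (N : ℝ) ^ β) • Measure.pi fun _ => dens ρ := by
  have := E.isProb
  set W := ∫ y, w y ∂dens ρ with hW
  set B := Real.exp (β + 3 * β / 2 * ∑' k, ‖fc ρ k‖) with hB
  refine ⟨Real.exp (-W / 2) * B, by positivity, fun N hN => ?_⟩
  have hNp : (0 : ℝ) < N := by exact_mod_cast hN
  rw [E.gibbs_eq hβ]
  set I := ∫⁻ x, ENNReal.ofReal (wt β w N x) ∂(Measure.pi fun _ => dens ρ) with hI
  have hlow := E.le_lintegral_wt hβ hN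
  rw [← hI, ← hW] at hlow
  have hup : ∀ x, ENNReal.ofReal (wt β w N x) ≤
      ENNReal.ofReal (Real.exp (N * W / 2) * (B * (N : ℝ) ^ β)) := fun x =>
    ENNReal.ofReal_le_ofReal (E.wt_le hβ hN x)
  have hI0 : I ≠ 0 := by
    intro h
    rw [h] at hlow
    have := Real.exp_pos ((N + 1) * W / 2)
    simp at hlow
    linarith
  have hIt : I ≠ ⊤ := by
    refine ne_top_of_le_ne_top ?_ (lintegral_mono hup)
    simp [ENNReal.ofReal_ne_top]
  constructor
  · constructor
    simp [withDensity_apply, ← hI, ENNReal.inv_mul_cancel hI0 hIt]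
  · calc I⁻¹ • (Measure.pi fun _ : Fin N => dens ρ).withDensity
            (fun x => ENNReal.ofReal (wt β w N x))
        ≤ (ENNReal.ofReal (Real.exp ((N + 1) * W / 2)))⁻¹ •
          (ENNReal.ofReal (Real.exp (N * W / 2) * (B * (N : ℝ) ^ β)) •
            Measure.pi fun _ => dens ρ) := by
          have hwd := withDensity_mono (μ := Measure.pi fun _ : Fin N => dens ρ) (ae_of_all _ hup)
          rw [withDensity_const] at hwd
          refine Measure.le_iff.2 fun s _ => ?_
          simp only [Measure.smul_apply, smul_eq_mul]
          exact mul_le_mul' (ENNReal.inv_le_inv.2 hlow) (hwd s)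
      _ = _ := by
          rw [smul_smul, ← ENNReal.ofReal_inv_of_pos (Real.exp_pos _),
            ← ENNReal.ofReal_mul (by positivity), ← Real.exp_neg, ← mul_assoc, ← Real.exp_add]
          congr 2
          rw [mul_assoc]
          congr 2
          ring

end

/-! ### Moments of linear statistics -/

/-- The centred and normalized linear statistic of `g`. -/
def flu (ρ g : Torus → ℝ) (N : ℕ) (x : Fin N → Torus) : ℝ :=
  (∑ i, (g (x i) - ∫ y, g y ∂dens ρ)) / √(N : ℝ)

theorem continuous_flu (ρ : Torus → ℝ) {g : Torus → ℝ} (hg : Continuous g) (N : ℕ) :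
    Continuous (flu ρ g N) := by
  unfold flu
  fun_prop

theorem integrable_pi_of_continuous {N : ℕ} {f : (Fin N → Torus) → ℝ} (hf : Continuous f)
    (m : Measure (Fin N → Torus)) [IsFiniteMeasure m] : Integrable f m :=
  hf.integrable_of_hasCompactSupport (HasCompactSupport.of_compactSpace _)

theorem pow_le_factorial_mul_exp (s : ℝ) (n : ℕ) :
    s ^ (2 * n) ≤ (2 * n).factorial * (Real.exp s + Real.exp (-s)) := by
  have h1 := Real.pow_div_factorial_le_exp |s| (abs_nonneg s) (2 * n)
  have h2 : |s| ^ (2 * n) = s ^ (2 * n) := by rw [pow_mul, sq_abs, ← pow_mul]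
  rw [h2, div_le_iff₀' (by positivity)] at h1
  refine h1.trans ?_
  gcongr
  rcases abs_cases s with h | h
  · rw [h.1]; linarith [Real.exp_pos (-s)]
  · rw [h.1]; linarith [Real.exp_pos s]

section
variable {β : ℝ} {V V₁ ρ ρ₁ ρ₂ w w₁ : Torus → ℝ}

/-- Hoeffding's lemma makes each centred summand sub-Gaussian with parameter `1`, so the normalized
sum has exponential moments bounded uniformly in `N`, and these dominate every even power. -/
theorem EqDensity.iid_moment (E : EqDensity β V V₁ ρ ρ₁ ρ₂ w w₁) {g : Torus → ℝ}
    (hg : Continuous g) (hg1 : ∀ x, |g x| ≤ 1) {N : ℕ} (hN : 1 ≤ N) (n : ℕ) :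
    ∫ x, flu ρ g N x ^ (2 * n) ∂(Measure.pi fun _ => dens ρ) ≤
      (2 * n).factorial * (2 * Real.exp (1 / 2)) := by
  have := E.isProb
  have hNp : (0 : ℝ) < N := by exact_mod_cast hN
  set Q := Measure.pi fun _ : Fin N => dens ρ with hQ
  have hmean : ∀ i : Fin N, ∫ x : Fin N → Torus, g (x i) ∂Q = ∫ y, g y ∂dens ρ := fun i => by
    have := (measurePreserving_eval (fun _ : Fin N => dens ρ) i)
    conv_rhs => rw [← this.map_eq, integral_map (measurable_pi_apply i).aemeasurable
      hg.aestronglyMeasurable]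
  have hsub : ∀ i : Fin N, HasSubgaussianMGF
      (fun x : Fin N → Torus => g (x i) - ∫ y, g y ∂dens ρ) 1 Q := by
    intro i
    have h := hasSubgaussianMGF_of_mem_Icc (μ := Q) (X := fun x : Fin N → Torus => g (x i))
      (a := -1) (b := 1) (hg.comp (continuous_apply i)).measurable.aemeasurable
      (ae_of_all _ fun x => abs_le.1 (hg1 (x i)))
    rw [hmean i] at h
    have e : ((‖(1 : ℝ) - (-1)‖₊ / 2) ^ 2 : NNReal) = 1 := by
      have : ‖(1 : ℝ) - (-1)‖₊ = 2 := by
        ext; simp; norm_num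
      rw [this]; simp
    rwa [e] at h
  have hind : iIndepFun (fun (i : Fin N) (x : Fin N → Torus) => g (x i) - ∫ y, g y ∂dens ρ) Q :=
    iIndepFun_pi (X := fun _ y => g y - ∫ y, g y ∂dens ρ)
      fun _ => (hg.sub continuous_const).measurable.aemeasurable
  have hsum := HasSubgaussianMGF.sum_of_iIndepFun hind (s := Finset.univ) (c := fun _ => 1)
    fun i _ => hsub i
  have hexp : ∀ t : ℝ, t ^ 2 = 1 → ∫ x, Real.exp (t * flu ρ g N x) ∂Q ≤ Real.exp (1 / 2) := by
    intro t ht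
    have h := hsum.mgf_le (t / √N)
    have e : ((∑ _i : Fin N, (1 : NNReal) : NNReal) : ℝ) * (t / √N) ^ 2 / 2 = 1 / 2 := by
      rw [div_pow, ht, Real.sq_sqrt hNp.le]; simp; field_simp
    rw [e, mgf] at h
    refine le_trans (le_of_eq (integral_congr_ae (ae_of_all _ fun x => ?_))) h
    simp only [flu]
    congr 1; ring
  have hc := continuous_flu ρ hg N
  have i1 : Integrable (fun x => Real.exp (flu ρ g N x)) Q :=
    integrable_pi_of_continuous (by fun_prop) _
  have i2 : Integrable (fun x => Real.exp (-flu ρ g N x)) Q :=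
    integrable_pi_of_continuous (by fun_prop) _
  calc ∫ x, flu ρ g N x ^ (2 * n) ∂Q
      ≤ ∫ x, (2 * n).factorial * (Real.exp (flu ρ g N x) + Real.exp (-flu ρ g N x)) ∂Q :=
        integral_mono (integrable_pi_of_continuous (by fun_prop) _)
          (integrable_pi_of_continuous (by fun_prop) _) fun x => pow_le_factorial_mul_exp _ _
    _ = (2 * n).factorial * (∫ x, Real.exp (flu ρ g N x) ∂Q + ∫ x, Real.exp (-flu ρ g N x) ∂Q) := by
        rw [integral_const_mul, integral_add i1 i2]
    _ ≤ _ := by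
        have h1 := hexp 1 (by norm_num)
        have h2 := hexp (-1) (by norm_num)
        simp only [one_mul, neg_mul] at h1 h2
        gcongr
        linarith

/-- The factor `N^β` in the comparison with the product measure is beaten by a sufficiently high
moment of the independent variables, at the price of `N^δ`. -/
theorem EqDensity.exists_gibbs_moment_of_le_one (hβ : 0 < β)
    (E : EqDensity β V V₁ ρ ρ₁ ρ₂ w w₁) {δ : ℝ} (hδ : 0 < δ) :
    ∃ C : ℝ, 0 < C ∧ ∀ N : ℕ, 1 ≤ N → ∀ g : Torus → ℝ, Continuous g → (∀ x, |g x| ≤ 1) →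
      ∫ x, flu ρ g N x ^ 4 ∂gibbs β V N ≤ C * (N : ℝ) ^ δ := by
  have := E.isProb
  obtain ⟨C, hC, hle⟩ := E.exists_gibbs_le hβ
  -- With `p δ ≥ β` the threshold `T = N^δ` satisfies `T^p ≥ N^β`.
  obtain ⟨p, hp⟩ := exists_nat_ge (β / δ)
  rw [div_le_iff₀ hδ] at hp
  set K : ℝ := (2 * (2 * (p + 1))).factorial * (2 * Real.exp (1 / 2)) with hK
  have hK0 : 0 ≤ K := by positivity
  refine ⟨1 + C * K, by positivity, fun N hN g hg hg1 => ?_⟩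
  obtain ⟨hPr, hdom⟩ := hle N hN
  have hN1 : (1 : ℝ) ≤ N := by exact_mod_cast hN
  have hNp : (0 : ℝ) < N := by linarith
  set T : ℝ := (N : ℝ) ^ δ with hT
  have hT1 : 1 ≤ T := Real.one_le_rpow hN1 hδ.le
  have hTp : 0 < T := by linarith
  have hTb : (N : ℝ) ^ β ≤ T ^ p := by
    rw [hT, ← Real.rpow_mul_natCast hNp.le]
    exact Real.rpow_le_rpow_of_exponent_le hN1 (by linarith)
  have hc := continuous_flu ρ hg N
  -- Below the threshold the fourth power is at most `T`; above it, Markov's factor `(s⁴ / T)^p ≥ 1`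
  -- may be inserted.
  have hpt : ∀ x, flu ρ g N x ^ 4 ≤ T + flu ρ g N x ^ (2 * (2 * (p + 1))) / T ^ p := by
    intro x
    set s := flu ρ g N x
    have e : s ^ (2 * (2 * (p + 1))) = s ^ 4 * (s ^ 4) ^ p := by ring
    have h4 : 0 ≤ s ^ 4 := by positivity
    rw [e]
    rcases le_total (s ^ 4) T with h | h
    · have : 0 ≤ s ^ 4 * (s ^ 4) ^ p / T ^ p := by positivity
      linarith
    · have : s ^ 4 ≤ s ^ 4 * (s ^ 4) ^ p / T ^ p := by
        rw [le_div_iff₀ (by positivity)]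
        gcongr
      linarith
  have hmom : ∫ x, flu ρ g N x ^ (2 * (2 * (p + 1))) ∂gibbs β V N ≤ C * (N : ℝ) ^ β * K := by
    have h1 := integral_mono_measure (f := fun x => flu ρ g N x ^ (2 * (2 * (p + 1)))) hdom
      (ae_of_all _ fun x => by
        change 0 ≤ flu ρ g N x ^ (2 * (2 * (p + 1)))
        rw [pow_mul]; positivity)
      ((integrable_pi_of_continuous (by fun_prop) _).smul_measure ENNReal.ofReal_ne_top)
    rw [integral_smul_measure, ENNReal.toReal_ofReal (by positivity), smul_eq_mul] at h1
    refine h1.trans ?_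
    gcongr
    exact E.iid_moment hg hg1 hN _
  calc ∫ x, flu ρ g N x ^ 4 ∂gibbs β V N
      ≤ ∫ x, (T + flu ρ g N x ^ (2 * (2 * (p + 1))) / T ^ p) ∂gibbs β V N :=
        integral_mono (integrable_pi_of_continuous (by fun_prop) _)
          (integrable_pi_of_continuous (by fun_prop) _) hpt
    _ = T + (∫ x, flu ρ g N x ^ (2 * (2 * (p + 1))) ∂gibbs β V N) / T ^ p := by
        rw [integral_add (integrable_const _) (integrable_pi_of_continuous (by fun_prop) _),
          integral_div]
        simp
    _ ≤ T + C * (N : ℝ) ^ β * K / T ^ p := by gcongr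
    _ ≤ T + C * T ^ p * K / T ^ p := by gcongr
    _ = T + C * K := by field_simp
    _ ≤ (1 + C * K) * T := by nlinarith [mul_nonneg hC.le hK0]

theorem flu_const_mul (ρ g : Torus → ℝ) (M : ℝ) (N : ℕ) (x : Fin N → Torus) :
    flu ρ (fun y => M * g y) N x = M * flu ρ g N x := by
  simp only [flu, integral_const_mul, ← mul_sub, ← Finset.mul_sum, mul_div_assoc]

/-- Fourth moments of linear statistics grow slower than any power of `N`. -/
theorem EqDensity.exists_gibbs_moment (hβ : 0 < β)
    (E : EqDensity β V V₁ ρ ρ₁ ρ₂ w w₁) {δ : ℝ} (hδ : 0 < δ) {M : ℝ} (hM : 0 < M) :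
    ∃ C : ℝ, 0 < C ∧ ∀ N : ℕ, 1 ≤ N → ∀ g : Torus → ℝ, Continuous g → (∀ x, |g x| ≤ M) →
      ∫ x, flu ρ g N x ^ 4 ∂gibbs β V N ≤ C * (N : ℝ) ^ δ := by
  obtain ⟨C, hC, h⟩ := E.exists_gibbs_moment_of_le_one hβ hδ
  refine ⟨M ^ 4 * C, by positivity, fun N hN g hg hgM => ?_⟩
  have h1 := h N hN (fun y => M⁻¹ * g y) (by fun_prop) fun x => by
    rw [abs_mul, abs_of_pos (inv_pos.2 hM), inv_mul_le_iff₀ hM]; simpa using hgM x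
  have e : ∀ x, flu ρ g N x ^ 4 = M ^ 4 * flu ρ (fun y => M⁻¹ * g y) N x ^ 4 := fun x => by
    rw [flu_const_mul]; field_simp
  simp only [e, integral_const_mul, mul_assoc]
  gcongr

/-- The fluctuation of a Fourier mode of the empirical measure. -/
def modeFlu (ρ : Torus → ℝ) (k : ℤ) (N : ℕ) (x : Fin N → Torus) : ℂ :=
  (∑ i, ex k (x i)) / N - conj (fc ρ k)

theorem continuous_modeFlu (ρ : Torus → ℝ) (k : ℤ) (N : ℕ) : Continuous (modeFlu ρ k N) := by
  unfold modeFlu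
  have := continuous_ex k
  fun_prop

theorem EqDensity.norm_modeFlu_sq (E : EqDensity β V V₁ ρ ρ₁ ρ₂ w w₁) {N : ℕ} (hN : 1 ≤ N) (k : ℤ)
    (x : Fin N → Torus) : ‖modeFlu ρ k N x‖ ^ 2 =
      (flu ρ (fun y => (ex k y).re) N x ^ 2 + flu ρ (fun y => (ex k y).im) N x ^ 2) / N := by
  have := E.isProb
  have hNp : (0 : ℝ) < N := by exact_mod_cast hN
  have hI : ∫ y, ex k y ∂dens ρ = conj (fc ρ k) := by
    rw [integral_ex_measure, dens,
      mc_withDensity E.ρ_cont.measurable.aemeasurable fun x => (E.ρ_pos x).le]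
  have hi : Integrable (ex k) (dens ρ) :=
    (continuous_ex k).integrable_of_hasCompactSupport (HasCompactSupport.of_compactSpace _)
  have hre : (modeFlu ρ k N x).re = flu ρ (fun y => (ex k y).re) N x / √N := by
    rw [flu, div_div, Real.mul_self_sqrt hNp.le, Finset.sum_sub_distrib, sub_div, modeFlu, ← hI,
      Complex.sub_re, Complex.div_natCast_re, Complex.re_sum]
    congr 1
    have : ∫ y, (ex k y).re ∂dens ρ = (∫ y, ex k y ∂dens ρ).re := integral_re hi
    rw [this]; simp; field_simp
  have him : (modeFlu ρ k N x).im = flu ρ (fun y => (ex k y).im) N x / √N := by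
    rw [flu, div_div, Real.mul_self_sqrt hNp.le, Finset.sum_sub_distrib, sub_div, modeFlu, ← hI,
      Complex.sub_im, Complex.div_natCast_im, Complex.im_sum]
    congr 1
    have : ∫ y, (ex k y).im ∂dens ρ = (∫ y, ex k y ∂dens ρ).im := integral_im hi
    rw [this]; simp; field_simp
  rw [Complex.sq_norm, Complex.normSq_apply, hre, him, ← sq, ← sq, div_pow, div_pow,
    Real.sq_sqrt hNp.le]
  ring

theorem EqDensity.exists_modeFlu_moment (hβ : 0 < β)
    (E : EqDensity β V V₁ ρ ρ₁ ρ₂ w w₁) {δ : ℝ} (hδ : 0 < δ) :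
    ∃ C : ℝ, 0 < C ∧ ∀ N : ℕ, 1 ≤ N → ∀ k : ℤ,
      ∫ x, ‖modeFlu ρ k N x‖ ^ 4 ∂gibbs β V N ≤ C * (N : ℝ) ^ δ / N ^ 2 := by
  obtain ⟨C, hC, h⟩ := E.exists_gibbs_moment hβ hδ one_pos
  obtain ⟨_, _, hle⟩ := E.exists_gibbs_le hβ
  refine ⟨4 * C, by positivity, fun N hN k => ?_⟩
  obtain ⟨hPr, -⟩ := hle N hN
  have hNp : (0 : ℝ) < N := by exact_mod_cast hN
  have c1 := continuous_flu ρ (continuous_re_ex k) N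
  have c2 := continuous_flu ρ (continuous_im_ex k) N
  have hpt : ∀ x, ‖modeFlu ρ k N x‖ ^ 4 ≤
      2 / N ^ 2 * (flu ρ (fun y => (ex k y).re) N x ^ 4 + flu ρ (fun y => (ex k y).im) N x ^ 4) := by
    intro x
    have e : ‖modeFlu ρ k N x‖ ^ 4 = (‖modeFlu ρ k N x‖ ^ 2) ^ 2 := by ring
    rw [e, E.norm_modeFlu_sq hN, div_pow, div_mul_eq_mul_div]
    gcongr
    nlinarith [sq_nonneg (flu ρ (fun y => (ex k y).re) N x ^ 2 -
      flu ρ (fun y => (ex k y).im) N x ^ 2)]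
  have hcm := continuous_modeFlu ρ k N
  calc _ ≤ _ := integral_mono (integrable_pi_of_continuous (by fun_prop) _)
        (integrable_pi_of_continuous (by fun_prop) _) hpt
    _ = 2 / N ^ 2 * (∫ x, flu ρ (fun y => (ex k y).re) N x ^ 4 ∂gibbs β V N +
        ∫ x, flu ρ (fun y => (ex k y).im) N x ^ 4 ∂gibbs β V N) := by
        rw [integral_const_mul, integral_add (integrable_pi_of_continuous (by fun_prop) _)
          (integrable_pi_of_continuous (by fun_prop) _)]
    _ ≤ 2 / N ^ 2 * (C * (N : ℝ) ^ δ + C * (N : ℝ) ^ δ) := by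
        gcongr
        · exact h N hN _ (continuous_re_ex k) (abs_re_ex_le k)
        · exact h N hN _ (continuous_im_ex k) (abs_im_ex_le k)
    _ = _ := by ring

end

/-! ### The interaction kernel `(u(x) - u(y)) / tan ((x - y) / 2)` -/

/-- The bilinear form in Fourier modes of the kernel `(e^{inx} - e^{iny}) / tan ((x - y) / 2)`. -/
def bil (n : ℕ) (a b : ℕ → ℂ) : ℂ :=
  Complex.I * ∑ j ∈ Finset.range n, (a (j + 1) * b (n - 1 - j) + a j * b (n - 1 - j + 1))

theorem norm_bil_le (n : ℕ) (a b : ℕ → ℂ) : ‖bil n a b‖ ≤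
    ∑ j ∈ Finset.range n, (‖a (j + 1)‖ * ‖b (n - 1 - j)‖ + ‖a j‖ * ‖b (n - 1 - j + 1)‖) := by
  rw [bil, norm_mul, Complex.norm_I, one_mul]
  refine (norm_sum_le _ _).trans (Finset.sum_le_sum fun j _ => ?_)
  refine (norm_add_le _ _).trans ?_
  simp only [norm_mul, le_refl]

theorem norm_bil_le_of_le (n : ℕ) {a b : ℕ → ℂ} {M : ℝ} (ha : ∀ k, ‖a k‖ ≤ M) (hb : ∀ k, ‖b k‖ ≤ M) :
    ‖bil n a b‖ ≤ 2 * M ^ 2 * n := by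
  have hM : 0 ≤ M := (norm_nonneg _).trans (ha 0)
  refine (norm_bil_le n a b).trans ?_
  calc _ ≤ ∑ j ∈ Finset.range n, (2 * M ^ 2) := by
        refine Finset.sum_le_sum fun j _ => ?_
        have h1 := mul_le_mul (ha (j + 1)) (hb (n - 1 - j)) (norm_nonneg _) hM
        have h2 := mul_le_mul (ha j) (hb (n - 1 - j + 1)) (norm_nonneg _) hM
        linarith
    _ = _ := by simp; ring

theorem bil_comm (n : ℕ) (a b : ℕ → ℂ) : bil n a b = bil n b a := by
  rw [bil, bil, ← Finset.sum_range_reflect]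
  congr 1
  refine Finset.sum_congr rfl fun j hj => ?_
  have hj := Finset.mem_range.1 hj
  have e : n - 1 - (n - 1 - j) = j := by omega
  rw [e]; ring

theorem bil_sub_sub (n : ℕ) (a c : ℕ → ℂ) :
    bil n (fun k => a k - c k) (fun k => a k - c k) = bil n a a - 2 * bil n a c + bil n c c := by
  have h : bil n (fun k => a k - c k) (fun k => a k - c k)
      = bil n a a - bil n a c - bil n c a + bil n c c := by
    simp only [bil, ← mul_sub, ← mul_add, ← Finset.sum_sub_distrib, ← Finset.sum_add_distrib]
    congr 1
    refine Finset.sum_congr rfl fun j _ => ?_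
    ring
  rw [h, bil_comm n c a]; ring

theorem bil_sum_right {ι : Type*} (s : Finset ι) (n : ℕ) (a : ℕ → ℂ) (b : ι → ℕ → ℂ) :
    bil n a (fun k => ∑ i ∈ s, b i k) = ∑ i ∈ s, bil n a (b i) := by
  simp only [bil, ← Finset.mul_sum]
  rw [Finset.sum_comm]
  congr 1
  refine Finset.sum_congr rfl fun j _ => ?_
  rw [Finset.mul_sum, Finset.mul_sum, ← Finset.sum_add_distrib]

theorem bil_sum_left {ι : Type*} (s : Finset ι) (n : ℕ) (a : ι → ℕ → ℂ) (b : ℕ → ℂ) :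
    bil n (fun k => ∑ i ∈ s, a i k) b = ∑ i ∈ s, bil n (a i) b := by
  rw [bil_comm, bil_sum_right]
  exact Finset.sum_congr rfl fun i _ => bil_comm _ _ _

theorem bil_div_right (n : ℕ) (a b : ℕ → ℂ) (z : ℂ) :
    bil n a (fun k => b k / z) = bil n a b / z := by
  simp only [bil, mul_div_assoc, Finset.sum_div, add_div]

theorem bil_div_left (n : ℕ) (a b : ℕ → ℂ) (z : ℂ) :
    bil n (fun k => a k / z) b = bil n a b / z := by
  rw [bil_comm, bil_div_right, bil_comm]

/-- The nonnegative Fourier modes of a point. -/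
def modes (x : Torus) (k : ℕ) : ℂ := ex k x

theorem norm_modes (x : Torus) (k : ℕ) : ‖modes x k‖ ≤ 1 := (norm_ex _ _).le

/-- The factorization of `a^n - b^n` as a geometric sum removes the pole of the cotangent. Each mode
of `u` thus contributes a finite bilinear expression in the modes of the two points, of size `O(n)`.
-/
theorem bil_modes {x y : Torus} (h : x ≠ y) (n : ℕ) :
    bil n (modes x) (modes y) = (ex n x - ex n y) * (cotHalf (x - y) : ℂ) := by
  have h1 := cotHalf_mul (sub_ne_zero.2 h)
  have hxy : ex 1 (x - y) * ex 1 y = ex 1 x := by rw [← ex_add]; simp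
  have h2 : (cotHalf (x - y) : ℂ) * (ex 1 x - ex 1 y) = Complex.I * (ex 1 x + ex 1 y) := by
    calc (cotHalf (x - y) : ℂ) * (ex 1 x - ex 1 y)
        = (cotHalf (x - y) : ℂ) * (ex 1 (x - y) - 1) * ex 1 y := by rw [← hxy]; ring
      _ = _ := by rw [h1, ← hxy]; ring
  have h3 := geom_sum₂_mul (ex 1 x) (ex 1 y) n
  rw [ex_natCast, ex_natCast, ← h3, mul_assoc, mul_comm _ (cotHalf (x - y) : ℂ), h2, bil,
    mul_comm _ (Complex.I * _), mul_assoc]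
  congr 1
  rw [Finset.mul_sum]
  refine Finset.sum_congr rfl fun j _ => ?_
  simp only [modes, ex_natCast]
  ring

/-- The quadratic form of the interaction kernel. -/
def kerForm (u : Torus → ℝ) (a b : ℕ → ℂ) : ℝ := ∑' n : ℕ, 2 * (fc u n * bil n a b).re

theorem abs_kerForm_term_le (u : Torus → ℝ) (n : ℕ) {a b : ℕ → ℂ} {M : ℝ} (ha : ∀ k, ‖a k‖ ≤ M)
    (hb : ∀ k, ‖b k‖ ≤ M) :
    |2 * (fc u n * bil n a b).re| ≤ 4 * M ^ 2 * (n * ‖fc u n‖) := by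
  rw [abs_mul, abs_two]
  have h1 := Complex.abs_re_le_norm (fc u n * bil n a b)
  rw [norm_mul] at h1
  have h2 := mul_le_mul_of_nonneg_left (norm_bil_le_of_le n ha hb) (norm_nonneg (fc u n))
  nlinarith

theorem hasSum_kerForm {u : Torus → ℝ} (hu : Summable fun n : ℕ => n * ‖fc u n‖) {a b : ℕ → ℂ}
    {M : ℝ} (ha : ∀ k, ‖a k‖ ≤ M) (hb : ∀ k, ‖b k‖ ≤ M) :
    HasSum (fun n : ℕ => 2 * (fc u n * bil n a b).re) (kerForm u a b) :=
  (Summable.of_norm_bounded (hu.mul_left (4 * M ^ 2)) fun n =>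
    abs_kerForm_term_le u n ha hb).hasSum

theorem abs_kerForm_le {u : Torus → ℝ} (hu : Summable fun n : ℕ => n * ‖fc u n‖) {a b : ℕ → ℂ}
    {M : ℝ} (ha : ∀ k, ‖a k‖ ≤ M) (hb : ∀ k, ‖b k‖ ≤ M) :
    |kerForm u a b| ≤ 4 * M ^ 2 * ∑' n : ℕ, (n * ‖fc u n‖) := by
  rw [kerForm, ← Real.norm_eq_abs]
  exact tsum_of_norm_bounded (hu.hasSum.mul_left (4 * M ^ 2)) fun n => abs_kerForm_term_le u n ha hb

/-- The frequencies `n` and `-n` are conjugate, whence twice the real part over natural indices. On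
the diagonal `kerForm` is still a convergent series, whereas the right side would be `0` by the
default value of `cotHalf`; hence the restriction to distinct points. -/
theorem kerForm_modes {u : Torus → ℝ} (huc : Continuous u) (hu1 : Summable fun k : ℤ => ‖fc u k‖)
    {x y : Torus} (h : x ≠ y) :
    kerForm u (modes x) (modes y) = (u x - u y) * cotHalf (x - y) := by
  have h1 := ((hasSum_fc huc hu1 x).sub (hasSum_fc huc hu1 y)).nat_add_neg
  have h2 := (h1.mul_right (cotHalf (x - y) : ℂ))
  have h3 := (Complex.hasSum_re h2).tsum_eq
  simp only [ex_zero_index, sub_self, add_zero] at h3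
  have h4 : (((u x : ℂ) - (u y : ℂ)) * (cotHalf (x - y) : ℂ)).re = (u x - u y) * cotHalf (x - y) := by
    rw [← Complex.ofReal_sub, ← Complex.ofReal_mul, Complex.ofReal_re]
  rw [h4] at h3
  rw [← h3, kerForm]
  refine tsum_congr fun n => ?_
  rw [bil_modes h, fc_neg_index, ex_neg_index, ex_neg_index]
  set p := fc u n * ex n x - fc u n * ex n y with hp
  have e1 : conj (fc u n) * conj (ex n x) - conj (fc u n) * conj (ex n y) = conj p := by
    rw [hp]; simp
  have e2 : fc u n * ((ex n x - ex n y) * (cotHalf (x - y) : ℂ)) = p * (cotHalf (x - y) : ℂ) := by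
    rw [hp]; ring
  rw [e1, e2, Complex.re_mul_ofReal, Complex.re_mul_ofReal, Complex.add_re, Complex.conj_re]
  ring

section
variable {β : ℝ} {V V₁ ρ ρ₁ ρ₂ w w₁ : Torus → ℝ}

/-- The nonnegative Fourier modes of the equilibrium measure. -/
def eqModes (ρ : Torus → ℝ) (k : ℕ) : ℂ := conj (fc ρ k)

theorem EqDensity.norm_eqModes (E : EqDensity β V V₁ ρ ρ₁ ρ₂ w w₁) (k : ℕ) : ‖eqModes ρ k‖ ≤ 1 := by
  have := E.isProb
  rw [eqModes, Complex.norm_conj,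
    ← mc_withDensity E.ρ_cont.measurable.aemeasurable fun x => (E.ρ_pos x).le]
  exact norm_mc_le (dens ρ) k

theorem EqDensity.integral_modes (E : EqDensity β V V₁ ρ ρ₁ ρ₂ w w₁) (k : ℕ) :
    ∫ y, modes y k ∂dens ρ = eqModes ρ k := by
  simp only [modes]
  rw [integral_ex_measure, dens,
      mc_withDensity E.ρ_cont.measurable.aemeasurable fun x => (E.ρ_pos x).le, eqModes]

theorem continuous_modes (k : ℕ) : Continuous fun y => modes y k := continuous_ex k

theorem EqDensity.integral_bil (E : EqDensity β V V₁ ρ ρ₁ ρ₂ w w₁) (n : ℕ) (a : ℕ → ℂ) :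
    ∫ y, bil n a (modes y) ∂dens ρ = bil n a (eqModes ρ) := by
  have := E.isProb
  have hi : ∀ (z : ℂ) (k : ℕ), Integrable (fun y => z * modes y k) (dens ρ) := fun z k =>
    (continuous_const.mul (continuous_modes k)).integrable_of_hasCompactSupport
      (HasCompactSupport.of_compactSpace _)
  simp only [bil]
  have hi2 : ∀ j ∈ Finset.range n, Integrable (fun y => a (j + 1) * modes y (n - 1 - j) +
      a j * modes y (n - 1 - j + 1)) (dens ρ) := fun j _ => (hi _ _).add (hi _ _)
  rw [integral_const_mul, integral_finsetSum _ hi2]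
  congr 1
  refine Finset.sum_congr rfl fun j _ => ?_
  rw [integral_add (hi _ _) (hi _ _), integral_const_mul, integral_const_mul, E.integral_modes,
    E.integral_modes]

theorem continuous_bil_modes (n : ℕ) (a : ℕ → ℂ) : Continuous fun y => bil n a (modes y) := by
  unfold bil
  have := continuous_modes
  fun_prop

theorem EqDensity.integral_kerForm (E : EqDensity β V V₁ ρ ρ₁ ρ₂ w w₁) {u : Torus → ℝ}
    (hu : Summable fun n : ℕ => n * ‖fc u n‖) {a : ℕ → ℂ} (ha : ∀ k, ‖a k‖ ≤ 1) :
    ∫ y, kerForm u a (modes y) ∂dens ρ = kerForm u a (eqModes ρ) := by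
  have := E.isProb
  have hc : ∀ n : ℕ, Continuous fun y => 2 * (fc u n * bil n a (modes y)).re := fun n => by
    have := continuous_bil_modes n a
    exact continuous_const.mul (Complex.continuous_re.comp (continuous_const.mul this))
  have h := hasSum_integral_of_summable_integral_norm (μ := dens ρ)
    (F := fun (n : ℕ) y => 2 * (fc u n * bil n a (modes y)).re)
    (fun n => integrable_of_continuous (hc n) _)
    (by
      refine Summable.of_nonneg_of_le (fun n => integral_nonneg fun y => norm_nonneg _) (fun n => ?_)
        (hu.mul_left (4 * 1 ^ 2))
      calc ∫ y, ‖2 * (fc u n * bil n a (modes y)).re‖ ∂dens ρ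
          ≤ ∫ _y, 4 * 1 ^ 2 * (n * ‖fc u n‖) ∂dens ρ :=
            integral_mono (integrable_of_continuous (hc n).norm _) (integrable_const _)
              fun y => abs_kerForm_term_le u n ha (norm_modes y)
        _ = _ := by simp)
  have h2 : ∀ n : ℕ, ∫ y, 2 * (fc u n * bil n a (modes y)).re ∂dens ρ
      = 2 * (fc u n * bil n a (eqModes ρ)).re := by
    intro n
    have hi : Integrable (fun y => fc u n * bil n a (modes y)) (dens ρ) :=
      (continuous_const.mul (continuous_bil_modes n a)).integrable_of_hasCompactSupport
        (HasCompactSupport.of_compactSpace _)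
    have h3 : ∫ y, (fc u n * bil n a (modes y)).re ∂dens ρ
        = (∫ y, fc u n * bil n a (modes y) ∂dens ρ).re := integral_re hi
    rw [integral_const_mul, h3, integral_const_mul, E.integral_bil]
  simp only [h2] at h
  exact h.tsum_eq.symm

theorem continuous_kerForm_modes {u : Torus → ℝ} (hu : Summable fun n : ℕ => n * ‖fc u n‖)
    {a : ℕ → ℂ} (ha : ∀ k, ‖a k‖ ≤ 1) : Continuous fun y => kerForm u a (modes y) := by
  unfold kerForm
  refine continuous_tsum (fun n => ?_) (hu.mul_left (4 * 1 ^ 2)) fun n y =>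
    abs_kerForm_term_le u n ha (norm_modes y)
  exact continuous_const.mul (Complex.continuous_re.comp
    (continuous_const.mul (continuous_bil_modes n a)))

theorem kerForm_comm (u : Torus → ℝ) (a b : ℕ → ℂ) : kerForm u a b = kerForm u b a := by
  simp only [kerForm, bil_comm _ a b]

/-- Bilinearity, applied to the empirical modes minus the equilibrium modes. The identity is checked
mode by mode and summed, every series involved being absolutely convergent. -/
theorem EqDensity.kerForm_modeFlu (E : EqDensity β V V₁ ρ ρ₁ ρ₂ w w₁) {u : Torus → ℝ}
    (hu : Summable fun n : ℕ => n * ‖fc u n‖) {N : ℕ} (x : Fin N → Torus) :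
    kerForm u (fun k => modeFlu ρ k N x) (fun k => modeFlu ρ k N x) =
      (∑ i, ∑ j, kerForm u (modes (x i)) (modes (x j))) / N ^ 2
        - 2 * (∑ i, kerForm u (modes (x i)) (eqModes ρ)) / N
        + kerForm u (eqModes ρ) (eqModes ρ) := by
  have h1 : HasSum _ (∑ i, ∑ j, kerForm u (modes (x i)) (modes (x j))) :=
    hasSum_sum (s := Finset.univ) fun (i : Fin N) _ => hasSum_sum (s := Finset.univ)
      fun (j : Fin N) _ => hasSum_kerForm hu (norm_modes (x i)) (norm_modes (x j))
  have h2 : HasSum _ (∑ i, kerForm u (modes (x i)) (eqModes ρ)) :=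
    hasSum_sum (s := Finset.univ) fun (i : Fin N) _ =>
      hasSum_kerForm hu (norm_modes (x i)) E.norm_eqModes
  have h3 := hasSum_kerForm hu E.norm_eqModes E.norm_eqModes
  have h := ((h1.div_const ((N : ℝ) ^ 2)).sub ((h2.mul_left 2).div_const (N : ℝ))).add h3
  rw [← h.tsum_eq, kerForm]
  refine tsum_congr fun n => ?_
  have e1 : (fun k : ℕ => modeFlu ρ k N x)
      = fun k => (∑ i, modes (x i) k) / N - eqModes ρ k := rfl
  rw [e1, bil_sub_sub, bil_div_right, bil_div_left, bil_div_left, bil_sum_left, bil_sum_left]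
  simp only [bil_sum_right]
  have e2 : fc u n * ((∑ i, ∑ j, bil n (modes (x i)) (modes (x j))) / N / N -
      2 * ((∑ i, bil n (modes (x i)) (eqModes ρ)) / N) + bil n (eqModes ρ) (eqModes ρ)) =
      (∑ i, ∑ j, fc u n * bil n (modes (x i)) (modes (x j))) * (((1 / N ^ 2 : ℝ)) : ℂ)
      - (∑ i, fc u n * bil n (modes (x i)) (eqModes ρ)) * ((2 / N : ℝ) : ℂ)
      + fc u n * bil n (eqModes ρ) (eqModes ρ) := by
    simp only [← Finset.mul_sum]
    push_cast; ring
  rw [e2, Complex.add_re, Complex.sub_re, Complex.re_mul_ofReal, Complex.re_mul_ofReal,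
    Complex.re_sum, Complex.re_sum]
  simp only [Complex.re_sum]
  obtain ⟨A, hA⟩ : ∃ A : Fin N → Fin N → ℝ, ∀ i j,
      (fc u n * bil n (modes (x i)) (modes (x j))).re = A i j := ⟨_, fun _ _ => rfl⟩
  obtain ⟨B, hB⟩ : ∃ B : Fin N → ℝ, ∀ i,
      (fc u n * bil n (modes (x i)) (eqModes ρ)).re = B i := ⟨_, fun _ => rfl⟩
  simp only [hA, hB, ← Finset.mul_sum]
  ring

/-- The symbol `i sign k` is purely imaginary, so the Hilbert transform is antisymmetric. -/
theorem integral_mul_hil {f g : Torus → ℝ} (hf : Continuous f) (hg : Continuous g) (hf' : Hol f)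
    (hg' : Hol g) : ∫ x, f x * hil g x ∂unif = -∫ x, hil f x * g x ∂unif := by
  have h1 := parseval (memLp_of_continuous hf 2) (memLp_of_continuous (continuous_hil hg hg') 2)
  have h2 := (parseval (memLp_of_continuous (continuous_hil hf hf') 2) (memLp_of_continuous hg 2)).neg
  have e : (fun k => conj (fc f k) * fc (hil g) k) = fun k => -(conj (fc (hil f) k) * fc g k) := by
    funext k
    rw [fc_hil hg hg', fc_hil hf hf']
    simp
    ring
  rw [e] at h1
  have := h1.unique h2
  exact_mod_cast this

/-- Averaging the kernel over one variable yields a commutator of the Hilbert transform with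
multiplication by `u`; the subtractions at `x` in the two absolutely convergent integrals cancel. -/
theorem EqDensity.kerForm_eq_hil (E : EqDensity β V V₁ ρ ρ₁ ρ₂ w w₁) {u : Torus → ℝ}
    (huc : Continuous u) (hu1 : Summable fun k : ℤ => ‖fc u k‖)
    (hu : Summable fun n : ℕ => n * ‖fc u n‖) (hv : Hol fun x => ρ x * u x) (x : Torus) :
    kerForm u (modes x) (eqModes ρ) = hil (fun x => ρ x * u x) x - u x * hil ρ x := by
  have hρ := E.ρ_cont
  have hvi : Integrable (fun t => (ρ t * u t - ρ x * u x) * cotHalf (x - t)) unif :=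
    hv.integrable' (hρ.mul huc) x
  rw [← E.integral_kerForm hu (norm_modes x), E.integral_dens, hil, hil, mul_neg,
    ← integral_const_mul, sub_neg_eq_add, neg_add_eq_sub,
    ← integral_sub ((E.ρ_hol.integrable' hρ x).const_mul _)
      hvi]
  refine integral_congr_ae ?_
  filter_upwards [ae_ne x] with t ht
  rw [kerForm_modes huc hu1 ht.symm]
  ring

variable {ψ φ u u₁ u₂ f κ : Torus → ℝ} {c : ℝ}

theorem LinSol.summable_u (L : LinSol β ρ ρ₁ ψ φ u u₁ u₂ f κ c) :
    (Summable fun k : ℤ => ‖fc u k‖) ∧ Summable fun n : ℕ => n * ‖fc u n‖ := by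
  have h1 := L.u_deriv.sqSum L.u₁_deriv.continuous
  have h2 := L.u₁_deriv.sqSum L.u₂_cont
  have h3 := h2.summable_mul_of_deriv fun k => fc_deriv L.u_deriv L.u₁_deriv.continuous k
  refine ⟨h1.summable, ?_⟩
  have h4 := h3.comp_injective Nat.cast_injective
  refine h4.congr fun n => ?_
  simp

theorem LinSol.hol (L : LinSol β ρ ρ₁ ψ φ u u₁ u₂ f κ c) : Hol fun x => ρ x * u x :=
  (L.v_deriv.sqSum L.f_cont).hol L.v_deriv.continuous

/-- The reason for taking `u = φ'`: since `(log ρ)' = -(V' + w')` and `w' = β hil ρ`, the one-body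
drift equals `-ψ`, a constant, and minus the mean field of the kernel. -/
theorem LinSol.drift_eq (E : EqDensity β V V₁ ρ ρ₁ ρ₂ w w₁) (L : LinSol β ρ ρ₁ ψ φ u u₁ u₂ f κ c)
    (x : Torus) :
    u₁ x - u x * V₁ x = -(ψ x + c) - β * kerForm u (modes x) (eqModes ρ) := by
  rw [E.kerForm_eq_hil L.u_deriv.continuous L.summable_u.1 L.summable_u.2 L.hol]
  have h1 := L.eq x
  have h2 := E.ρ₁_eq x
  have h3 := E.w₁_eq x
  have hne := (E.ρ_pos x).ne'
  have h4 : ρ₁ x / ρ x = -(V₁ x + w₁ x) := by rw [h2]; field_simp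
  rw [h4, h3] at h1
  linarith

/-- Integrating the drift equation against `ρ` and using the antisymmetry of the Hilbert transform.
This value is exactly the one that cancels the constant term in the expansion of the double sum
around equilibrium. -/
theorem LinSol.const_eq (E : EqDensity β V V₁ ρ ρ₁ ρ₂ w w₁)
    (L : LinSol β ρ ρ₁ ψ φ u u₁ u₂ f κ c) (hψ : Continuous ψ)
    (hψ0 : ∫ x, ψ x * ρ x ∂unif = 0) :
    c = -(β / 2) * kerForm u (eqModes ρ) (eqModes ρ) := by
  have hρ := E.ρ_cont
  have hu := L.u_deriv.continuous
  have hu₁ := L.u₁_deriv.continuous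
  have hhv := continuous_hil L.v_deriv.continuous L.hol
  have hhρ := continuous_hil hρ E.ρ_hol
  set k₂ := kerForm u (eqModes ρ) (eqModes ρ) with hk₂
  have hk1 : ∫ x, kerForm u (modes x) (eqModes ρ) * ρ x ∂unif = k₂ := by
    rw [← E.integral_dens, hk₂, ← E.integral_kerForm L.summable_u.2 E.norm_eqModes]
    simp only [kerForm_comm u _ (eqModes ρ)]
  have hk2 : k₂ = -2 * ∫ x, (ρ x * u x) * hil ρ x ∂unif := by
    rw [← hk1]
    simp only [E.kerForm_eq_hil hu L.summable_u.1 L.summable_u.2 L.hol]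
    have e : ∀ x, (hil (fun x => ρ x * u x) x - u x * hil ρ x) * ρ x =
        hil (fun x => ρ x * u x) x * ρ x - (ρ x * u x) * hil ρ x := fun x => by ring
    simp only [e]
    have j1 : Integrable (fun x => hil (fun x => ρ x * u x) x * ρ x) unif :=
      integrable_of_continuous (hhv.mul hρ) _
    have j2 : Integrable (fun x => ρ x * u x * hil ρ x) unif :=
      integrable_of_continuous ((hρ.mul hu).mul hhρ) _
    rw [integral_sub j1 j2,
      integral_mul_hil L.v_deriv.continuous hρ L.hol E.ρ_hol]
    ring
  have hkc : Continuous fun x => kerForm u (modes x) (eqModes ρ) := by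
    simp only [kerForm_comm u _ (eqModes ρ)]
    exact continuous_kerForm_modes L.summable_u.2 E.norm_eqModes
  have hpt : ∀ x, f x + β * ((ρ x * u x) * hil ρ x) =
      -(ψ x * ρ x) - c * ρ x - β * (kerForm u (modes x) (eqModes ρ) * ρ x) := by
    intro x
    have h1 := L.drift_eq E x
    have hf : f x = ρ₁ x * u x + ρ x * u₁ x := by
      induction x using QuotientAddGroup.induction_on with
      | H t => exact (L.v_deriv t).unique ((E.ρ_deriv t).mul (L.u_deriv t))
    rw [hf, E.ρ₁_eq, E.w₁_eq]
    linear_combination ρ x * h1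
  have hint := integral_congr_ae (μ := unif) (ae_of_all _ hpt)
  have i1 : Integrable (fun x => ρ x * u x * hil ρ x) unif :=
    integrable_of_continuous ((hρ.mul hu).mul hhρ) _
  have i2 : Integrable (fun x => -(ψ x * ρ x)) unif :=
    integrable_of_continuous (hψ.mul hρ).neg _
  have i3 : Integrable (fun x => c * ρ x) unif := integrable_of_continuous (continuous_const.mul hρ) _
  have i4 : Integrable (fun x => kerForm u (modes x) (eqModes ρ) * ρ x) unif :=
    integrable_of_continuous (hkc.mul hρ) _
  rw [integral_add (integrable_of_continuous L.f_cont _) (i1.const_mul _), integral_const_mul,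
    L.v_deriv.integral_eq_zero L.f_cont, integral_sub (f := fun x => -(ψ x * ρ x) - c * ρ x)
      (i2.sub i3) (i4.const_mul _), integral_sub i2 i3, integral_neg, hψ0, integral_const_mul,
    integral_const_mul, hk1, E.ρ_int] at hint
  linear_combination hint - (β / 2) * hk2

end

/-! ### The loop equation -/

/-- Translation of one coordinate. -/
def shiftAt {N : ℕ} (i : Fin N) (t : ℝ) (x : Fin N → Torus) : Fin N → Torus :=
  x + Pi.single i (t : Torus)

theorem shiftAt_apply {N : ℕ} (i : Fin N) (t : ℝ) (x : Fin N → Torus) (k : Fin N) :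
    shiftAt i t x k = x k + (((if k = i then 1 else 0) * t : ℝ) : Torus) := by
  rw [shiftAt, Pi.add_apply, Pi.single_apply]
  split_ifs <;> simp

theorem shiftAt_zero {N : ℕ} (i : Fin N) (x : Fin N → Torus) : shiftAt i 0 x = x := by
  simp [shiftAt]

theorem shiftAt_shiftAt {N : ℕ} (i : Fin N) (s t : ℝ) (x : Fin N → Torus) :
    shiftAt i s (shiftAt i t x) = shiftAt i (t + s) x := by
  simp only [shiftAt]
  rw [add_assoc, ← Pi.single_add, ← AddCircle.coe_add]

theorem continuous_shiftAt {N : ℕ} (i : Fin N) (t : ℝ) : Continuous (shiftAt i t) := by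
  unfold shiftAt
  fun_prop

/-- The integral of a translate does not depend on the translation, so differentiating in the
translation gives zero. This replaces Fubini and one-dimensional integration by parts. -/
theorem integral_pi_deriv_eq_zero {N : ℕ} (i : Fin N) {G D : (Fin N → Torus) → ℝ}
    (hG : Continuous G) (hD : Continuous D)
    (h : ∀ x, HasDerivAt (fun t : ℝ => G (shiftAt i t x)) (D x) 0) :
    ∫ x, D x ∂(Measure.pi fun _ : Fin N => unif) = 0 := by
  set m := Measure.pi fun _ : Fin N => unif with hm
  obtain ⟨M, hM⟩ := (isCompact_univ (X := Fin N → Torus)).exists_bound_of_continuousOn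
    hD.continuousOn
  have hder : ∀ (x : Fin N → Torus) (t : ℝ), HasDerivAt
      (fun t : ℝ => G (shiftAt i t x)) (D (shiftAt i t x)) t := by
    intro x t
    have h1 : HasDerivAt (fun s : ℝ => G (shiftAt i s (shiftAt i t x)))
        (D (shiftAt i t x)) (t - t) := by
      rw [sub_self]
      exact h (shiftAt i t x)
    have h2 := h1.comp_sub_const t t
    refine h2.congr_of_eventuallyEq (Eventually.of_forall fun s => ?_)
    simp only [shiftAt_shiftAt, add_sub_cancel]
  have key := hasDerivAt_integral_of_dominated_loc_of_deriv_le (μ := m) (𝕜 := ℝ) (x₀ := 0)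
    (F := fun (t : ℝ) x => G (shiftAt i t x))
    (F' := fun (t : ℝ) x => D (shiftAt i t x)) (bound := fun _ => M)
    (Metric.ball_mem_nhds 0 one_pos)
    (Eventually.of_forall fun t => (hG.comp (continuous_shiftAt i t)).aestronglyMeasurable)
    (integrable_pi_of_continuous (hG.comp (continuous_shiftAt i 0)) _)
    (hD.comp (continuous_shiftAt i 0)).aestronglyMeasurable
    (ae_of_all _ fun x t _ => hM _ trivial) (integrable_const _)
    (ae_of_all _ fun x t _ => hder x t)
  have h1 := key.2
  have h2 : (fun t : ℝ => ∫ x, G (shiftAt i t x) ∂m) = fun _ => ∫ x, G x ∂m := by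
    funext t
    exact integral_add_right_eq_self G _
  rw [h2] at h1
  simpa only [shiftAt_zero] using h1.unique (hasDerivAt_const _ _)

/-- The derivative of the regularized logarithm. -/
def dpk (r : ℝ) (z : Torus) : ℝ := -(r * (ex 1 z).im) / (1 - 2 * r * (ex 1 z).re + r ^ 2)

theorem one_sub_pos {r : ℝ} (hr : 0 ≤ r) (hr1 : r < 1) (z : Torus) :
    0 < 1 - 2 * r * (ex 1 z).re + r ^ 2 := by
  rw [← norm_one_sub_sq]
  have := le_norm_one_sub hr z
  have : 0 < ‖1 - (r : ℂ) * ex 1 z‖ := by linarith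
  positivity

theorem hasTDeriv_pk {r : ℝ} (hr : 0 ≤ r) (hr1 : r < 1) : HasTDeriv (pk r) (dpk r) := by
  intro x
  have h0 := one_sub_pos hr hr1 (x : Torus)
  have h1 := (((hasTDeriv_re_ex 1 x).const_mul (2 * r)).const_sub 1).add_const (r ^ 2)
  have h2 := (h1.log h0.ne').const_mul (-(1 / 2))
  refine (h2.congr_of_eventuallyEq (Eventually.of_forall fun t => ?_)).congr_deriv ?_
  · simp only
    rw [pk, ← norm_one_sub_sq, Real.log_pow]
    push_cast; ring
  · rw [dpk]
    push_cast
    field_simp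

theorem continuous_dpk {r : ℝ} (hr : 0 ≤ r) (hr1 : r < 1) : Continuous (dpk r) := by
  have h1 := continuous_re_ex 1
  have h2 := continuous_im_ex 1
  unfold dpk
  exact (continuous_const.mul h2).neg.div (by fun_prop) fun z => (one_sub_pos hr hr1 z).ne'

theorem re_sq_add_im_sq (z : Torus) : (ex 1 z).re ^ 2 + (ex 1 z).im ^ 2 = 1 := by
  have := Complex.sq_norm (ex 1 z)
  rw [norm_ex, Complex.normSq_apply] at this
  nlinarith

/-- From `|Im e^{iz}| ≤ ch z` and `1 - 2r Re e^{iz} + r² ≥ r ch² z`, the defect being `(1 - r)²`.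
Against a function that is Lipschitz for the chord, the regularized force is bounded uniformly in
`r`. -/
theorem abs_dpk_mul_ch_le {r : ℝ} (hr : 0 < r) (hr1 : r < 1) (z : Torus) :
    |dpk r z| * ch z ≤ 1 := by
  have h0 := one_sub_pos hr.le hr1 z
  have hc := ch_nonneg z
  have hsq := ch_sq z
  have h1 := re_sq_add_im_sq z
  have h2 : |(ex 1 z).im| ≤ ch z := by
    refine abs_le_of_sq_le_sq ?_ hc
    have : (ex 1 z).re ≤ 1 := by nlinarith [sq_nonneg (ex 1 z).im]
    nlinarith
  rw [dpk, abs_div, abs_neg, abs_mul, abs_of_pos hr, abs_of_pos h0, div_mul_eq_mul_div,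
    div_le_one h0]
  calc r * |(ex 1 z).im| * ch z ≤ r * ch z * ch z := by gcongr
    _ = r * (2 - 2 * (ex 1 z).re) := by rw [← hsq]; ring
    _ ≤ _ := by nlinarith [sq_nonneg (1 - r)]

theorem cotHalf_eq {z : Torus} (hz : z ≠ 0) : cotHalf z = (ex 1 z).im / (1 - (ex 1 z).re) := by
  have h := congrArg Complex.re (cotHalf_mul hz)
  simp at h
  have h1 := ch_sq z
  have h2 := ch_pos hz
  have h3 : 1 - (ex 1 z).re ≠ 0 := by
    intro h4
    have : ch z ^ 2 = 0 := by rw [h1]; linarith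
    simp at this
    linarith
  rw [eq_div_iff h3]
  linarith

theorem tendsto_dpk {z : Torus} (hz : z ≠ 0) :
    Tendsto (fun r => dpk r z) (𝓝[<] 1) (𝓝 (-(1 / 2) * cotHalf z)) := by
  have h1 := ch_sq z
  have h2 := ch_pos hz
  have h3 : 1 - (ex 1 z).re ≠ 0 := by
    intro h4
    have : ch z ^ 2 = 0 := by rw [h1]; linarith
    simp at this
    linarith
  have hne : 1 - 2 * (1 : ℝ) * (ex 1 z).re + 1 ^ 2 ≠ 0 := by
    intro h
    apply h3
    linarith
  have hc : ContinuousAt (fun r : ℝ => dpk r z) 1 := by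
    unfold dpk
    exact ContinuousAt.div (by fun_prop) (by fun_prop) hne
  have he : dpk 1 z = -(1 / 2) * cotHalf z := by
    rw [cotHalf_eq hz, dpk]
    have : 1 - 2 * (1 : ℝ) * (ex 1 z).re + 1 ^ 2 = 2 * (1 - (ex 1 z).re) := by ring
    rw [this]
    field_simp
  rw [← he]
  exact hc.tendsto.mono_left nhdsWithin_le_nhds

theorem pk_sub_comm (r : ℝ) (x y : Torus) : pk r (x - y) = pk r (y - x) := by
  have h1 : ex 1 (y - x) = conj (ex 1 (x - y)) := by rw [← neg_sub, ex_neg]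
  simp only [pk]
  rw [h1, ← Complex.norm_conj]; simp

/-- The logarithm of the regularized Gibbs weight. -/
def regLog (β : ℝ) (V : Torus → ℝ) (r : ℝ) (N : ℕ) (x : Fin N → Torus) : ℝ :=
  -(β / N) * ∑ k, ∑ l, pk r (x k - x l) + β * pk r 0 - ∑ k, V (x k)

/-- The definition sums over all pairs, diagonal included, which is convenient for differentiation;
the term `β pk r 0` compensates for the diagonal, so that only distinct pairs remain, as in the
Gibbs weight. -/
theorem regLog_eq (β : ℝ) (V : Torus → ℝ) (r : ℝ) {N : ℕ} (hN : 1 ≤ N) (x : Fin N → Torus) :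
    regLog β V r N x = -(2 * β / N) * ∑ k, ∑ l ∈ Finset.Ioi k, pk r (x k - x l) - ∑ k, V (x k) := by
  have hNp : (N : ℝ) ≠ 0 := by
    have : (0 : ℝ) < N := by exact_mod_cast hN
    exact this.ne'
  rw [regLog, sum_sum_eq_diag_add (fun k l => pk r (x k - x l)) fun k l => pk_sub_comm r _ _]
  simp only [sub_self, Finset.sum_const, Finset.card_univ, Fintype.card_fin, nsmul_eq_mul]
  field_simp
  ring

theorem continuous_regLog (β : ℝ) {V : Torus → ℝ} (hV : Continuous V) {r : ℝ} (hr : 0 ≤ r)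
    (hr1 : r < 1) (N : ℕ) : Continuous (regLog β V r N) := by
  have := continuous_pk hr hr1
  unfold regLog
  fun_prop

theorem exp_regLog_le {β : ℝ} (hβ : 0 ≤ β) {V : Torus → ℝ} {M : ℝ} (hM : ∀ x, |V x| ≤ M) {r : ℝ}
    (hr : 0 ≤ r) (hr1 : r < 1) {N : ℕ} (hN : 1 ≤ N) (x : Fin N → Torus) :
    Real.exp (regLog β V r N x) ≤ Real.exp ((2 * β / N) * (∑ k : Fin N, ∑ _l ∈ Finset.Ioi k,
      Real.log 2) + N * M) := by
  refine Real.exp_le_exp.2 ?_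
  rw [regLog_eq β V r hN]
  have h1 : -(∑ k : Fin N, ∑ _l ∈ Finset.Ioi k, Real.log 2) ≤
      ∑ k, ∑ l ∈ Finset.Ioi k, pk r (x k - x l) := by
    rw [← Finset.sum_neg_distrib]
    refine Finset.sum_le_sum fun k _ => ?_
    rw [← Finset.sum_neg_distrib]
    exact Finset.sum_le_sum fun l _ => pk_ge hr hr1 _
  have h2 : -∑ k, V (x k) ≤ N * M := by
    rw [← Finset.sum_neg_distrib]
    calc ∑ k, -V (x k) ≤ ∑ _k : Fin N, M :=
          Finset.sum_le_sum fun k _ => (neg_le_abs _).trans (hM _)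
      _ = _ := by simp
  have h3 := mul_le_mul_of_nonneg_left h1 (by positivity : 0 ≤ 2 * β / (N : ℝ))
  linarith

theorem tendsto_exp_regLog (β : ℝ) (V : Torus → ℝ) {N : ℕ} (hN : 1 ≤ N) {x : Fin N → Torus}
    (hx : ∀ i j, i ≠ j → x i ≠ x j) :
    Tendsto (fun r => Real.exp (regLog β V r N x)) (𝓝[<] 1) (𝓝 (gibbsWeight β V N x)) := by
  have hlim : gibbsWeight β V N x = Real.exp (-(2 * β / N) *
      ∑ k, ∑ l ∈ Finset.Ioi k, lg (x k - x l) - ∑ k, V (x k)) := by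
    have h1 := wt_of_ne β (fun y => -V y) N hx
    rw [wt, Real.exp_sum] at h1
    simp only [gibbsWeight, chord_eq]
    rw [h1, Finset.sum_neg_distrib, sub_eq_add_neg]
  rw [hlim]
  simp only [regLog_eq β V _ hN]
  refine (Real.continuous_exp.tendsto _).comp ?_
  refine Tendsto.sub_const (Tendsto.const_mul _ ?_) _
  refine tendsto_finsetSum _ fun k _ => tendsto_finsetSum _ fun l hl => ?_
  exact tendsto_pk (sub_ne_zero.2 (hx k l (Finset.mem_Ioi.1 hl).ne))

theorem HasTDeriv.hasDerivAt_coord {f g : Torus → ℝ} (h : HasTDeriv f g) {N : ℕ} (i k : Fin N)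
    (x : Fin N → Torus) : HasDerivAt (fun t : ℝ => f ((shiftAt i t x) k))
      ((if k = i then 1 else 0) * g (x k)) 0 := by
  by_cases hk : k = i
  · subst hk
    have := h.shift (x k) 0
    simpa [shiftAt_apply] using this
  · simp only [shiftAt_apply, if_neg hk, zero_mul, AddCircle.coe_zero, add_zero]
    exact hasDerivAt_const _ _

theorem HasTDeriv.hasDerivAt_coord_sub {f g : Torus → ℝ} (h : HasTDeriv f g) {N : ℕ}
    (i k l : Fin N) (x : Fin N → Torus) :
    HasDerivAt (fun t : ℝ =>
        f ((shiftAt i t x) k - (shiftAt i t x) l))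
      (((if k = i then 1 else 0) - (if l = i then 1 else 0)) * g (x k - x l)) 0 := by
  set s : ℝ := (if k = i then 1 else 0) - (if l = i then 1 else 0) with hs
  have h1 := h.shift (x k - x l) (s * 0)
  have h2 := h1.comp (0 : ℝ) ((hasDerivAt_id (0 : ℝ)).const_mul s)
  refine (h2.congr_of_eventuallyEq (Eventually.of_forall fun t => ?_)).congr_deriv ?_
  · simp only [Function.comp]
    congr 1
    rw [shiftAt_apply, shiftAt_apply, hs, sub_mul, AddCircle.coe_sub]
    abel
  · simp [mul_comm]

section
variable {β : ℝ} {V V₁ ψ ψ₁ u u₁ : Torus → ℝ}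

theorem HasTDeriv.regLog_coord (hV : HasTDeriv V V₁) (β : ℝ) {r : ℝ} (hr : 0 ≤ r) (hr1 : r < 1)
    {N : ℕ} (i : Fin N) (x : Fin N → Torus) :
    HasDerivAt (fun t : ℝ => regLog β V r N (shiftAt i t x))
      (-(β / N) * ∑ k, ∑ l, (((if k = i then 1 else 0) - (if l = i then 1 else 0)) *
        dpk r (x k - x l)) - V₁ (x i)) 0 := by
  have h1 : HasDerivAt (fun t : ℝ => ∑ k, ∑ l, pk r ((shiftAt i t x) k -
      (shiftAt i t x) l)) (∑ k, ∑ l, (((if k = i then 1 else 0) -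
        (if l = i then 1 else 0)) * dpk r (x k - x l))) 0 :=
    HasDerivAt.fun_sum fun k _ => HasDerivAt.fun_sum fun l _ =>
      (hasTDeriv_pk hr hr1).hasDerivAt_coord_sub i k l x
  have h2 : HasDerivAt (fun t : ℝ => ∑ k, V ((shiftAt i t x) k))
      (∑ k, ((if k = i then 1 else 0) * V₁ (x k))) 0 :=
    HasDerivAt.fun_sum fun k _ => hV.hasDerivAt_coord i k x
  have h3 := ((h1.const_mul (-(β / N))).add_const (β * pk r 0)).sub h2
  refine h3.congr_deriv ?_
  simp

theorem HasTDeriv.linStat_coord (hψ : HasTDeriv ψ ψ₁) {N : ℕ} (i : Fin N) (x : Fin N → Torus) :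
    HasDerivAt (fun t : ℝ => linStat ψ N (shiftAt i t x)) (ψ₁ (x i) / √N) 0 := by
  have h2 : HasDerivAt (fun t : ℝ => ∑ k, ψ ((shiftAt i t x) k))
      (∑ k, ((if k = i then 1 else 0) * ψ₁ (x k))) 0 :=
    HasDerivAt.fun_sum fun k _ => hψ.hasDerivAt_coord i k x
  refine (h2.div_const (√(N : ℝ))).congr_deriv ?_
  simp

theorem continuous_linStat (hψ : Continuous ψ) (N : ℕ) : Continuous (linStat ψ N) := by
  unfold linStat
  fun_prop

/-- The generator of the loop equation. -/
def loopTerm (β : ℝ) (V₁ ψ ψ₁ u u₁ : Torus → ℝ) (h h' : ℝ → ℝ) (κ : Torus → ℝ) (N : ℕ)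
    (x : Fin N → Torus) : ℝ :=
  (∑ i, (u₁ (x i) - u (x i) * V₁ (x i)) - β / N * ∑ k, ∑ l, (u (x k) - u (x l)) * κ (x k - x l)) *
      h (linStat ψ N x) + (∑ i, u (x i) * ψ₁ (x i)) / √N * h' (linStat ψ N x)

/-- Integration by parts in the direction of the i-th coordinate against `u(x_i) h(F)` and the
smooth regularized weight, summed over `i`. -/
theorem integral_regularized_loopTerm (hV : HasTDeriv V V₁) (hV₁ : Continuous V₁)
    (hψ : HasTDeriv ψ ψ₁) (hψ₁ : Continuous ψ₁) (hu : HasTDeriv u u₁) (hu₁ : Continuous u₁)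
    {h h' : ℝ → ℝ} (hh : ∀ s, HasDerivAt h (h' s) s) (hh' : Continuous h') {r : ℝ} (hr : 0 ≤ r)
    (hr1 : r < 1) (N : ℕ) :
    ∫ x, Real.exp (regLog β V r N x) * loopTerm β V₁ ψ ψ₁ u u₁ h h' (dpk r) N x
      ∂(Measure.pi fun _ : Fin N => unif) = 0 := by
  have hhc : Continuous h := continuous_iff_continuousAt.2 fun s => (hh s).continuousAt
  have hVc := hV.continuous
  have hψc := hψ.continuous
  have huc := hu.continuous
  have hL := continuous_regLog β hVc hr hr1 N
  have hF := continuous_linStat hψc N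
  have hd := continuous_dpk hr hr1
  set D : Fin N → (Fin N → Torus) → ℝ := fun i x => Real.exp (regLog β V r N x) *
    ((u₁ (x i) + u (x i) * (-(β / N) * ∑ k, ∑ l, (((if k = i then 1 else 0) -
      (if l = i then 1 else 0)) * dpk r (x k - x l)) - V₁ (x i))) * h (linStat ψ N x) +
      u (x i) * ψ₁ (x i) / √N * h' (linStat ψ N x)) with hD
  have hDc : ∀ i, Continuous (D i) := fun i => by
    simp only [hD]
    fun_prop
  have hDi : ∀ i, ∫ x, D i x ∂(Measure.pi fun _ : Fin N => unif) = 0 := by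
    intro i
    refine integral_pi_deriv_eq_zero i
      (G := fun x => u (x i) * h (linStat ψ N x) * Real.exp (regLog β V r N x))
      (by fun_prop) (hDc i) fun x => ?_
    have h1 := hu.hasDerivAt_coord i i x
    have h2 := hψ.linStat_coord i x
    have h3 := (hV.regLog_coord β hr hr1 i x).exp
    have h4 : HasDerivAt (fun t : ℝ => h (linStat ψ N (shiftAt i t x)))
        (h' (linStat ψ N x) * (ψ₁ (x i) / √N)) 0 := by
      have h5 := hh (linStat ψ N (shiftAt i 0 x))
      have := h5.comp (0 : ℝ) h2
      simpa only [Function.comp_def, shiftAt_zero] using this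
    refine ((h1.mul h4).mul h3).congr_deriv ?_
    simp only [hD, if_true, one_mul, shiftAt_zero, Pi.mul_apply]
    ring
  have hsum : ∀ x, Real.exp (regLog β V r N x) * loopTerm β V₁ ψ ψ₁ u u₁ h h' (dpk r) N x
      = ∑ i, D i x := by
    intro x
    simp only [hD, loopTerm]
    rw [← Finset.mul_sum, Finset.sum_add_distrib, ← Finset.sum_mul, ← Finset.sum_mul,
      ← Finset.sum_div]
    congr 4
    have e1 : ∀ i : Fin N, u₁ (x i) + u (x i) * (-(β / N) * ∑ k, ∑ l, (((if k = i then 1 else 0) -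
        (if l = i then 1 else 0)) * dpk r (x k - x l)) - V₁ (x i)) =
        (u₁ (x i) - u (x i) * V₁ (x i)) - β / N * ∑ k, ∑ l, (((if k = i then u (x i) else 0) -
        (if l = i then u (x i) else 0)) * dpk r (x k - x l)) := by
      intro i
      have : ∀ k l : Fin N, ((if k = i then u (x i) else 0) -
        (if l = i then u (x i) else 0)) * dpk r (x k - x l) =
        u (x i) * (((if k = i then 1 else 0) - (if l = i then 1 else 0)) * dpk r (x k - x l)) := by
        intro k l
        split_ifs <;> ring
      simp only [this, ← Finset.mul_sum]
      ring
    simp only [e1]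
    -- Exchanging sums, the index `i` picks up `u (x k)` once and `u (x l)` once with the opposite
    -- sign: this is how the divided difference of `u` appears.
    conv_rhs => rw [Finset.sum_sub_distrib, ← Finset.mul_sum]
    congr 2
    symm
    rw [Finset.sum_comm]
    refine Finset.sum_congr rfl fun k _ => ?_
    rw [Finset.sum_comm]
    refine Finset.sum_congr rfl fun l _ => ?_
    rw [← Finset.sum_mul, Finset.sum_sub_distrib]
    simp
  simp only [hsum]
  rw [integral_finsetSum _ fun i _ => integrable_pi_of_continuous (hDc i) _]
  simp [hDi]

end

theorem continuous_gibbsWeight {β : ℝ} (hβ : 0 ≤ β) {V : Torus → ℝ} (hV : Continuous V) (N : ℕ) :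
    Continuous (gibbsWeight β V N) := by
  unfold gibbsWeight
  simp only [chord_eq]
  exact (continuous_interaction hβ N).mul (by fun_prop)

theorem gibbsWeight_nonneg (β : ℝ) (V : Torus → ℝ) (N : ℕ) (x : Fin N → Torus) :
    0 ≤ gibbsWeight β V N x :=
  mul_nonneg (Finset.prod_nonneg fun _ _ => Finset.prod_nonneg fun _ _ =>
    Real.rpow_nonneg (norm_nonneg _) _) (Finset.prod_nonneg fun _ _ => Real.exp_nonneg _)

theorem integral_gibbs {β : ℝ} (hβ : 0 ≤ β) {V : Torus → ℝ} (hV : Continuous V) (N : ℕ)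
    (f : (Fin N → Torus) → ℝ) :
    ∫ x, f x ∂gibbs β V N = (partitionFunction β V N)⁻¹.toReal *
      ∫ x, gibbsWeight β V N x * f x ∂(Measure.pi fun _ : Fin N => unif) := by
  rw [gibbs, integral_smul_measure, smul_eq_mul,
    integral_withDensity_eq_integral_toReal_smul
      (continuous_gibbsWeight hβ hV N).measurable.ennreal_ofReal
      (ae_of_all _ fun x => ENNReal.ofReal_lt_top)]
  simp only [ENNReal.toReal_ofReal (gibbsWeight_nonneg β V N _), smul_eq_mul]

theorem ae_distinct {m : Measure Torus} [IsProbabilityMeasure m] (hm : m ≪ unif) (N : ℕ) :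
    ∀ᵐ x ∂(Measure.pi fun _ : Fin N => m), ∀ i j, i ≠ j → x i ≠ x j := by
  rw [ae_all_iff]; intro i
  rw [ae_all_iff]; intro j
  by_cases hij : i = j
  · exact ae_of_all _ fun x h => absurd hij h
  · have := (map_eval_pair (m := m) (N := N) hij).quasiMeasurePreserving.ae (ae_ne_prod m hm)
    filter_upwards [this] with x hx _ using hx

theorem ae_gibbs_distinct (β : ℝ) (V : Torus → ℝ) (N : ℕ) :
    ∀ᵐ x ∂gibbs β V N, ∀ i j, i ≠ j → x i ≠ x j := by
  have : gibbs β V N ≪ Measure.pi fun _ : Fin N => unif :=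
    (withDensity_absolutelyContinuous _ _).smul_left _
  exact this.ae_le (ae_distinct Measure.AbsolutelyContinuous.rfl N)

theorem abs_sub_le_mul_ch {u : Torus → ℝ} (huc : Continuous u)
    (h1 : Summable fun k : ℤ => ‖fc u k‖) (h2 : Summable fun k : ℤ => |(k : ℝ)| * ‖fc u k‖)
    (x y : Torus) : |u x - u y| ≤ (∑' k : ℤ, |(k : ℝ)| * ‖fc u k‖) * ch (x - y) := by
  have h := (hasSum_fc huc h1 x).sub (hasSum_fc huc h1 y)
  have hb : ∀ k : ℤ, ‖fc u k * ex k x - fc u k * ex k y‖ ≤ |(k : ℝ)| * ‖fc u k‖ * ch (x - y) := by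
    intro k
    have e : ex k x = ex k (x - y) * ex k y := by rw [← ex_add]; simp
    have : fc u k * ex k x - fc u k * ex k y = fc u k * ((ex k (x - y) - 1) * ex k y) := by
      rw [e]; ring
    rw [this, norm_mul, norm_mul, norm_ex, mul_one]
    have := mul_le_mul_of_nonneg_left (norm_ex_sub_one_le_ch k (x - y)) (norm_nonneg (fc u k))
    linarith
  have hn := tsum_of_norm_bounded (h2.hasSum.mul_right (ch (x - y))) hb
  rw [h.tsum_eq, ← Complex.ofReal_sub, Complex.norm_real] at hn
  exact hn

section
variable {β : ℝ} {V V₁ ψ ψ₁ u u₁ : Torus → ℝ}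

theorem exists_pi_bound {N : ℕ} {f : (Fin N → Torus) → ℝ} (hf : Continuous f) :
    ∃ M : ℝ, 0 ≤ M ∧ ∀ x, |f x| ≤ M := by
  obtain ⟨M, hM⟩ := (isCompact_univ (X := Fin N → Torus)).exists_bound_of_continuousOn
    hf.continuousOn
  exact ⟨|M|, abs_nonneg M, fun x => (hM x trivial).trans (le_abs_self M)⟩

/-- Limit `r → 1` of the regularized identity. The cotangent is compensated by the Lipschitz
increment of `u`, and the weight is bounded because the regularized kernel is at least `-log 2`;
dominated convergence applies with a constant. -/
theorem integral_loopTerm (hβ : 0 ≤ β) (hV : HasTDeriv V V₁) (hV₁ : Continuous V₁)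
    (hψ : HasTDeriv ψ ψ₁) (hψ₁ : Continuous ψ₁) (hu : HasTDeriv u u₁) (hu₁ : Continuous u₁)
    {L : ℝ} (hL : ∀ x y, |u x - u y| ≤ L * ch (x - y))
    {h h' : ℝ → ℝ} (hh : ∀ s, HasDerivAt h (h' s) s) (hh' : Continuous h') {N : ℕ} (hN : 1 ≤ N) :
    ∫ x, loopTerm β V₁ ψ ψ₁ u u₁ h h' (fun z => -(1 / 2) * cotHalf z) N x ∂gibbs β V N = 0 := by
  have hhc : Continuous h := continuous_iff_continuousAt.2 fun s => (hh s).continuousAt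
  have hVc := hV.continuous
  have hψc := hψ.continuous
  have huc := hu.continuous
  have hF := continuous_linStat hψc N
  rw [integral_gibbs hβ hVc]
  suffices hs : ∫ x, gibbsWeight β V N x *
      loopTerm β V₁ ψ ψ₁ u u₁ h h' (fun z => -(1 / 2) * cotHalf z) N x
        ∂(Measure.pi fun _ : Fin N => unif) = 0 by rw [hs, mul_zero]
  have hL0 : 0 ≤ L := by
    have := (abs_nonneg _).trans (hL ((Real.pi : ℝ) : Torus) 0)
    have hπ : ((Real.pi : ℝ) : Torus) ≠ 0 := by
      intro h0
      have := ch_eq_zero.2 h0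
      rw [ch_coe] at this
      simp at this
    rw [sub_zero] at this
    exact nonneg_of_mul_nonneg_left this (ch_pos hπ)
  obtain ⟨MV, _, hMV⟩ := exists_abs_le hVc
  obtain ⟨MA, hMA0, hMA⟩ := exists_pi_bound (N := N)
    (f := fun x => ∑ i, (u₁ (x i) - u (x i) * V₁ (x i))) (by fun_prop)
  obtain ⟨MH, hMH0, hMH⟩ := exists_pi_bound (N := N) (f := fun x => h (linStat ψ N x)) (by fun_prop)
  obtain ⟨MB, hMB0, hMB⟩ := exists_pi_bound (N := N)
    (f := fun x => (∑ i, u (x i) * ψ₁ (x i)) / √N * h' (linStat ψ N x)) (by fun_prop)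
  set B := Real.exp ((2 * β / N) * (∑ k : Fin N, ∑ _l ∈ Finset.Ioi k, Real.log 2) + N * MV) with hB
  have hev : ∀ᶠ r : ℝ in 𝓝[<] 1, r ∈ Set.Ioo (0 : ℝ) 1 := Ioo_mem_nhdsLT one_pos
  have hlim := tendsto_integral_filter_of_dominated_convergence
    (μ := Measure.pi fun _ : Fin N => unif) (l := 𝓝[<] (1 : ℝ))
    (F := fun r x => Real.exp (regLog β V r N x) * loopTerm β V₁ ψ ψ₁ u u₁ h h' (dpk r) N x)
    (f := fun x => gibbsWeight β V N x *
      loopTerm β V₁ ψ ψ₁ u u₁ h h' (fun z => -(1 / 2) * cotHalf z) N x)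
    (fun _ => B * ((MA + β / N * (N * (N * L))) * MH + MB))
    (by
      filter_upwards [hev] with r hr
      have h1 := continuous_regLog β hVc hr.1.le hr.2 N
      have h2 := continuous_dpk hr.1.le hr.2
      refine Continuous.aestronglyMeasurable ?_
      unfold loopTerm
      fun_prop)
    (by
      filter_upwards [hev] with r hr
      refine ae_of_all _ fun x => ?_
      rw [norm_mul, Real.norm_of_nonneg (Real.exp_nonneg _)]
      refine mul_le_mul (exp_regLog_le hβ hMV hr.1.le hr.2 hN x) ?_ (norm_nonneg _)
        (Real.exp_nonneg _)
      unfold loopTerm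
      have hS : |∑ k, ∑ l, (u (x k) - u (x l)) * dpk r (x k - x l)| ≤ N * (N * L) := by
        calc _ ≤ ∑ k, ∑ l, |(u (x k) - u (x l)) * dpk r (x k - x l)| :=
              (Finset.abs_sum_le_sum_abs _ _).trans
                (Finset.sum_le_sum fun k _ => Finset.abs_sum_le_sum_abs _ _)
          _ ≤ ∑ _k : Fin N, ∑ _l : Fin N, L := by
              refine Finset.sum_le_sum fun k _ => Finset.sum_le_sum fun l _ => ?_
              rw [abs_mul]
              calc |u (x k) - u (x l)| * |dpk r (x k - x l)|
                  ≤ L * ch (x k - x l) * |dpk r (x k - x l)| := by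
                    gcongr; exact hL _ _
                _ = L * (|dpk r (x k - x l)| * ch (x k - x l)) := by ring
                _ ≤ L * 1 := by gcongr; exact abs_dpk_mul_ch_le hr.1 hr.2 _
                _ = L := mul_one L
          _ = _ := by simp
      refine (norm_add_le _ _).trans (add_le_add ?_ (hMB x))
      rw [norm_mul]
      refine mul_le_mul ?_ (hMH x) (norm_nonneg _) (by positivity)
      refine (norm_sub_le _ _).trans (add_le_add (hMA x) ?_)
      rw [norm_mul, Real.norm_of_nonneg (by positivity : 0 ≤ β / (N : ℝ))]
      gcongr
      exact hS)
    (integrable_const _)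
    (by
      filter_upwards [ae_distinct Measure.AbsolutelyContinuous.rfl N] with x hx
      refine (tendsto_exp_regLog β V hN hx).mul ?_
      unfold loopTerm
      refine Tendsto.add_const _ (Tendsto.mul_const _ (Tendsto.const_sub _ (Tendsto.const_mul _ ?_)))
      refine tendsto_finsetSum _ fun k _ => tendsto_finsetSum _ fun l _ => ?_
      -- Diagonal terms vanish identically, before and after the limit.
      by_cases hkl : k = l
      · subst hkl; simp
      · exact (tendsto_dpk (sub_ne_zero.2 (hx k l hkl))).const_mul _)
  refine tendsto_nhds_unique hlim (tendsto_const_nhds.congr' ?_)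
  filter_upwards [hev] with r hr
  exact (integral_regularized_loopTerm hV hV₁ hψ hψ₁ hu hu₁ hh hh' hr.1.le hr.2 N).symm

end

section
variable {β : ℝ} {V V₁ ρ ρ₁ ρ₂ w w₁ ψ ψ₁ φ u u₁ u₂ f κ : Torus → ℝ} {c : ℝ}

/-- The Stein factor. -/
def steinFactor (ψ₁ u : Torus → ℝ) (N : ℕ) (x : Fin N → Torus) : ℝ :=
  (∑ i, ψ₁ (x i) * u (x i)) / N

/-- The remainder in the loop equation. -/
def steinRem (β : ℝ) (ρ u : Torus → ℝ) (N : ℕ) (x : Fin N → Torus) : ℝ :=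
  β / 2 * √N * kerForm u (fun k => modeFlu ρ k N x) (fun k => modeFlu ρ k N x)
    - β / (2 * N * √N) * ∑ i, kerForm u (modes (x i)) (modes (x i))

theorem LinSol.abs_sub_le (L : LinSol β ρ ρ₁ ψ φ u u₁ u₂ f κ c) :
    ∃ M : ℝ, ∀ x y, |u x - u y| ≤ M * ch (x - y) := by
  have h2 := L.u₁_deriv.sqSum L.u₂_cont
  have h3 := h2.summable_mul_of_deriv fun k => fc_deriv L.u_deriv L.u₁_deriv.continuous k
  exact ⟨_, abs_sub_le_mul_ch L.u_deriv.continuous L.summable_u.1 h3⟩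

/-- The double sum splits into a quadratic form in the fluctuations, a linear part and a constant.
The linear part cancels the mean field in the drift and the constant cancels `c`. The missing
diagonal, absent from the cotangent sum but present in the form, is the second term of `steinRem`.
-/
theorem LinSol.loopTerm_eq (E : EqDensity β V V₁ ρ ρ₁ ρ₂ w w₁)
    (L : LinSol β ρ ρ₁ ψ φ u u₁ u₂ f κ c) (hψ : Continuous ψ)
    (hψ0 : ∫ x, ψ x * ρ x ∂unif = 0) (h h' : ℝ → ℝ) {N : ℕ} (hN : 1 ≤ N) {x : Fin N → Torus}
    (hx : ∀ i j, i ≠ j → x i ≠ x j) :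
    loopTerm β V₁ ψ ψ₁ u u₁ h h' (fun z => -(1 / 2) * cotHalf z) N x =
      √N * (-(linStat ψ N x * h (linStat ψ N x)) + steinRem β ρ u N x * h (linStat ψ N x)
        + steinFactor ψ₁ u N x * h' (linStat ψ N x)) := by
  have hNp : (0 : ℝ) < N := by exact_mod_cast hN
  have hq := E.kerForm_modeFlu L.summable_u.2 x
  have hc := L.const_eq E hψ hψ0
  set q := kerForm u (fun k => modeFlu ρ k N x) (fun k => modeFlu ρ k N x) with hqdef
  set k₂ := kerForm u (eqModes ρ) (eqModes ρ) with hk₂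
  set K1 := ∑ i, kerForm u (modes (x i)) (eqModes ρ) with hK1
  set KK := ∑ i, ∑ j, kerForm u (modes (x i)) (modes (x j)) with hKK
  set KD := ∑ i, kerForm u (modes (x i)) (modes (x i)) with hKD
  have hdrift : ∑ i, (u₁ (x i) - u (x i) * V₁ (x i)) = -(∑ i, ψ (x i)) - N * c - β * K1 := by
    simp only [L.drift_eq E, hK1, Finset.mul_sum]
    rw [Finset.sum_sub_distrib, Finset.sum_neg_distrib, Finset.sum_add_distrib]
    simp; ring
  have hker : ∑ k, ∑ l, (u (x k) - u (x l)) * (-(1 / 2) * cotHalf (x k - x l)) =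
      -(1 / 2) * (KK - KD) := by
    have h1 : ∀ k l, (u (x k) - u (x l)) * (-(1 / 2) * cotHalf (x k - x l)) =
        -(1 / 2) * (kerForm u (modes (x k)) (modes (x l)) -
          if k = l then kerForm u (modes (x k)) (modes (x l)) else 0) := by
      intro k l
      by_cases hkl : k = l
      · subst hkl; simp
      · rw [if_neg hkl, kerForm_modes L.u_deriv.continuous L.summable_u.1 (hx k l hkl)]; ring
    simp only [h1, ← Finset.mul_sum, Finset.sum_sub_distrib]
    simp [hKK, hKD]
  have hKKq : KK = N ^ 2 * q + 2 * N * K1 - N ^ 2 * k₂ := by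
    rw [hq]; field_simp; ring
  have hs : √(N : ℝ) * √N = N := Real.mul_self_sqrt hNp.le
  have hsp : 0 < √(N : ℝ) := Real.sqrt_pos.2 hNp
  have e1 : √(N : ℝ) * linStat ψ N x = ∑ i, ψ (x i) := by
    rw [linStat]; field_simp
  have e2 : √(N : ℝ) * steinRem β ρ u N x = β / 2 * N * q - β / (2 * N) * KD := by
    rw [steinRem, ← hqdef, ← hKD, mul_sub]
    congr 1
    · calc √(N : ℝ) * (β / 2 * √N * q) = β / 2 * (√(N : ℝ) * √N) * q := by ring
        _ = _ := by rw [hs]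
    · field_simp
  have e3 : √(N : ℝ) * steinFactor ψ₁ u N x = (∑ i, u (x i) * ψ₁ (x i)) / √N := by
    have : ∑ i, ψ₁ (x i) * u (x i) = ∑ i, u (x i) * ψ₁ (x i) :=
      Finset.sum_congr rfl fun i _ => mul_comm _ _
    rw [steinFactor, this, eq_div_iff hsp.ne']
    calc √(N : ℝ) * ((∑ i, u (x i) * ψ₁ (x i)) / N) * √N
        = (√(N : ℝ) * √N) * ((∑ i, u (x i) * ψ₁ (x i)) / N) := by ring
      _ = _ := by rw [hs]; field_simp
  have hmain : ∑ i, (u₁ (x i) - u (x i) * V₁ (x i)) - β / N * (-(1 / 2) * (KK - KD)) =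
      √N * (-(linStat ψ N x) + steinRem β ρ u N x) := by
    rw [mul_add, mul_neg, e1, e2, hdrift, hKKq, hc]
    field_simp
    ring
  rw [loopTerm, hker, hmain, ← e3]
  ring

theorem continuous_steinFactor (hψ₁ : Continuous ψ₁) (hu : Continuous u) (N : ℕ) :
    Continuous (steinFactor ψ₁ u N) := by
  unfold steinFactor
  fun_prop

theorem EqDensity.norm_modeFlu_le (E : EqDensity β V V₁ ρ ρ₁ ρ₂ w w₁) (k : ℕ) (N : ℕ)
    (x : Fin N → Torus) : ‖modeFlu ρ k N x‖ ≤ 2 := by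
  have h1 : ‖(∑ i, ex k (x i)) / (N : ℂ)‖ ≤ 1 := by
    rw [norm_div, Complex.norm_natCast]
    refine div_le_one_of_le₀ ?_ (Nat.cast_nonneg N)
    refine (norm_sum_le _ _).trans ?_
    simp [norm_ex]
  have h2 := E.norm_eqModes k
  refine (norm_sub_le _ _).trans ?_
  rw [eqModes] at h2
  linarith

theorem LinSol.continuous_steinRem (E : EqDensity β V V₁ ρ ρ₁ ρ₂ w w₁)
    (L : LinSol β ρ ρ₁ ψ φ u u₁ u₂ f κ c) (N : ℕ) : Continuous (steinRem β ρ u N) := by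
  have h1 : Continuous fun x : Fin N → Torus =>
      kerForm u (fun k => modeFlu ρ k N x) (fun k => modeFlu ρ k N x) := by
    unfold kerForm
    refine continuous_tsum (fun n => ?_) (L.summable_u.2.mul_left (4 * 2 ^ 2)) fun n x =>
      abs_kerForm_term_le u n (fun k => E.norm_modeFlu_le k N x) fun k => E.norm_modeFlu_le k N x
    have := fun k : ℕ => continuous_modeFlu ρ k N
    refine continuous_const.mul (Complex.continuous_re.comp (continuous_const.mul ?_))
    unfold bil
    fun_prop
  have h2 : Continuous fun y => kerForm u (modes y) (modes y) := by
    unfold kerForm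
    refine continuous_tsum (fun n => ?_) (L.summable_u.2.mul_left (4 * 1 ^ 2)) fun n x =>
      abs_kerForm_term_le u n (norm_modes x) (norm_modes x)
    have := continuous_modes
    refine continuous_const.mul (Complex.continuous_re.comp (continuous_const.mul ?_))
    unfold bil
    fun_prop
  unfold steinRem
  exact (continuous_const.mul h1).sub (continuous_const.mul (continuous_finsetSum _ fun i _ =>
    h2.comp (continuous_apply i)))

/-- The approximate Stein identity satisfied by the linear statistic. -/
theorem LinSol.stein_identity (hβ : 0 < β) (E : EqDensity β V V₁ ρ ρ₁ ρ₂ w w₁)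
    (L : LinSol β ρ ρ₁ ψ φ u u₁ u₂ f κ c) (hψ : HasTDeriv ψ ψ₁) (hψ₁ : Continuous ψ₁)
    (hψ0 : ∫ x, ψ x * ρ x ∂unif = 0) {h h' : ℝ → ℝ} (hh : ∀ s, HasDerivAt h (h' s) s)
    (hh' : Continuous h') {N : ℕ} (hN : 1 ≤ N) :
    ∫ x, linStat ψ N x * h (linStat ψ N x) ∂gibbs β V N =
      ∫ x, steinFactor ψ₁ u N x * h' (linStat ψ N x) ∂gibbs β V N
        + ∫ x, steinRem β ρ u N x * h (linStat ψ N x) ∂gibbs β V N := by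
  obtain ⟨_, _, hle⟩ := E.exists_gibbs_le hβ
  obtain ⟨hPr, -⟩ := hle N hN
  have hNp : (0 : ℝ) < N := by exact_mod_cast hN
  have hhc : Continuous h := continuous_iff_continuousAt.2 fun s => (hh s).continuousAt
  have hF := continuous_linStat hψ.continuous N
  have hτ := continuous_steinFactor hψ₁ L.u_deriv.continuous N
  have hR := L.continuous_steinRem E N
  obtain ⟨M, hM⟩ := L.abs_sub_le
  have h0 := integral_loopTerm hβ.le E.V_deriv E.V₁_cont hψ hψ₁ L.u_deriv L.u₁_deriv.continuous hM
    hh hh' hN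
  have h1 : ∫ x, loopTerm β V₁ ψ ψ₁ u u₁ h h' (fun z => -(1 / 2) * cotHalf z) N x ∂gibbs β V N =
      ∫ x, √N * (-(linStat ψ N x * h (linStat ψ N x)) + steinRem β ρ u N x * h (linStat ψ N x)
        + steinFactor ψ₁ u N x * h' (linStat ψ N x)) ∂gibbs β V N := by
    refine integral_congr_ae ?_
    filter_upwards [ae_gibbs_distinct β V N] with x hx
    exact L.loopTerm_eq E hψ.continuous hψ0 h h' hN hx
  have i1 : Integrable (fun x => linStat ψ N x * h (linStat ψ N x)) (gibbs β V N) :=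
    integrable_pi_of_continuous (by fun_prop) _
  have i2 : Integrable (fun x => steinRem β ρ u N x * h (linStat ψ N x)) (gibbs β V N) :=
    integrable_pi_of_continuous (by fun_prop) _
  have i3 : Integrable (fun x => steinFactor ψ₁ u N x * h' (linStat ψ N x)) (gibbs β V N) :=
    integrable_pi_of_continuous (by fun_prop) _
  have i12 : Integrable (fun x => -(linStat ψ N x * h (linStat ψ N x)) +
      steinRem β ρ u N x * h (linStat ψ N x)) (gibbs β V N) := i1.neg.add i2
  have i1n : Integrable (fun x => -(linStat ψ N x * h (linStat ψ N x))) (gibbs β V N) := i1.neg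
  rw [h1, integral_const_mul, integral_add i12 i3, integral_add i1n i2, integral_neg] at h0
  have hsp : √(N : ℝ) ≠ 0 := (Real.sqrt_pos.2 hNp).ne'
  have := (mul_eq_zero.1 h0).resolve_left hsp
  linarith

end

/-! ### Second moments of the remainders in the Stein identity -/

/-- Weighted Cauchy–Schwarz, from nonnegativity of `∑ c_n (A z_n - T)²`, where `A` is the total
weight and `T` the sum to be bounded. -/
theorem sq_tsum_mul_le {c z : ℕ → ℝ} (hc : Summable c) (hc0 : ∀ n, 0 ≤ c n) {M : ℝ}
    (hz : ∀ n, |z n| ≤ M) :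
    (∑' n, c n * z n) ^ 2 ≤ (∑' n, c n) * ∑' n, c n * z n ^ 2 := by
  have hM : 0 ≤ M := (abs_nonneg _).trans (hz 0)
  have h1 : Summable fun n => c n * z n := by
    refine Summable.of_norm_bounded (hc.mul_right M) fun n => ?_
    rw [norm_mul, Real.norm_of_nonneg (hc0 n)]
    exact mul_le_mul_of_nonneg_left (hz n) (hc0 n)
  have h2 : Summable fun n => c n * z n ^ 2 := by
    refine Summable.of_norm_bounded (hc.mul_right (M ^ 2)) fun n => ?_
    rw [norm_mul, Real.norm_of_nonneg (hc0 n), Real.norm_of_nonneg (sq_nonneg _)]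
    exact mul_le_mul_of_nonneg_left (sq_le_sq' (abs_le.1 (hz n)).1 (abs_le.1 (hz n)).2) (hc0 n)
  set A := ∑' n, c n with hA
  set T := ∑' n, c n * z n with hT
  set Q := ∑' n, c n * z n ^ 2 with hQ
  have hA0 : 0 ≤ A := tsum_nonneg hc0
  have hsum : HasSum (fun n => c n * (A * z n - T) ^ 2) (A ^ 2 * Q - 2 * A * T * T + T ^ 2 * A) := by
    have := ((h2.hasSum.mul_left (A ^ 2)).sub (h1.hasSum.mul_left (2 * A * T))).add
      (hc.hasSum.mul_left (T ^ 2))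
    refine this.congr_fun fun n => ?_
    ring
  have h3 : 0 ≤ A ^ 2 * Q - 2 * A * T * T + T ^ 2 * A :=
    hsum.nonneg fun n => mul_nonneg (hc0 n) (sq_nonneg _)
  rcases hA0.eq_or_lt with h | h
  · have hcz : ∀ n, c n = 0 := by
      have := (hasSum_zero_iff_of_nonneg hc0).1 (h.symm ▸ hA ▸ hc.hasSum)
      exact fun n => congrFun this n
    have : T = 0 := by rw [hT]; simp [hcz]
    rw [this, ← h]; simp
  · have h4 : 0 ≤ A * (A * Q - T ^ 2) := by nlinarith
    have := nonneg_of_mul_nonneg_right h4 h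
    linarith

/-- Only a bound on each second moment uniform in `n` is needed, the weights being summable. This
reduces the quadratic remainder to finitely many modes at a time. -/
theorem integral_sq_le_of_tsum {N : ℕ} (P : Measure (Fin N → Torus)) [IsProbabilityMeasure P]
    {c : ℕ → ℝ} (hc : Summable c) (hc0 : ∀ n, 0 ≤ c n) {z : ℕ → (Fin N → Torus) → ℝ}
    (hzc : ∀ n, Continuous (z n)) {M : ℝ} (hz : ∀ n x, |z n x| ≤ M) {B : ℝ}
    (hB : ∀ n, ∫ x, z n x ^ 2 ∂P ≤ B) {q : (Fin N → Torus) → ℝ} (hq : Continuous q)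
    (hqz : ∀ x, |q x| ≤ ∑' n, c n * z n x) :
    ∫ x, q x ^ 2 ∂P ≤ (∑' n, c n) ^ 2 * B := by
  have hA0 : 0 ≤ ∑' n, c n := tsum_nonneg hc0
  have hsq : ∀ n x, z n x ^ 2 ≤ M ^ 2 := fun n x =>
    sq_le_sq' (abs_le.1 (hz n x)).1 (abs_le.1 (hz n x)).2
  have hcz : ∀ n, Continuous fun x => c n * z n x ^ 2 := fun n =>
    continuous_const.mul ((hzc n).pow 2)
  have hb : ∀ n x, ‖c n * z n x ^ 2‖ ≤ c n * M ^ 2 := fun n x => by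
    rw [norm_mul, Real.norm_of_nonneg (hc0 n), Real.norm_of_nonneg (sq_nonneg _)]
    exact mul_le_mul_of_nonneg_left (hsq n x) (hc0 n)
  have hsum := hasSum_integral_of_summable_integral_norm (μ := P)
    (F := fun n x => c n * z n x ^ 2) (fun n => integrable_pi_of_continuous (hcz n) _)
    (Summable.of_nonneg_of_le (fun n => integral_nonneg fun x => norm_nonneg _) (fun n => by
      calc ∫ x, ‖c n * z n x ^ 2‖ ∂P ≤ ∫ _x, c n * M ^ 2 ∂P :=
            integral_mono (integrable_pi_of_continuous (hcz n).norm _) (integrable_const _) (hb n)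
        _ = c n * M ^ 2 := by simp) (hc.mul_right (M ^ 2)))
  have htc : Continuous fun x => ∑' n, c n * z n x ^ 2 :=
    continuous_tsum hcz (hc.mul_right (M ^ 2)) hb
  calc ∫ x, q x ^ 2 ∂P ≤ ∫ x, (∑' n, c n) * ∑' n, c n * z n x ^ 2 ∂P := by
        refine integral_mono (integrable_pi_of_continuous (hq.pow 2) _)
          (integrable_pi_of_continuous (continuous_const.mul htc) _) fun x => ?_
        refine le_trans ?_ (sq_tsum_mul_le hc hc0 fun n => hz n x)
        rw [← sq_abs (q x)]
        exact pow_le_pow_left₀ (abs_nonneg _) (hqz x) 2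
    _ = (∑' n, c n) * ∑' n, ∫ x, c n * z n x ^ 2 ∂P := by
        rw [integral_const_mul, hsum.tsum_eq]
    _ ≤ (∑' n, c n) * ∑' n, c n * B := by
        refine mul_le_mul_of_nonneg_left (hsum.summable.tsum_le_tsum (fun n => ?_)
          (hc.mul_right B)) hA0
        rw [integral_const_mul]
        exact mul_le_mul_of_nonneg_left (hB n) (hc0 n)
    _ = _ := by rw [tsum_mul_right]; ring

section
variable {β : ℝ} {V V₁ ρ ρ₁ ρ₂ w w₁ ψ ψ₁ φ u u₁ u₂ f κ : Torus → ℝ} {c : ℝ}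

/-- The sum of products of modes bounding `bil`. -/
def modeSum (ρ : Torus → ℝ) (N n : ℕ) (x : Fin N → Torus) : ℝ :=
  ∑ j ∈ Finset.range n, (‖modeFlu ρ (j + 1 : ℕ) N x‖ * ‖modeFlu ρ (n - 1 - j : ℕ) N x‖ +
    ‖modeFlu ρ j N x‖ * ‖modeFlu ρ (n - 1 - j + 1 : ℕ) N x‖)

theorem continuous_modeSum (ρ : Torus → ℝ) (N n : ℕ) : Continuous (modeSum ρ N n) := by
  have := fun k : ℕ => continuous_modeFlu ρ k N
  unfold modeSum
  fun_prop

theorem integral_modeSum_sq_le {N : ℕ} (P : Measure (Fin N → Torus)) [IsProbabilityMeasure P]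
    {B : ℝ} (hB : ∀ k : ℕ, ∫ x, ‖modeFlu ρ k N x‖ ^ 4 ∂P ≤ B) (n : ℕ) :
    ∫ x, modeSum ρ N n x ^ 2 ∂P ≤ 4 * n ^ 2 * B := by
  have hc := fun k : ℕ => (continuous_modeFlu ρ k N).norm
  have hi : ∀ k : ℕ, Integrable (fun x => ‖modeFlu ρ k N x‖ ^ 4) P := fun k =>
    integrable_pi_of_continuous ((hc k).pow 4) _
  set b : ℕ → (Fin N → Torus) → ℝ := fun j x => ‖modeFlu ρ (j + 1 : ℕ) N x‖ ^ 4 +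
    ‖modeFlu ρ (n - 1 - j : ℕ) N x‖ ^ 4 + (‖modeFlu ρ j N x‖ ^ 4 +
    ‖modeFlu ρ (n - 1 - j + 1 : ℕ) N x‖ ^ 4) with hb
  have hbi : ∀ j, Integrable (b j) P := fun j =>
    ((hi _).add (hi _)).add ((hi _).add (hi _))
  have hbI : ∀ j, ∫ x, b j x ∂P ≤ 4 * B := fun j => by
    have i12 : Integrable (fun x => ‖modeFlu ρ (j + 1 : ℕ) N x‖ ^ 4 +
      ‖modeFlu ρ (n - 1 - j : ℕ) N x‖ ^ 4) P := (hi _).add (hi _)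
    have i34 : Integrable (fun x => ‖modeFlu ρ j N x‖ ^ 4 +
      ‖modeFlu ρ (n - 1 - j + 1 : ℕ) N x‖ ^ 4) P := (hi _).add (hi _)
    simp only [hb]
    rw [integral_add i12 i34, integral_add (hi _) (hi _), integral_add (hi _) (hi _)]
    linarith [hB (j + 1), hB (n - 1 - j), hB j, hB (n - 1 - j + 1)]
  have hpt : ∀ x, modeSum ρ N n x ^ 2 ≤ n * ∑ j ∈ Finset.range n, b j x := by
    intro x
    have h1 := sq_sum_le_card_mul_sum_sq (s := Finset.range n)
      (f := fun j => ‖modeFlu ρ (j + 1 : ℕ) N x‖ * ‖modeFlu ρ (n - 1 - j : ℕ) N x‖ +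
        ‖modeFlu ρ j N x‖ * ‖modeFlu ρ (n - 1 - j + 1 : ℕ) N x‖)
    rw [Finset.card_range] at h1
    refine h1.trans (mul_le_mul_of_nonneg_left (Finset.sum_le_sum fun j _ => ?_) (Nat.cast_nonneg n))
    simp only [hb]
    generalize ‖modeFlu ρ (j + 1 : ℕ) N x‖ = a₁
    generalize ‖modeFlu ρ (n - 1 - j : ℕ) N x‖ = a₂
    generalize ‖modeFlu ρ j N x‖ = a₃
    generalize ‖modeFlu ρ (n - 1 - j + 1 : ℕ) N x‖ = a₄
    -- The square of a sum of two products of modes is at most the sum of the four fourth powers.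
    nlinarith [sq_nonneg (a₁ * a₂ - a₃ * a₄), sq_nonneg (a₁ ^ 2 - a₂ ^ 2),
      sq_nonneg (a₃ ^ 2 - a₄ ^ 2)]
  calc ∫ x, modeSum ρ N n x ^ 2 ∂P ≤ ∫ x, n * ∑ j ∈ Finset.range n, b j x ∂P :=
        integral_mono (integrable_pi_of_continuous ((continuous_modeSum ρ N n).pow 2) _)
          ((integrable_finsetSum _ fun j _ => hbi j).const_mul _) hpt
    _ = n * ∑ j ∈ Finset.range n, ∫ x, b j x ∂P := by
        rw [integral_const_mul, integral_finsetSum _ fun j _ => hbi j]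
    _ ≤ n * ∑ _j ∈ Finset.range n, 4 * B := by
        gcongr with j
        exact hbI j
    _ = _ := by simp; ring

theorem EqDensity.modeSum_le (E : EqDensity β V V₁ ρ ρ₁ ρ₂ w w₁) (N n : ℕ) (x : Fin N → Torus) :
    0 ≤ modeSum ρ N n x ∧ modeSum ρ N n x ≤ 8 * n := by
  constructor
  · exact Finset.sum_nonneg fun j _ => by positivity
  · calc modeSum ρ N n x ≤ ∑ _j ∈ Finset.range n, (8 : ℝ) := by
          refine Finset.sum_le_sum fun j _ => ?_
          have h1 := mul_le_mul (E.norm_modeFlu_le (j + 1) N x) (E.norm_modeFlu_le (n - 1 - j) N x)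
            (norm_nonneg _) zero_le_two
          have h2 := mul_le_mul (E.norm_modeFlu_le j N x) (E.norm_modeFlu_le (n - 1 - j + 1) N x)
            (norm_nonneg _) zero_le_two
          linarith
      _ = _ := by simp; ring

/-- The weight `n ‖û_n‖` is summable and the normalized sums `modeSum / (2n)` have second moments
bounded uniformly in `n`: the form required by `integral_sq_le_of_tsum`. At `n = 0` both sides
vanish. -/
theorem EqDensity.abs_kerForm_modeFlu_le (E : EqDensity β V V₁ ρ ρ₁ ρ₂ w w₁)
    (hu : Summable fun n : ℕ => n * ‖fc u n‖) (N : ℕ) (x : Fin N → Torus) :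
    |kerForm u (fun k => modeFlu ρ k N x) (fun k => modeFlu ρ k N x)| ≤
      ∑' n : ℕ, 4 * (n * ‖fc u n‖) * (modeSum ρ N n x / (2 * n)) := by
  have hs : Summable fun n : ℕ => 4 * (n * ‖fc u n‖) * (modeSum ρ N n x / (2 * n)) := by
    refine Summable.of_norm_bounded ((hu.mul_left 4).mul_right 4) fun n => ?_
    obtain ⟨h0, h1⟩ := E.modeSum_le N n x
    rw [Real.norm_of_nonneg (by positivity)]
    refine mul_le_mul_of_nonneg_left ?_ (by positivity)
    exact div_le_of_le_mul₀ (by positivity) (by positivity) (by linarith)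
  rw [kerForm, ← Real.norm_eq_abs]
  refine tsum_of_norm_bounded hs.hasSum fun n => ?_
  have h1 := norm_bil_le n (fun k => modeFlu ρ k N x) (fun k => modeFlu ρ k N x)
  rw [norm_mul, Real.norm_of_nonneg zero_le_two, Real.norm_eq_abs]
  have h2 := Complex.abs_re_le_norm
    (fc u n * bil n (fun k => modeFlu ρ k N x) (fun k => modeFlu ρ k N x))
  rw [norm_mul] at h2
  have h3 : ‖fc u n‖ * ‖bil n (fun k => modeFlu ρ k N x) (fun k => modeFlu ρ k N x)‖ ≤
      ‖fc u n‖ * modeSum ρ N n x := mul_le_mul_of_nonneg_left h1 (norm_nonneg _)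
  rcases Nat.eq_zero_or_pos n with rfl | hn
  · simp [bil]
  · have hn' : (0 : ℝ) < n := by exact_mod_cast hn
    calc _ ≤ 2 * (‖fc u n‖ * modeSum ρ N n x) := by linarith
      _ = _ := by field_simp; ring

/-- The quadratic form has second moment `O(N^{δ-2})` by the fourth moments of the modes, and enters
the remainder with a factor `√N`; the diagonal part is deterministically `O(N^{-1/2})`. The Stein
factor is itself an empirical mean, centred at its equilibrium value, so its variance is `1/N` times
a second moment of a linear statistic. -/
theorem LinSol.exists_stein_bounds (hβ : 0 < β) (E : EqDensity β V V₁ ρ ρ₁ ρ₂ w w₁)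
    (L : LinSol β ρ ρ₁ ψ φ u u₁ u₂ f κ c) (hψ₁ : Continuous ψ₁) {δ : ℝ} (hδ : 0 < δ) :
    ∃ C : ℝ, 0 < C ∧ ∀ N : ℕ, 1 ≤ N →
      ∫ x, steinRem β ρ u N x ^ 2 ∂gibbs β V N ≤ C * ((N : ℝ) ^ δ / N) ∧
      ∫ x, (steinFactor ψ₁ u N x - ∫ y, ψ₁ y * u y * ρ y ∂unif) ^ 2 ∂gibbs β V N ≤
        C * ((N : ℝ) ^ δ / N) := by
  have hu := L.summable_u.2
  have huc := L.u_deriv.continuous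
  obtain ⟨_, _, hle⟩ := E.exists_gibbs_le hβ
  obtain ⟨C₁, hC₁, hm⟩ := E.exists_modeFlu_moment hβ hδ
  obtain ⟨M, hM, hMb⟩ := exists_abs_le (hψ₁.mul huc)
  obtain ⟨C₂, hC₂, hg⟩ := E.exists_gibbs_moment hβ hδ hM
  set S := ∑' n : ℕ, (n * ‖fc u n‖) with hS
  have hS0 : 0 ≤ S := tsum_nonneg fun n => by positivity
  refine ⟨β ^ 2 / 2 * ((4 * S) ^ 2 * C₁) + 8 * β ^ 2 * S ^ 2 + (1 + C₂), by positivity,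
    fun N hN => ?_⟩
  obtain ⟨hPr, -⟩ := hle N hN
  have hN1 : (1 : ℝ) ≤ N := by exact_mod_cast hN
  have hNp : (0 : ℝ) < N := by linarith
  have hT1 : 1 ≤ (N : ℝ) ^ δ := Real.one_le_rpow hN1 hδ.le
  have hTN : 1 / (N : ℝ) ≤ (N : ℝ) ^ δ / N := by gcongr
  have hTp : 0 < (N : ℝ) ^ δ / N := by positivity
  constructor
  · set q : (Fin N → Torus) → ℝ := fun x =>
      kerForm u (fun k => modeFlu ρ k N x) (fun k => modeFlu ρ k N x) with hq
    have hqc : Continuous q := by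
      simp only [hq]
      unfold kerForm
      refine continuous_tsum (fun n => ?_) (hu.mul_left (4 * 2 ^ 2)) fun n x =>
        abs_kerForm_term_le u n (fun k => E.norm_modeFlu_le k N x) fun k => E.norm_modeFlu_le k N x
      have := fun k : ℕ => continuous_modeFlu ρ k N
      refine continuous_const.mul (Complex.continuous_re.comp (continuous_const.mul ?_))
      unfold bil
      fun_prop
    have hq2 : ∫ x, q x ^ 2 ∂gibbs β V N ≤ (4 * S) ^ 2 * (C₁ * (N : ℝ) ^ δ / N ^ 2) := by
      have := integral_sq_le_of_tsum (gibbs β V N) (c := fun n : ℕ => 4 * (n * ‖fc u n‖))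
        (hu.mul_left 4) (fun n => by positivity) (z := fun n x => modeSum ρ N n x / (2 * n))
        (fun n => (continuous_modeSum ρ N n).div_const _) (M := 4) (fun n x => by
          obtain ⟨h0, h1⟩ := E.modeSum_le N n x
          rw [abs_of_nonneg (by positivity)]
          exact div_le_of_le_mul₀ (by positivity) (by positivity) (by linarith))
        (B := C₁ * (N : ℝ) ^ δ / N ^ 2) (fun n => by
          simp only [div_pow, integral_div]
          refine div_le_of_le_mul₀ (by positivity) (by positivity) ?_
          refine (integral_modeSum_sq_le _ (fun k => hm N hN k) n).trans (le_of_eq ?_)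
          ring) hqc (E.abs_kerForm_modeFlu_le hu N)
      rwa [tsum_mul_left] at this
    have hpt : ∀ x, steinRem β ρ u N x ^ 2 ≤ β ^ 2 / 2 * N * q x ^ 2 + 8 * β ^ 2 * S ^ 2 / N := by
      intro x
      have hD : |∑ i, kerForm u (modes (x i)) (modes (x i))| ≤ N * (4 * S) := by
        refine (Finset.abs_sum_le_sum_abs _ _).trans ?_
        calc _ ≤ ∑ _i : Fin N, 4 * S := Finset.sum_le_sum fun i _ => by
              have := abs_kerForm_le hu (norm_modes (x i)) (norm_modes (x i))
              simpa using this
          _ = _ := by simp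
      set D := ∑ i, kerForm u (modes (x i)) (modes (x i)) with hDdef
      have hD2 : D ^ 2 ≤ (N * (4 * S)) ^ 2 := sq_le_sq' (abs_le.1 hD).1 (abs_le.1 hD).2
      have e1 : (β / 2 * √N * q x) ^ 2 = β ^ 2 / 4 * N * q x ^ 2 := by
        rw [mul_pow, mul_pow, Real.sq_sqrt hNp.le]; ring
      have e2 : (β / (2 * N * √N) * D) ^ 2 ≤ 4 * β ^ 2 * S ^ 2 / N := by
        rw [mul_pow, div_pow, mul_pow, mul_pow, Real.sq_sqrt hNp.le]
        calc β ^ 2 / (2 ^ 2 * (N : ℝ) ^ 2 * N) * D ^ 2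
            ≤ β ^ 2 / (2 ^ 2 * (N : ℝ) ^ 2 * N) * (N * (4 * S)) ^ 2 := by gcongr
          _ = _ := by field_simp; ring
      have e3 : steinRem β ρ u N x = β / 2 * √N * q x - β / (2 * N * √N) * D := rfl
      rw [e3]
      have e4 : 8 * β ^ 2 * S ^ 2 / N = 2 * (4 * β ^ 2 * S ^ 2 / N) := by ring
      rw [e4]
      nlinarith [sq_nonneg (β / 2 * √N * q x + β / (2 * N * √N) * D)]
    calc ∫ x, steinRem β ρ u N x ^ 2 ∂gibbs β V N
        ≤ ∫ x, (β ^ 2 / 2 * N * q x ^ 2 + 8 * β ^ 2 * S ^ 2 / N) ∂gibbs β V N :=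
          integral_mono (integrable_pi_of_continuous ((L.continuous_steinRem E N).pow 2) _)
            (integrable_pi_of_continuous (by fun_prop) _) hpt
      _ = β ^ 2 / 2 * N * ∫ x, q x ^ 2 ∂gibbs β V N + 8 * β ^ 2 * S ^ 2 / N := by
          rw [integral_add (integrable_pi_of_continuous (by fun_prop) _) (integrable_const _),
            integral_const_mul]
          simp
      _ ≤ β ^ 2 / 2 * N * ((4 * S) ^ 2 * (C₁ * (N : ℝ) ^ δ / N ^ 2)) + 8 * β ^ 2 * S ^ 2 / N := by
          gcongr
      _ = β ^ 2 / 2 * ((4 * S) ^ 2 * C₁) * ((N : ℝ) ^ δ / N) + 8 * β ^ 2 * S ^ 2 * (1 / N) := by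
          field_simp
      _ ≤ β ^ 2 / 2 * ((4 * S) ^ 2 * C₁) * ((N : ℝ) ^ δ / N) +
          8 * β ^ 2 * S ^ 2 * ((N : ℝ) ^ δ / N) := by gcongr
      _ ≤ _ := by
          have : 0 ≤ (1 + C₂) * ((N : ℝ) ^ δ / N) := by positivity
          linarith
  · set g : Torus → ℝ := fun y => ψ₁ y * u y with hgdef
    have hgc : Continuous g := hψ₁.mul huc
    have hfc := continuous_flu ρ hgc N
    have he : ∀ x, (steinFactor ψ₁ u N x - ∫ y, ψ₁ y * u y * ρ y ∂unif) ^ 2 =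
        flu ρ g N x ^ 2 / N := by
      intro x
      have h1 : steinFactor ψ₁ u N x - ∫ y, ψ₁ y * u y * ρ y ∂unif = flu ρ g N x / √N := by
        rw [flu, div_div, Real.mul_self_sqrt hNp.le, Finset.sum_sub_distrib, sub_div, steinFactor,
          E.integral_dens]
        simp only [hgdef]
        congr 1
        simp; field_simp
      rw [h1, div_pow, Real.sq_sqrt hNp.le]
    simp only [he, integral_div]
    have h4 := hg N hN g hgc hMb
    have h2 : ∫ x, flu ρ g N x ^ 2 ∂gibbs β V N ≤ 1 + C₂ * (N : ℝ) ^ δ := by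
      calc _ ≤ ∫ x, (1 + flu ρ g N x ^ 4) ∂gibbs β V N := by
            refine integral_mono (integrable_pi_of_continuous (by fun_prop) _)
              (integrable_pi_of_continuous (by fun_prop) _) fun x => ?_
            change flu ρ g N x ^ 2 ≤ 1 + flu ρ g N x ^ 4
            nlinarith [sq_nonneg (flu ρ g N x ^ 2 - 1)]
        _ = 1 + ∫ x, flu ρ g N x ^ 4 ∂gibbs β V N := by
            rw [integral_add (integrable_const _) (integrable_pi_of_continuous (by fun_prop) _)]
            simp
        _ ≤ _ := by linarith
    calc (∫ x, flu ρ g N x ^ 2 ∂gibbs β V N) / N ≤ (1 + C₂ * (N : ℝ) ^ δ) / N := by gcongr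
      _ = 1 / N + C₂ * ((N : ℝ) ^ δ / N) := by ring
      _ ≤ (N : ℝ) ^ δ / N + C₂ * ((N : ℝ) ^ δ / N) := by gcongr
      _ ≤ _ := by
          have : 0 ≤ (β ^ 2 / 2 * ((4 * S) ^ 2 * C₁) + 8 * β ^ 2 * S ^ 2) * ((N : ℝ) ^ δ / N) := by
            positivity
          linarith

end

/-! ### From an approximate Stein identity to the Wasserstein distance -/

/-- The standard Gaussian density. -/
def gd (x : ℝ) : ℝ := gaussianPDFReal 0 1 x

theorem gd_eq (x : ℝ) : gd x = (√(2 * Real.pi))⁻¹ * Real.exp (-x ^ 2 / 2) := by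
  simp [gd, gaussianPDFReal]

theorem gd_pos (x : ℝ) : 0 < gd x := gaussianPDFReal_pos 0 1 x one_ne_zero

theorem continuous_gd : Continuous gd := by
  have : gd = fun x => (√(2 * Real.pi))⁻¹ * Real.exp (-x ^ 2 / 2) := funext gd_eq
  rw [this]; fun_prop

theorem gd_le_one (x : ℝ) : gd x ≤ 1 := by
  rw [gd_eq]
  refine mul_le_one₀ ?_ (Real.exp_nonneg _) (Real.exp_le_one_iff.2 (by nlinarith [sq_nonneg x]))
  refine inv_le_one_of_one_le₀ (Real.one_le_sqrt.2 ?_)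
  nlinarith [Real.pi_gt_three]

theorem hasDerivAt_gd (x : ℝ) : HasDerivAt gd (-(x * gd x)) x := by
  have h1 : HasDerivAt (fun y : ℝ => -y ^ 2 / 2) (-x) x := by
    have := (((hasDerivAt_id x).pow 2).neg).div_const 2
    refine (this.congr_of_eventuallyEq (Eventually.of_forall fun y => by simp)).congr_deriv ?_
    simp
    ring
  have h2 := (h1.exp).const_mul (√(2 * Real.pi))⁻¹
  refine (h2.congr_of_eventuallyEq (Eventually.of_forall gd_eq)).congr_deriv ?_
  rw [gd_eq]; ring

theorem gd_neg (x : ℝ) : gd (-x) = gd x := by rw [gd_eq, gd_eq]; simp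

theorem integrable_gd : Integrable gd := integrable_gaussianPDFReal 0 1

theorem gaussianReal_eq : gaussianReal 0 1 = volume.withDensity fun x => ENNReal.ofReal (gd x) :=
  gaussianReal_of_var_ne_zero 0 one_ne_zero

/-- The centred standard Gaussian distribution function. -/
def gc (z : ℝ) : ℝ := ∫ x in (0 : ℝ)..z, gd x

theorem hasDerivAt_gc (z : ℝ) : HasDerivAt gc (gd z) z :=
  intervalIntegral.integral_hasDerivAt_right (continuous_gd.intervalIntegrable _ _)
    (continuous_gd.stronglyMeasurableAtFilter _ _) continuous_gd.continuousAt

theorem continuous_gc : Continuous gc :=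
  continuous_iff_continuousAt.2 fun z => (hasDerivAt_gc z).continuousAt

theorem abs_gc_le (z : ℝ) : |gc z| ≤ 1 := by
  have h1 := intervalIntegral.norm_integral_le_integral_norm_uIoc (f := gd) (μ := volume)
    (a := 0) (b := z)
  refine h1.trans ?_
  calc ∫ x in Set.uIoc 0 z, ‖gd x‖ ≤ ∫ x, ‖gd x‖ :=
        setIntegral_le_integral integrable_gd.norm (ae_of_all _ fun x => norm_nonneg _)
    _ = 1 := by
        simp only [Real.norm_of_nonneg (gd_pos _).le]
        exact integral_gaussianPDFReal_eq_one 0 one_ne_zero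

theorem gc_neg (z : ℝ) : gc (-z) = -gc z := by
  have h := intervalIntegral.integral_comp_neg (f := gd) (a := 0) (b := z)
  simp only [gd_neg, neg_zero] at h
  rw [gc, gc, h, intervalIntegral.integral_symm]

theorem exists_tendsto_gc : ∃ c : ℝ, Tendsto gc atTop (𝓝 c) ∧ Tendsto gc atBot (𝓝 (-c)) := by
  have h1 := intervalIntegral_tendsto_integral_Ioi (f := gd) (μ := volume) 0
    integrable_gd.integrableOn tendsto_id
  refine ⟨_, h1, ?_⟩
  have h2 := (h1.comp tendsto_neg_atBot_atTop).neg
  refine h2.congr fun z => ?_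
  change -gc (-z) = gc z
  rw [gc_neg, neg_neg]

/-! ### Gaussian smoothing of a bounded variable and the monotone flow between the laws of `Z + t
F`. -/

section
variable {Ω : Type*} [MeasurableSpace Ω] {P : Measure Ω} [IsProbabilityMeasure P] {F : Ω → ℝ}

theorem integrable_of_bounded {G : Ω → ℝ} (hG : Measurable G) {M : ℝ} (hM : ∀ ω, |G ω| ≤ M) :
    Integrable G P :=
  Integrable.of_bound hG.aestronglyMeasurable M (ae_of_all _ hM)

theorem continuous_smoothing (hF : Measurable F) {k : ℝ → ℝ} (hk : Continuous k)
    (hk1 : ∀ z, |k z| ≤ 1) {G : Ω → ℝ} (hG : Measurable G) {M : ℝ} (hM : ∀ ω, |G ω| ≤ M) :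
    Continuous fun x : ℝ × ℝ => ∫ ω, G ω * k (x.2 - x.1 * F ω) ∂P := by
  refine continuous_of_dominated (bound := fun _ => M * 1) (fun x => ?_)
    (fun x => ae_of_all _ fun ω => ?_) (integrable_const _) (ae_of_all _ fun ω => ?_)
  · exact (hG.mul (hk.measurable.comp (by fun_prop))).aestronglyMeasurable
  · rw [norm_mul]
    exact mul_le_mul (hM ω) (hk1 _) (norm_nonneg _) ((abs_nonneg _).trans (hM ω))
  · fun_prop

/-- The centred distribution function of `Z + t F`, where `Z` is an independent standard Gaussian
variable. -/
def cdfT (P : Measure Ω) (F : Ω → ℝ) (t z : ℝ) : ℝ := ∫ ω, gc (z - t * F ω) ∂P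

/-- The density of `Z + t F`. -/
def pdfT (P : Measure Ω) (F : Ω → ℝ) (t z : ℝ) : ℝ := ∫ ω, gd (z - t * F ω) ∂P

/-- The expectation of `F` on the event `Z + t F = z`. -/
def numT (P : Measure Ω) (F : Ω → ℝ) (t z : ℝ) : ℝ := ∫ ω, F ω * gd (z - t * F ω) ∂P

theorem abs_gd_le (x : ℝ) : |gd x| ≤ 1 := by rw [abs_of_pos (gd_pos x)]; exact gd_le_one x

theorem integrable_gd_sub (hF : Measurable F) (t z : ℝ) :
    Integrable (fun ω => gd (z - t * F ω)) P :=
  integrable_of_bounded (continuous_gd.measurable.comp (by fun_prop)) fun _ => abs_gd_le _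

theorem continuous_cdfT (hF : Measurable F) : Continuous fun x : ℝ × ℝ => cdfT P F x.1 x.2 := by
  have := continuous_smoothing (P := P) hF continuous_gc abs_gc_le (measurable_const (a := (1 : ℝ)))
    (M := 1) (by simp)
  simp only [one_mul] at this
  exact this

theorem continuous_pdfT (hF : Measurable F) : Continuous fun x : ℝ × ℝ => pdfT P F x.1 x.2 := by
  have := continuous_smoothing (P := P) hF continuous_gd abs_gd_le (measurable_const (a := (1 : ℝ)))
    (M := 1) (by simp)
  simp only [one_mul] at this
  exact this

theorem continuous_numT (hF : Measurable F) {A : ℝ} (hA : ∀ ω, |F ω| ≤ A) :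
    Continuous fun x : ℝ × ℝ => numT P F x.1 x.2 :=
  continuous_smoothing hF continuous_gd abs_gd_le hF hA

theorem pdfT_pos (hF : Measurable F) (t z : ℝ) : 0 < pdfT P F t z := by
  rw [pdfT, integral_pos_iff_support_of_nonneg (fun ω => (gd_pos _).le) (integrable_gd_sub hF t z)]
  have : Function.support (fun ω => gd (z - t * F ω)) = Set.univ :=
    Set.eq_univ_of_forall fun ω => (gd_pos _).ne'
  simp [this]

/-- Joint differentiability in `(t, z)`, obtained under the integral sign because `F` is bounded. It
feeds the implicit description of the flow as a level curve of the distribution functions. -/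
theorem hasFDerivAt_cdfT (hF : Measurable F) {A : ℝ} (hA : ∀ ω, |F ω| ≤ A) (t z : ℝ) :
    ∃ L : ℝ × ℝ →L[ℝ] ℝ, HasFDerivAt (fun x : ℝ × ℝ => cdfT P F x.1 x.2) L (t, z) ∧
      ∀ a b, L (a, b) = b * pdfT P F t z - a * numT P F t z := by
  set F' : ℝ × ℝ → Ω → (ℝ × ℝ →L[ℝ] ℝ) := fun x ω => gd (x.2 - x.1 * F ω) •
    (ContinuousLinearMap.snd ℝ ℝ ℝ - F ω • ContinuousLinearMap.fst ℝ ℝ ℝ) with hF'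
  have hgdm : ∀ x : ℝ × ℝ, Measurable fun ω => gd (x.2 - x.1 * F ω) := fun x =>
    continuous_gd.measurable.comp (by fun_prop)
  have hF'm : ∀ x, AEStronglyMeasurable (F' x) P := fun x =>
    (hgdm x).aestronglyMeasurable.smul
      (aestronglyMeasurable_const.sub (hF.aestronglyMeasurable.smul aestronglyMeasurable_const))
  have hbd : ∀ x ω, ‖F' x ω‖ ≤ 1 + A := by
    intro x ω
    rw [norm_smul, Real.norm_eq_abs]
    have h1 : ‖ContinuousLinearMap.snd ℝ ℝ ℝ - F ω • ContinuousLinearMap.fst ℝ ℝ ℝ‖ ≤ 1 + A := by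
      refine (norm_sub_le _ _).trans (add_le_add (ContinuousLinearMap.norm_snd_le ..) ?_)
      rw [norm_smul]
      calc ‖F ω‖ * ‖ContinuousLinearMap.fst ℝ ℝ ℝ‖ ≤ ‖F ω‖ * 1 := by
            gcongr; exact ContinuousLinearMap.norm_fst_le ..
        _ ≤ A := by rw [mul_one]; exact hA ω
    calc |gd (x.2 - x.1 * F ω)| * _ ≤ 1 * (1 + A) :=
          mul_le_mul (abs_gd_le _) h1 (norm_nonneg _) zero_le_one
      _ = 1 + A := one_mul _
  have hi : Integrable (F' (t, z)) P := Integrable.of_bound (hF'm _) (1 + A) (ae_of_all _ (hbd _))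
  have key := hasFDerivAt_integral_of_dominated_of_fderiv_le (𝕜 := ℝ) (μ := P) (x₀ := (t, z))
    (F := fun x ω => gc (x.2 - x.1 * F ω)) (F' := F') (bound := fun _ => 1 + A) (s := Set.univ)
    univ_mem
    (Eventually.of_forall fun x =>
      (continuous_gc.measurable.comp (by fun_prop)).aestronglyMeasurable)
    (integrable_of_bounded (continuous_gc.measurable.comp (by fun_prop)) fun _ => abs_gc_le _)
    (hF'm _) (ae_of_all _ fun ω x _ => hbd x ω) (integrable_const _)
    (ae_of_all _ fun ω x _ => by
      have h1 : HasFDerivAt (fun x : ℝ × ℝ => x.2 - x.1 * F ω)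
          (ContinuousLinearMap.snd ℝ ℝ ℝ - F ω • ContinuousLinearMap.fst ℝ ℝ ℝ) x :=
        hasFDerivAt_snd.sub (hasFDerivAt_fst.mul_const (F ω))
      exact (hasDerivAt_gc _).comp_hasFDerivAt x h1)
  refine ⟨_, key, fun a b => ?_⟩
  rw [ContinuousLinearMap.integral_apply hi]
  have i1 := integrable_gd_sub (P := P) hF t z
  have i2 : Integrable (fun ω => F ω * gd (z - t * F ω)) P := i1.bdd_mul (c := A)
    hF.aestronglyMeasurable (ae_of_all _ hA)
  simp only [pdfT, numT]
  rw [← integral_const_mul, ← integral_const_mul, ← integral_sub (i1.const_mul _) (i2.const_mul _)]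
  refine integral_congr_ae (ae_of_all _ fun ω => ?_)
  simp [hF']
  ring

theorem hasDerivAt_cdfT (hF : Measurable F) {A : ℝ} (hA : ∀ ω, |F ω| ≤ A) (t z : ℝ) :
    HasDerivAt (cdfT P F t) (pdfT P F t z) z := by
  obtain ⟨L, hL, hLab⟩ := hasFDerivAt_cdfT (P := P) hF hA t z
  have h1 : HasDerivAt (fun y : ℝ => (t, y)) ((0 : ℝ), (1 : ℝ)) z :=
    (hasDerivAt_const z t).prodMk (hasDerivAt_id z)
  have := hL.comp_hasDerivAt z h1
  rw [hLab] at this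
  simpa [Function.comp_def] using this

theorem strictMono_cdfT (hF : Measurable F) {A : ℝ} (hA : ∀ ω, |F ω| ≤ A) (t : ℝ) :
    StrictMono (cdfT P F t) :=
  strictMono_of_hasDerivAt_pos (fun z => hasDerivAt_cdfT hF hA t z) fun z => pdfT_pos hF t z

/-- The limits at infinity are those of the Gaussian distribution function, whatever `t`. A range
common to all `t` is what makes the flow defined for every pair of times. -/
theorem exists_range_cdfT (hF : Measurable F) {A : ℝ} (hA : ∀ ω, |F ω| ≤ A) :
    ∃ c : ℝ, ∀ t, Set.range (cdfT P F t) = Set.Ioo (-c) c := by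
  obtain ⟨c, hc1, hc2⟩ := exists_tendsto_gc
  refine ⟨c, fun t => ?_⟩
  have hmono := strictMono_cdfT (P := P) hF hA t
  have hlim : ∀ {l : Filter ℝ} [l.IsCountablyGenerated] {a : ℝ}, Tendsto gc l (𝓝 a) →
      (∀ d : ℝ, Tendsto (fun z : ℝ => z - d) l l) → Tendsto (cdfT P F t) l (𝓝 a) := by
    intro l _ a ha hd
    have := tendsto_integral_filter_of_dominated_convergence (μ := P) (l := l)
      (F := fun z ω => gc (z - t * F ω)) (f := fun _ => a) (fun _ => 1)
      (Eventually.of_forall fun z =>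
        (continuous_gc.measurable.comp (by fun_prop)).aestronglyMeasurable)
      (Eventually.of_forall fun z => ae_of_all _ fun ω => abs_gc_le _) (integrable_const _)
      (ae_of_all _ fun ω => ha.comp (hd (t * F ω)))
    simp only [integral_const, probReal_univ, one_smul] at this
    exact this
  have h1 : Tendsto (cdfT P F t) atTop (𝓝 c) :=
    hlim hc1 fun d => tendsto_atTop_add_const_right _ (-d) tendsto_id
  have h2 : Tendsto (cdfT P F t) atBot (𝓝 (-c)) :=
    hlim hc2 fun d => tendsto_atBot_add_const_right _ (-d) tendsto_id
  have hcont : Continuous (cdfT P F t) :=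
    continuous_iff_continuousAt.2 fun z => (hasDerivAt_cdfT hF hA t z).continuousAt
  ext s
  constructor
  · rintro ⟨z, rfl⟩
    exact ⟨(hmono.monotone.le_of_tendsto h2 (z - 1)).trans_lt (hmono (by linarith)),
      (hmono (by linarith : z < z + 1)).trans_le (hmono.monotone.ge_of_tendsto h1 (z + 1))⟩
  · rintro ⟨hs1, hs2⟩
    obtain ⟨a, ha⟩ := (h2.eventually (gt_mem_nhds hs1)).exists
    obtain ⟨b, hb⟩ := (h1.eventually (lt_mem_nhds hs2)).exists
    exact mem_range_of_exists_le_of_exists_ge hcont ⟨a, ha.le⟩ ⟨b, hb.le⟩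

/-- The monotone transport from the law of `Z + T F` to the law of `Z + t F`. -/
def flow (P : Measure Ω) (F : Ω → ℝ) (T t ξ : ℝ) : ℝ :=
  Function.invFun (cdfT P F t) (cdfT P F T ξ)

theorem cdfT_flow (hF : Measurable F) {A : ℝ} (hA : ∀ ω, |F ω| ≤ A) (T t ξ : ℝ) :
    cdfT P F t (flow P F T t ξ) = cdfT P F T ξ := by
  obtain ⟨c, hc⟩ := exists_range_cdfT (P := P) hF hA
  have : cdfT P F T ξ ∈ Set.range (cdfT P F t) := by
    rw [hc t, ← hc T]; exact Set.mem_range_self ξ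
  exact Function.invFun_eq this

theorem flow_self (hF : Measurable F) {A : ℝ} (hA : ∀ ω, |F ω| ≤ A) (T ξ : ℝ) :
    flow P F T T ξ = ξ :=
  (strictMono_cdfT (P := P) hF hA T).injective (cdfT_flow hF hA T T ξ)

/-- Strict monotonicity turns the conditions `flow > a` and `flow < a` into strict inequalities
between jointly continuous distribution functions, hence open conditions. -/
theorem continuous_flow (hF : Measurable F) {A : ℝ} (hA : ∀ ω, |F ω| ≤ A) (T : ℝ) :
    Continuous fun x : ℝ × ℝ => flow P F T x.1 x.2 := by
  have hc := continuous_cdfT (P := P) hF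
  have h1 : Continuous fun x : ℝ × ℝ => cdfT P F T x.2 := hc.comp (by fun_prop :
    Continuous fun x : ℝ × ℝ => (T, x.2))
  have h2 : ∀ a, Continuous fun x : ℝ × ℝ => cdfT P F x.1 a := fun a => hc.comp (by fun_prop :
    Continuous fun x : ℝ × ℝ => (x.1, a))
  rw [OrderTopology.continuous_iff]
  intro a
  have e1 : (fun x : ℝ × ℝ => flow P F T x.1 x.2) ⁻¹' Set.Ioi a =
      {x | cdfT P F x.1 a < cdfT P F T x.2} := by
    ext x
    rw [Set.mem_preimage, Set.mem_Ioi, ← (strictMono_cdfT (P := P) hF hA x.1).lt_iff_lt,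
      cdfT_flow hF hA]
    rfl
  have e2 : (fun x : ℝ × ℝ => flow P F T x.1 x.2) ⁻¹' Set.Iio a =
      {x | cdfT P F T x.2 < cdfT P F x.1 a} := by
    ext x
    rw [Set.mem_preimage, Set.mem_Iio, ← (strictMono_cdfT (P := P) hF hA x.1).lt_iff_lt,
      cdfT_flow hF hA]
    rfl
  rw [e1, e2]
  exact ⟨isOpen_lt (h2 a) h1, isOpen_lt h1 (h2 a)⟩

/-- Continuity of the curve suffices: the first-order expansion on the level set first forces the
increment of `q` to be `O(t - t₀)`, after which the error becomes `o(t - t₀)`. -/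
theorem hasDerivAt_of_implicit {G : ℝ × ℝ → ℝ} {q : ℝ → ℝ} {t₀ : ℝ} {L : ℝ × ℝ →L[ℝ] ℝ}
    (hG : HasFDerivAt G L (t₀, q t₀)) (hL : L (0, 1) ≠ 0) (hq : ContinuousAt q t₀)
    (hGq : ∀ t, G (t, q t) = G (t₀, q t₀)) :
    HasDerivAt q (-L (1, 0) / L (0, 1)) t₀ := by
  set p := L (0, 1) with hp
  set l := L (1, 0) with hl
  have hLab : ∀ a b : ℝ, L (a, b) = a * l + b * p := by
    intro a b
    have : ((a, b) : ℝ × ℝ) = a • ((1 : ℝ), (0 : ℝ)) + b • ((0 : ℝ), (1 : ℝ)) := by simp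
    rw [this, map_add, map_smul, map_smul]; rfl
  have hk : Tendsto (fun t => (t, q t)) (𝓝 t₀) (𝓝 (t₀, q t₀)) :=
    tendsto_id.prodMk_nhds hq
  have h1 := hG.isLittleO.comp_tendsto hk
  have h2 : (fun t => ((0 : ℝ), ((t - t₀) * l + (q t - q t₀) * p) / p)) =o[𝓝 t₀]
      fun t => ((t, q t) - (t₀, q t₀) : ℝ × ℝ) := by
    have h3 : (fun t => (t - t₀) * l + (q t - q t₀) * p) =o[𝓝 t₀]
        fun t => ((t, q t) - (t₀, q t₀) : ℝ × ℝ) := by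
      refine (h1.neg_left).congr_left fun t => ?_
      simp only [Function.comp, hGq t, Prod.mk_sub_mk, hLab]
      ring
    have h4 := h3.const_mul_left p⁻¹
    have h0 : (fun _ : ℝ => (0 : ℝ)) =o[𝓝 t₀] fun t => ((t, q t) - (t₀, q t₀) : ℝ × ℝ) :=
      Asymptotics.isLittleO_zero _ _
    refine (h0.prod_left h4).congr_left fun t => ?_
    rw [div_eq_inv_mul]
  have h5 := h2.right_isBigO_sub
  have h6 : (fun t => ((t, q t) - (t₀, q t₀) : ℝ × ℝ)) =O[𝓝 t₀] fun t => t - t₀ := by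
    refine h5.trans ?_
    have : (fun t => ((t, q t) - (t₀, q t₀) : ℝ × ℝ) -
        ((0 : ℝ), ((t - t₀) * l + (q t - q t₀) * p) / p)) =
        fun t => (t - t₀) • ((1 : ℝ), -l / p) := by
      funext t
      ext
      · simp
      · simp; field_simp; ring
    rw [this]
    exact Asymptotics.IsBigO.of_bound ‖((1 : ℝ), -l / p)‖
      (Eventually.of_forall fun t => by rw [norm_smul, mul_comm])
  have h7 := (h2.trans_isBigO h6)
  have h8 := (Asymptotics.isLittleO_prod_left.1 h7).2
  rw [hasDerivAt_iff_isLittleO]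
  refine h8.congr_left fun t => ?_
  simp; field_simp; ring

/-- The velocity is `E[F | Z + t F = z]`, as expected from the continuity equation for the laws of
`Z + t F`. -/
theorem hasDerivAt_flow (hF : Measurable F) {A : ℝ} (hA : ∀ ω, |F ω| ≤ A) (T t ξ : ℝ) :
    HasDerivAt (fun t => flow P F T t ξ)
      (numT P F t (flow P F T t ξ) / pdfT P F t (flow P F T t ξ)) t := by
  obtain ⟨L, hL, hLab⟩ := hasFDerivAt_cdfT (P := P) hF hA t (flow P F T t ξ)
  have hp := pdfT_pos (P := P) hF t (flow P F T t ξ)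
  have h1 := hasDerivAt_of_implicit (q := fun t => flow P F T t ξ) hL
    (by rw [hLab]; simpa using hp.ne')
    ((continuous_flow hF hA T).comp (by fun_prop : Continuous fun t : ℝ => (t, ξ))).continuousAt
    (fun s => by simp only [cdfT_flow hF hA])
  rw [hLab, hLab] at h1
  simpa using h1

/-- Both sides equal the same integral over the common range of the distribution functions, after a
monotone change of variables at time `T` and at time `t`. -/
theorem lintegral_flow (hF : Measurable F) {A : ℝ} (hA : ∀ ω, |F ω| ≤ A) (T t : ℝ)
    (f : ℝ → ENNReal) :
    ∫⁻ ξ, ENNReal.ofReal (pdfT P F T ξ) * f (flow P F T t ξ) =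
      ∫⁻ z, ENNReal.ofReal (pdfT P F t z) * f z := by
  obtain ⟨c, hc⟩ := exists_range_cdfT (P := P) hF hA
  have key : ∀ s (k : ℝ → ENNReal), ∫⁻ y in Set.Ioo (-c) c, k y =
      ∫⁻ z, ENNReal.ofReal (pdfT P F s z) * k (cdfT P F s z) := by
    intro s k
    have := lintegral_image_eq_lintegral_deriv_mul_of_monotoneOn (f := cdfT P F s)
      (f' := pdfT P F s) MeasurableSet.univ
      (fun z _ => (hasDerivAt_cdfT hF hA s z).hasDerivWithinAt)
      ((strictMono_cdfT (P := P) hF hA s).monotone.monotoneOn _) k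
    rwa [Set.image_univ, hc s, Measure.restrict_univ] at this
  have h1 := key T fun y => f (Function.invFun (cdfT P F t) y)
  have h2 := key t fun y => f (Function.invFun (cdfT P F t) y)
  simp only [Function.leftInverse_invFun (strictMono_cdfT (P := P) hF hA t).injective _] at h2
  exact h1.symm.trans h2

end

theorem lintegral_gd : ∫⁻ x, ENNReal.ofReal (gd x) = 1 := by
  have := lintegral_gaussianPDFReal_eq_one 0 (one_ne_zero (α := NNReal))
  exact this

theorem lintegral_sq_gaussianReal : ∫⁻ x, ENNReal.ofReal (x ^ 2) ∂gaussianReal 0 1 = 1 := by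
  have h1 := variance_fun_id_gaussianReal (μ := 0) (v := 1)
  rw [variance_eq_integral (by fun_prop)] at h1
  simp only [integral_id_gaussianReal, sub_zero] at h1
  have h2 : Integrable (fun x : ℝ => x ^ 2) (gaussianReal 0 1) :=
    (memLp_id_gaussianReal (μ := 0) (v := 1) 2).integrable_sq
  rw [← ofReal_integral_eq_lintegral_ofReal h2 (ae_of_all _ fun x => sq_nonneg x), h1]
  simp

theorem lintegral_sq_mul_gd : ∫⁻ x, ENNReal.ofReal (x ^ 2 * gd x) = 1 := by
  have h := lintegral_sq_gaussianReal
  rw [gaussianReal_eq, lintegral_withDensity_eq_lintegral_mul _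
    (continuous_gd.measurable.ennreal_ofReal) (by fun_prop)] at h
  rw [← h]
  refine lintegral_congr fun x => ?_
  rw [Pi.mul_apply, mul_comm, ENNReal.ofReal_mul (gd_pos x).le]

/-! ### Velocity estimates and the transport bound under an approximate Stein identity. -/

section
variable {Ω : Type*} [MeasurableSpace Ω] {P : Measure Ω} [IsProbabilityMeasure P] {F τ R : Ω → ℝ}

/-- The Stein kernel identity for `F`, with Stein factor `τ` and remainder `R`. -/
def SteinIdentity (P : Measure Ω) (F τ R : Ω → ℝ) : Prop :=
  ∀ h h' : ℝ → ℝ, (∀ s, HasDerivAt h (h' s) s) → Continuous h' →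
    ∫ ω, F ω * h (F ω) ∂P = ∫ ω, τ ω * h' (F ω) ∂P + ∫ ω, R ω * h (F ω) ∂P

/-- The velocity of the rescaled flow `flow / √(1 + t²)`, multiplied by `(1 + t²)^{3/2}`. -/
def velT (P : Measure Ω) (F : Ω → ℝ) (t z : ℝ) : ℝ :=
  ((1 + t ^ 2) * numT P F t z - t * z * pdfT P F t z) / pdfT P F t z

theorem abs_mul_gd_le (x : ℝ) : |x * gd x| ≤ 1 := by
  have h1 : |x| ≤ Real.exp (x ^ 2 / 2) := by
    have h2 := Real.add_one_le_exp (x ^ 2 / 2)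
    have h3 : |x| ^ 2 = x ^ 2 := sq_abs x
    nlinarith [sq_nonneg (|x| - 1)]
  have h4 : gd x ≤ Real.exp (-(x ^ 2 / 2)) := by
    rw [gd_eq, neg_div]
    refine mul_le_of_le_one_left (Real.exp_nonneg _)
      (inv_le_one_of_one_le₀ (Real.one_le_sqrt.2 ?_))
    nlinarith [Real.pi_gt_three]
  rw [abs_mul, abs_of_pos (gd_pos x)]
  calc |x| * gd x ≤ Real.exp (x ^ 2 / 2) * Real.exp (-(x ^ 2 / 2)) :=
        mul_le_mul h1 h4 (gd_pos x).le (Real.exp_nonneg _)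
    _ = 1 := by rw [← Real.exp_add]; simp

/-- The Stein identity for the test function `s ↦ gd (z - t s)`. It expresses the velocity as the
conditional expectation of `R + t (τ - 1) Z` given `Z + t F = z`, which vanishes for an exact
Gaussian. -/
theorem SteinIdentity.velT_mul (S : SteinIdentity P F τ R) (hF : Measurable F) {A : ℝ}
    (hA : ∀ ω, |F ω| ≤ A) (hτ : Measurable τ) {B : ℝ} (hB : ∀ ω, |τ ω| ≤ B) (hR : Measurable R)
    {B' : ℝ} (hB' : ∀ ω, |R ω| ≤ B') (t z : ℝ) :
    velT P F t z * pdfT P F t z = ∫ ω, (R ω + t * (τ ω - 1) * (z - t * F ω)) *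
      gd (z - t * F ω) ∂P := by
  have hd : ∀ s, HasDerivAt (fun s => gd (z - t * s)) (t * ((z - t * s) * gd (z - t * s))) s := by
    intro s
    have h1 : HasDerivAt (fun s : ℝ => z - t * s) (-t) s := by
      simpa using ((hasDerivAt_id s).const_mul t).const_sub z
    exact ((hasDerivAt_gd (z - t * s)).comp s h1).congr_deriv (by ring)
  have key := S _ _ hd (by
    have := continuous_gd
    fun_prop)
  have e1 : ∫ ω, F ω * gd (z - t * F ω) ∂P = numT P F t z := rfl
  rw [e1] at key
  have hg := integrable_gd_sub (P := P) hF t z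
  have iF : Integrable (fun ω => F ω * gd (z - t * F ω)) P :=
    hg.bdd_mul (c := A) hF.aestronglyMeasurable (ae_of_all _ hA)
  have iR : Integrable (fun ω => R ω * gd (z - t * F ω)) P :=
    hg.bdd_mul (c := B') hR.aestronglyMeasurable (ae_of_all _ hB')
  have ig : Integrable (fun ω => (z - t * F ω) * gd (z - t * F ω)) P :=
    integrable_of_bounded ((by fun_prop : Measurable fun ω => z - t * F ω).mul
      (continuous_gd.measurable.comp (by fun_prop))) fun ω => abs_mul_gd_le _
  have iτ : Integrable (fun ω => τ ω * (t * ((z - t * F ω) * gd (z - t * F ω)))) P :=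
    (ig.const_mul t).bdd_mul (c := B) hτ.aestronglyMeasurable (ae_of_all _ hB)
  have e2 : ∫ ω, (z - t * F ω) * gd (z - t * F ω) ∂P = z * pdfT P F t z - t * numT P F t z := by
    rw [pdfT, numT, ← integral_const_mul, ← integral_const_mul,
      ← integral_sub (hg.const_mul z) (iF.const_mul t)]
    exact integral_congr_ae (ae_of_all _ fun ω => by ring)
  have e3 : ∫ ω, (R ω + t * (τ ω - 1) * (z - t * F ω)) * gd (z - t * F ω) ∂P =
      ∫ ω, τ ω * (t * ((z - t * F ω) * gd (z - t * F ω))) ∂P + ∫ ω, R ω * gd (z - t * F ω) ∂P -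
        t * ∫ ω, (z - t * F ω) * gd (z - t * F ω) ∂P := by
    have iadd : Integrable (fun ω => τ ω * (t * ((z - t * F ω) * gd (z - t * F ω))) +
      R ω * gd (z - t * F ω)) P := iτ.add iR
    rw [← integral_const_mul, ← integral_add iτ iR, ← integral_sub iadd (ig.const_mul t)]
    exact integral_congr_ae (ae_of_all _ fun ω => by ring)
  rw [e3, ← key, e2, velT, div_mul_cancel₀ _ (pdfT_pos hF t z).ne']
  ring

/-- Conditional Jensen, written as nonnegativity of the conditional variance of `R + t (τ - 1) Z`.
-/
theorem SteinIdentity.sq_velT_mul_le (S : SteinIdentity P F τ R) (hF : Measurable F) {A : ℝ}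
    (hA : ∀ ω, |F ω| ≤ A) (hτ : Measurable τ) {B : ℝ} (hB : ∀ ω, |τ ω| ≤ B) (hR : Measurable R)
    {B' : ℝ} (hB' : ∀ ω, |R ω| ≤ B') (t z : ℝ) :
    pdfT P F t z * velT P F t z ^ 2 ≤ ∫ ω, (R ω + t * (τ ω - 1) * (z - t * F ω)) ^ 2 *
      gd (z - t * F ω) ∂P := by
  set a : Ω → ℝ := fun ω => z - t * F ω with ha
  set G : Ω → ℝ := fun ω => R ω + t * (τ ω - 1) * a ω with hG
  have ham : Measurable a := by fun_prop
  have hGm : Measurable G := by fun_prop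
  have hab : ∀ ω, |a ω| ≤ |z| + |t| * A := fun ω => by
    refine (abs_sub _ _).trans ?_
    rw [abs_mul]; gcongr; exact hA ω
  have hGb : ∀ ω, |G ω| ≤ B' + |t| * (B + 1) * (|z| + |t| * A) := fun ω => by
    refine (abs_add_le _ _).trans (add_le_add (hB' ω) ?_)
    rw [abs_mul, abs_mul]
    have h1 : |τ ω - 1| ≤ B + 1 := (abs_sub _ _).trans (by simpa using hB ω)
    exact mul_le_mul (mul_le_mul_of_nonneg_left h1 (abs_nonneg _)) (hab ω) (abs_nonneg _)
      (mul_nonneg (abs_nonneg _) ((abs_nonneg _).trans h1))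
  set M := B' + |t| * (B + 1) * (|z| + |t| * A)
  have hg : Integrable (fun ω => gd (a ω)) P := integrable_gd_sub (P := P) hF t z
  have i1 : Integrable (fun ω => G ω * gd (a ω)) P :=
    hg.bdd_mul (c := M) hGm.aestronglyMeasurable (ae_of_all _ hGb)
  have i2 : Integrable (fun ω => G ω ^ 2 * gd (a ω)) P :=
    hg.bdd_mul (c := M ^ 2) (hGm.pow_const 2).aestronglyMeasurable (ae_of_all _ fun ω => by
      rw [norm_pow, Real.norm_eq_abs]; gcongr; exact hGb ω)
  set Y := velT P F t z
  have hY : Y * pdfT P F t z = ∫ ω, G ω * gd (a ω) ∂P := S.velT_mul hF hA hτ hB hR hB' t z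
  have h0 : 0 ≤ ∫ ω, (G ω - Y) ^ 2 * gd (a ω) ∂P :=
    integral_nonneg fun ω => mul_nonneg (sq_nonneg _) (gd_pos _).le
  have h1 : ∫ ω, (G ω - Y) ^ 2 * gd (a ω) ∂P = ∫ ω, G ω ^ 2 * gd (a ω) ∂P -
      2 * Y * ∫ ω, G ω * gd (a ω) ∂P + Y ^ 2 * pdfT P F t z := by
    have i3 : Integrable (fun ω => G ω ^ 2 * gd (a ω) - 2 * Y * (G ω * gd (a ω))) P :=
      i2.sub (i1.const_mul _)
    have hpa : pdfT P F t z = ∫ ω, gd (a ω) ∂P := rfl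
    rw [hpa, ← integral_const_mul, ← integral_const_mul, ← integral_sub i2 (i1.const_mul _),
      ← integral_add i3 (hg.const_mul _)]
    exact integral_congr_ae (ae_of_all _ fun ω => by ring)
  rw [h1, ← hY] at h0
  nlinarith

/-- Tonelli and a translation in `z` decouple `Z` from `F`; the Gaussian has total mass and second
moment one, which leaves `2 E[R²] + 2 t² E[(τ - 1)²]`. -/
theorem SteinIdentity.lintegral_velT_le (S : SteinIdentity P F τ R) (hF : Measurable F) {A : ℝ}
    (hA : ∀ ω, |F ω| ≤ A) (hτ : Measurable τ) {B : ℝ} (hB : ∀ ω, |τ ω| ≤ B) (hR : Measurable R)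
    {B' : ℝ} (hB' : ∀ ω, |R ω| ≤ B') {D : ℝ} (hDR : ∫ ω, R ω ^ 2 ∂P ≤ D)
    (hDτ : ∫ ω, (τ ω - 1) ^ 2 ∂P ≤ D) (t : ℝ) :
    ∫⁻ z, ENNReal.ofReal (pdfT P F t z) * ENNReal.ofReal (velT P F t z ^ 2) ≤
      ENNReal.ofReal (2 * D * (1 + t ^ 2)) := by
  have hgm := continuous_gd.measurable
  have iR : Integrable (fun ω => R ω ^ 2) P :=
    integrable_of_bounded (hR.pow_const 2) (M := B' ^ 2) fun ω => by
      rw [abs_pow]; gcongr; exact hB' ω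
  have iτ : Integrable (fun ω => (τ ω - 1) ^ 2) P :=
    integrable_of_bounded ((hτ.sub_const 1).pow_const 2) (M := (B + 1) ^ 2) fun ω => by
      rw [abs_pow]; gcongr
      exact (abs_sub _ _).trans (by simpa using hB ω)
  have h1 : ∀ z, ENNReal.ofReal (pdfT P F t z) * ENNReal.ofReal (velT P F t z ^ 2) ≤
      ∫⁻ ω, (ENNReal.ofReal (2 * R ω ^ 2) * ENNReal.ofReal (gd (z - t * F ω)) +
        ENNReal.ofReal (2 * t ^ 2 * (τ ω - 1) ^ 2) *
          ENNReal.ofReal ((z - t * F ω) ^ 2 * gd (z - t * F ω))) ∂P := by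
    intro z
    rw [← ENNReal.ofReal_mul (pdfT_pos hF t z).le]
    refine (ENNReal.ofReal_le_ofReal (S.sq_velT_mul_le hF hA hτ hB hR hB' t z)).trans ?_
    rw [integral_eq_lintegral_of_nonneg_ae
      (ae_of_all _ fun ω => mul_nonneg (sq_nonneg _) (gd_pos _).le)
      (Measurable.aestronglyMeasurable (by fun_prop))]
    refine ENNReal.ofReal_toReal_le.trans (lintegral_mono fun ω => ?_)
    have hg := (gd_pos (z - t * F ω)).le
    rw [← ENNReal.ofReal_mul (by positivity), ← ENNReal.ofReal_mul (by positivity),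
      ← ENNReal.ofReal_add (by positivity) (by positivity)]
    refine ENNReal.ofReal_le_ofReal ?_
    have : (R ω + t * (τ ω - 1) * (z - t * F ω)) ^ 2 ≤
        2 * R ω ^ 2 + 2 * t ^ 2 * (τ ω - 1) ^ 2 * (z - t * F ω) ^ 2 := by
      nlinarith [sq_nonneg (R ω - t * (τ ω - 1) * (z - t * F ω))]
    calc _ ≤ (2 * R ω ^ 2 + 2 * t ^ 2 * (τ ω - 1) ^ 2 * (z - t * F ω) ^ 2) *
          gd (z - t * F ω) := mul_le_mul_of_nonneg_right this hg
      _ = _ := by ring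
  refine (lintegral_mono h1).trans ?_
  rw [lintegral_lintegral_swap (by
    refine Measurable.aemeasurable ?_
    have hF2 : Measurable fun p : ℝ × Ω => p.1 - t * F p.2 := by fun_prop
    have := hgm.comp hF2
    have hR2 : Measurable fun p : ℝ × Ω => R p.2 := by fun_prop
    have hτ2 : Measurable fun p : ℝ × Ω => τ p.2 := by fun_prop
    refine Measurable.add (Measurable.mul (by fun_prop) this.ennreal_ofReal)
      (Measurable.mul (by fun_prop) ((hF2.pow_const 2).mul this).ennreal_ofReal))]
  have h2 : ∀ ω, ∫⁻ z, (ENNReal.ofReal (2 * R ω ^ 2) * ENNReal.ofReal (gd (z - t * F ω)) +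
        ENNReal.ofReal (2 * t ^ 2 * (τ ω - 1) ^ 2) *
          ENNReal.ofReal ((z - t * F ω) ^ 2 * gd (z - t * F ω))) =
      ENNReal.ofReal (2 * R ω ^ 2 + 2 * t ^ 2 * (τ ω - 1) ^ 2) := by
    intro ω
    rw [lintegral_sub_right_eq_self (fun z => ENNReal.ofReal (2 * R ω ^ 2) *
      ENNReal.ofReal (gd z) + ENNReal.ofReal (2 * t ^ 2 * (τ ω - 1) ^ 2) *
          ENNReal.ofReal (z ^ 2 * gd z)) (t * F ω),
      lintegral_add_left (by fun_prop), lintegral_const_mul _ (by fun_prop),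
      lintegral_const_mul _ (by fun_prop), lintegral_gd, lintegral_sq_mul_gd, mul_one, mul_one,
      ENNReal.ofReal_add (by positivity) (by positivity)]
  simp only [h2]
  have iadd : Integrable (fun ω => 2 * R ω ^ 2 + 2 * t ^ 2 * (τ ω - 1) ^ 2) P :=
    (iR.const_mul 2).add (iτ.const_mul (2 * t ^ 2))
  rw [← ofReal_integral_eq_lintegral_ofReal iadd
    (ae_of_all _ fun ω => by positivity), integral_add (iR.const_mul 2) (iτ.const_mul (2 * t ^ 2)),
    integral_const_mul, integral_const_mul]
  refine ENNReal.ofReal_le_ofReal ?_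
  nlinarith [mul_le_mul_of_nonneg_left hDτ (sq_nonneg t)]

theorem continuous_velT (hF : Measurable F) {A : ℝ} (hA : ∀ ω, |F ω| ≤ A) :
    Continuous fun x : ℝ × ℝ => velT P F x.1 x.2 := by
  have h1 := continuous_numT (P := P) hF hA
  have h2 := continuous_pdfT (P := P) hF
  exact Continuous.div (by fun_prop) h2 fun x => (pdfT_pos hF _ _).ne'

theorem hasDerivAt_rescaled_flow (hF : Measurable F) {A : ℝ} (hA : ∀ ω, |F ω| ≤ A) (T t ξ : ℝ) :
    HasDerivAt (fun t => flow P F T t ξ / √(1 + t ^ 2))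
      (velT P F t (flow P F T t ξ) / ((1 + t ^ 2) * √(1 + t ^ 2))) t := by
  have hw : (0 : ℝ) < 1 + t ^ 2 := by positivity
  have h1 : HasDerivAt (fun t : ℝ => 1 + t ^ 2) (2 * t) t := by
    simpa using ((hasDerivAt_id t).pow 2).const_add 1
  have h2 := (hasDerivAt_flow (P := P) hF hA T t ξ).div (h1.sqrt hw.ne') (Real.sqrt_pos.2 hw).ne'
  refine h2.congr_deriv ?_
  have hs : √(1 + t ^ 2) ≠ 0 := (Real.sqrt_pos.2 hw).ne'
  have hs2 : √(1 + t ^ 2) ^ 2 = 1 + t ^ 2 := Real.sq_sqrt hw.le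
  have hp := (pdfT_pos (P := P) hF t (flow P F T t ξ)).ne'
  rw [velT]
  set s := √(1 + t ^ 2)
  rw [← hs2]
  field_simp

/-- Cauchy–Schwarz in time, splitting the speed `v / (1 + t²)^{3/2}` as `v / (1 + t²)` times `(1 +
t²)^{-1/2}`. The square of the second factor integrates to `arctan T ≤ π / 2`. -/
theorem sq_rescaled_flow_le (hF : Measurable F) {A : ℝ} (hA : ∀ ω, |F ω| ≤ A) {T : ℝ} (hT : 0 < T)
    (ξ : ℝ) :
    (ξ / √(1 + T ^ 2) - flow P F T 0 ξ) ^ 2 ≤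
      Real.pi / 2 * ∫ t in (0 : ℝ)..T, velT P F t (flow P F T t ξ) ^ 2 / (1 + t ^ 2) ^ 2 := by
  have hc : Continuous fun t => velT P F t (flow P F T t ξ) :=
    (continuous_velT hF hA).comp (continuous_id.prodMk ((continuous_flow (P := P) hF hA T).comp
      (by fun_prop : Continuous fun t : ℝ => (t, ξ))))
  set v := fun t => velT P F t (flow P F T t ξ)
  have hw : ∀ t : ℝ, (1 + t ^ 2) ≠ 0 := fun t => by positivity
  have hs : ∀ t : ℝ, √(1 + t ^ 2) ≠ 0 := fun t => (Real.sqrt_pos.2 (by positivity)).ne'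
  have c1 : Continuous fun t => v t / ((1 + t ^ 2) * √(1 + t ^ 2)) :=
    hc.div (by fun_prop) fun t => mul_ne_zero (hw t) (hs t)
  have c2 : Continuous fun t => v t ^ 2 / (1 + t ^ 2) ^ 2 :=
    (hc.pow 2).div (by fun_prop) fun t => pow_ne_zero 2 (hw t)
  have c3 : Continuous fun t : ℝ => (1 + t ^ 2)⁻¹ := Continuous.inv₀ (by fun_prop) hw
  have hFTC := intervalIntegral.integral_eq_sub_of_hasDerivAt (a := 0) (b := T)
    (fun t _ => hasDerivAt_rescaled_flow (P := P) hF hA T t ξ) (c1.intervalIntegrable _ _)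
  rw [flow_self hF hA] at hFTC
  simp only [ne_eq, OfNat.ofNat_ne_zero, not_false_eq_true, zero_pow, add_zero, Real.sqrt_one,
    div_one] at hFTC
  rw [← hFTC]
  set d := ∫ t in (0 : ℝ)..T, v t / ((1 + t ^ 2) * √(1 + t ^ 2)) with hd
  set I := ∫ t in (0 : ℝ)..T, v t ^ 2 / (1 + t ^ 2) ^ 2 with hI
  have ha : ∫ t in (0 : ℝ)..T, (1 + t ^ 2)⁻¹ = Real.arctan T := by simp
  have hpos : 0 < Real.arctan T := Real.arctan_pos.2 hT
  set k := d / Real.arctan T with hk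
  have h0 : 0 ≤ ∫ t in (0 : ℝ)..T, (v t / (1 + t ^ 2) - k / √(1 + t ^ 2)) ^ 2 :=
    intervalIntegral.integral_nonneg hT.le fun t _ => sq_nonneg _
  have h1 : ∫ t in (0 : ℝ)..T, (v t / (1 + t ^ 2) - k / √(1 + t ^ 2)) ^ 2 =
      I - 2 * k * d + k ^ 2 * Real.arctan T := by
    rw [hI, hd, ← ha, ← intervalIntegral.integral_const_mul, ← intervalIntegral.integral_const_mul,
      ← intervalIntegral.integral_sub (c2.intervalIntegrable _ _)
        ((c1.intervalIntegrable _ _).const_mul _),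
      ← intervalIntegral.integral_add ((c2.intervalIntegrable _ _).sub
        ((c1.intervalIntegrable _ _).const_mul _)) ((c3.intervalIntegrable _ _).const_mul _)]
    refine intervalIntegral.integral_congr fun t _ => ?_
    have e : √(1 + t ^ 2) ^ 2 = 1 + t ^ 2 := Real.sq_sqrt (by positivity)
    have e1 := hw t
    have e2 := hs t
    rw [sub_sq, div_pow, div_pow, e]
    field_simp
  have hI0 : 0 ≤ I := intervalIntegral.integral_nonneg hT.le fun t _ => by positivity
  rw [h1, hk] at h0
  have h2 : d ^ 2 ≤ Real.arctan T * I := by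
    have h3 : I - 2 * (d / Real.arctan T) * d + (d / Real.arctan T) ^ 2 * Real.arctan T =
        I - d ^ 2 / Real.arctan T := by field_simp; ring
    rw [h3, sub_nonneg, div_le_iff₀ hpos] at h0
    linarith
  exact h2.trans (mul_le_mul_of_nonneg_right (Real.arctan_lt_pi_div_two T).le hI0)

/-- The flow transports each velocity estimate back to time `T`. The growth `1 + t²` of the squared
velocity against the weight `(1 + t²)^{-2}` leaves a second arctangent, so the bound is uniform in
`T`. -/
theorem SteinIdentity.lintegral_rescaled_flow_le (S : SteinIdentity P F τ R) (hF : Measurable F)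
    {A : ℝ} (hA : ∀ ω, |F ω| ≤ A) (hτ : Measurable τ) {B : ℝ} (hB : ∀ ω, |τ ω| ≤ B)
    (hR : Measurable R) {B' : ℝ} (hB' : ∀ ω, |R ω| ≤ B') {D : ℝ} (hDR : ∫ ω, R ω ^ 2 ∂P ≤ D)
    (hDτ : ∫ ω, (τ ω - 1) ^ 2 ∂P ≤ D) {T : ℝ} (hT : 0 < T) :
    ∫⁻ ξ, ENNReal.ofReal (pdfT P F T ξ) *
        ENNReal.ofReal ((ξ / √(1 + T ^ 2) - flow P F T 0 ξ) ^ 2) ≤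
      ENNReal.ofReal (Real.pi ^ 2 / 2 * D) := by
  have hD : 0 ≤ D := (integral_nonneg fun ω => sq_nonneg _).trans hDR
  have hc : Continuous fun x : ℝ × ℝ => velT P F x.2 (flow P F T x.2 x.1) :=
    (continuous_velT hF hA).comp (continuous_snd.prodMk ((continuous_flow (P := P) hF hA T).comp
      (by fun_prop : Continuous fun x : ℝ × ℝ => (x.2, x.1))))
  have hp : Continuous fun ξ => pdfT P F T ξ := (continuous_pdfT (P := P) hF).comp
    (by fun_prop : Continuous fun ξ : ℝ => (T, ξ))
  have h1 : ∀ ξ, ENNReal.ofReal (pdfT P F T ξ) *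
        ENNReal.ofReal ((ξ / √(1 + T ^ 2) - flow P F T 0 ξ) ^ 2) ≤
      ∫⁻ t in Set.Ioc 0 T, ENNReal.ofReal (Real.pi / 2 / (1 + t ^ 2) ^ 2) *
        (ENNReal.ofReal (pdfT P F T ξ) *
          ENNReal.ofReal (velT P F t (flow P F T t ξ) ^ 2)) := by
    intro ξ
    have hcξ : Continuous fun t => velT P F t (flow P F T t ξ) :=
      hc.comp (by fun_prop : Continuous fun t : ℝ => (ξ, t))
    have hci : Continuous fun t => velT P F t (flow P F T t ξ) ^ 2 / (1 + t ^ 2) ^ 2 :=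
      (hcξ.pow 2).div (by fun_prop) fun t => by positivity
    have h2 := ENNReal.ofReal_le_ofReal (sq_rescaled_flow_le (P := P) hF hA hT ξ)
    rw [ENNReal.ofReal_mul (by positivity), intervalIntegral.integral_of_le hT.le,
      ofReal_integral_eq_lintegral_ofReal ((hci.integrableOn_Icc).mono_set Set.Ioc_subset_Icc_self)
        (ae_of_all _ fun t => by positivity)] at h2
    refine (mul_le_mul_right h2 _).trans (le_of_eq ?_)
    rw [← mul_assoc, ← lintegral_const_mul _ (by fun_prop)]
    refine lintegral_congr fun t => ?_
    have hpp := (pdfT_pos (P := P) hF T ξ).le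
    rw [← ENNReal.ofReal_mul hpp, ← ENNReal.ofReal_mul (by positivity), ← ENNReal.ofReal_mul hpp,
      ← ENNReal.ofReal_mul (by positivity)]
    congr 1
    ring
  refine (lintegral_mono h1).trans ?_
  rw [lintegral_lintegral_swap (by
    refine Measurable.aemeasurable ?_
    have := hp.comp (continuous_fst (X := ℝ) (Y := ℝ))
    refine Measurable.mul (by fun_prop) (Measurable.mul this.measurable.ennreal_ofReal
      (hc.pow 2).measurable.ennreal_ofReal))]
  have h3 : ∀ t, ∫⁻ ξ, ENNReal.ofReal (Real.pi / 2 / (1 + t ^ 2) ^ 2) *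
        (ENNReal.ofReal (pdfT P F T ξ) * ENNReal.ofReal (velT P F t (flow P F T t ξ) ^ 2)) ≤
      ENNReal.ofReal (Real.pi * D * (1 + t ^ 2)⁻¹) := by
    intro t
    have hct : Continuous fun ξ => velT P F t (flow P F T t ξ) :=
      hc.comp (by fun_prop : Continuous fun ξ : ℝ => (ξ, t))
    have hctm : Measurable fun ξ => ENNReal.ofReal (pdfT P F T ξ) *
        ENNReal.ofReal (velT P F t (flow P F T t ξ) ^ 2) :=
      hp.measurable.ennreal_ofReal.mul (hct.pow 2).measurable.ennreal_ofReal
    rw [lintegral_const_mul _ hctm,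
      lintegral_flow hF hA T t fun z => ENNReal.ofReal (velT P F t z ^ 2)]
    refine (mul_le_mul_right (S.lintegral_velT_le hF hA hτ hB hR hB' hDR hDτ t) _).trans
      (le_of_eq ?_)
    rw [← ENNReal.ofReal_mul (by positivity)]
    congr 1
    field_simp
  refine (lintegral_mono h3).trans ?_
  have hci : Continuous fun t : ℝ => Real.pi * D * (1 + t ^ 2)⁻¹ :=
    continuous_const.mul (Continuous.inv₀ (by fun_prop) fun t => by positivity)
  rw [← ofReal_integral_eq_lintegral_ofReal
    ((hci.integrableOn_Icc).mono_set Set.Ioc_subset_Icc_self) (ae_of_all _ fun t => by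
      have := Real.pi_pos; positivity), ← intervalIntegral.integral_of_le hT.le,
    intervalIntegral.integral_const_mul]
  refine ENNReal.ofReal_le_ofReal ?_
  have : ∫ t in (0 : ℝ)..T, (1 + t ^ 2)⁻¹ = Real.arctan T := by simp
  rw [this]
  nlinarith [mul_le_mul_of_nonneg_left (Real.arctan_lt_pi_div_two T).le
    (mul_nonneg Real.pi_pos.le hD)]

/-- Tonelli and a translation show that `Z + t F` has density `pdfT`, giving the flow estimates a
meaning on the product space that carries the coupling. -/
theorem lintegral_add_gaussian (hF : Measurable F) (t : ℝ) {k : ℝ → ENNReal} (hk : Measurable k) :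
    ∫⁻ p, k (p.2 + t * F p.1) ∂P.prod (gaussianReal 0 1) =
      ∫⁻ ξ, ENNReal.ofReal (pdfT P F t ξ) * k ξ := by
  have hgm := continuous_gd.measurable
  rw [lintegral_prod _ (by fun_prop)]
  have h1 : ∀ ω, ∫⁻ z, k (z + t * F ω) ∂gaussianReal 0 1 =
      ∫⁻ ξ, ENNReal.ofReal (gd (ξ - t * F ω)) * k ξ := by
    intro ω
    rw [gaussianReal_eq, lintegral_withDensity_eq_lintegral_mul _
      (hgm.ennreal_ofReal) (by fun_prop),
      ← lintegral_add_right_eq_self (fun ξ => ENNReal.ofReal (gd (ξ - t * F ω)) * k ξ) (t * F ω)]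
    simp
  simp only [h1]
  rw [lintegral_lintegral_swap (by
    refine Measurable.aemeasurable ?_
    have hF2 : Measurable fun p : Ω × ℝ => p.2 - t * F p.1 := by fun_prop
    exact (hgm.comp hF2).ennreal_ofReal.mul (by fun_prop))]
  refine lintegral_congr fun ξ => ?_
  rw [lintegral_mul_const _ (by fun_prop), pdfT,
    ofReal_integral_eq_lintegral_ofReal (integrable_gd_sub hF t ξ)
      (ae_of_all _ fun ω => (gd_pos _).le)]

/-- With `s = √(1 + T²)` the difference is `(f (s - T) - z) / s`, and `0 ≤ s - T ≤ 1`. So `F` and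
the rescaled `Z + T F` are within `O(1/T)`. -/
theorem sq_sub_le_of_rescale {T : ℝ} (hT : 0 < T) (f z : ℝ) :
    (f - (z + T * f) / √(1 + T ^ 2)) ^ 2 ≤ 2 * (f ^ 2 + z ^ 2) / (1 + T ^ 2) := by
  have hw : (0 : ℝ) < 1 + T ^ 2 := by positivity
  have hs : 0 < √(1 + T ^ 2) := Real.sqrt_pos.2 hw
  have hs2 : √(1 + T ^ 2) ^ 2 = 1 + T ^ 2 := Real.sq_sqrt hw.le
  set s := √(1 + T ^ 2)
  have h1 : f - (z + T * f) / s = (f * (s - T) - z) / s := by field_simp; ring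
  rw [h1, div_pow, hs2]
  have h2 : T ≤ s := by nlinarith
  have h3 : s ≤ T + 1 := by nlinarith
  have h4 : (s - T) ^ 2 ≤ 1 := by nlinarith
  gcongr
  nlinarith [sq_nonneg (f * (s - T) + z), mul_le_mul_of_nonneg_left h4 (sq_nonneg f)]

/-- An approximate Stein identity controls the quadratic transport cost to the Gaussian law. -/
theorem SteinIdentity.exists_coupling (S : SteinIdentity P F τ R) (hF : Measurable F)
    {A : ℝ} (hA : ∀ ω, |F ω| ≤ A) (hτ : Measurable τ) {B : ℝ} (hB : ∀ ω, |τ ω| ≤ B)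
    (hR : Measurable R) {B' : ℝ} (hB' : ∀ ω, |R ω| ≤ B') {D : ℝ} (hD : 0 < D)
    (hDR : ∫ ω, R ω ^ 2 ∂P ≤ D) (hDτ : ∫ ω, (τ ω - 1) ^ 2 ∂P ≤ D) :
    ∃ π : Measure (ℝ × ℝ), (π.map Prod.fst = P.map F ∧ π.map Prod.snd = gaussianReal 0 1) ∧
      ∫⁻ z, ENNReal.ofReal ((z.1 - z.2) ^ 2) ∂π ≤ ENNReal.ofReal ((Real.pi ^ 2 + 1) * D) := by
  -- `F` is bounded, so a finite time suffices: the gap between `F` and the end of the interpolation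
  -- is made smaller than the target `D`. The coupling pairs `F` with the image of `Z + T F` under
  -- the flow down to time `0`, which is exactly Gaussian.
  obtain ⟨T, hT, hTD⟩ : ∃ T : ℝ, 0 < T ∧ 4 * (A ^ 2 + 1) / (1 + T ^ 2) ≤ D := by
    refine ⟨4 * (A ^ 2 + 1) / D + 1, by positivity, ?_⟩
    have h1 : 0 ≤ 4 * (A ^ 2 + 1) / D := by positivity
    rw [div_le_iff₀ (by positivity)]
    have h2 : D * (4 * (A ^ 2 + 1) / D) = 4 * (A ^ 2 + 1) := by field_simp
    nlinarith [mul_nonneg hD.le (sq_nonneg (4 * (A ^ 2 + 1) / D)), mul_nonneg hD.le h1]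
  have hflow : Continuous fun ξ => flow P F T 0 ξ := (continuous_flow (P := P) hF hA T).comp
    (by fun_prop : Continuous fun ξ : ℝ => ((0 : ℝ), ξ))
  have hflm := hflow.measurable
  have hFm : Measurable fun p : Ω × ℝ => F p.1 := by fun_prop
  have hGm : Measurable fun p : Ω × ℝ => flow P F T 0 (p.2 + T * F p.1) :=
    hflm.comp (by fun_prop)
  refine ⟨(P.prod (gaussianReal 0 1)).map fun p => (F p.1, flow P F T 0 (p.2 + T * F p.1)),
    ⟨?_, ?_⟩, ?_⟩
  · rw [Measure.map_map measurable_fst (hFm.prodMk hGm)]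
    change Measure.map (F ∘ Prod.fst) _ = _
    rw [← Measure.map_map hF measurable_fst, Measure.map_fst_prod]
    simp
  · rw [Measure.map_map measurable_snd (hFm.prodMk hGm)]
    refine Measure.ext_of_lintegral _ fun f hf => ?_
    rw [lintegral_map hf (by exact hGm)]
    have h1 := lintegral_add_gaussian (P := P) hF T (hf.comp hflm)
    simp only [Function.comp] at h1 ⊢
    rw [h1, lintegral_flow hF hA T 0 f, gaussianReal_eq, lintegral_withDensity_eq_lintegral_mul _
      (continuous_gd.measurable.ennreal_ofReal) hf]
    refine lintegral_congr fun z => ?_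
    simp [pdfT]
  · rw [lintegral_map (by fun_prop) (hFm.prodMk hGm)]
    have h1 : ∀ p : Ω × ℝ, ENNReal.ofReal ((F p.1 - flow P F T 0 (p.2 + T * F p.1)) ^ 2) ≤
        ENNReal.ofReal (4 / (1 + T ^ 2)) * (ENNReal.ofReal (A ^ 2) + ENNReal.ofReal (p.2 ^ 2)) +
        2 * ENNReal.ofReal (((p.2 + T * F p.1) / √(1 + T ^ 2) -
          flow P F T 0 (p.2 + T * F p.1)) ^ 2) := by
      intro p
      have e2 : (2 : ENNReal) = ENNReal.ofReal 2 := by simp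
      rw [e2, ← ENNReal.ofReal_add (by positivity) (by positivity),
        ← ENNReal.ofReal_mul (by positivity), ← ENNReal.ofReal_mul (by positivity),
        ← ENNReal.ofReal_add (by positivity) (by positivity)]
      refine ENNReal.ofReal_le_ofReal ?_
      have h2 := sq_sub_le_of_rescale hT (F p.1) p.2
      have h3 : F p.1 ^ 2 ≤ A ^ 2 := sq_le_sq' (abs_le.1 (hA p.1)).1 (abs_le.1 (hA p.1)).2
      have h4 : 2 * (2 * (F p.1 ^ 2 + p.2 ^ 2) / (1 + T ^ 2)) ≤
          4 / (1 + T ^ 2) * (A ^ 2 + p.2 ^ 2) := by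
        have : 2 * (2 * (F p.1 ^ 2 + p.2 ^ 2) / (1 + T ^ 2)) =
          4 / (1 + T ^ 2) * (F p.1 ^ 2 + p.2 ^ 2) := by ring
        rw [this]; gcongr
      set x := (p.2 + T * F p.1) / √(1 + T ^ 2)
      set y := flow P F T 0 (p.2 + T * F p.1)
      nlinarith [sq_nonneg ((F p.1 - x) - (x - y))]
    refine (lintegral_mono h1).trans ?_
    have hkm : Measurable fun ξ => ENNReal.ofReal ((ξ / √(1 + T ^ 2) - flow P F T 0 ξ) ^ 2) := by
      fun_prop
    have h5 := lintegral_add_gaussian (P := P) hF T hkm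
    have h6 := S.lintegral_rescaled_flow_le hF hA hτ hB hR hB' hDR hDτ hT
    rw [lintegral_add_left (by fun_prop), lintegral_const_mul _ (by fun_prop),
      lintegral_add_left (by fun_prop), lintegral_const_mul _ (by fun_prop), h5]
    have h7 : ∫⁻ p : Ω × ℝ, ENNReal.ofReal (p.2 ^ 2) ∂P.prod (gaussianReal 0 1) = 1 := by
      rw [lintegral_prod _ (by fun_prop)]
      simp [lintegral_sq_gaussianReal]
    rw [h7, lintegral_const, measure_univ, mul_one]
    have e1 : (1 : ENNReal) = ENNReal.ofReal 1 := by simp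
    have e2 : (2 : ENNReal) = ENNReal.ofReal 2 := by simp
    refine (add_le_add le_rfl (mul_le_mul_right h6 2)).trans ?_
    rw [e1, e2, ← ENNReal.ofReal_add (by positivity) (by positivity),
        ← ENNReal.ofReal_mul (by positivity), ← ENNReal.ofReal_mul (by positivity),
        ← ENNReal.ofReal_add (by positivity) (by positivity)]
    refine ENNReal.ofReal_le_ofReal ?_
    have e3 : 4 / (1 + T ^ 2) * (A ^ 2 + 1) = 4 * (A ^ 2 + 1) / (1 + T ^ 2) := by ring
    rw [e3]
    linarith

end

/-! ### The central limit theorem -/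

variable {β c : ℝ} {V V₁ ρ ρ₁ ρ₂ w w₁ ψ ψ₁ φ u u₁ u₂ f κ : Torus → ℝ}

theorem SteinIdentity.rescale {Ω : Type*} [MeasurableSpace Ω] {P : Measure Ω} {F τ R : Ω → ℝ}
    (S : SteinIdentity P F τ R) {s : ℝ} (hs : s ≠ 0) :
    SteinIdentity P (fun ω => F ω / s) (fun ω => τ ω / s ^ 2) (fun ω => R ω / s) := by
  intro h h' hh hh'
  have hd : ∀ x, HasDerivAt (fun x => h (x / s)) (h' (x / s) / s) x := fun x => by
    exact ((hh (x / s)).comp x ((hasDerivAt_id x).div_const s)).congr_deriv (by ring)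
  have key := congrArg (fun y => y / s) (S _ _ hd (by fun_prop))
  simp only [add_div, ← integral_div] at key
  convert key using 1
  · exact integral_congr_ae (ae_of_all _ fun ω => by ring)
  · congr 1
    · exact integral_congr_ae (ae_of_all _ fun ω => by field_simp)
    · exact integral_congr_ae (ae_of_all _ fun ω => by ring)

theorem gaussianReal_map_sqrt_mul (v : NNReal) :
    (gaussianReal 0 1).map (fun x => √(v : ℝ) * x) = gaussianReal 0 v := by
  rw [gaussianReal_map_const_mul, mul_zero, mul_one]
  congr 1
  ext
  simp

theorem LinSol.exists_linStat_coupling (hβ : 0 < β) (E : EqDensity β V V₁ ρ ρ₁ ρ₂ w w₁)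
    (L : LinSol β ρ ρ₁ ψ φ u u₁ u₂ f κ c) (hψ : HasTDeriv ψ ψ₁) (hψ₁ : Continuous ψ₁)
    (hψ0 : ∫ x, ψ x * ρ x ∂unif = 0) {v : NNReal}
    (hv : (v : ℝ) = ∫ x, ψ₁ x * u x * ρ x ∂unif) {δ : ℝ} (hδ : 0 < δ) :
    ∃ C : ℝ, 0 < C ∧ ∀ N : ℕ, 1 ≤ N → ∃ π : Measure (ℝ × ℝ),
      (π.map Prod.fst = linStatLaw β V ψ N ∧ π.map Prod.snd = gaussianReal 0 v) ∧
      ∫⁻ z, ENNReal.ofReal ((z.1 - z.2) ^ 2) ∂π ≤ ENNReal.ofReal (C * ((N : ℝ) ^ δ / N)) := by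
  obtain ⟨_, _, hle⟩ := E.exists_gibbs_le hβ
  rcases eq_or_ne v 0 with rfl | hv0
  -- A vanishing variance forces `ψ = 0`, so both laws are the point mass at `0`; elsewhere one may
  -- divide by `σ`.
  · have hz := (L.variance hβ E hψ hψ₁ hψ0).2 (by rw [← hv]; simp)
    refine ⟨1, one_pos, fun N hN => ⟨Measure.dirac (0, 0), ⟨?_, ?_⟩, ?_⟩⟩
    · have := (hle N hN).1
      have h0 : linStat ψ N = fun _ => 0 := by funext x; simp [linStat, hz]
      rw [linStatLaw, h0, Measure.map_const, measure_univ, one_smul,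
        Measure.map_dirac' measurable_fst]
    · rw [gaussianReal_zero_var, Measure.map_dirac' measurable_snd]
    · rw [lintegral_dirac' _ (by fun_prop)]
      simp
  · have hvp : 0 < (v : ℝ) := NNReal.coe_pos.2 (pos_iff_ne_zero.2 hv0)
    have hs : 0 < √(v : ℝ) := Real.sqrt_pos.2 hvp
    have hs2 : √(v : ℝ) ^ 2 = v := Real.sq_sqrt hvp.le
    obtain ⟨C, hC, hb⟩ := L.exists_stein_bounds hβ E hψ₁ hδ
    rw [← hv] at hb
    set s := √(v : ℝ) with hsd
    refine ⟨(v : ℝ) * ((Real.pi ^ 2 + 1) * (C / v + C / v ^ 2)), by positivity, fun N hN => ?_⟩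
    have := (hle N hN).1
    obtain ⟨hb1, hb2⟩ := hb N hN
    have hNp : (0 : ℝ) < N := by exact_mod_cast hN
    have hq : 0 < (N : ℝ) ^ δ / N := by positivity
    set q := (N : ℝ) ^ δ / N
    have hF := (continuous_linStat hψ.continuous N).div_const s
    have hτ := (continuous_steinFactor hψ₁ L.u_deriv.continuous N).div_const (s ^ 2)
    have hR := (L.continuous_steinRem E N).div_const s
    obtain ⟨A, -, hA⟩ := exists_pi_bound hF
    obtain ⟨B, -, hB⟩ := exists_pi_bound hτ
    obtain ⟨B', -, hB'⟩ := exists_pi_bound hR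
    have S : SteinIdentity (gibbs β V N) (linStat ψ N) (steinFactor ψ₁ u N) (steinRem β ρ u N) :=
      fun h h' hh hh' => L.stein_identity hβ E hψ hψ₁ hψ0 hh hh' hN
    obtain ⟨π, ⟨hπ1, hπ2⟩, hπ⟩ := (S.rescale hs.ne').exists_coupling hF.measurable hA
      hτ.measurable hB hR.measurable hB' (D := (C / v + C / v ^ 2) * q) (by positivity) (by
        simp only [div_pow, hs2, integral_div]
        calc _ ≤ C * q / v := div_le_div_of_nonneg_right hb1 hvp.le
          _ ≤ (C / v + C / v ^ 2) * q := by
            have : 0 ≤ C / v ^ 2 * q := by positivity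
            have e : C * q / v = C / v * q := by ring
            rw [e]; linarith) (by
        have e : ∀ x, (steinFactor ψ₁ u N x / s ^ 2 - 1) ^ 2 =
            (steinFactor ψ₁ u N x - v) ^ 2 / v ^ 2 := fun x => by
          rw [hs2]; field_simp
        simp only [e, integral_div]
        calc _ ≤ C * q / v ^ 2 := div_le_div_of_nonneg_right hb2 (by positivity)
          _ ≤ (C / v + C / v ^ 2) * q := by
            have : 0 ≤ C / v * q := by positivity
            have e : C * q / v ^ 2 = C / v ^ 2 * q := by ring
            rw [e]; linarith)
    have hm : Measurable fun z : ℝ × ℝ => (s * z.1, s * z.2) := by fun_prop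
    refine ⟨π.map fun z => (s * z.1, s * z.2), ⟨?_, ?_⟩, ?_⟩
    · rw [Measure.map_map measurable_fst hm]
      change π.map ((fun y => s * y) ∘ Prod.fst) = _
      rw [← Measure.map_map (by fun_prop) measurable_fst, hπ1,
        Measure.map_map (by fun_prop) hF.measurable, linStatLaw]
      congr 1
      funext x
      simp only [Function.comp]
      field_simp
    · rw [Measure.map_map measurable_snd hm]
      change π.map ((fun y => s * y) ∘ Prod.snd) = _
      rw [← Measure.map_map (by fun_prop) measurable_snd, hπ2, hsd, gaussianReal_map_sqrt_mul]
    · rw [lintegral_map (by fun_prop) hm]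
      have e : ∀ z : ℝ × ℝ, ENNReal.ofReal ((s * z.1 - s * z.2) ^ 2) =
          ENNReal.ofReal v * ENNReal.ofReal ((z.1 - z.2) ^ 2) := fun z => by
        rw [← ENNReal.ofReal_mul hvp.le, ← mul_sub, mul_pow, hs2]
      simp only [e]
      rw [lintegral_const_mul _ (by fun_prop)]
      refine (mul_le_mul_right hπ _).trans (le_of_eq ?_)
      rw [← ENNReal.ofReal_mul hvp.le]
      congr 1
      ring

/-- The inequality `|d| ≤ d² / (2√r) + √r / 2` bounds the mean distance by the quadratic cost. It
turns the Wasserstein estimate into convergence against bounded Lipschitz functions. -/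
theorem abs_integral_sub_le_of_coupling {P Q : Measure ℝ} [IsProbabilityMeasure P]
    {π : Measure (ℝ × ℝ)} (h1 : π.map Prod.fst = P) (h2 : π.map Prod.snd = Q) {r : ℝ} (hr : 0 < r)
    (h : ∫⁻ z, ENNReal.ofReal ((z.1 - z.2) ^ 2) ∂π ≤ ENNReal.ofReal r) {g : ℝ → ℝ} {K : NNReal}
    (hg : LipschitzWith K g) {M : ℝ} (hM : ∀ x, |g x| ≤ M) :
    |∫ x, g x ∂P - ∫ x, g x ∂Q| ≤ K * √r := by
  have hπ : IsProbabilityMeasure π := by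
    have : IsProbabilityMeasure (π.map Prod.fst) := by rw [h1]; infer_instance
    exact Measure.isProbabilityMeasure_of_map (f := Prod.fst)
  have hgc := hg.continuous
  have hgs : ∀ m : Measure ℝ, AEStronglyMeasurable g m := fun m => hgc.aestronglyMeasurable
  have i1 : Integrable (fun z : ℝ × ℝ => g z.1) π := integrable_of_bounded (by fun_prop)
    fun z => hM z.1
  have i2 : Integrable (fun z : ℝ × ℝ => g z.2) π := integrable_of_bounded (by fun_prop)
    fun z => hM z.2
  have i3 : Integrable (fun z : ℝ × ℝ => (z.1 - z.2) ^ 2) π :=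
    ⟨Measurable.aestronglyMeasurable (by fun_prop), by
      rw [hasFiniteIntegral_iff_ofReal (ae_of_all _ fun z => sq_nonneg _)]
      exact h.trans_lt ENNReal.ofReal_lt_top⟩
  have h3 : ∫ z : ℝ × ℝ, (z.1 - z.2) ^ 2 ∂π ≤ r := by
    rw [← ofReal_integral_eq_lintegral_ofReal i3 (ae_of_all _ fun z => sq_nonneg _)] at h
    exact (ENNReal.ofReal_le_ofReal_iff hr.le).1 h
  rw [← h1, ← h2, integral_map measurable_fst.aemeasurable (hgs _),
    integral_map measurable_snd.aemeasurable (hgs _), ← integral_sub i1 i2]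
  have hs : 0 < √r := Real.sqrt_pos.2 hr
  have hs2 : √r ^ 2 = r := Real.sq_sqrt hr.le
  have i4 : Integrable (fun z : ℝ × ℝ => K * ((z.1 - z.2) ^ 2 / (2 * √r) + √r / 2)) π :=
    ((i3.div_const _).add (integrable_const _)).const_mul _
  calc |∫ z : ℝ × ℝ, (g z.1 - g z.2) ∂π| ≤ ∫ z : ℝ × ℝ, |g z.1 - g z.2| ∂π :=
        abs_integral_le_integral_abs
    _ ≤ ∫ z : ℝ × ℝ, K * ((z.1 - z.2) ^ 2 / (2 * √r) + √r / 2) ∂π := by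
        refine integral_mono (i1.sub i2).abs i4 fun z => ?_
        have h4 := hg.dist_le_mul z.1 z.2
        rw [Real.dist_eq, Real.dist_eq] at h4
        refine h4.trans (mul_le_mul_of_nonneg_left ?_ K.coe_nonneg)
        have e : (z.1 - z.2) ^ 2 / (2 * √r) + √r / 2 = (|z.1 - z.2| ^ 2 + √r ^ 2) / (2 * √r) := by
          rw [sq_abs]; field_simp
        rw [e, le_div_iff₀ (by positivity)]
        nlinarith [sq_nonneg (|z.1 - z.2| - √r)]
    _ = K * ((∫ z : ℝ × ℝ, (z.1 - z.2) ^ 2 ∂π) / (2 * √r) + √r / 2) := by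
        rw [integral_const_mul, integral_add (i3.div_const _) (integrable_const _), integral_div]
        simp
    _ ≤ K * (r / (2 * √r) + √r / 2) := by gcongr
    _ = K * √r := by
        rw [← hs2, Real.sqrt_sq hs.le]
        field_simp
        ring

theorem tendsto_integral_of_coupling {P : ℕ → Measure ℝ} {Q : Measure ℝ} [IsProbabilityMeasure Q]
    {r : ℕ → ℝ} (hr : Tendsto r atTop (𝓝 0))
    (h : ∀ N, 1 ≤ N → 0 < r N ∧ IsProbabilityMeasure (P N) ∧ ∃ π : Measure (ℝ × ℝ),
      (π.map Prod.fst = P N ∧ π.map Prod.snd = Q) ∧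
      ∫⁻ z, ENNReal.ofReal ((z.1 - z.2) ^ 2) ∂π ≤ ENNReal.ofReal (r N))
    (g : BoundedContinuousFunction ℝ ℝ) :
    Tendsto (fun N => ∫ x, g x ∂P N) atTop (𝓝 (∫ x, g x ∂Q)) := by
  rw [← tendsto_add_atTop_iff_nat 1]
  set ν : ℕ → ProbabilityMeasure ℝ := fun N => ⟨P (N + 1), (h (N + 1) (by omega)).2.1⟩
  have key : Tendsto ν atTop (𝓝 (⟨Q, inferInstance⟩ : ProbabilityMeasure ℝ)) := by
    refine tendsto_iff_forall_lipschitz_integral_tendsto.2 ?_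
    rintro k ⟨B, hB⟩ ⟨K, hK⟩
    have hM : ∀ x, |k x| ≤ B + |k 0| := fun x => by
      have h1 := hB x 0
      rw [Real.dist_eq] at h1
      have h2 := abs_sub_abs_le_abs_sub (k x) (k 0)
      linarith
    rw [tendsto_iff_dist_tendsto_zero]
    have h0 : Tendsto (fun N => (K : ℝ) * √(r (N + 1))) atTop (𝓝 0) := by
      have := ((Real.continuous_sqrt.tendsto 0).comp
        (hr.comp (tendsto_add_atTop_nat 1))).const_mul (K : ℝ)
      simpa using this
    refine squeeze_zero (fun N => dist_nonneg) (fun N => ?_) h0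
    obtain ⟨h1, h2, π, ⟨h3, h4⟩, h5⟩ := h (N + 1) (by omega)
    exact abs_integral_sub_le_of_coupling h3 h4 h1 h5 hK hM
  exact ProbabilityMeasure.tendsto_iff_forall_integral_tendsto.1 key g

theorem W2_le_of_coupling {P Q : Measure ℝ} {π : Measure (ℝ × ℝ)}
    (h : π.map Prod.fst = P ∧ π.map Prod.snd = Q) {r : ℝ} (hr : 0 ≤ r)
    (hc : ∫⁻ z, ENNReal.ofReal ((z.1 - z.2) ^ 2) ∂π ≤ ENNReal.ofReal r) :
    W2 P Q ≤ ENNReal.ofReal (√r) := by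
  refine (iInf₂_le π h).trans ?_
  rw [Real.sqrt_eq_rpow, ← ENNReal.ofReal_rpow_of_nonneg hr (by norm_num)]
  gcongr

theorem exponent_eq {γ : ℕ} {N : ℕ} (hN : 1 ≤ N) :
    (N : ℝ) ^ (2 / ((γ : ℝ) + 1)) / N = ((N : ℝ) ^ (((γ : ℝ) - 1) / ((γ : ℝ) + 1)))⁻¹ := by
  have hNp : (0 : ℝ) < N := by exact_mod_cast hN
  rw [← Real.rpow_neg hNp.le]
  nth_rewrite 2 [← Real.rpow_one (N : ℝ)]
  rw [← Real.rpow_sub hNp]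
  congr 1
  field_simp
  ring

end HighTempCircular

end

/-! ### Assembly of the theorem. -/

open HighTempCircular in
theorem mainTheorem1 (β : ℝ) (hβ : 0 < β) (V : HighTempCircular.Torus → ℝ)
    (hV : HighTempCircular.IsCk1 3 V) :
    ∃ μ : ProbabilityMeasure HighTempCircular.Torus,
      (HighTempCircular.IsEquilibrium β V μ ∧
        ∀ μ' : ProbabilityMeasure HighTempCircular.Torus,
          HighTempCircular.IsEquilibrium β V μ' → μ' = μ) ∧
      ∀ γ : ℕ, 2 ≤ γ → ∀ ψ : HighTempCircular.Torus → ℝ,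
        HighTempCircular.IsCk (2 * γ + 1) ψ →
        ∫ x, ψ x ∂(μ : Measure HighTempCircular.Torus) = 0 →
        ∃ φ : HighTempCircular.Torus → ℝ,
          (HighTempCircular.IsInverseL β μ ψ φ ∧
            ∀ φ' : HighTempCircular.Torus → ℝ, HighTempCircular.IsInverseL β μ ψ φ' →
              φ' =ᵐ[HighTempCircular.unif] φ) ∧
          ∃ σ2 : NNReal, (σ2 : ℝ) = HighTempCircular.innerH μ ψ φ ∧
            (∀ f : BoundedContinuousFunction ℝ ℝ,
              Tendsto (fun N : ℕ => ∫ y, f y ∂(HighTempCircular.linStatLaw β V ψ N)) atTop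
                (𝓝 (∫ y, f y ∂(gaussianReal 0 σ2)))) ∧
            ∃ C : ℝ, 0 < C ∧ ∀ N : ℕ, 2 ≤ N →
              HighTempCircular.W2 (HighTempCircular.linStatLaw β V ψ N) (gaussianReal 0 σ2) ≤
                ENNReal.ofReal (C * √(Real.log (N : ℝ) /
                  (N : ℝ) ^ (((γ : ℝ) - 1) / ((γ : ℝ) + 1)))) := by
  obtain ⟨V₁, hV1, hV₁⟩ := hV.1.exists_deriv
  obtain ⟨V₂, hV2, hV₂⟩ := hV₁.exists_deriv
  obtain ⟨ρ, ρ₁, ρ₂, w, w₁, E⟩ := exists_eqDensity hβ hV1 hV2 hV₂.continuous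
  have hprob := E.isProb
  refine ⟨⟨dens ρ, hprob⟩, ⟨E.isEquilibrium hβ rfl,
    fun μ' hμ' => E.eq_of_isEquilibrium hβ rfl hμ'⟩, fun γ hγ ψ hψk hψ0 => ?_⟩
  obtain ⟨ψ₁, hψ, hψ₁k⟩ := hψk.exists_deriv
  have hψ₁ := hψ₁k.continuous
  replace hψ0 : ∫ x, ψ x * ρ x ∂unif = 0 := by rw [← E.integral_dens]; exact hψ0
  obtain ⟨φ, u, u₁, u₂, f, κ, c, L⟩ := E.exists_linSol hβ hψ hψ₁
  refine ⟨φ, ⟨L.isInverseL E rfl hψ hψ₁ hψ0, fun φ' h => L.unique hβ E rfl h⟩, ?_⟩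
  have hvar := (L.variance hβ E hψ hψ₁ hψ0).1
  set v : NNReal := ⟨∫ x, ψ₁ x * u x * ρ x ∂unif, hvar⟩
  have hγ1 : (0 : ℝ) < γ + 1 := by positivity
  have hγ2 : (2 : ℝ) ≤ γ := by exact_mod_cast hγ
  -- This `δ` satisfies `δ - 1 = -(γ - 1) / (γ + 1)`, the power required for the squared distance;
  -- it is negative since `γ ≥ 2`.
  obtain ⟨C, hC, hb⟩ := L.exists_linStat_coupling hβ E hψ hψ₁ hψ0 (v := v) rfl
    (δ := 2 / ((γ : ℝ) + 1)) (by positivity)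
  obtain ⟨_, _, hle⟩ := E.exists_gibbs_le hβ
  -- Dividing by `log 2` inserts the logarithmic factor, since `log N ≥ log 2` for `N ≥ 2`.
  refine ⟨v, (L.innerH_eq E rfl hψ hψ₁).symm, fun g => ?_, √(C / Real.log 2), ?_, fun N hN => ?_⟩
  · refine tendsto_integral_of_coupling
      (r := fun N : ℕ => C * ((N : ℝ) ^ (2 / ((γ : ℝ) + 1)) / N)) ?_ (fun N hN => ?_) g
    · have h1 : Tendsto (fun N : ℕ => C * ((N : ℝ) ^ (((γ : ℝ) - 1) / ((γ : ℝ) + 1)))⁻¹) atTop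
          (𝓝 (C * 0)) :=
        (((tendsto_rpow_atTop (div_pos (by linarith) hγ1)).comp
          tendsto_natCast_atTop_atTop).inv_tendsto_atTop).const_mul C
      rw [mul_zero] at h1
      refine h1.congr' ?_
      filter_upwards [eventually_ge_atTop 1] with N hN
      rw [exponent_eq hN]
    · have hNp : (0 : ℝ) < N := by exact_mod_cast hN
      have := (hle N hN).1
      exact ⟨by positivity, Measure.isProbabilityMeasure_map
        (continuous_linStat hψ.continuous N).measurable.aemeasurable, hb N hN⟩
  · exact Real.sqrt_pos.2 (div_pos hC (Real.log_pos (by norm_num)))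
  · have hN1 : 1 ≤ N := by omega
    have hNp : (0 : ℝ) < N := by exact_mod_cast hN1
    obtain ⟨π, hπ, hcost⟩ := hb N hN1
    have hl2 : 0 < Real.log 2 := Real.log_pos (by norm_num)
    have hlN : Real.log 2 ≤ Real.log N :=
      Real.log_le_log (by norm_num) (by exact_mod_cast hN)
    refine (W2_le_of_coupling hπ (by positivity) hcost).trans (ENNReal.ofReal_le_ofReal ?_)
    rw [← Real.sqrt_mul (by positivity)]
    refine Real.sqrt_le_sqrt ?_
    rw [exponent_eq hN1]
    set q := (N : ℝ) ^ (((γ : ℝ) - 1) / ((γ : ℝ) + 1))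
    have hq : 0 < q := by positivity
    calc C * q⁻¹ = C / Real.log 2 * (Real.log 2 / q) := by field_simp
      _ ≤ C / Real.log 2 * (Real.log N / q) := by gcongr
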